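/- Model. Macro base stations (BSs, tier $1$) and pico BSs (tier $2$) form two independent homogeneous Poisson point processes $\Phi_1,\Phi_2$ in $\mathbb R^2$ with densities $\lambda_1,\lambda_2>0$; the typical user is at the origin. Every BS of tier $i$ caches the $f$-th file with probability $p_{i,f}$, independently of the others; $\Phi_{i,f}$ is the set of BSs of tier $i$ caching it. The path loss laws are $L_1(r)=C_1r^{-\alpha_1}$ and $L_2(r)=\mathbf U(R_L-r)\,C_2r^{-\alpha_2}$, where $\alpha_1>2$, $\alpha_2\ge 2$, $R_L>0$ and $\mathbf U$ is the unit step function ($\mathbf U(x)=1$ for $x\ge0$, $0$ otherwise). A BS of tier $i$ has transmit power $P_i>0$, $N_i$ antenna elements and bias factor $b_i^P>0$. Each BS $x\in\Phi_i$ has a fading power gain $|h_x|^2$ that is Gamma distributed with shape and rate $N_i^p$, where $N_1^p=1$ and $N_2^p\ge1$ is an integer, and an angle $\omega_x$ uniform on $[-\frac d\lambda,\frac d\lambda]$ ($d$ antenna spacing, $\lambda$ wavelength); locations, caching decisions, fading gains and angles are mutually independent. The array gains are $G_1(\omega)=1$ and $G_2(\omega)=\frac{\sin^2(\pi N_2\omega)}{N_2^2\sin^2(\pi\omega)}$,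 and $G_0=1$. Under maximum received power (Max-RP) association, the user requesting file $f$ is served by the BS $x_0\in\Phi_{1,f}\cup\Phi_{2,f}$ with the largest biased average received power $b_i^PP_iL_i(\|x_0\|)N_iG_0$ (provided this is positive). Ignoring noise, the SINR of a user served by $x_0\in\Phi_{i,f}$ is $$\Upsilon_{i,f}=\frac{P_iL_i(\|x_0\|)G_0N_i|h_{x_0}|^2}{\sum_{x\in\Phi_i\setminus x_0}P_iL_i(\|x\|)N_i|h_x|^2G_i(\omega_x)}$$ ($=\infty$ if there is no interference). Let $\Theta_{i,f}(\tau)$ be the probability that the serving BS belongs to tier $i$ and $\Upsilon_{i,f}>\tau$, and $\mathcal A^P_{i,f}$ the probability that the largest biased average received power among $\Phi_{i,f}$ exceeds the one among $\Phi_{j,f}$, $j\ne i$. Notation. Let $P^r_{j,i}=\frac{b_j^PP_jC_jN_j}{b_i^PP_iC_iN_i}$, $\alpha^r_{j,i}=\frac{\alpha_j}{\alpha_i}$, $R_r=(P^r_{1,2}R_L^{\alpha_2})^{1/\alpha_1}$ and $$f^P_{1,f}(r)=2\pi p_{1,f}\lambda_1r\,e^{-\pi\sum_{j=1}^2p_{j,f}\lambda_j(P^r_{j,1})^{2/\alpha_2}r^{2/\alpha^r_{j,1}}}\,\mathbf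 U(R_r-r)+2\pi p_{1,f}\lambda_1r\,e^{-\pi p_{2,f}\lambda_2R_L^2-\pi p_{1,f}\lambda_1r^2}\,\mathbf U(r-R_r),$$ $$f^P_{2,f}(r)=2\pi p_{2,f}\lambda_2r\,e^{-\pi\sum_{j=1}^2p_{j,f}\lambda_j(P^r_{j,2})^{2/\alpha_1}r^{2/\alpha^r_{j,2}}}\,\mathbf U(R_L-r).$$ Let $S_i^0(z)={}_2F_1(-\frac2{\alpha_i},N_i^p;1-\frac2{\alpha_i};-z)$, $\Delta_i(z)=\Gamma(1-\frac2{\alpha_i})\Gamma(N_i^p+\frac2{\alpha_i})\Gamma(N_i^p)^{-1}z^{2/\alpha_i}$, $\eta_L=N_2^p(N_2^p!)^{-1/N_2^p}$, and for a number $u$ of Gauss–Chebyshev nodes let $x_k=\cos(\frac{2k-1}{2u}\pi)$, $k=1,\dots,u$. With $X=sG_2(\omega)\tau/N_2^p$, let $$W_f(\omega,s,\tau)=p_{2,f}S_2^0\big(Xr^{-\alpha_2}\big)r^2+(1-p_{2,f})\Delta_2(X)-S_2^0\big(XR_L^{-\alpha_2}\big)R_L^2\quad(\alpha_2>2),$$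 $$W_f(\omega,s,\tau)=X\big(F_y(XR_L^{-2})-p_{2,f}F_y(Xr^{-2})\big)\quad(\alpha_2=2),$$ $$F_y(y)=N_2^p\ln\big(1+\tfrac1y\big)-\frac1{y(1+y)^{N_2^p-1}}-\sum_{m=1}^{N_2^p-1}\frac{N_2^p}{(1+y)^{N_2^p-m}(N_2^p-m)}$$ (for $\alpha_2=2$ and $X=0$, $W_f$ is its limit $p_{2,f}r^2-R_L^2$), and $$\mathcal L_2(s,\tau)=\exp\Big(-\pi\lambda_2(R_L^2-p_{2,f}r^2)-\frac{\pi^2\lambda_2}{2u_1}\sum_{k_1=1}^{u_1}W_f\big(\tfrac{x_{k_1}d}\lambda,s,\tau\big)\sqrt{1-x_{k_1}^2}\Big),\qquad F_R(r,\tau)=\mathcal L_2\Big(\frac{n\eta_Lr^{\alpha_2}}{G_0},\tau\Big)f^P_{2,f}(r).$$ Lemma. Let $\tau\ge0$. Then $$\Theta_{1,f}(\tau)=\int_0^\infty\exp\Big(-\pi\lambda_1r^2\big(p_{1,f}(S_1^0(\tau)-1)+(1-p_{1,f})\Delta_1(\tau)\big)\Big)f^P_{1,f}(r)\,dr,$$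 with a convergent integral, and $$\Theta_{2,f}(\tau)\approx\frac{\pi R_L}{2u_2}\sum_{n=1}^{N_2^p}(-1)^{n+1}\binom{N_2^p}n\sum_{k_2=1}^{u_2}F_R\Big(\frac{(x_{k_2}+1)R_L}2,\tau\Big)\sqrt{1-x_{k_2}^2}$$ in the following sense: as $u_1,u_2\to\infty$ jointly, the right-hand side converges to a limit $\Theta^*$ with $$0\le\Theta^*-\Theta_{2,f}(\tau)\le\mathcal A^P_{2,f}\cdot\sup_{\gamma>0}\Big|\mathbb P\big[|h|^2\le\gamma\big]-\big(1-e^{-\eta_L\gamma}\big)^{N_2^p}\Big|,$$ where $|h|^2$ has the fading law of tier $2$; in particular $\Theta^*=\Theta_{2,f}(\tau)$ if $N_2^p=1$. -/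

import Mathlib

open MeasureTheory ProbabilityTheory Filter Topology

namespace HetNet

noncomputable section

/-! ### The network parameters -/

/-- The two tiers: macro base stations (tier 1, sub-6 GHz) and pico base stations
(tier 2, mmWave). -/
inductive Tier
  | macroBS
  | picoBS

/-- The tier different from the given one. -/
def Tier.other : Tier → Tier
  | .macroBS => .picoBS
  | .picoBS => .macroBS

/-- Deterministic parameters of the two-tier cache-enabled network. -/
structure Params where
  /-- density of the base stations of each tier -/
  lam : Tier → ℝ
  lam_pos : ∀ i, 0 < lam i
  /-- transmit power -/
  power : Tier → ℝ
  power_pos : ∀ i, 0 < power i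
  /-- intercept of the path loss law -/
  C : Tier → ℝ
  C_pos : ∀ i, 0 < C i
  /-- path loss exponent -/
  alpha : Tier → ℝ
  two_lt_alpha_macro : 2 < alpha .macroBS
  two_le_alpha_pico : 2 ≤ alpha .picoBS
  /-- number of antenna elements -/
  N : Tier → ℕ
  N_pos : ∀ i, 0 < N i
  /-- bias factor of the maximum received power association -/
  bias : Tier → ℝ
  bias_pos : ∀ i, 0 < bias i
  /-- radius of the LOS ball of the pico tier -/
  RL : ℝ
  RL_pos : 0 < RL
  /-- Nakagami parameter of the pico tier -/
  Nak : ℕ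
  Nak_pos : 0 < Nak
  /-- antenna spacing -/
  d : ℝ
  d_pos : 0 < d
  /-- wavelength -/
  wavelength : ℝ
  wavelength_pos : 0 < wavelength
  /-- `p i f`: probability that a base station of tier `i` caches the `f`-th file -/
  p : Tier → ℕ → ℝ

/-- The unit step function. -/
def unitStep (x : ℝ) : ℝ := if 0 ≤ x then 1 else 0

/-- Maximum directivity gain, provided by the serving base station. -/
def G0 : ℝ := 1

/-- The array gain of a uniform linear array with `N` elements,
`sin² (π N ω) / (N² sin² (π ω))`, with its limit value `1` where `sin (π ω) = 0`. -/
def arrayGain (N : ℕ) (ω : ℝ) : ℝ :=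
  if Real.sin (Real.pi * ω) = 0 then 1
  else Real.sin (Real.pi * N * ω) ^ 2 / ((N : ℝ) ^ 2 * Real.sin (Real.pi * ω) ^ 2)

namespace Params

variable (par : Params)

/-- Fading parameter of each tier: Rayleigh fading (parameter `1`) in the macro tier, Nakagami
fading in the pico tier. -/
def fadingParam : Tier → ℕ
  | .macroBS => 1
  | .picoBS => par.Nak

/-- Path loss laws `L₁ (r) = C₁ r ^ (-α₁)` and `L₂ (r) = U (R_L - r) C₂ r ^ (-α₂)`. -/
def pathLoss : Tier → ℝ → ℝ
  | .macroBS, r => par.C .macroBS * r ^ (-par.alpha .macroBS)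
  | .picoBS, r => unitStep (par.RL - r) * (par.C .picoBS * r ^ (-par.alpha .picoBS))

/-- Array gain functions: omnidirectional macro base stations, uniform linear arrays at the pico
base stations. -/
def gain : Tier → ℝ → ℝ
  | .macroBS, _ => 1
  | .picoBS, ω => arrayGain (par.N .picoBS) ω

end Params

/-! ### The random network -/

/-- The plane. The typical user is at the origin. -/
abbrev Plane := EuclideanSpace ℝ (Fin 2)

section Random

variable {Ω : Type*} [MeasurableSpace Ω]

/-- The number of points of the enumerated point process `X` in the set `A`. -/
def count (X : ℕ → Ω → Plane) (A : Set Plane) (w : Ω) : ℕ∞ :=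
  Set.encard {n : ℕ | X n w ∈ A}

/-- `X` enumerates the points of a homogeneous Poisson point process of density `lam > 0` in the
plane: numbers of points are Poisson distributed, and independent for disjoint sets. -/
structure IsHPPP (P : Measure Ω) (lam : ℝ) (X : ℕ → Ω → Plane) : Prop where
  measurable : ∀ n, Measurable (X n)
  poisson : ∀ A : Set Plane, MeasurableSet A → volume A ≠ ⊤ → ∀ k : ℕ,
    P {w | count X A w = k} = poissonMeasure (lam * (volume A).toReal).toNNReal {k}
  indep : ∀ (m : ℕ) (A : Fin m → Set Plane), (∀ j, MeasurableSet (A j)) →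
    Pairwise (fun j j' => Disjoint (A j) (A j')) → iIndepFun (fun j => count X (A j)) P

/-- The random elements of the network. The base stations of tier `i` are numbered by `n : ℕ`. -/
structure Elements (Ω : Type*) where
  /-- location of a base station -/
  loc : Tier → ℕ → Ω → Plane
  /-- set of (ranks of) files cached at a base station -/
  cache : Tier → ℕ → Ω → Set ℕ
  /-- power gain `|h|²` of the small scale fading between a base station and the typical user -/
  fading : Tier → ℕ → Ω → ℝ
  /-- spatial angle `φ - θ` between the beam of a base station and the direction of the typical
  user -/
  angle : Tier → ℕ → Ω → ℝ

/-- Labels of the independent sources of randomness. -/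
inductive Source
  | loc (i : Tier)
  | cache (i : Tier) (n : ℕ)
  | fading (i : Tier) (n : ℕ)
  | angle (i : Tier) (n : ℕ)

/-- The σ-algebra generated by a source of randomness: the locations of all base stations of one
tier, or one of the attributes of one base station. -/
@[reducible] def Elements.sigmaAlg (E : Elements Ω) : Source → MeasurableSpace Ω
  | .loc i => MeasurableSpace.comap (fun w n => E.loc i n w) inferInstance
  | .cache i n => MeasurableSpace.comap (E.cache i n) inferInstance
  | .fading i n => MeasurableSpace.comap (E.fading i n) inferInstance
  | .angle i n => MeasurableSpace.comap (E.angle i n) inferInstance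

/-- The probabilistic assumptions: Poisson locations, random caching with the prescribed caching
probabilities, normalized Gamma fading power gains (exponential in the macro tier), angles that
are uniform on `[-d / wavelength, d / wavelength]`, all of them mutually independent. -/
structure IsNetwork (par : Params) (P : Measure Ω) (E : Elements Ω) : Prop where
  hppp : ∀ i, IsHPPP P (par.lam i) (E.loc i)
  cache_measurable : ∀ i n, Measurable (E.cache i n)
  cache_prob : ∀ i n f, P.real {w | f ∈ E.cache i n w} = par.p i f
  fading_measurable : ∀ i n, Measurable (E.fading i n)
  fading_law : ∀ i n,
    P.map (E.fading i n) = gammaMeasure (par.fadingParam i) (par.fadingParam i)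
  angle_measurable : ∀ i n, Measurable (E.angle i n)
  angle_law : ∀ i n, pdf.IsUniform (E.angle i n)
    (Set.Icc (-(par.d / par.wavelength)) (par.d / par.wavelength)) P volume
  indep : iIndep E.sigmaAlg P

variable (par : Params) (E : Elements Ω)

/-- Biased average received power `b P L(‖x‖) N G₀` from base station `n` of tier `i`. -/
def biasedPower (i : Tier) (n : ℕ) (w : Ω) : ENNReal :=
  ENNReal.ofReal (par.bias i * par.power i * par.pathLoss i ‖E.loc i n w‖ * par.N i * G0)

/-- The largest biased average received power from the base stations of tier `i` that cache the
`f`-th file (zero if there are none). -/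
def bestPower (f : ℕ) (i : Tier) (w : Ω) : ENNReal :=
  ⨆ (n : ℕ) (_ : f ∈ E.cache i n w), biasedPower par E i n w

/-- Under maximum received power association, base station `n` of tier `i` serves the typical user
when the latter requests the `f`-th file: it caches this file, and its biased average received
power is the maximum within its tier and exceeds that of the other tier. -/
def IsServing (f : ℕ) (i : Tier) (n : ℕ) (w : Ω) : Prop :=
  f ∈ E.cache i n w ∧ biasedPower par E i n w = bestPower par E f i w ∧
    bestPower par E f i.other w < biasedPower par E i n w

/-- Power received from base station `n` of tier `i` when this base station is the serving one. -/
def signal (i : Tier) (n : ℕ) (w : Ω) : ENNReal :=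
  ENNReal.ofReal (par.power i * par.pathLoss i ‖E.loc i n w‖ * G0 * par.N i * E.fading i n w)

/-- Interference at the typical user served by base station `n` of tier `i`: the power received
from all other base stations of the tier, whether or not they cache the requested file. -/
def interference (i : Tier) (n : ℕ) (w : Ω) : ENNReal :=
  ∑' m : {m : ℕ // m ≠ n}, ENNReal.ofReal (par.power i * par.pathLoss i ‖E.loc i m w‖ *
    (par.N i * E.fading i m w * par.gain i (E.angle i m w)))

/-- SINR at the typical user served by base station `n` of tier `i`, with noise power
`noise`. It is infinite when there is neither noise nor interference. -/
def sinr (noise : ℝ) (i : Tier) (n : ℕ) (w : Ω) : ENNReal :=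
  signal par E i n w / (ENNReal.ofReal noise + interference par E i n w)

/-- SINR coverage probability `Θ_{i,f} (τ)` of tier `i` under maximum received power association,
noise ignored: the probability that the typical user requesting the `f`-th file is served by a base
station of tier `i` with an SINR above `τ`. -/
def coverageProb (P : Measure Ω) (f : ℕ) (i : Tier) (τ : ℝ) : ℝ :=
  P.real {w | ∃ n, IsServing par E f i n w ∧ ENNReal.ofReal τ < sinr par E 0 i n w}

/-- Association probability of tier `i` under maximum received power association. -/
def assocProb (P : Measure Ω) (f : ℕ) (i : Tier) : ℝ :=
  P.real {w | bestPower par E f i.other w < bestPower par E f i w}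

end Random

/-! ### The functions in the analytical expressions -/

/-- The Gauss hypergeometric function `₂F₁ (a, b; c; z)` at real `z < 1`: the hypergeometric series
for `-1 < z`, and its analytic continuation to `z ≤ -1`, given by Pfaff's transformation
`₂F₁ (a, b; c; z) = (1 - z) ^ (-b) ₂F₁ (c - a, b; c; z / (z - 1))`. -/
def gaussHyp (a b c z : ℝ) : ℝ :=
  if -1 < z then ordinaryHypergeometric a b c z
  else (1 - z) ^ (-b) * ordinaryHypergeometric (c - a) b c (z / (z - 1))

/-- Gauss-Chebyshev node `x_k` of the rule with `u` nodes. -/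
def node (u k : ℕ) : ℝ := Real.cos ((2 * (k : ℝ) - 1) / (2 * (u : ℝ)) * Real.pi)

/-- `η_L = N (N!) ^ (-1 / N)`. -/
def etaL (N : ℕ) : ℝ := N * (N.factorial : ℝ) ^ (-1 / (N : ℝ))

/-- The largest deviation between the distribution function of the normalized Gamma distribution
with parameter `N` and its approximation `γ ↦ (1 - exp (-η_L γ)) ^ N`, `γ > 0`. -/
def gammaGap (N : ℕ) : ℝ :=
  ⨆ γ : Set.Ioi (0 : ℝ),
    |cdf (gammaMeasure N N) (γ : ℝ) - (1 - Real.exp (-(etaL N * (γ : ℝ)))) ^ N|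

/-- `F_y (y)` for the Nakagami parameter `N`. -/
def Fy (N : ℕ) (y : ℝ) : ℝ :=
  N * Real.log (1 + 1 / y) - 1 / (y * (1 + y) ^ (N - 1))
    - ∑ m ∈ Finset.Icc 1 (N - 1), (N : ℝ) / ((1 + y) ^ (N - m) * ((N : ℝ) - m))

namespace Params

variable (par : Params) (f : ℕ)

/-- `S_i (z) = ₂F₁ (-2 / α_i, N_i; 1 - 2 / α_i; -z)`, with `N_i` the fading parameter. -/
def S (i : Tier) (z : ℝ) : ℝ :=
  gaussHyp (-(2 / par.alpha i)) (par.fadingParam i) (1 - 2 / par.alpha i) (-z)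

/-- `Δ_i (z) = Γ (1 - 2 / α_i) Γ (N_i + 2 / α_i) Γ (N_i)⁻¹ z ^ (2 / α_i)`. -/
def Delta (i : Tier) (z : ℝ) : ℝ :=
  Real.Gamma (1 - 2 / par.alpha i) * Real.Gamma (par.fadingParam i + 2 / par.alpha i) *
    (Real.Gamma (par.fadingParam i))⁻¹ * z ^ (2 / par.alpha i)

/-- `P^r_{j,i} = (b_j P_j C_j N_j) / (b_i P_i C_i N_i)`. -/
def powerRatio (j i : Tier) : ℝ :=
  (par.bias j * par.power j * par.C j * par.N j) / (par.bias i * par.power i * par.C i * par.N i)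

/-- `α^r_{j,i} = α_j / α_i`. -/
def alphaRatio (j i : Tier) : ℝ := par.alpha j / par.alpha i

/-- `R_r = (P^r_{1,2} R_L ^ α₂) ^ (1 / α₁)`. -/
def Rr : ℝ :=
  (par.powerRatio .macroBS .picoBS * par.RL ^ par.alpha .picoBS) ^ (1 / par.alpha .macroBS)

/-- The density `f^P_{i,f}` of the distance to the serving base station, on the event that it
belongs to tier `i`, under maximum received power association. -/
def servingDensity : Tier → ℝ → ℝ
  | .macroBS, r =>
      2 * Real.pi * par.p .macroBS f * par.lam .macroBS * r *
        Real.exp (-Real.pi *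
          (par.p .macroBS f * par.lam .macroBS *
              par.powerRatio .macroBS .macroBS ^ (2 / par.alpha .picoBS) *
              r ^ (2 / par.alphaRatio .macroBS .macroBS)
            + par.p .picoBS f * par.lam .picoBS *
              par.powerRatio .picoBS .macroBS ^ (2 / par.alpha .picoBS) *
              r ^ (2 / par.alphaRatio .picoBS .macroBS))) * unitStep (par.Rr - r)
      + 2 * Real.pi * par.p .macroBS f * par.lam .macroBS * r *
        Real.exp (-Real.pi * par.p .picoBS f * par.lam .picoBS * par.RL ^ 2
          - Real.pi * par.p .macroBS f * par.lam .macroBS * r ^ 2) * unitStep (r - par.Rr)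
  | .picoBS, r =>
      2 * Real.pi * par.p .picoBS f * par.lam .picoBS * r *
        Real.exp (-Real.pi *
          (par.p .macroBS f * par.lam .macroBS *
              par.powerRatio .macroBS .picoBS ^ (2 / par.alpha .macroBS) *
              r ^ (2 / par.alphaRatio .macroBS .picoBS)
            + par.p .picoBS f * par.lam .picoBS *
              par.powerRatio .picoBS .picoBS ^ (2 / par.alpha .macroBS) *
              r ^ (2 / par.alphaRatio .picoBS .picoBS))) * unitStep (par.RL - r)

/-- `W_f (ω, s, τ)` at distance `r`. The expression for `α₂ = 2` contains `F_y (0)` when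
`s G₂(ω) τ = 0`, where `F_y` is not defined: its limit value is taken there. -/
def W (r ω s τ : ℝ) : ℝ :=
  if 2 < par.alpha .picoBS then
    par.p .picoBS f *
        par.S .picoBS (s * par.gain .picoBS ω * τ / (par.Nak * r ^ par.alpha .picoBS)) * r ^ 2
      + (1 - par.p .picoBS f) * par.Delta .picoBS (s * par.gain .picoBS ω * τ / par.Nak)
      - par.S .picoBS (s * par.gain .picoBS ω * τ / (par.Nak * par.RL ^ par.alpha .picoBS)) *
        par.RL ^ 2
  else if s * par.gain .picoBS ω * τ = 0 then
    par.p .picoBS f * r ^ 2 - par.RL ^ 2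
  else
    s * par.gain .picoBS ω * τ / par.Nak *
      (Fy par.Nak (s * par.gain .picoBS ω * τ / (par.Nak * par.RL ^ 2))
        - par.p .picoBS f * Fy par.Nak (s * par.gain .picoBS ω * τ / (par.Nak * r ^ 2)))

/-- The Laplace transform of interference `ℒ₂ (s, τ)` of the pico tier at distance `r`, evaluated by
the Gauss-Chebyshev rule with `u₁` nodes. -/
def L2 (u₁ : ℕ) (r s τ : ℝ) : ℝ :=
  Real.exp (-Real.pi * par.lam .picoBS * (par.RL ^ 2 - par.p .picoBS f * r ^ 2)
    - Real.pi ^ 2 * par.lam .picoBS / (2 * u₁) *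
      ∑ k ∈ Finset.Icc 1 u₁,
        par.W f r (node u₁ k * par.d / par.wavelength) s τ * Real.sqrt (1 - node u₁ k ^ 2))

/-- `F_R (r, τ)`, which depends on the summation index `n`. -/
def FR (u₁ n : ℕ) (r τ : ℝ) : ℝ :=
  par.L2 f u₁ r (n * etaL par.Nak * r ^ par.alpha .picoBS / G0) τ * par.servingDensity f .picoBS r

/-- The approximate expression of `Θ_{2,f} (τ)`, with `u₁` and `u₂` Gauss-Chebyshev nodes. -/
def coverageApprox (u₁ u₂ : ℕ) (τ : ℝ) : ℝ :=
  Real.pi * par.RL / (2 * u₂) *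
    ∑ n ∈ Finset.Icc 1 par.Nak, (-1 : ℝ) ^ (n + 1) * (par.Nak.choose n : ℝ) *
      ∑ k ∈ Finset.Icc 1 u₂,
        par.FR f u₁ n ((node u₂ k + 1) * par.RL / 2) τ * Real.sqrt (1 - node u₂ k ^ 2)

/-- The integrand of the expression of `Θ_{1,f} (τ)`. -/
def macroIntegrand (τ r : ℝ) : ℝ :=
  Real.exp (-Real.pi * par.lam .macroBS * r ^ 2 *
      (par.p .macroBS f * (par.S .macroBS τ - 1) + (1 - par.p .macroBS f) * par.Delta .macroBS τ)) *
    par.servingDensity f .macroBS r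

end Params

end

end HetNet

/-! Base stations are enumerated, so an expectation over a point process is a series over the index
`n` of integrals with values in `[0, ∞]`, and no summability question arises. Almost surely the
serving station is characterized geometrically: it is in range, it caches the file, no caching
station of its own tier is nearer, and no caching station of the other tier lies in the ball of
radius `exclRadius` (`isServing_iff`). Almost surely at most one index has these properties
(`IsNetwork.ae_unique`), so the coverage probability is a sum over `n`. For a server at distance `r`
the SINR condition reads `|h|² > τ r ^ α I`, with `I` the interference at unit power. The gain `h`
of the server is independent of all the rest and can be replaced by its Gamma tail
(`IsNetwork.coverageProb_eq`).

What has to be computed is therefore the sum over `n` of the mean of `exp (-κ r ^ α I)` on the event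
that `n` serves. In `IsNetwork.mecke` the marks are averaged station by station, the other tier
yields a void probability, and the Mecke formula for the serving tier leaves a single integral over
the plane. The Mecke formula is built from Poisson counts: for functions constant on finitely many
disjoint cells it is the Poisson generating function and its derivative, combined with independence;
the general case follows by monotone and dominated limits.

The remaining exponent is explicit because `2 s (1 + X s ^ (-α)) ^ (-b)` has the antiderivative `s ^
2 ₂F₁ (-2/α, b; 1 - 2/α; -X s ^ (-α))`. This hypergeometric function solves a first-order equation,
and its growth at infinity makes the antiderivative tend to the `Δ` term as `s → 0`. For `α = 2` the
function `F_y` plays the same role.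

In the macro tier the fading tail is exponential, and `κ = τ` gives the exact formula. In the pico
tier the tail is replaced by `1 - (1 - exp (-η γ)) ^ N`, which expands into exponentials with `κ = n
η τ`. By Alzer's inequality (`one_sub_exp_pow_le_cdf`) this replacement only increases the result,
and the error is at most `gammaGap` times the total mass of the serving events, which the
association probability bounds. Finally, a Gauss-Chebyshev sum is a midpoint rule in `θ = arccos x`,
hence the integral of a step function. Dominated convergence turns both quadratures into integrals
jointly, because the inner rule converges together with a moving value of the radius. -/

namespace HetNet

noncomputable section

open scoped ENNReal

set_option linter.unusedSectionVars false

/-! ### Exponentials and infinite products with values in `[0, ∞]`. -/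

section

/-- `exp (-x)` on `[0, ∞]`. -/
def expNeg (x : ℝ≥0∞) : ℝ≥0∞ := (EReal.exp (x : EReal))⁻¹

lemma expNeg_zero : expNeg 0 = 1 := by simp [expNeg]

lemma expNeg_top : expNeg ⊤ = 0 := by simp [expNeg]

lemma continuous_expNeg : Continuous expNeg :=
  continuous_inv.comp (EReal.expHomeomorph.continuous.comp continuous_coe_ennreal_ereal)

lemma measurable_expNeg : Measurable expNeg := continuous_expNeg.measurable

lemma expNeg_antitone : Antitone expNeg := fun x y h => by
  simp only [expNeg, ENNReal.inv_le_inv]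
  exact EReal.exp_monotone (by exact_mod_cast h)

lemma expNeg_le_one (x : ℝ≥0∞) : expNeg x ≤ 1 := by
  rw [← expNeg_zero]; exact expNeg_antitone zero_le

lemma expNeg_add (x y : ℝ≥0∞) : expNeg (x + y) = expNeg x * expNeg y := by
  have h : ∀ z : ℝ≥0∞, EReal.exp (z : EReal) ≠ 0 := fun z => by simp
  rw [expNeg, expNeg, expNeg, EReal.coe_ennreal_add, EReal.exp_add,
    ENNReal.mul_inv (Or.inl (h x)) (Or.inr (h y))]

lemma expNeg_sum {ι : Type*} (s : Finset ι) (x : ι → ℝ≥0∞) :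
    expNeg (∑ i ∈ s, x i) = ∏ i ∈ s, expNeg (x i) := by
  classical
  induction s using Finset.induction_on with
  | empty => simp [expNeg_zero]
  | insert a s ha ih => rw [Finset.sum_insert ha, Finset.prod_insert ha, expNeg_add, ih]

lemma expNeg_ofReal {x : ℝ} (hx : 0 ≤ x) :
    expNeg (ENNReal.ofReal x) = ENNReal.ofReal (Real.exp (-x)) := by
  rw [expNeg, EReal.coe_ennreal_ofReal, max_eq_left hx, EReal.exp_coe, Real.exp_neg,
    ENNReal.ofReal_inv_of_pos (Real.exp_pos x)]

lemma expNeg_eq {x : ℝ≥0∞} (hx : x ≠ ⊤) : expNeg x = ENNReal.ofReal (Real.exp (-x.toReal)) := by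
  rw [← expNeg_ofReal ENNReal.toReal_nonneg, ENNReal.ofReal_toReal hx]

/-- Infinite product of factors in `[0, 1]`. -/
def infProd (φ : ℕ → ℝ≥0∞) : ℝ≥0∞ := ⨅ M, ∏ m ∈ Finset.range M, φ m

lemma infProd_le_one (φ : ℕ → ℝ≥0∞) : infProd φ ≤ 1 :=
  (iInf_le _ 0).trans (by simp)

lemma antitone_partialProd {φ : ℕ → ℝ≥0∞} (h : ∀ m, φ m ≤ 1) :
    Antitone fun M => ∏ m ∈ Finset.range M, φ m :=
  antitone_nat_of_succ_le fun M => by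
    rw [Finset.prod_range_succ]; exact mul_le_of_le_one_right' (h M)

lemma tendsto_infProd {φ : ℕ → ℝ≥0∞} (h : ∀ m, φ m ≤ 1) :
    Tendsto (fun M => ∏ m ∈ Finset.range M, φ m) atTop (𝓝 (infProd φ)) :=
  tendsto_atTop_iInf (antitone_partialProd h)

lemma infProd_le_infProd {φ φ' : ℕ → ℝ≥0∞} (h : ∀ m, φ m ≤ φ' m) : infProd φ ≤ infProd φ' :=
  iInf_mono fun _ => Finset.prod_le_prod' fun m _ => h m

lemma measurable_infProd {α : Type*} [MeasurableSpace α] {φ : ℕ → α → ℝ≥0∞}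
    (h : ∀ m, Measurable (φ m)) : Measurable fun x => infProd fun m => φ m x :=
  Measurable.iInf fun _ => Finset.measurable_prod _ fun m _ => h m

lemma infProd_eq_prod {φ : ℕ → ℝ≥0∞} (h : ∀ m, φ m ≤ 1) (F : Finset ℕ) (hF : ∀ m ∉ F, φ m = 1) :
    infProd φ = ∏ m ∈ F, φ m := by
  refine tendsto_nhds_unique (tendsto_infProd h) (tendsto_atTop_of_eventually_const
    (i₀ := F.sup id + 1) fun M hM => ?_)
  refine (Finset.prod_subset (fun m hm => ?_) fun m _ hm => hF m hm).symm
  have : m ≤ F.sup id := Finset.le_sup (f := id) hm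
  simp; omega

lemma infProd_mul {φ φ' : ℕ → ℝ≥0∞} (h : ∀ m, φ m ≤ 1) (h' : ∀ m, φ' m ≤ 1) :
    infProd (fun m => φ m * φ' m) = infProd φ * infProd φ' := by
  refine tendsto_nhds_unique (tendsto_infProd fun m => mul_le_one' (h m) (h' m)) ?_
  simp_rw [Finset.prod_mul_distrib]
  exact ENNReal.Tendsto.mul (tendsto_infProd h)
    (Or.inr (ne_top_of_le_ne_top ENNReal.one_ne_top (infProd_le_one _))) (tendsto_infProd h')
    (Or.inr (ne_top_of_le_ne_top ENNReal.one_ne_top (infProd_le_one _)))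

/-- An infinite product is an infimum over `M`, and a decreasing limit is an infimum over `k`; the
two infima commute. Without monotonicity in `k` the limit need not pass through the infinite
product. -/
lemma tendsto_infProd_of_antitone {φ : ℕ → ℕ → ℝ≥0∞} {φ' : ℕ → ℝ≥0∞} (h1 : ∀ k m, φ k m ≤ 1)
    (hanti : ∀ m, Antitone fun k => φ k m)
    (hlim : ∀ m, Tendsto (fun k => φ k m) atTop (𝓝 (φ' m))) :
    Tendsto (fun k => infProd (φ k)) atTop (𝓝 (infProd φ')) := by
  have hinf : infProd φ' = ⨅ k, infProd (φ k) := by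
    simp only [infProd]
    rw [iInf_comm]
    congr 1; ext M
    have ht : Tendsto (fun k => ∏ m ∈ Finset.range M, φ k m) atTop
        (𝓝 (∏ m ∈ Finset.range M, φ' m)) :=
      ENNReal.tendsto_finsetProd_of_ne_top _ (fun m _ => hlim m) fun m _ =>
        ne_top_of_le_ne_top ENNReal.one_ne_top (le_of_tendsto' (hlim m) fun k => h1 k m)
    exact tendsto_nhds_unique ht (tendsto_atTop_iInf fun k k' hk =>
      Finset.prod_le_prod' fun m _ => hanti m hk)
  rw [hinf]
  exact tendsto_atTop_iInf fun k k' hk => infProd_le_infProd fun m => hanti m hk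

/-- Viewing the series as one integral against counting measure times `P` makes the convergence
theorems for integrals, and later densities, available for sums over points. -/
lemma tsum_lintegral_eq_lintegral_prod {Ω : Type*} [MeasurableSpace Ω] (P : Measure Ω) [SFinite P]
    {F : ℕ → Ω → ℝ≥0∞} (hF : ∀ n, Measurable (F n)) :
    ∑' n, ∫⁻ w, F n w ∂P = ∫⁻ q, F q.1 q.2 ∂(Measure.count.prod P) := by
  have hm : Measurable fun q : ℕ × Ω => F q.1 q.2 := measurable_from_prod_countable_right hF
  rw [lintegral_prod _ hm.aemeasurable, lintegral_count]

/-- Dominated convergence for series of Lebesgue integrals. -/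
lemma tendsto_tsum_lintegral {Ω : Type*} [MeasurableSpace Ω] (P : Measure Ω) [SFinite P]
    {F : ℕ → ℕ → Ω → ℝ≥0∞} {F' G : ℕ → Ω → ℝ≥0∞} (hF : ∀ k n, Measurable (F k n))
    (hG : ∀ n, Measurable (G n))
    (hle : ∀ k n w, F k n w ≤ G n w) (hfin : ∑' n, ∫⁻ w, G n w ∂P ≠ ⊤)
    (hlim : ∀ n w, Tendsto (fun k => F k n w) atTop (𝓝 (F' n w))) :
    Tendsto (fun k => ∑' n, ∫⁻ w, F k n w ∂P) atTop (𝓝 (∑' n, ∫⁻ w, F' n w ∂P)) := by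
  have hF' : ∀ n, Measurable (F' n) := fun n =>
    measurable_of_tendsto_metrizable (fun k => hF k n)
      (tendsto_pi_nhds.2 fun w => hlim n w)
  rw [tsum_lintegral_eq_lintegral_prod P hF']
  simp_rw [fun k => tsum_lintegral_eq_lintegral_prod P (hF k)]
  rw [tsum_lintegral_eq_lintegral_prod P hG] at hfin
  exact tendsto_lintegral_of_dominated_convergence (fun q => G q.1 q.2)
    (fun k => measurable_from_prod_countable_right (hF k))
    (fun k => .of_forall fun q => hle k q.1 q.2) hfin (.of_forall fun q => hlim q.1 q.2)

/-! ### Poisson counts and their generating function. -/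

section Count

variable {Ω : Type*} [MeasurableSpace Ω]

/-- At least `k` points lie in `A` exactly when all points of some `k`-element set of indices do,
and there are countably many finite index sets. -/
lemma measurable_count {X : ℕ → Ω → Plane} (hX : ∀ n, Measurable (X n)) {A : Set Plane}
    (hA : MeasurableSet A) : Measurable (count X A) := by
  have key : ∀ k : ℕ, MeasurableSet {w | (k : ℕ∞) ≤ count X A w} := fun k => by
    have : {w | (k : ℕ∞) ≤ count X A w} =
        ⋃ s ∈ {s : Finset ℕ | s.card = k}, ⋂ n ∈ s, X n ⁻¹' A := by
      ext w
      simp only [count, Set.mem_ofPred_eq, Set.mem_iUnion, Set.mem_iInter, Set.mem_preimage,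
        exists_prop]
      constructor
      · intro h
        obtain ⟨t, ht, htk⟩ := Set.exists_subset_encard_eq h
        have hfin : t.Finite := Set.finite_of_encard_eq_coe htk
        refine ⟨hfin.toFinset, ?_, fun n hn => ht (by simpa using hn)⟩
        rw [hfin.encard_eq_coe_toFinset_card] at htk
        exact_mod_cast htk
      · rintro ⟨s, hs, h⟩
        rw [← hs, ← Set.encard_coe_eq_coe_finsetCard]
        exact Set.encard_le_encard fun n hn => h n hn
    rw [this]
    exact MeasurableSet.biUnion (Set.to_countable _) fun s _ =>
      MeasurableSet.biInter (Set.to_countable _) fun n _ => hX n hA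
  refine measurable_to_countable' fun k => ?_
  induction k using ENat.recTopCoe with
  | top =>
    have : count X A ⁻¹' {⊤} = ⋂ k : ℕ, {w | (k : ℕ∞) ≤ count X A w} := by
      ext w
      simp only [Set.mem_preimage, Set.mem_singleton_iff, Set.mem_iInter, Set.mem_ofPred_eq]
      exact ENat.eq_top_iff_forall_ge
    rw [this]
    exact MeasurableSet.iInter key
  | coe k =>
    have : count X A ⁻¹' {(k : ℕ∞)} =
        {w | (k : ℕ∞) ≤ count X A w} \ {w | ((k + 1 : ℕ) : ℕ∞) ≤ count X A w} := by
      ext w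
      simp only [Set.mem_preimage, Set.mem_singleton_iff, Set.mem_sdiff, Set.mem_ofPred_eq, not_le]
      constructor
      · intro h
        rw [h]
        exact ⟨le_rfl, by exact_mod_cast Nat.lt_succ_self k⟩
      · rintro ⟨h1, h2⟩
        rw [Nat.cast_add, Nat.cast_one, ENat.lt_add_one_iff (ENat.natCast_ne_top k)] at h2
        exact le_antisymm h2 h1
    rw [this]
    exact (key k).diff (key (k + 1))

variable {P : Measure Ω} [IsProbabilityMeasure P] {lam : ℝ} {X : ℕ → Ω → Plane}

/-- Mean number of points. -/
def meanCount (lam : ℝ) (A : Set Plane) : ℝ := lam * (volume A).toReal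

lemma meanCount_nonneg {lam : ℝ} (hl : 0 ≤ lam) (A : Set Plane) : 0 ≤ meanCount lam A :=
  mul_nonneg hl ENNReal.toReal_nonneg

lemma IsHPPP.measure_count (h : IsHPPP P lam X) (hl : 0 ≤ lam) {A : Set Plane}
    (hA : MeasurableSet A) (hfin : volume A ≠ ⊤) (k : ℕ) :
    P {w | count X A w = k} = ENNReal.ofReal
      (Real.exp (-meanCount lam A) * meanCount lam A ^ k / k.factorial) := by
  rw [h.poisson A hA hfin k, poissonMeasure_singleton]
  rw [Real.coe_toNNReal (lam * (volume A).toReal) (meanCount_nonneg hl A)]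
  rfl

lemma hasSum_poisson (μ : ℝ) :
    HasSum (fun k : ℕ => Real.exp (-μ) * μ ^ k / k.factorial) 1 := by
  have := (NormedSpace.expSeries_div_hasSum_exp μ).mul_left (Real.exp (-μ))
  rw [← Real.exp_eq_exp_ℝ, ← Real.exp_add, neg_add_cancel, Real.exp_zero] at this
  simpa [mul_div_assoc] using this

/-- The Poisson masses of the finite values already add up to `1`, so the value `⊤` has probability
zero. -/
lemma IsHPPP.count_lt_top (h : IsHPPP P lam X) (hl : 0 ≤ lam) {A : Set Plane}
    (hA : MeasurableSet A) (hfin : volume A ≠ ⊤) : ∀ᵐ w ∂P, count X A w ≠ ⊤ := by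
  have hm := measurable_count h.measurable hA
  have h1 : P {w | count X A w ≠ ⊤} = 1 := by
    have : {w | count X A w ≠ ⊤} = ⋃ k : ℕ, {w | count X A w = k} := by
      ext w
      simp only [Set.mem_ofPred_eq, Set.mem_iUnion]
      exact ⟨fun h => ⟨_, (ENat.natCast_toNat h).symm⟩, fun ⟨k, hk⟩ => hk ▸ ENat.natCast_ne_top k⟩
    rw [this, measure_iUnion]
    · simp_rw [h.measure_count hl hA hfin]
      rw [← ENNReal.ofReal_tsum_of_nonneg _ (hasSum_poisson _).summable, (hasSum_poisson _).tsum_eq,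
        ENNReal.ofReal_one]
      intro k
      have := meanCount_nonneg hl A
      positivity
    · intro i j hij
      exact Set.disjoint_left.2 fun w hi hj => hij (by
        simp only [Set.mem_ofPred_eq] at hi hj; rw [hi] at hj; exact_mod_cast hj)
    · intro k; exact hm (measurableSet_singleton _)
  rw [ae_iff]
  have := prob_compl_eq_zero_iff (μ := P) (s := {w | count X A w ≠ ⊤})
    (hm (measurableSet_singleton _).compl)
  exact this.2 h1

lemma IsHPPP.lintegral_count (h : IsHPPP P lam X) (hl : 0 ≤ lam) {A : Set Plane}
    (hA : MeasurableSet A) (hfin : volume A ≠ ⊤) (φ : ℕ∞ → ℝ≥0∞) :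
    ∫⁻ w, φ (count X A w) ∂P = ∑' k : ℕ, φ k * ENNReal.ofReal
      (Real.exp (-meanCount lam A) * meanCount lam A ^ k / k.factorial) := by
  have hm := measurable_count h.measurable hA
  have h1 : ∀ᵐ w ∂P, φ (count X A w) =
      ∑' k : ℕ, {w | count X A w = k}.indicator (fun _ => φ k) w := by
    filter_upwards [h.count_lt_top hl hA hfin] with w hw
    obtain ⟨k, hk⟩ := ENat.ne_top_iff_exists.1 hw
    rw [tsum_eq_single k, Set.indicator_of_mem (by simp [← hk]), ← hk]
    intro j hj
    rw [Set.indicator_of_notMem]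
    simp only [Set.mem_ofPred_eq, ← hk]
    exact_mod_cast hj.symm
  have hs : ∀ k : ℕ, MeasurableSet {w | count X A w = k} := fun k => hm (measurableSet_singleton _)
  rw [lintegral_congr_ae h1, lintegral_tsum fun k => (measurable_const.indicator (hs k)).aemeasurable]
  congr 1; ext k
  rw [lintegral_indicator_const (hs k), h.measure_count hl hA hfin]

/-- The generating function of the Poisson law: weighting by `c ^ k` turns mean `μ` into mean `c μ`,
up to normalization. -/
lemma tsum_pow_mul_poisson {μ c : ℝ} (hμ : 0 ≤ μ) (hc : 0 ≤ c) :
    ∑' k : ℕ, ENNReal.ofReal c ^ k * ENNReal.ofReal (Real.exp (-μ) * μ ^ k / k.factorial) =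
      ENNReal.ofReal (Real.exp (-((1 - c) * μ))) := by
  have hs : HasSum (fun k : ℕ => c ^ k * (Real.exp (-μ) * μ ^ k / k.factorial))
      (Real.exp (-((1 - c) * μ))) := by
    have := (hasSum_poisson (c * μ)).mul_left (Real.exp (-((1 - c) * μ)))
    rw [mul_one] at this
    refine this.congr_fun fun k => ?_
    rw [show -μ = -((1 - c) * μ) + -(c * μ) by ring, Real.exp_add, mul_pow]; ring
  rw [← hs.tsum_eq, ENNReal.ofReal_tsum_of_nonneg (fun k => by positivity) hs.summable]
  congr 1; ext k
  rw [ENNReal.ofReal_mul (by positivity), ENNReal.ofReal_pow hc]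

/-- The derivative of the generating function in `c`. Probabilistically, marking one of the `k`
points costs a factor `μ` and leaves a Poisson number of other points. -/
lemma tsum_mul_pow_mul_poisson {μ c : ℝ} (hμ : 0 ≤ μ) (hc : 0 ≤ c) :
    ∑' k : ℕ, k * ENNReal.ofReal c ^ (k - 1) *
        ENNReal.ofReal (Real.exp (-μ) * μ ^ k / k.factorial) =
      ENNReal.ofReal μ * ENNReal.ofReal (Real.exp (-((1 - c) * μ))) := by
  -- The term `k = 0` vanishes, so after the shift the truncated exponent `k - 1` is harmless and `k
  -- + 1` cancels against the factorial.
  rw [tsum_eq_zero_add' ENNReal.summable, ← tsum_pow_mul_poisson hμ hc, ← ENNReal.tsum_mul_left]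
  simp only [Nat.cast_zero, zero_mul, zero_add, Nat.add_sub_cancel]
  congr 1; ext k
  rw [← ENNReal.ofReal_pow hc, ← ENNReal.ofReal_natCast, ← ENNReal.ofReal_mul (by positivity),
    ← ENNReal.ofReal_mul (by positivity), ← ENNReal.ofReal_mul (by positivity),
    ← ENNReal.ofReal_mul (by positivity)]
  congr 1
  rw [Nat.factorial_succ]
  push_cast
  field_simp
  try ring

end Count

end

/-! ### The Mecke formula for finitely many disjoint cells. -/

section

section Cells

/-- Intensity measure of a homogeneous point process. -/
def intensity (lam : ℝ) : Measure Plane := ENNReal.ofReal lam • volume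

lemma intensity_eq_ofReal_meanCount {lam : ℝ} (hl : 0 ≤ lam) {A : Set Plane} (hA : volume A ≠ ⊤) :
    intensity lam A = ENNReal.ofReal (meanCount lam A) := by
  rw [meanCount, ENNReal.ofReal_mul hl, ENNReal.ofReal_toReal hA]; rfl

variable {Ω : Type*} [MeasurableSpace Ω] {P : Measure Ω} [IsProbabilityMeasure P] {lam : ℝ}
  {X : ℕ → Ω → Plane}

lemma IsHPPP.lintegral_pow_count (h : IsHPPP P lam X) (hl : 0 ≤ lam) {A : Set Plane}
    (hA : MeasurableSet A) (hfin : volume A ≠ ⊤) {c : ℝ≥0∞} (hc : c ≤ 1) :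
    ∫⁻ w, c ^ (count X A w).toNat ∂P = expNeg ((1 - c) * intensity lam A) := by
  have hc' : c ≠ ⊤ := ne_top_of_le_ne_top ENNReal.one_ne_top hc
  have hc1 : c.toReal ≤ 1 := ENNReal.toReal_le_of_le_ofReal zero_le_one (by simpa using hc)
  rw [h.lintegral_count hl hA hfin fun k => c ^ k.toNat]
  have := tsum_pow_mul_poisson (meanCount_nonneg hl A) (c := c.toReal) ENNReal.toReal_nonneg
  rw [ENNReal.ofReal_toReal hc'] at this
  simp only [ENat.toNat_natCast]
  rw [this, ← expNeg_ofReal (mul_nonneg (sub_nonneg.2 hc1) (meanCount_nonneg hl A)),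
    intensity_eq_ofReal_meanCount hl hfin, ENNReal.ofReal_mul (sub_nonneg.2 hc1),
    ENNReal.ofReal_sub _ ENNReal.toReal_nonneg, ENNReal.ofReal_one, ENNReal.ofReal_toReal hc']

lemma IsHPPP.lintegral_mul_pow_count (h : IsHPPP P lam X) (hl : 0 ≤ lam) {A : Set Plane}
    (hA : MeasurableSet A) (hfin : volume A ≠ ⊤) {c : ℝ≥0∞} (hc : c ≤ 1) :
    ∫⁻ w, (count X A w).toNat * c ^ ((count X A w).toNat - 1) ∂P =
      intensity lam A * expNeg ((1 - c) * intensity lam A) := by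
  have hc' : c ≠ ⊤ := ne_top_of_le_ne_top ENNReal.one_ne_top hc
  have hc1 : c.toReal ≤ 1 := ENNReal.toReal_le_of_le_ofReal zero_le_one (by simpa using hc)
  rw [h.lintegral_count hl hA hfin fun k => k.toNat * c ^ (k.toNat - 1)]
  have := tsum_mul_pow_mul_poisson (meanCount_nonneg hl A) (c := c.toReal) ENNReal.toReal_nonneg
  rw [ENNReal.ofReal_toReal hc'] at this
  simp only [ENat.toNat_natCast]
  rw [this, ← expNeg_ofReal (mul_nonneg (sub_nonneg.2 hc1) (meanCount_nonneg hl A)),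
    intensity_eq_ofReal_meanCount hl hfin, ENNReal.ofReal_mul (sub_nonneg.2 hc1),
    ENNReal.ofReal_sub _ ENNReal.toReal_nonneg, ENNReal.ofReal_one, ENNReal.ofReal_toReal hc']

open Classical in
/-- Sum over the points in finitely many cells, pathwise. -/
lemma tsum_cells_eq {m : ℕ} {A : Fin m → Set Plane}
    (hdisj : Pairwise fun j j' => Disjoint (A j) (A j')) (a c : Fin m → ℝ≥0∞)
    (hc : ∀ j, c j ≤ 1) (x : ℕ → Plane) (hfin : ∀ j, {n | x n ∈ A j}.Finite) :
    ∑' n, (∑ j, (A j).indicator (fun _ => a j) (x n)) *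
        infProd (fun k => if k = n then 1 else ∏ j, if x k ∈ A j then c j else 1) =
      ∑ j, a j * ∏ i, if i = j then
        ({n | x n ∈ A i}.encard.toNat : ℝ≥0∞) * c i ^ ({n | x n ∈ A i}.encard.toNat - 1)
        else c i ^ {n | x n ∈ A i}.encard.toNat := by
  -- Only finitely many indices fall into some cell; every other index contributes `0` to the sum
  -- and a factor `1` to the products.
  set F : Finset ℕ := Finset.univ.biUnion fun j => (hfin j).toFinset with hF
  have hmem : ∀ {n j}, x n ∈ A j → n ∈ F := fun {n j} h => by
    simp only [hF, Finset.mem_biUnion, Finset.mem_univ, true_and, Set.Finite.mem_toFinset]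
    exact ⟨j, h⟩
  have hcard : ∀ j, {n | x n ∈ A j}.encard.toNat = (F.filter fun n => x n ∈ A j).card := fun j => by
    have : {n | x n ∈ A j} = ↑(F.filter fun n => x n ∈ A j) := by
      ext n; simp only [Finset.coe_filter, Set.mem_ofPred_eq]
      exact ⟨fun h => ⟨hmem h, h⟩, fun h => h.2⟩
    rw [this, Set.encard_coe_eq_coe_finsetCard, ENat.toNat_natCast]
  -- Leaving out the distinguished point `n` lowers the count of its own cell by one and changes no
  -- other count, the cells being disjoint.
  have hprod : ∀ j n, x n ∈ A j →
      infProd (fun k => if k = n then 1 else ∏ j, if x k ∈ A j then c j else 1) =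
      ∏ i, c i ^ ({n | x n ∈ A i}.encard.toNat - if i = j then 1 else 0) := by
    intro j n hn
    rw [infProd_eq_prod _ (F.erase n)]
    · rw [Finset.prod_congr rfl fun k hk => if_neg (Finset.ne_of_mem_erase hk), Finset.prod_comm]
      refine Finset.prod_congr rfl fun i _ => ?_
      rw [Finset.prod_ite, Finset.prod_const_one, mul_one, Finset.prod_const, hcard i,
        Finset.filter_erase]
      congr 1
      by_cases hij : i = j
      · subst hij
        rw [if_pos rfl, Finset.card_erase_of_mem (by simp [hn, hmem hn])]
      · rw [if_neg hij, Finset.erase_eq_of_notMem, Nat.sub_zero]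
        simp only [Finset.mem_filter, not_and]
        exact fun _ hi => Set.disjoint_left.1 (hdisj hij) hi hn
    · intro k hk
      split_ifs with hkn
      · rfl
      · refine Finset.prod_eq_one fun i _ => if_neg fun hi => hk ?_
        exact Finset.mem_erase.2 ⟨hkn, hmem hi⟩
    · intro k
      split_ifs
      · exact le_rfl
      · refine Finset.prod_le_one' fun i _ => ?_
        split_ifs
        exacts [hc i, le_rfl]
  have hterm : ∀ n, (∑ j, (A j).indicator (fun _ => a j) (x n)) *
        infProd (fun k => if k = n then 1 else ∏ j, if x k ∈ A j then c j else 1) =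
      ∑ j, if x n ∈ A j then
        a j * ∏ i, c i ^ ({n | x n ∈ A i}.encard.toNat - if i = j then 1 else 0) else 0 := by
    intro n
    rw [Finset.sum_mul]
    refine Finset.sum_congr rfl fun j _ => ?_
    by_cases hj : x n ∈ A j
    · rw [Set.indicator_of_mem hj, if_pos hj, hprod j n hj]
    · rw [Set.indicator_of_notMem hj, if_neg hj, zero_mul]
  rw [tsum_congr hterm, tsum_eq_sum (s := F), Finset.sum_comm]
  · refine Finset.sum_congr rfl fun j _ => ?_
    rw [Finset.sum_ite, Finset.sum_const_zero, add_zero, Finset.sum_const, ← hcard j, nsmul_eq_mul,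
      mul_left_comm]
    congr 1
    rw [← Finset.mul_prod_erase _ _ (Finset.mem_univ j), ← Finset.mul_prod_erase _ _
      (Finset.mem_univ j), if_pos rfl, if_pos rfl, mul_assoc]
    congr 2
    refine Finset.prod_congr rfl fun i hi => ?_
    rw [if_neg (Finset.ne_of_mem_erase hi), if_neg (Finset.ne_of_mem_erase hi), Nat.sub_zero]
  · intro n hn
    exact Finset.sum_eq_zero fun j _ => if_neg fun hj => hn (hmem hj)

open Classical in
-- After pathwise summation both factors depend on the counts alone. Counts of disjoint cells are
-- independent, so the mean factorizes: the cell of the distinguished point gives the derivative of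
-- the generating function, the other cells the generating function itself. Independence of counts
-- enters the Mecke formula only here.
lemma IsHPPP.mecke_cells (h : IsHPPP P lam X) (hl : 0 ≤ lam) {m : ℕ} {A : Fin m → Set Plane}
    (hA : ∀ j, MeasurableSet (A j)) (hdisj : Pairwise fun j j' => Disjoint (A j) (A j'))
    (hfin : ∀ j, volume (A j) ≠ ⊤) (a c : Fin m → ℝ≥0∞) (hc : ∀ j, c j ≤ 1) :
    ∑' n, ∫⁻ w, (∑ j, (A j).indicator (fun _ => a j) (X n w)) *
        infProd (fun k => if k = n then 1 else ∏ j, if X k w ∈ A j then c j else 1) ∂P =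
      (∑ j, a j * intensity lam (A j)) * expNeg (∑ j, (1 - c j) * intensity lam (A j)) := by
  have hX := h.measurable
  have hmeas : ∀ n, Measurable fun w => (∑ j, (A j).indicator (fun _ => a j) (X n w)) *
      infProd (fun k => if k = n then 1 else ∏ j, if X k w ∈ A j then c j else 1) := by
    intro n
    refine Measurable.mul (Finset.measurable_sum _ fun j _ =>
      (measurable_const.indicator (hA j)).comp (hX n)) (measurable_infProd fun k => ?_)
    by_cases hk : k = n
    · simp [hk]
    · simp only [if_neg hk]
      exact Finset.measurable_prod _ fun j _ =>
        Measurable.ite (hX k (hA j)) measurable_const measurable_const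
  rw [← lintegral_tsum fun n => (hmeas n).aemeasurable]
  -- Contribution of cell `i` when the distinguished point lies in cell `j`.
  let φ : Fin m → Fin m → ℕ∞ → ℝ≥0∞ := fun j i N =>
    if i = j then N.toNat * c i ^ (N.toNat - 1) else c i ^ N.toNat
  have hae : ∀ᵐ w ∂P, ∑' n, (∑ j, (A j).indicator (fun _ => a j) (X n w)) *
        infProd (fun k => if k = n then 1 else ∏ j, if X k w ∈ A j then c j else 1) =
      ∑ j, a j * ∏ i, φ j i (count X (A i) w) := by
    filter_upwards [ae_all_iff.2 fun j => h.count_lt_top hl (hA j) (hfin j)] with w hw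
    exact tsum_cells_eq hdisj a c hc (fun n => X n w) fun j => Set.encard_ne_top_iff.1 (hw j)
  rw [lintegral_congr_ae hae]
  have hφm : ∀ j i, Measurable (φ j i) := fun j i => measurable_of_countable _
  have hcm := fun i => measurable_count hX (hA i)
  have hpm : ∀ j, Measurable fun w => ∏ i, φ j i (count X (A i) w) := fun j =>
    Finset.measurable_prod _ fun i _ => (hφm j i).comp (hcm i)
  rw [lintegral_finsetSum _ fun j _ => (hpm j).const_mul _, Finset.sum_mul]
  refine Finset.sum_congr rfl fun j _ => ?_
  rw [lintegral_const_mul _ (hpm j),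
    lintegral_prod_eq_prod_lintegral_of_indepFun Finset.univ (fun i w => φ j i (count X (A i) w))
      ((h.indep m A hA hdisj).comp (φ j) (hφm j)) (fun i => (hφm j i).comp (hcm i)), mul_assoc]
  congr 1
  rw [expNeg_sum, ← Finset.mul_prod_erase _ _ (Finset.mem_univ j),
    ← Finset.mul_prod_erase _ (fun i => expNeg _) (Finset.mem_univ j), ← mul_assoc]
  congr 1
  · simp only [φ, if_true]
    exact h.lintegral_mul_pow_count hl (hA j) (hfin j) (hc j)
  · refine Finset.prod_congr rfl fun i hi => ?_
    simp only [φ, if_neg (Finset.ne_of_mem_erase hi)]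
    exact h.lintegral_pow_count hl (hA i) (hfin i) (hc i)

end Cells

end

/-! ### The Mecke formula by approximation. -/

section

section Mecke

variable {Ω : Type*} [MeasurableSpace Ω] {P : Measure Ω} [IsProbabilityMeasure P] {lam : ℝ}
  {X : ℕ → Ω → Plane}

lemma measurable_infProd_excl {ψ : Plane → ℝ≥0∞} (hX : ∀ n, Measurable (X n)) (hψ : Measurable ψ)
    (n : ℕ) : Measurable fun w => infProd fun k => if k = n then 1 else ψ (X k w) :=
  measurable_infProd fun k => by
    by_cases hk : k = n
    · simp [hk]
    · simp only [if_neg hk]; exact hψ.comp (hX k)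

/-- Both functions are constant on the joint level sets of the pair, which serve as the cells, with
weights the values of `u` and retention factors one minus the values of `v`. -/
lemma IsHPPP.mecke_simple (h : IsHPPP P lam X) (hl : 0 ≤ lam) (u v : SimpleFunc Plane ℝ≥0∞)
    (hu : volume {x | u x ≠ 0} ≠ ⊤) (hv : volume {x | v x ≠ 0} ≠ ⊤) (hv1 : ∀ x, v x ≤ 1) :
    ∑' n, ∫⁻ w, u (X n w) * infProd (fun k => if k = n then 1 else 1 - v (X k w)) ∂P =
      (∫⁻ x, u x ∂intensity lam) * expNeg (∫⁻ x, v x ∂intensity lam) := by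
  classical
  set s := u.pair v with hs
  -- The level set of `(0, 0)` has infinite volume, but there the weight is `0` and the factor in
  -- the product is `1`. All other level sets lie in the supports and have finite volume.
  set T := s.range.erase (0, 0) with hT
  let e := T.equivFin.symm
  have he : ∀ j, ((e j : ℝ≥0∞ × ℝ≥0∞)) ≠ (0, 0) := fun j => (Finset.mem_erase.1 (e j).2).1
  let A : Fin T.card → Set Plane := fun j => s ⁻¹' {(e j : ℝ≥0∞ × ℝ≥0∞)}
  have hA : ∀ j, MeasurableSet (A j) := fun j => s.measurableSet_fiber _
  have hdisj : Pairwise fun j j' => Disjoint (A j) (A j') := fun j j' hj =>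
    Set.disjoint_left.2 fun x hx hx' => hj (e.injective (Subtype.ext
      ((Set.mem_singleton_iff.1 hx).symm.trans (Set.mem_singleton_iff.1 hx'))))
  have hfin : ∀ j, volume (A j) ≠ ⊤ := fun j => by
    refine ne_top_of_le_ne_top (ENNReal.add_ne_top.2 ⟨hu, hv⟩)
      ((measure_mono fun x hx => ?_).trans (measure_union_le _ _))
    have hx' : s x = e j := hx
    by_contra hcon
    simp only [Set.mem_union, Set.mem_ofPred_eq, not_or, not_not] at hcon
    exact he j (by rw [← hx', hs, SimpleFunc.pair_apply, hcon.1, hcon.2])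
  have hval : ∀ x j, x ∈ A j → u x = (e j).1.1 ∧ v x = (e j).1.2 := fun x j hx => by
    have hx' : s x = e j := hx
    rw [← hx']; exact ⟨rfl, rfl⟩
  have hcase : ∀ x, (u x = 0 ∧ v x = 0 ∧ ∀ j, x ∉ A j) ∨ ∃ j, x ∈ A j := fun x => by
    by_cases hx : s x = (0, 0)
    · refine Or.inl ⟨congrArg Prod.fst hx, congrArg Prod.snd hx, fun j hj => he j ?_⟩
      rw [← hx]; exact (Set.mem_singleton_iff.1 hj).symm
    · exact Or.inr ⟨e.symm ⟨s x, Finset.mem_erase.2 ⟨hx, s.mem_range_self x⟩⟩, by simp [A]⟩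
  have hsum : ∀ (b : Fin T.card → ℝ≥0∞) x j, x ∈ A j →
      ∑ i, (A i).indicator (fun _ => b i) x = b j := fun b x j hx => by
    rw [Finset.sum_eq_single j, Set.indicator_of_mem hx]
    · exact fun i _ hij => Set.indicator_of_notMem (fun hi => Set.disjoint_left.1 (hdisj hij) hi hx) _
    · simp
  have hsum0 : ∀ (b : Fin T.card → ℝ≥0∞) x, (∀ j, x ∉ A j) →
      ∑ i, (A i).indicator (fun _ => b i) x = 0 := fun b x hx =>
    Finset.sum_eq_zero fun i _ => Set.indicator_of_notMem (hx i) _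
  have hu' : ∀ x, u x = ∑ j, (A j).indicator (fun _ => (e j).1.1) x := fun x => by
    rcases hcase x with ⟨h1, _, h3⟩ | ⟨j, hj⟩
    · rw [hsum0 _ x h3, h1]
    · rw [hsum _ x j hj, (hval x j hj).1]
  have hv' : ∀ x, v x = ∑ j, (A j).indicator (fun _ => (e j).1.2) x := fun x => by
    rcases hcase x with ⟨_, h2, h3⟩ | ⟨j, hj⟩
    · rw [hsum0 _ x h3, h2]
    · rw [hsum _ x j hj, (hval x j hj).2]
  have hpr : ∀ x, 1 - v x = ∏ j, if x ∈ A j then 1 - (e j).1.2 else 1 := fun x => by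
    rcases hcase x with ⟨_, h2, h3⟩ | ⟨j, hj⟩
    · rw [h2, Finset.prod_eq_one fun i _ => if_neg (h3 i), tsub_zero]
    · rw [Finset.prod_eq_single j, if_pos hj, (hval x j hj).2]
      · exact fun i _ hij => if_neg fun hi => Set.disjoint_left.1 (hdisj hij) hi hj
      · simp
  have hint : ∀ b : Fin T.card → ℝ≥0∞,
      ∫⁻ x, ∑ j, (A j).indicator (fun _ => b j) x ∂intensity lam =
        ∑ j, b j * intensity lam (A j) := fun b => by
    rw [lintegral_finsetSum _ fun j _ => measurable_const.indicator (hA j)]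
    exact Finset.sum_congr rfl fun j _ => lintegral_indicator_const (hA j) _
  have hle : ∀ j, (e j).1.2 ≤ 1 := fun j => by
    obtain ⟨x, hx⟩ := SimpleFunc.mem_range.1 (Finset.mem_erase.1 (e j).2).2
    have := hv1 x
    rw [(hval x j (by simpa [A] using hx)).2] at this
    exact this
  have key := h.mecke_cells hl hA hdisj hfin (fun j => (e j).1.1) (fun j => 1 - (e j).1.2)
    (fun j => tsub_le_self)
  simp_rw [← hpr, ← hu'] at key
  rw [key, ← hint, lintegral_congr fun x => (hu' x)]
  congr 2
  rw [lintegral_congr fun x => (hv' x), hint]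
  refine Finset.sum_congr rfl fun j _ => ?_
  rw [ENNReal.sub_sub_cancel ENNReal.one_ne_top (hle j)]

/-- Approximation from below by simple functions with finite values and bounded support. -/
lemma exists_simple_approx {g : Plane → ℝ≥0∞} (hg : Measurable g) :
    ∃ u : ℕ → SimpleFunc Plane ℝ≥0∞, (∀ x, Monotone fun k => u k x) ∧
      (∀ x, Tendsto (fun k => u k x) atTop (𝓝 (g x))) ∧ (∀ k x, u k x ≤ g x) ∧
      (∀ k, volume {x | u k x ≠ 0} ≠ ⊤) ∧ (∀ k x, u k x ≠ ⊤) ∧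
      ∀ k lam, ∫⁻ x, u k x ∂intensity lam ≠ ⊤ := by
  have hb : ∀ k : ℕ, MeasurableSet (Metric.ball (0 : Plane) k) := fun k => measurableSet_ball
  have happ : ∀ (k : ℕ) x, ((SimpleFunc.eapprox g k).restrict (Metric.ball 0 k)) x =
      (Metric.ball (0 : Plane) k).indicator (SimpleFunc.eapprox g k) x := fun k x =>
    SimpleFunc.restrict_apply _ (hb k) x
  have hlt : ∀ (k : ℕ) x, SimpleFunc.eapprox g k x ≤ g x := fun k x => by
    rw [← SimpleFunc.iSup_eapprox_apply hg x]
    exact le_iSup (fun n => SimpleFunc.eapprox g n x) k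
  have hsupp : ∀ k : ℕ, volume {x | ((SimpleFunc.eapprox g k).restrict (Metric.ball 0 k)) x ≠ 0}
      ≠ ⊤ := fun k => by
    refine ne_top_of_le_ne_top (measure_ball_lt_top (μ := volume) (x := (0 : Plane)) (r := k)).ne
      (measure_mono fun x hx => ?_)
    by_contra hcon
    exact hx (by rw [happ, Set.indicator_of_notMem hcon])
  refine ⟨fun k => (SimpleFunc.eapprox g k).restrict (Metric.ball 0 k), fun x k k' hk => ?_,
    fun x => ?_, fun k x => ?_, hsupp, fun k x => ?_, fun k lam => ?_⟩
  · simp only [happ]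
    refine (Set.indicator_le_indicator (SimpleFunc.monotone_eapprox g hk x)).trans
      (Set.indicator_le_indicator_of_subset (Metric.ball_subset_ball (by exact_mod_cast hk))
        (fun _ => zero_le) x)
  · have ht : Tendsto (fun k => SimpleFunc.eapprox g k x) atTop (𝓝 (g x)) := by
      rw [← SimpleFunc.iSup_eapprox_apply hg x]
      exact tendsto_atTop_iSup fun k k' hk => SimpleFunc.monotone_eapprox g hk x
    refine ht.congr' ?_
    obtain ⟨N, hN⟩ := exists_nat_gt ‖x‖
    filter_upwards [eventually_ge_atTop N] with k hk
    rw [happ, Set.indicator_of_mem]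
    rw [mem_ball_zero_iff]
    exact hN.trans_le (by exact_mod_cast hk)
  · simp only [happ]
    exact (Set.indicator_le_self _ _ x).trans (hlt k x)
  · simp only [happ]
    exact ((Set.indicator_le_self _ _ x).trans_lt (SimpleFunc.eapprox_lt_top g k x)).ne
  · change ∫⁻ x, ((SimpleFunc.eapprox g k).restrict (Metric.ball 0 k)) x ∂intensity lam ≠ ⊤
    rw [SimpleFunc.lintegral_eq_lintegral]
    refine (SimpleFunc.FinMeasSupp.lintegral_lt_top ?_ (.of_forall fun x => ?_)).ne
    · rw [SimpleFunc.finMeasSupp_iff_support]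
      refine lt_top_iff_ne_top.2 ?_
      rw [intensity, Measure.smul_apply, smul_eq_mul]
      exact ENNReal.mul_ne_top ENNReal.ofReal_ne_top (hsupp k)
    · rw [happ]
      exact ((Set.indicator_le_self _ _ x).trans_lt (SimpleFunc.eapprox_lt_top g k x)).ne

lemma infProd_one : infProd (fun _ => 1) = 1 := by simp [infProd]

lemma excl_le_one {ψ : ℕ → ℝ≥0∞} (h : ∀ k, ψ k ≤ 1) (n k : ℕ) :
    (if k = n then 1 else ψ k) ≤ 1 := by
  split_ifs
  exacts [le_rfl, h k]

/-- Limits of monotone sequences in the first factor of sums over points. -/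
lemma tendsto_tsum_lintegral_of_monotone {Q : ℕ → Ω → ℝ≥0∞} {u : ℕ → ℕ → Ω → ℝ≥0∞}
    {g : ℕ → Ω → ℝ≥0∞} (hu : ∀ k n, Measurable (u k n)) (hQ : ∀ n, Measurable (Q n))
    (hQ1 : ∀ n w, Q n w ≤ 1)
    (hmono : ∀ n w, Monotone fun k => u k n w)
    (hlim : ∀ n w, Tendsto (fun k => u k n w) atTop (𝓝 (g n w))) :
    Tendsto (fun k => ∑' n, ∫⁻ w, u k n w * Q n w ∂P) atTop
      (𝓝 (∑' n, ∫⁻ w, g n w * Q n w ∂P)) := by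
  have hg : ∀ n, Measurable (g n) := fun n => measurable_of_tendsto_metrizable
    (fun k => hu k n) (tendsto_pi_nhds.2 fun w => hlim n w)
  rw [tsum_lintegral_eq_lintegral_prod P (F := fun n w => g n w * Q n w)
    fun n => (hg n).mul (hQ n)]
  simp_rw [fun k => tsum_lintegral_eq_lintegral_prod P (F := fun n w => u k n w * Q n w)
    fun n => (hu k n).mul (hQ n)]
  refine lintegral_tendsto_of_tendsto_of_monotone (fun k => (measurable_from_prod_countable_right
    fun n => (hu k n).mul (hQ n)).aemeasurable) (.of_forall fun q k k' hk => ?_)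
    (.of_forall fun q => ?_)
  · exact mul_le_mul_left (hmono q.1 q.2 hk) _
  · exact ENNReal.Tendsto.mul_const (hlim q.1 q.2)
      (Or.inr (ne_top_of_le_ne_top ENNReal.one_ne_top (hQ1 q.1 q.2)))

lemma IsHPPP.campbell_simple (h : IsHPPP P lam X) (hl : 0 ≤ lam) (u : SimpleFunc Plane ℝ≥0∞)
    (hu : volume {x | u x ≠ 0} ≠ ⊤) :
    ∑' n, ∫⁻ w, u (X n w) ∂P = ∫⁻ x, u x ∂intensity lam := by
  have := h.mecke_simple hl u 0 hu (by simp) (by simp)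
  simpa [expNeg_zero, infProd_one] using this

/-- Mecke formula for the product over the other points of a fixed function. -/
theorem IsHPPP.mecke_fixed (h : IsHPPP P lam X) (hl : 0 ≤ lam) {g ψ : Plane → ℝ≥0∞}
    (hg : Measurable g) (hψ : Measurable ψ) (hψ1 : ∀ x, ψ x ≤ 1) :
    ∑' n, ∫⁻ w, g (X n w) * infProd (fun k => if k = n then 1 else ψ (X k w)) ∂P =
      (∫⁻ x, g x ∂intensity lam) * expNeg (∫⁻ x, 1 - ψ x ∂intensity lam) := by
  have hX := h.measurable
  -- First limit: simple functions increase to `1 - ψ`, so the products decrease. They are dominated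
  -- by the weight `u` alone, whose total is finite by Campbell's formula.
  have simple : ∀ u : SimpleFunc Plane ℝ≥0∞, volume {x | u x ≠ 0} ≠ ⊤ →
      (∀ x, u x ≠ ⊤) → ∫⁻ x, u x ∂intensity lam ≠ ⊤ →
      ∑' n, ∫⁻ w, u (X n w) * infProd (fun k => if k = n then 1 else ψ (X k w)) ∂P =
      (∫⁻ x, u x ∂intensity lam) * expNeg (∫⁻ x, 1 - ψ x ∂intensity lam) := by
    intro u hu hutop hufin
    obtain ⟨v, vmono, vlim, vle, vsupp, -, -⟩ := exists_simple_approx (g := fun x => 1 - ψ x)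
      (measurable_const.sub hψ)
    have hv1 : ∀ k x, v k x ≤ 1 := fun k x => (vle k x).trans tsub_le_self
    have hl1 : Tendsto (fun k => ∑' n, ∫⁻ w, u (X n w) *
        infProd (fun i => if i = n then 1 else 1 - v k (X i w)) ∂P) atTop
        (𝓝 (∑' n, ∫⁻ w, u (X n w) * infProd (fun k => if k = n then 1 else ψ (X k w)) ∂P)) := by
      refine tendsto_tsum_lintegral P (G := fun n w => u (X n w)) (fun k n =>
        (u.measurable.comp (hX n)).mul (measurable_infProd_excl hX
          (measurable_const.sub (v k).measurable) n))
        (fun n => u.measurable.comp (hX n)) (fun k n w => mul_le_of_le_one_right' (infProd_le_one _))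
        (by rw [h.campbell_simple hl u hu]; exact hufin) fun n w => ?_
      refine ENNReal.Tendsto.const_mul (tendsto_infProd_of_antitone
        (fun k i => excl_le_one (fun _ => tsub_le_self) n i) (fun i k k' hk => ?_) fun i => ?_)
        (Or.inr (hutop _))
      · dsimp only
        split_ifs
        · exact le_rfl
        · exact tsub_le_tsub_left (vmono _ hk) _
      · split_ifs
        · exact tendsto_const_nhds
        · have := ENNReal.Tendsto.sub (tendsto_const_nhds (x := (1 : ℝ≥0∞))) (vlim (X i w))
            (Or.inl ENNReal.one_ne_top)
          rwa [ENNReal.sub_sub_cancel ENNReal.one_ne_top (hψ1 _)] at this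
    refine tendsto_nhds_unique hl1 ?_
    simp_rw [fun k => h.mecke_simple hl u (v k) hu (vsupp k) (hv1 k)]
    refine ENNReal.Tendsto.const_mul ((continuous_expNeg.tendsto _).comp
      (lintegral_tendsto_of_tendsto_of_monotone (fun k => (v k).measurable.aemeasurable)
        (.of_forall vmono) (.of_forall vlim))) (Or.inr hufin)
  -- Second limit: the weight increases to `g`, by monotone convergence.
  obtain ⟨u, umono, ulim, -, usupp, utop, ufin⟩ := exists_simple_approx hg
  refine tendsto_nhds_unique (tendsto_tsum_lintegral_of_monotone (u := fun k n w => u k (X n w))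
    (fun k n => (u k).measurable.comp (hX n)) (fun n => measurable_infProd_excl hX hψ n)
    (fun n w => infProd_le_one _) (fun n w => umono _) fun n w => ulim _) ?_
  simp_rw [fun k => simple (u k) (usupp k) (utop k) (ufin k lam)]
  exact ENNReal.Tendsto.mul_const (lintegral_tendsto_of_tendsto_of_monotone
    (fun k => (u k).measurable.aemeasurable) (.of_forall umono) (.of_forall ulim))
    (Or.inr (ne_top_of_le_ne_top ENNReal.one_ne_top (expNeg_le_one _)))

/-- Campbell's formula. -/
theorem IsHPPP.campbell (h : IsHPPP P lam X) (hl : 0 ≤ lam) {g : Plane → ℝ≥0∞}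
    (hg : Measurable g) : ∑' n, ∫⁻ w, g (X n w) ∂P = ∫⁻ x, g x ∂intensity lam := by
  have := h.mecke_fixed hl hg (ψ := fun _ => 1) measurable_const fun _ => le_rfl
  simpa [expNeg_zero, infProd_one] using this

/-- Dyadic approximation from below. -/
def dyadic (k : ℕ) (r : ℝ) : ℝ := (⌊2 ^ k * r⌋₊ : ℝ) / 2 ^ k

lemma dyadic_nonneg (k : ℕ) (r : ℝ) : 0 ≤ dyadic k r := by unfold dyadic; positivity

lemma dyadic_le {k : ℕ} {r : ℝ} (hr : 0 ≤ r) : dyadic k r ≤ r := by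
  rw [dyadic, div_le_iff₀ (by positivity), mul_comm]
  exact Nat.floor_le (by positivity)

lemma dyadic_mono {r : ℝ} (hr : 0 ≤ r) : Monotone fun k => dyadic k r := by
  refine monotone_nat_of_le_succ fun k => ?_
  simp only [dyadic]
  rw [div_le_div_iff₀ (by positivity) (by positivity), pow_succ, ← mul_assoc, mul_right_comm]
  refine mul_le_mul_of_nonneg_right ?_ (by positivity)
  have h1 : ((⌊2 ^ k * r⌋₊ * 2 : ℕ) : ℝ) ≤ 2 ^ k * 2 * r := by
    push_cast
    have := Nat.floor_le (a := 2 ^ k * r) (by positivity)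
    linarith
  have := Nat.le_floor h1
  exact_mod_cast this

lemma tendsto_dyadic {r : ℝ} (hr : 0 ≤ r) : Tendsto (fun k => dyadic k r) atTop (𝓝 r) := by
  have h2 : Tendsto (fun k : ℕ => r - (1 / 2 : ℝ) ^ k) atTop (𝓝 r) := by
    simpa using (tendsto_const_nhds (x := r)).sub
      (tendsto_pow_atTop_nhds_zero_of_lt_one (r := (1 / 2 : ℝ)) (by norm_num) (by norm_num))
  refine tendsto_of_tendsto_of_tendsto_of_le_of_le h2 tendsto_const_nhds (fun k => ?_)
    fun k => dyadic_le hr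
  simp only [dyadic]
  rw [le_div_iff₀ (by positivity), sub_mul, ← mul_pow]
  have := Nat.lt_floor_add_one (2 ^ k * r)
  norm_num
  linarith

/-- Mecke formula for a product over the other points that depends on the distance of the
distinguished point from the origin. -/
theorem IsHPPP.mecke (h : IsHPPP P lam X) (hl : 0 ≤ lam) {g : Plane → ℝ≥0∞}
    {ψ : ℝ → Plane → ℝ≥0∞} (hg : Measurable g) (hψ : ∀ r, Measurable (ψ r))
    (hψ1 : ∀ r x, ψ r x ≤ 1) (hanti : ∀ x, AntitoneOn (fun r => ψ r x) (Set.Ici 0))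
    (hcont : ∀ x r, 0 ≤ r → ContinuousWithinAt (fun r => ψ r x) (Set.Icc 0 r) r) :
    ∑' n, ∫⁻ w, g (X n w) * infProd (fun k => if k = n then 1 else ψ ‖X n w‖ (X k w)) ∂P =
      ∫⁻ x, g x * expNeg (∫⁻ y, 1 - ψ ‖x‖ y ∂intensity lam) ∂intensity lam := by
  have hX := h.measurable
  -- The distance is replaced by its dyadic approximation from below, which takes countably many
  -- values. On each level set the function in the product is fixed, so the previous form of the
  -- formula applies.
  let N : ℕ → Plane → ℕ := fun k x => ⌊2 ^ k * ‖x‖⌋₊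
  have hN : ∀ k, Measurable (N k) := fun k =>
    Nat.measurable_floor.comp ((measurable_norm (α := Plane)).const_mul _)
  have hdy : ∀ k x, dyadic k ‖x‖ = (N k x : ℝ) / 2 ^ k := fun k x => rfl
  -- Approximation from below needs continuity from the left only; the factors used later jump on
  -- the right, where a station starts to be strictly nearer.
  have hψlim : ∀ x y : Plane, Tendsto (fun k => ψ (dyadic k ‖x‖) y) atTop (𝓝 (ψ ‖x‖ y)) := fun x y =>
    (hcont y ‖x‖ (norm_nonneg x)).tendsto.comp (tendsto_nhdsWithin_iff.2
      ⟨tendsto_dyadic (norm_nonneg x), .of_forall fun k => ⟨dyadic_nonneg _ _,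
        dyadic_le (norm_nonneg x)⟩⟩)
  have hψanti : ∀ x y : Plane, Antitone fun k => ψ (dyadic k ‖x‖) y := fun x y k k' hk =>
    hanti y (dyadic_nonneg _ _) (dyadic_nonneg _ _) (dyadic_mono (norm_nonneg x) hk)
  have hE : ∀ x : Plane, Tendsto (fun k => expNeg (∫⁻ y, 1 - ψ (dyadic k ‖x‖) y ∂intensity lam)) atTop
      (𝓝 (expNeg (∫⁻ y, 1 - ψ ‖x‖ y ∂intensity lam))) := fun x =>
    (continuous_expNeg.tendsto _).comp (lintegral_tendsto_of_tendsto_of_monotone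
      (fun k => (measurable_const.sub (hψ _)).aemeasurable)
      (.of_forall fun y k k' hk => tsub_le_tsub_left (hψanti x y hk) _)
      (.of_forall fun y => ENNReal.Tendsto.sub tendsto_const_nhds (hψlim x y)
        (Or.inl ENNReal.one_ne_top)))
  have hEm : ∀ k, Measurable fun x : Plane =>
      expNeg (∫⁻ y, 1 - ψ (dyadic k ‖x‖) y ∂intensity lam) := fun k =>
    (measurable_from_nat (f := fun j : ℕ =>
      expNeg (∫⁻ y, 1 - ψ ((j : ℝ) / 2 ^ k) y ∂intensity lam))).comp (hN k)
  have hQm : ∀ k n, Measurable fun w => infProd fun i =>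
      if i = n then 1 else ψ (dyadic k ‖X n w‖) (X i w) := fun k n => by
    have : Measurable fun q : ℕ × Ω => infProd fun i =>
        if i = n then 1 else ψ ((q.1 : ℝ) / 2 ^ k) (X i q.2) :=
      measurable_from_prod_countable_right fun j =>
        measurable_infProd_excl hX (hψ ((j : ℝ) / 2 ^ k)) n
    simp only [hdy]
    exact this.comp (g := fun q : ℕ × Ω => infProd fun i =>
        if i = n then 1 else ψ ((q.1 : ℝ) / 2 ^ k) (X i q.2)) (f := fun w => (N k (X n w), w))
      (((hN k).comp (hX n)).prodMk measurable_id)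
  have hQlim : ∀ n w, Tendsto (fun k => infProd fun i =>
      if i = n then 1 else ψ (dyadic k ‖X n w‖) (X i w)) atTop (𝓝 (infProd fun i =>
      if i = n then 1 else ψ ‖X n w‖ (X i w))) := fun n w => by
    refine tendsto_infProd_of_antitone (fun k i => excl_le_one (fun _ => hψ1 _ _) n i)
      (fun i k k' hk => ?_) fun i => ?_
    · dsimp only
      split_ifs
      · exact le_rfl
      · exact hψanti _ _ hk
    · split_ifs
      · exact tendsto_const_nhds
      · exact hψlim _ _
  have hQm' : ∀ n, Measurable fun w => infProd fun i =>
      if i = n then 1 else ψ ‖X n w‖ (X i w) := fun n =>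
    measurable_of_tendsto_metrizable (fun k => hQm k n) (tendsto_pi_nhds.2 fun w => hQlim n w)
  -- The weight is split according to the dyadic level `j`, each piece is treated with its fixed
  -- function, and the pieces are added up again.
  have step : ∀ (u : SimpleFunc Plane ℝ≥0∞) k,
      ∑' n, ∫⁻ w, u (X n w) *
        infProd (fun i => if i = n then 1 else ψ (dyadic k ‖X n w‖) (X i w)) ∂P =
      ∫⁻ x, u x * expNeg (∫⁻ y, 1 - ψ (dyadic k ‖x‖) y ∂intensity lam) ∂intensity lam := by
    intro u k
    have hu := u.measurable
    have hsingle : ∀ (x : Plane) (b : ℕ → ℝ≥0∞), ∑' j : ℕ,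
        (N k ⁻¹' {j}).indicator u x * b j = u x * b (N k x) := fun x b => by
      rw [tsum_eq_single (N k x), Set.indicator_of_mem (Set.mem_preimage.2 (Set.mem_singleton _))]
      exact fun j hj => by rw [Set.indicator_of_notMem fun hx => hj hx.symm, zero_mul]
    have hmeas : ∀ j, Measurable ((N k ⁻¹' {j}).indicator u) := fun j =>
      hu.indicator (hN k (measurableSet_singleton j))
    have h1 := fun j : ℕ => h.mecke_fixed hl (hmeas j) (hψ ((j : ℝ) / 2 ^ k)) (hψ1 _)
    calc _ = ∑' n, ∑' j : ℕ, ∫⁻ w, (N k ⁻¹' {j}).indicator u (X n w) *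
            infProd (fun i => if i = n then 1 else ψ ((j : ℝ) / 2 ^ k) (X i w)) ∂P := by
          congr 1; ext n
          have hjm : ∀ j : ℕ, AEMeasurable (fun w => (N k ⁻¹' {j}).indicator u (X n w) *
              infProd (fun i => if i = n then 1 else ψ ((j : ℝ) / 2 ^ k) (X i w))) P := fun j =>
            (((hmeas j).comp (hX n)).mul
              (measurable_infProd_excl hX (hψ ((j : ℝ) / 2 ^ k)) n)).aemeasurable
          rw [← lintegral_tsum hjm]
          refine lintegral_congr fun w => ?_
          rw [hsingle (X n w) fun j => infProd (fun i => if i = n then 1 else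
            ψ ((j : ℝ) / 2 ^ k) (X i w))]
          rfl
      _ = ∑' j : ℕ, ∫⁻ x, (N k ⁻¹' {j}).indicator u x *
            expNeg (∫⁻ y, 1 - ψ ((j : ℝ) / 2 ^ k) y ∂intensity lam) ∂intensity lam := by
          rw [ENNReal.tsum_comm]
          congr 1; ext j
          rw [h1 j, lintegral_mul_const _ (hmeas j)]
      _ = _ := by
          rw [← lintegral_tsum fun j => ((hmeas j).mul_const _).aemeasurable]
          refine lintegral_congr fun x => ?_
          rw [hsingle x fun j => expNeg (∫⁻ y, 1 - ψ ((j : ℝ) / 2 ^ k) y ∂intensity lam)]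
          rfl
  obtain ⟨u, umono, ulim, -, usupp, utop, ufin⟩ := exists_simple_approx hg
  have simple : ∀ m, ∑' n, ∫⁻ w, u m (X n w) *
        infProd (fun i => if i = n then 1 else ψ ‖X n w‖ (X i w)) ∂P =
      ∫⁻ x, u m x * expNeg (∫⁻ y, 1 - ψ ‖x‖ y ∂intensity lam) ∂intensity lam := by
    intro m
    have hum := (u m).measurable
    refine tendsto_nhds_unique (tendsto_tsum_lintegral P (G := fun n w => u m (X n w))
      (fun k n => (hum.comp (hX n)).mul (hQm k n)) (fun n => hum.comp (hX n))
      (fun k n w => mul_le_of_le_one_right' (infProd_le_one _))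
      (by rw [h.campbell hl hum]; exact ufin m lam) fun n w => ENNReal.Tendsto.const_mul
        (hQlim n w) (Or.inr (utop m _))) ?_
    refine Tendsto.congr (fun k => (step (u m) k).symm) ?_
    refine tendsto_lintegral_of_dominated_convergence (u m) (fun k => hum.mul (hEm k))
      (fun k => .of_forall fun x => mul_le_of_le_one_right' (expNeg_le_one _)) (ufin m lam)
      (.of_forall fun x => ENNReal.Tendsto.const_mul (hE x) (Or.inr (utop m x)))
  refine tendsto_nhds_unique (tendsto_tsum_lintegral_of_monotone (u := fun k n w => u k (X n w))
    (fun k n => (u k).measurable.comp (hX n)) hQm'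
    (fun n w => infProd_le_one _) (fun n w => umono _) fun n w => ulim _) ?_
  refine Tendsto.congr (fun m => (simple m).symm) ?_
  have hEm' := measurable_of_tendsto_metrizable hEm (tendsto_pi_nhds.2 hE)
  exact lintegral_tendsto_of_tendsto_of_monotone
    (fun k => ((u k).measurable.mul hEm').aemeasurable)
    (.of_forall fun x k k' hk => mul_le_mul_left (umono x hk) _)
    (.of_forall fun x => ENNReal.Tendsto.mul_const (ulim x)
      (Or.inr (ne_top_of_le_ne_top ENNReal.one_ne_top (expNeg_le_one _))))

end Mecke

end

/-! ### Marks of the base stations and their independence. -/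

section

section Marks

instance : DecidableEq Tier := Classical.decEq _

instance : Fintype Tier := ⟨{.macroBS, .picoBS}, fun x => by cases x <;> simp⟩

lemma Tier.other_ne (i : Tier) : i.other ≠ i := by cases i <;> simp [Tier.other]

lemma Tier.prod_eq (i : Tier) (φ : Tier → ℝ≥0∞) : ∏ t, φ t = φ i * φ i.other := by
  have : ∏ t, φ t = φ .macroBS * φ .picoBS := by
    change ∏ t ∈ ({.macroBS, .picoBS} : Finset Tier), φ t = _
    rw [Finset.prod_pair (by simp)]
  cases i
  · exact this
  · rw [this, mul_comm]; rfl

variable {Ω : Type*} [MeasurableSpace Ω]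

/-- Marks of a base station: whether it caches the requested file, fading gain and angle. -/
abbrev Mark := Prop × ℝ × ℝ

/-- The mark of a base station. -/
def mark (E : Elements Ω) (f : ℕ) (k : Tier × ℕ) (w : Ω) : Mark :=
  (f ∈ E.cache k.1 k.2 w, E.fading k.1 k.2 w, E.angle k.1 k.2 w)

/-- The locations of all base stations. -/
def locs (E : Elements Ω) (w : Ω) : Tier → ℕ → Plane := fun i n => E.loc i n w

/-- The distribution of the mark of a base station of tier `i`. -/
def markLaw (par : Params) (f : ℕ) (i : Tier) : Measure Mark :=
  (ENNReal.ofReal (par.p i f) • Measure.dirac True +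
      ENNReal.ofReal (1 - par.p i f) • Measure.dirac False).prod
    ((gammaMeasure (par.fadingParam i) (par.fadingParam i)).prod
      (cond volume (Set.Icc (-(par.d / par.wavelength)) (par.d / par.wavelength))))

variable {P : Measure Ω} [IsProbabilityMeasure P] {par : Params} {E : Elements Ω} {f : ℕ}

lemma IsNetwork.p_nonneg (hE : IsNetwork par P E) (i : Tier) (f : ℕ) : 0 ≤ par.p i f := by
  rw [← hE.cache_prob i 0 f]; exact measureReal_nonneg

lemma IsNetwork.p_le_one (hE : IsNetwork par P E) (i : Tier) (f : ℕ) : par.p i f ≤ 1 := by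
  rw [← hE.cache_prob i 0 f]; exact measureReal_le_one

lemma IsNetwork.measurable_mem_cache (hE : IsNetwork par P E) (i : Tier) (n f : ℕ) :
    Measurable fun w => f ∈ E.cache i n w :=
  (measurable_set_mem f).comp (hE.cache_measurable i n)

lemma IsNetwork.measurable_mark (hE : IsNetwork par P E) (k : Tier × ℕ) :
    Measurable (mark E f k) :=
  (hE.measurable_mem_cache _ _ f).prodMk
    ((hE.fading_measurable _ _).prodMk (hE.angle_measurable _ _))

lemma IsNetwork.measurable_locs (hE : IsNetwork par P E) : Measurable (locs E) :=
  measurable_pi_lambda _ fun i => measurable_pi_lambda _ fun n => (hE.hppp i).measurable n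

lemma IsNetwork.sigmaAlg_le (hE : IsNetwork par P E) (s : Source) :
    E.sigmaAlg s ≤ (inferInstance : MeasurableSpace Ω) := by
  cases s with
  | loc i => exact (measurable_pi_lambda _ fun n => (hE.hppp i).measurable n).comap_le
  | cache i n => exact (hE.cache_measurable i n).comap_le
  | fading i n => exact (hE.fading_measurable i n).comap_le
  | angle i n => exact (hE.angle_measurable i n).comap_le

/-- The σ-algebra of the domain is an explicit argument because it will be a supremum of source
σ-algebras instead of the ambient instance. -/
lemma measurable_prodMk_of {α β γ : Type*} (m : MeasurableSpace α) [MeasurableSpace β]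
    [MeasurableSpace γ] {f : α → β} {g : α → γ} (hf : Measurable[m] f) (hg : Measurable[m] g) :
    Measurable[m] fun x => (f x, g x) := hf.prodMk hg

lemma measurable_pi_of {α ι : Type*} {β : ι → Type*} (m : MeasurableSpace α)
    [∀ i, MeasurableSpace (β i)] {f : α → ∀ i, β i} (hf : ∀ i, Measurable[m] fun x => f x i) :
    Measurable[m] f := measurable_pi_lambda _ hf

lemma measurable_source {E : Elements Ω} {S : Set Source} {s : Source} (hs : s ∈ S) :
    E.sigmaAlg s ≤ ⨆ s ∈ S, E.sigmaAlg s := le_biSup E.sigmaAlg hs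

lemma measurable_mark_sources {E : Elements Ω} {S : Set Source} {k : Tier × ℕ}
    (h1 : Source.cache k.1 k.2 ∈ S) (h2 : Source.fading k.1 k.2 ∈ S)
    (h3 : Source.angle k.1 k.2 ∈ S) :
    Measurable[⨆ s ∈ S, E.sigmaAlg s] (mark E f k) := by
  refine measurable_prodMk_of _ ?_ (measurable_prodMk_of _ ?_ ?_)
  · exact (measurable_set_mem f).comp (measurable_iff_comap_le.2 (measurable_source h1))
  · exact measurable_iff_comap_le.2 (measurable_source h2)
  · exact measurable_iff_comap_le.2 (measurable_source h3)

/-- The mark of a base station is independent of all locations and of the other marks. -/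
lemma IsNetwork.indepFun_mark (hE : IsNetwork par P E) (f : ℕ) (k : Tier × ℕ) (y₀ : Mark) :
    IndepFun (fun w => (locs E w, Function.update (fun j => mark E f j w) k y₀)) (mark E f k) P := by
  -- The three sources behind the mark of `k`. With that mark overwritten by a constant, the
  -- locations and the remaining marks are measurable for the sources outside `T`.
  set T : Set Source := {.cache k.1 k.2, .fading k.1 k.2, .angle k.1 k.2} with hT
  have h := indep_iSup_of_disjoint hE.sigmaAlg_le hE.indep (S := Tᶜ) (T := T)
    disjoint_compl_left
  rw [IndepFun_iff_Indep]
  refine indep_of_indep_of_le_right (indep_of_indep_of_le_left h ?_) ?_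
  · rw [← measurable_iff_comap_le]
    refine measurable_prodMk_of _ ?_ ?_
    · refine measurable_pi_of _ fun i => ?_
      exact measurable_iff_comap_le.2 (measurable_source (s := .loc i) (by simp [hT]))
    · refine measurable_pi_of _ fun j => ?_
      by_cases hj : j = k
      · subst hj; simp only [Function.update_self]; exact measurable_const
      · simp only [Function.update_of_ne hj]
        have hne : ¬(j.1 = k.1 ∧ j.2 = k.2) := fun h => hj (Prod.ext h.1 h.2)
        exact measurable_mark_sources (by simpa [hT] using hne) (by simpa [hT] using hne)
          (by simpa [hT] using hne)
  · rw [← measurable_iff_comap_le]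
    exact measurable_mark_sources (by simp [hT]) (by simp [hT]) (by simp [hT])

/-- The three attributes have disjoint sources, which makes the law a product. Of the random cache
only the membership of `f` matters, a two-point law fixed by the caching probability. -/
lemma IsNetwork.map_mark (hE : IsNetwork par P E) (f : ℕ) (k : Tier × ℕ) :
    P.map (mark E f k) = markLaw par f k.1 := by
  have hc := hE.measurable_mem_cache k.1 k.2 f
  have hh := hE.fading_measurable k.1 k.2
  have ha := hE.angle_measurable k.1 k.2
  have i1 : IndepFun (E.fading k.1 k.2) (E.angle k.1 k.2) P := by
    rw [IndepFun_iff_Indep]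
    exact hE.indep.indep (i := .fading k.1 k.2) (j := .angle k.1 k.2) (by simp)
  have i2 : IndepFun (fun w => f ∈ E.cache k.1 k.2 w)
      (fun w => (E.fading k.1 k.2 w, E.angle k.1 k.2 w)) P := by
    have h := indep_iSup_of_disjoint hE.sigmaAlg_le hE.indep (S := {.cache k.1 k.2})
      (T := {.fading k.1 k.2, .angle k.1 k.2}) (by simp)
    rw [IndepFun_iff_Indep]
    refine indep_of_indep_of_le_right (indep_of_indep_of_le_left h ?_) ?_
    · rw [← measurable_iff_comap_le]
      exact (measurable_set_mem f).comp (measurable_iff_comap_le.2 (measurable_source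
        (s := .cache k.1 k.2) (by simp)))
    · rw [← measurable_iff_comap_le]
      refine measurable_prodMk_of _ ?_ ?_
      · exact measurable_iff_comap_le.2 (measurable_source (s := .fading k.1 k.2) (by simp))
      · exact measurable_iff_comap_le.2 (measurable_source (s := .angle k.1 k.2) (by simp))
  have e2 := (indepFun_iff_map_prod_eq_prod_map_map hc.aemeasurable
    (hh.prodMk ha).aemeasurable).1 i2
  have e1 := (indepFun_iff_map_prod_eq_prod_map_map hh.aemeasurable ha.aemeasurable).1 i1
  have e3 : P.map (fun w => f ∈ E.cache k.1 k.2 w) =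
      ENNReal.ofReal (par.p k.1 f) • Measure.dirac True +
      ENNReal.ofReal (1 - par.p k.1 f) • Measure.dirac False := by
    have hp : P {w | f ∈ E.cache k.1 k.2 w} = ENNReal.ofReal (par.p k.1 f) := by
      rw [← hE.cache_prob k.1 k.2 f, ofReal_measureReal]
    have hp' : P {w | f ∉ E.cache k.1 k.2 w} = ENNReal.ofReal (1 - par.p k.1 f) := by
      have hm : MeasurableSet {w | f ∈ E.cache k.1 k.2 w} := measurableSet_setOfPred.2 hc
      have := prob_compl_eq_one_sub (μ := P) hm
      rw [hp] at this
      rw [ENNReal.ofReal_sub _ (hE.p_nonneg _ _), ENNReal.ofReal_one, ← this]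
      rfl
    refine Measure.ext_of_singleton fun a => ?_
    rw [Measure.map_apply hc (measurableSet_singleton a)]
    by_cases h : a
    · have : (fun w => f ∈ E.cache k.1 k.2 w) ⁻¹' {a} = {w | f ∈ E.cache k.1 k.2 w} := by
        ext w; simp [h]
      rw [this, hp]; simp [h]
    · have : (fun w => f ∈ E.cache k.1 k.2 w) ⁻¹' {a} = {w | f ∉ E.cache k.1 k.2 w} := by
        ext w; simp [h]
      rw [this, hp']; simp [h]
  rw [e1, e3, hE.fading_law, hE.angle_law k.1 k.2] at e2
  exact e2

instance (i : Tier) : IsProbabilityMeasure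
    (gammaMeasure (par.fadingParam i) (par.fadingParam i)) := by
  have : (0 : ℝ) < par.fadingParam i := by
    cases i
    · simp [Params.fadingParam]
    · exact_mod_cast par.Nak_pos
  exact isProbabilityMeasure_gammaMeasure this this

lemma IsNetwork.isProbabilityMeasure_markLaw (hE : IsNetwork par P E) (f : ℕ) (i : Tier) :
    IsProbabilityMeasure (markLaw par f i) := by
  rw [← hE.map_mark f (i, 0)]
  exact Measure.isProbabilityMeasure_map (hE.measurable_mark _).aemeasurable

/-- Integrating out the second of two independent variables. -/
lemma lintegral_indepFun {α β : Type*} [MeasurableSpace α] [MeasurableSpace β] {W : Ω → α}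
    {Y : Ω → β} (h : IndepFun W Y P) (hW : Measurable W) (hY : Measurable Y)
    {F : α → β → ℝ≥0∞} (hF : Measurable (Function.uncurry F)) :
    ∫⁻ w, F (W w) (Y w) ∂P = ∫⁻ w, ∫⁻ y, F (W w) y ∂(P.map Y) ∂P := by
  have h1 := (indepFun_iff_map_prod_eq_prod_map_map hW.aemeasurable hY.aemeasurable).1 h
  have : IsProbabilityMeasure (P.map Y) := Measure.isProbabilityMeasure_map hY.aemeasurable
  calc ∫⁻ w, F (W w) (Y w) ∂P
      = ∫⁻ q, Function.uncurry F q ∂(P.map fun w => (W w, Y w)) := by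
        rw [lintegral_map hF (hW.prodMk hY)]; rfl
    _ = ∫⁻ x, ∫⁻ y, F x y ∂(P.map Y) ∂(P.map W) := by
        rw [h1, lintegral_prod _ hF.aemeasurable]; rfl
    _ = _ := lintegral_map hF.lintegral_prod_right hW

/-- Fubini for one mark against everything else. `Function.update` prevents `F` from seeing this
mark through its first argument. -/
lemma IsNetwork.lintegral_mark (hE : IsNetwork par P E) (f : ℕ) (k : Tier × ℕ) (y₀ : Mark)
    {F : (Tier → ℕ → Plane) × (Tier × ℕ → Mark) → Mark → ℝ≥0∞}
    (hF : Measurable (Function.uncurry F)) :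
    ∫⁻ w, F (locs E w, Function.update (fun j => mark E f j w) k y₀) (mark E f k w) ∂P =
      ∫⁻ w, ∫⁻ y, F (locs E w, Function.update (fun j => mark E f j w) k y₀) y
        ∂(markLaw par f k.1) ∂P := by
  rw [← hE.map_mark f k]
  refine lintegral_indepFun (hE.indepFun_mark f k y₀) (hE.measurable_locs.prodMk
    (measurable_pi_lambda _ fun j => ?_)) (hE.measurable_mark k) hF
  by_cases hj : j = k
  · subst hj; simp only [Function.update_self]; exact measurable_const
  · simp only [Function.update_of_ne hj]; exact hE.measurable_mark j

/-- Integrating out finitely many marks. -/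
lemma IsNetwork.lintegral_prod_marks (hE : IsNetwork par P E) (f : ℕ) (s : Finset (Tier × ℕ))
    {B : (Tier → ℕ → Plane) → ℝ≥0∞} (hB : Measurable B)
    {φ : Tier × ℕ → (Tier → ℕ → Plane) → Mark → ℝ≥0∞}
    (hφ : ∀ k, Measurable (Function.uncurry (φ k))) :
    ∫⁻ w, B (locs E w) * ∏ k ∈ s, φ k (locs E w) (mark E f k w) ∂P =
      ∫⁻ w, B (locs E w) * ∏ k ∈ s, ∫⁻ y, φ k (locs E w) y ∂(markLaw par f k.1) ∂P := by
  induction s using Finset.induction_on generalizing B with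
  | empty => simp
  | insert k s hk ih =>
    have := hE.isProbabilityMeasure_markLaw f
    have hΦ : ∀ k, Measurable fun z => ∫⁻ y, φ k z y ∂(markLaw par f k.1) := fun k =>
      (hφ k).lintegral_prod_right
    simp_rw [Finset.prod_insert hk, ← mul_assoc]
    -- The average of the factor of `k` is a function of the locations alone and can be absorbed
    -- into `B`; this is why the induction generalizes over `B`.
    rw [← ih (B := fun z => B z * ∫⁻ y, φ k z y ∂(markLaw par f k.1)) (hB.mul (hΦ k))]
    have hne : ∀ j ∈ s, j ≠ k := fun j hj h => hk (h ▸ hj)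
    have key := hE.lintegral_mark f k (True, 0, 0) (F := fun q y =>
      B q.1 * φ k q.1 y * ∏ j ∈ s, φ j q.1 (q.2 j)) (by
        refine Measurable.mul (Measurable.mul ?_ ?_) (Finset.measurable_prod _ fun j _ => ?_)
        · exact hB.comp (measurable_fst.comp measurable_fst)
        · exact (hφ k).comp ((measurable_fst.comp measurable_fst).prodMk measurable_snd)
        · exact (hφ j).comp ((measurable_fst.comp measurable_fst).prodMk
            ((measurable_pi_apply j).comp (measurable_snd.comp measurable_fst))))
    have hupd : ∀ w, ∏ j ∈ s, φ j (locs E w) (Function.update (fun j => mark E f j w) k (True, 0, 0) j)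
        = ∏ j ∈ s, φ j (locs E w) (mark E f j w) := fun w =>
      Finset.prod_congr rfl fun j hj => by rw [Function.update_of_ne (hne j hj)]
    simp only [hupd] at key
    rw [key]
    refine lintegral_congr fun w => ?_
    have hm : Measurable fun y => φ k (locs E w) y := (hφ k).comp measurable_prodMk_left
    rw [lintegral_mul_const _ (hm.const_mul _), lintegral_const_mul _ hm]

/-- Integrating out all marks. -/
lemma IsNetwork.lintegral_infProd_marks (hE : IsNetwork par P E) (f : ℕ)
    {B : (Tier → ℕ → Plane) → ℝ≥0∞} (hB : Measurable B) (hB1 : ∀ z, B z ≤ 1)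
    {φ : Tier × ℕ → (Tier → ℕ → Plane) → Mark → ℝ≥0∞}
    (hφ : ∀ k, Measurable (Function.uncurry (φ k))) (hφ1 : ∀ k z y, φ k z y ≤ 1) :
    ∫⁻ w, B (locs E w) *
        infProd (fun m => ∏ t, φ (t, m) (locs E w) (mark E f (t, m) w)) ∂P =
      ∫⁻ w, B (locs E w) *
        infProd (fun m => ∏ t, ∫⁻ y, φ (t, m) (locs E w) y ∂(markLaw par f t)) ∂P := by
  have hpr := hE.isProbabilityMeasure_markLaw f
  have hL := hE.measurable_locs
  have hΦ : ∀ k, Measurable fun z => ∫⁻ y, φ k z y ∂(markLaw par f k.1) := fun k =>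
    (hφ k).lintegral_prod_right
  have hΦ1 : ∀ t m z, ∫⁻ y, φ (t, m) z y ∂(markLaw par f t) ≤ 1 := fun t m z =>
    (lintegral_mono fun y => hφ1 (t, m) z y).trans (by simp)
  -- Both sides are limits of products over the first `M` stations of both tiers, bounded by `1`, so
  -- the finite case suffices.
  have lim : ∀ θ : Tier → ℕ → Ω → ℝ≥0∞, (∀ t m, Measurable (θ t m)) → (∀ t m w, θ t m w ≤ 1) →
      Tendsto (fun M => ∫⁻ w, B (locs E w) *
        ∏ k ∈ (Finset.univ : Finset Tier) ×ˢ Finset.range M, θ k.1 k.2 w ∂P) atTop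
        (𝓝 (∫⁻ w, B (locs E w) * infProd (fun m => ∏ t, θ t m w) ∂P)) := by
    intro θ hθ hθ1
    simp_rw [Finset.prod_product_right]
    refine tendsto_lintegral_of_dominated_convergence (fun _ => 1) (fun M => (hB.comp hL).mul
      (Finset.measurable_prod _ fun m _ => Finset.measurable_prod _ fun t _ => hθ t m))
      (fun M => .of_forall fun w => ?_) (by simp) (.of_forall fun w => ?_)
    · exact mul_le_one' (hB1 _) (Finset.prod_le_one' fun m _ => Finset.prod_le_one' fun t _ =>
        hθ1 t m w)
    · exact ENNReal.Tendsto.const_mul (tendsto_infProd fun m => Finset.prod_le_one' fun t _ =>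
        hθ1 t m w) (Or.inr (ne_top_of_le_ne_top ENNReal.one_ne_top (hB1 _)))
  refine tendsto_nhds_unique (lim (fun t m w => φ (t, m) (locs E w) (mark E f (t, m) w))
    (fun t m => (hφ (t, m)).comp (hL.prodMk (hE.measurable_mark _))) fun t m w => hφ1 _ _ _) ?_
  refine Tendsto.congr (fun M => ?_) (lim (fun t m w =>
    ∫⁻ y, φ (t, m) (locs E w) y ∂(markLaw par f t)) (fun t m => (hΦ (t, m)).comp hL)
    fun t m w => hΦ1 _ _ _)
  exact (hE.lintegral_prod_marks f _ hB hφ).symm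

end Marks

end

/-! ### Mean factors and the Mecke formula for the network. -/

section

lemma expNeg_tsum (x : ℕ → ℝ≥0∞) : expNeg (∑' m, x m) = infProd fun m => expNeg (x m) := by
  refine tendsto_nhds_unique ((continuous_expNeg.tendsto _).comp
    (ENNReal.summable.hasSum.tendsto_sum_nat)) ?_
  simp only [Function.comp_def, expNeg_sum]
  exact tendsto_infProd fun m => expNeg_le_one _

lemma infProd_single {a : ℝ≥0∞} (ha : a ≤ 1) (n : ℕ) :
    infProd (fun m => if m = n then a else 1) = a := by
  have h : ∀ m, (if m = n then a else 1) ≤ 1 := fun m => by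
    split_ifs
    exacts [ha, le_rfl]
  rw [infProd_eq_prod h {n} (fun m hm => if_neg (by simpa using hm))]
  simp

lemma infProd_ite {a : ℝ≥0∞} (ha : a ≤ 1) {φ : ℕ → ℝ≥0∞} (hφ : ∀ m, φ m ≤ 1) (n : ℕ) :
    infProd (fun m => if m = n then a else φ m) =
      a * infProd (fun m => if m = n then 1 else φ m) := by
  conv_rhs => rw [← infProd_single ha n]
  rw [← infProd_mul]
  · congr 1; ext m; split_ifs <;> simp
  · intro m; split_ifs
    exacts [ha, le_rfl]
  · intro m; split_ifs
    exacts [le_rfl, hφ m]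

namespace Params

variable (par : Params)

/-- Path loss with unit intercept. -/
def loss : Tier → ℝ → ℝ
  | .macroBS, r => r ^ (-par.alpha .macroBS)
  | .picoBS, r => unitStep (par.RL - r) * r ^ (-par.alpha .picoBS)

lemma pathLoss_eq (i : Tier) (r : ℝ) : par.pathLoss i r = par.C i * par.loss i r := by
  cases i <;> simp only [pathLoss, loss]; ring

lemma alpha_pos (i : Tier) : 0 < par.alpha i := by
  cases i
  · linarith [par.two_lt_alpha_macro]
  · linarith [par.two_le_alpha_pico]

lemma loss_nonneg (i : Tier) {r : ℝ} (hr : 0 ≤ r) : 0 ≤ par.loss i r := by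
  cases i <;> simp only [loss, unitStep]
  · positivity
  · split_ifs <;> positivity

lemma measurable_unitStep : Measurable unitStep :=
  Measurable.ite measurableSet_Ici measurable_const measurable_const

lemma measurable_loss (i : Tier) : Measurable (par.loss i) := by
  cases i
  · exact measurable_id.pow_const _
  · exact (measurable_unitStep.comp (measurable_const.sub measurable_id)).mul
      (measurable_id.pow_const _)

lemma measurable_arrayGain (N : ℕ) : Measurable (arrayGain N) := by
  refine Measurable.ite (measurableSet_eq_fun (by fun_prop) measurable_const) measurable_const ?_
  fun_prop

lemma measurable_gain (i : Tier) : Measurable (par.gain i) := by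
  cases i
  · exact measurable_const
  · exact measurable_arrayGain _

lemma gain_nonneg (i : Tier) (ω : ℝ) : 0 ≤ par.gain i ω := by
  cases i
  · exact zero_le_one
  · simp only [gain, arrayGain]; split_ifs <;> positivity

open Classical in
/-- Factor contributed by another base station of the serving tier, at distance `s` and with mark
`y`, when the serving base station is at distance `r`. -/
def ownFactor (i : Tier) (κ r s : ℝ) (y : Mark) : ℝ≥0∞ :=
  if y.1 ∧ s < r then 0
  else expNeg (ENNReal.ofReal (κ * r ^ par.alpha i) *
    ENNReal.ofReal (par.loss i s * (y.2.1 * par.gain i y.2.2)))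

/-- Mean of `ownFactor` over the marks. -/
def meanOwnFactor (f : ℕ) (i : Tier) (κ r s : ℝ) : ℝ≥0∞ :=
  ∫⁻ y, par.ownFactor i κ r s y ∂markLaw par f i

lemma ownFactor_le_one (i : Tier) (κ r s : ℝ) (y : Mark) : par.ownFactor i κ r s y ≤ 1 := by
  unfold ownFactor
  split_ifs
  exacts [zero_le, expNeg_le_one _]

lemma measurable_ownFactor (i : Tier) (κ : ℝ) :
    Measurable fun q : ℝ × ℝ × Mark => par.ownFactor i κ q.1 q.2.1 q.2.2 := by
  have h1 : Measurable fun q : ℝ × ℝ × Mark => q.2.2.1 := by fun_prop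
  have h2 : Measurable fun q : ℝ × ℝ × Mark => ENNReal.ofReal (κ * q.1 ^ par.alpha i) := by
    fun_prop
  have h3 : Measurable fun q : ℝ × ℝ × Mark =>
      ENNReal.ofReal (par.loss i q.2.1 * (q.2.2.2.1 * par.gain i q.2.2.2.2)) :=
    (((par.measurable_loss i).comp (by fun_prop : Measurable fun q : ℝ × ℝ × Mark => q.2.1)).mul
      ((by fun_prop : Measurable fun q : ℝ × ℝ × Mark => q.2.2.2.1).mul
        ((par.measurable_gain i).comp
          (by fun_prop : Measurable fun q : ℝ × ℝ × Mark => q.2.2.2.2)))).ennreal_ofReal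
  have h4 : MeasurableSet {q : ℝ × ℝ × Mark | q.2.1 < q.1} :=
    measurableSet_lt (by fun_prop) (by fun_prop)
  exact Measurable.ite ((measurableSet_setOfPred.2 h1).inter h4) measurable_const
    (measurable_expNeg.comp (h2.mul h3))

/-- A larger `r` both enlarges the disc forbidden to caching stations and increases the argument `κ
r ^ α` of the Laplace transform. -/
lemma antitoneOn_ownFactor (i : Tier) {κ : ℝ} (hκ : 0 ≤ κ) (s : ℝ) (y : Mark) :
    AntitoneOn (fun r => par.ownFactor i κ r s y) (Set.Ici 0) := by
  intro r hr r' _ h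
  simp only [ownFactor]
  split_ifs with h1 h2 h2
  · exact le_rfl
  · exact zero_le
  · exact absurd ⟨h2.1, h2.2.trans_le h⟩ h1
  · refine expNeg_antitone (mul_le_mul_left (ENNReal.ofReal_le_ofReal ?_) _)
    exact mul_le_mul_of_nonneg_left (Real.rpow_le_rpow hr h (par.alpha_pos i).le) hκ

/-- The condition `s < r` is strict: if it holds at `r` it persists nearby, and if it fails at `r`
it fails for all smaller values. Hence there is continuity from the left, but in general not from
the right. -/
lemma continuousWithinAt_ownFactor (i : Tier) (κ : ℝ) (s r : ℝ) (y : Mark) :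
    ContinuousWithinAt (fun r => par.ownFactor i κ r s y) (Set.Icc 0 r) r := by
  have hc : ContinuousAt (fun r => expNeg (ENNReal.ofReal (κ * r ^ par.alpha i) *
      ENNReal.ofReal (par.loss i s * (y.2.1 * par.gain i y.2.2)))) r := by
    refine (continuous_expNeg.tendsto _).comp (ENNReal.Tendsto.mul_const
      (ENNReal.tendsto_ofReal (((Real.continuousAt_rpow_const _ _ (Or.inr (par.alpha_pos i).le))
        ).const_mul κ)) (Or.inr ENNReal.ofReal_ne_top))
  unfold ContinuousWithinAt
  by_cases h : y.1 ∧ s < r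
  · simp only [ownFactor]
    rw [if_pos h]
    refine tendsto_const_nhds.congr' ?_
    filter_upwards [nhdsWithin_le_nhds (lt_mem_nhds h.2)] with r' hr'
    rw [if_pos ⟨h.1, hr'⟩]
  · simp only [ownFactor]
    rw [if_neg h]
    refine (hc.tendsto.mono_left nhdsWithin_le_nhds).congr' ?_
    filter_upwards [self_mem_nhdsWithin] with r' hr'
    rw [if_neg fun h' => h ⟨h'.1, h'.2.trans_le hr'.2⟩]

end Params

variable {Ω : Type*} [MeasurableSpace Ω] {P : Measure Ω} [IsProbabilityMeasure P] {par : Params}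
  {E : Elements Ω} {f : ℕ}

lemma IsNetwork.meanOwnFactor_le_one (hE : IsNetwork par P E) (f : ℕ) (i : Tier) (κ r s : ℝ) :
    par.meanOwnFactor f i κ r s ≤ 1 := by
  have := hE.isProbabilityMeasure_markLaw f i
  exact (lintegral_mono fun y => par.ownFactor_le_one i κ r s y).trans (by simp)

lemma IsNetwork.measurable_meanOwnFactor_prod (hE : IsNetwork par P E) (f : ℕ) (i : Tier) (κ : ℝ) :
    Measurable fun q : ℝ × ℝ => par.meanOwnFactor f i κ q.1 q.2 := by
  have := hE.isProbabilityMeasure_markLaw f i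
  have h : Measurable (Function.uncurry fun (q : ℝ × ℝ) (y : Mark) =>
      par.ownFactor i κ q.1 q.2 y) :=
    (par.measurable_ownFactor i κ).comp ((measurable_fst.comp measurable_fst).prodMk
      ((measurable_snd.comp measurable_fst).prodMk measurable_snd))
  exact h.lintegral_prod_right

lemma IsNetwork.measurable_meanOwnFactor (hE : IsNetwork par P E) (f : ℕ) (i : Tier) (κ r : ℝ) :
    Measurable (par.meanOwnFactor f i κ r) := by
  exact (hE.measurable_meanOwnFactor_prod f i κ).comp measurable_prodMk_left

lemma antitoneOn_meanOwnFactor (par : Params) (f : ℕ) (i : Tier) {κ : ℝ} (hκ : 0 ≤ κ) (s : ℝ) :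
    AntitoneOn (fun r => par.meanOwnFactor f i κ r s) (Set.Ici 0) := fun _ hr _ hr' h =>
  lintegral_mono fun y => par.antitoneOn_ownFactor i hκ s y hr hr' h

lemma IsNetwork.continuousWithinAt_meanOwnFactor (hE : IsNetwork par P E) (f : ℕ) (i : Tier)
    (κ s r : ℝ) :
    ContinuousWithinAt (fun r => par.meanOwnFactor f i κ r s) (Set.Icc 0 r) r := by
  have := hE.isProbabilityMeasure_markLaw f i
  refine tendsto_lintegral_filter_of_dominated_convergence (fun _ => 1) (.of_forall fun r' => ?_)
    (.of_forall fun r' => .of_forall fun y => par.ownFactor_le_one i κ r' s y) (by simp)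
    (.of_forall fun y => par.continuousWithinAt_ownFactor i κ s r y)
  exact (par.measurable_ownFactor i κ).comp
    (measurable_const.prodMk (measurable_const.prodMk measurable_id))

/-- Interference seen by a user served by base station `n` of tier `i`, for unit power. -/
def unitInterference (par : Params) (E : Elements Ω) (i : Tier) (n : ℕ) (w : Ω) : ℝ≥0∞ :=
  ∑' m, if m = n then 0 else
    ENNReal.ofReal (par.loss i ‖E.loc i m w‖ * (E.fading i m w * par.gain i (E.angle i m w)))

open Classical in
/-- Indicator of the event that the file is cached at base station `n` of tier `i`, that no other
base station of this tier that caches it is closer, and that no base station of the other tier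
that caches it is within distance `ρ` of the distance of base station `n`. -/
def nearest (E : Elements Ω) (f : ℕ) (i : Tier) (ρ : ℝ → ℝ) (n : ℕ) (w : Ω) : ℝ≥0∞ :=
  (if f ∈ E.cache i n w then 1 else 0) *
    (infProd (fun m => if m = n then 1 else
      if f ∈ E.cache i m w ∧ ‖E.loc i m w‖ < ‖E.loc i n w‖ then 0 else 1) *
    infProd (fun m => if f ∈ E.cache i.other m w ∧ ‖E.loc i.other m w‖ ≤ ρ ‖E.loc i n w‖
      then 0 else 1))

open Classical in
-- The product equals `1 - p` raised to the number of stations in the ball, so this is the Poisson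
-- generating function: independent thinning yields the void probability of a process with density
-- `p λ`.
lemma IsNetwork.lintegral_infProd_other (hE : IsNetwork par P E) (f : ℕ) (i : Tier) (r : ℝ) :
    ∫⁻ w, infProd (fun m => if ‖E.loc i m w‖ ≤ r then 1 - ENNReal.ofReal (par.p i f) else 1) ∂P =
      expNeg (ENNReal.ofReal (par.p i f) * intensity (par.lam i) (Metric.closedBall 0 r)) := by
  have hH := hE.hppp i
  have hl := (par.lam_pos i).le
  have hp1 : ENNReal.ofReal (par.p i f) ≤ 1 := by
    rw [← ENNReal.ofReal_one]; exact ENNReal.ofReal_le_ofReal (hE.p_le_one i f)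
  have hm : MeasurableSet (Metric.closedBall (0 : Plane) r) := measurableSet_closedBall
  have hfin : volume (Metric.closedBall (0 : Plane) r) ≠ ⊤ := measure_closedBall_lt_top.ne
  have key := hH.lintegral_pow_count hl hm hfin
    (c := 1 - ENNReal.ofReal (par.p i f)) tsub_le_self
  rw [ENNReal.sub_sub_cancel ENNReal.one_ne_top hp1] at key
  rw [← key]
  refine lintegral_congr_ae ?_
  filter_upwards [hH.count_lt_top hl hm hfin] with w hw
  have hF : {n | E.loc i n w ∈ Metric.closedBall 0 r}.Finite := Set.encard_ne_top_iff.1 hw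
  rw [infProd_eq_prod (fun m => by split_ifs; exacts [tsub_le_self, le_rfl]) hF.toFinset
    fun m hm => if_neg (by simpa using hm)]
  rw [Finset.prod_congr rfl fun m hm => if_pos (by simpa using hm), Finset.prod_const]
  congr 1
  rw [count, hF.encard_eq_coe_toFinset_card, ENat.toNat_natCast]

lemma lintegral_bern (a b p : ℝ≥0∞) (φ : Prop → ℝ≥0∞) (hp : a = p) :
    ∫⁻ c, φ c ∂(a • Measure.dirac True + b • Measure.dirac False) = p * φ True + b * φ False := by
  rw [lintegral_add_measure, lintegral_smul_measure, lintegral_smul_measure, lintegral_dirac,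
    lintegral_dirac, hp]; rfl

lemma lintegral_markLaw_of_fst (i : Tier) (φ : Prop → ℝ≥0∞) :
    ∫⁻ y : Mark, φ y.1 ∂markLaw par f i =
      ENNReal.ofReal (par.p i f) * φ True + ENNReal.ofReal (1 - par.p i f) * φ False := by
  have : IsProbabilityMeasure
      (cond volume (Set.Icc (-(par.d / par.wavelength)) (par.d / par.wavelength))) := by
    refine cond_isProbabilityMeasure_of_finite ?_ ?_
    · have := par.d_pos; have := par.wavelength_pos
      rw [Real.volume_Icc, ENNReal.ofReal_ne_zero_iff]
      have : 0 < par.d / par.wavelength := by positivity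
      linarith
    · simp
  have h1 : Measurable φ := measurable_of_countable _
  rw [markLaw, lintegral_prod (fun y : Mark => φ y.1) (h1.comp measurable_fst).aemeasurable]
  simp only [lintegral_const, measure_univ, mul_one]
  exact lintegral_bern _ _ _ φ rfl

open Classical in
/-- The Mecke formula for the network: marks and the other tier are integrated out. -/
theorem IsNetwork.mecke (hE : IsNetwork par P E) (f : ℕ) (i : Tier) {g : ℝ → ℝ≥0∞} {ρ : ℝ → ℝ}
    (hg : Measurable g) (hg1 : ∀ r, g r ≤ 1) (hρ : Measurable ρ) {κ : ℝ} (hκ : 0 ≤ κ) :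
    ∑' n, ∫⁻ w, g ‖E.loc i n w‖ * (nearest E f i ρ n w *
        expNeg (ENNReal.ofReal (κ * ‖E.loc i n w‖ ^ par.alpha i) * unitInterference par E i n w))
        ∂P =
      ∫⁻ x : Plane, ENNReal.ofReal (par.p i f) * g ‖x‖ *
          expNeg (ENNReal.ofReal (par.p i.other f) *
            intensity (par.lam i.other) (Metric.closedBall 0 (ρ ‖x‖))) *
          expNeg (∫⁻ y : Plane, 1 - par.meanOwnFactor f i κ ‖x‖ ‖y‖ ∂intensity (par.lam i))
        ∂intensity (par.lam i) := by
  have hpr := hE.isProbabilityMeasure_markLaw f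
  have hp1 : ∀ t, ENNReal.ofReal (par.p t f) ≤ 1 := fun t => by
    rw [← ENNReal.ofReal_one]; exact ENNReal.ofReal_le_ofReal (hE.p_le_one t f)
  have hHi := hE.hppp i
  have hHj := hE.hppp i.other
  have hio : i.other ≠ i := i.other_ne
  -- Factor of station `k` when `n` is the distinguished one: caching for `n` itself, the own-tier
  -- factor for the rest of its tier, absence from the exclusion ball for caching stations of the
  -- other tier.
  let φ : ℕ → Tier × ℕ → (Tier → ℕ → Plane) → Mark → ℝ≥0∞ := fun n k z y =>
    if k.1 = i then
      (if k.2 = n then (if y.1 then 1 else 0)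
        else par.ownFactor i κ ‖z i n‖ ‖z i k.2‖ y)
    else if y.1 ∧ ‖z k.1 k.2‖ ≤ ρ ‖z i n‖ then 0 else 1
  have hz : ∀ t m, Measurable fun q : (Tier → ℕ → Plane) × Mark => ‖q.1 t m‖ := fun t m =>
    ((measurable_pi_apply m).comp ((measurable_pi_apply t).comp measurable_fst)).norm
  have hy1 : MeasurableSet {q : (Tier → ℕ → Plane) × Mark | q.2.1} :=
    measurableSet_setOfPred.2 (measurable_fst.comp measurable_snd)
  have hφ : ∀ n k, Measurable (Function.uncurry (φ n k)) := fun n k => by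
    simp only [φ, Function.uncurry_def]
    split_ifs with h1 h2
    · exact Measurable.ite hy1 measurable_const measurable_const
    · exact (par.measurable_ownFactor i κ).comp ((hz i n).prodMk ((hz i k.2).prodMk measurable_snd))
    · exact Measurable.ite (hy1.inter (measurableSet_le (hz _ _) (hρ.comp (hz i n))))
        measurable_const measurable_const
  have hφ1 : ∀ n k z y, φ n k z y ≤ 1 := fun n k z y => by
    simp only [φ]
    split_ifs
    all_goals first | exact le_rfl | exact zero_le | exact par.ownFactor_le_one _ _ _ _ _
  have hB : ∀ n, Measurable fun z : Tier → ℕ → Plane => g ‖z i n‖ := fun n =>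
    hg.comp ((measurable_pi_apply n).comp (measurable_pi_apply i)).norm
  -- The nearest-station indicator and the exponential of the interference merge into one product
  -- over all stations of both tiers, each factor involving a single mark.
  have step1 : ∀ n w, g ‖E.loc i n w‖ * (nearest E f i ρ n w *
        expNeg (ENNReal.ofReal (κ * ‖E.loc i n w‖ ^ par.alpha i) * unitInterference par E i n w)) =
      g ‖locs E w i n‖ *
        infProd (fun m => ∏ t, φ n (t, m) (locs E w) (mark E f (t, m) w)) := by
    intro n w
    have h1 : infProd (fun m => if m = n then 1 else
          par.ownFactor i κ ‖E.loc i n w‖ ‖E.loc i m w‖ (mark E f (i, m) w)) =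
        infProd (fun m => if m = n then 1 else
          if f ∈ E.cache i m w ∧ ‖E.loc i m w‖ < ‖E.loc i n w‖ then 0 else 1) *
        expNeg (ENNReal.ofReal (κ * ‖E.loc i n w‖ ^ par.alpha i) *
          unitInterference par E i n w) := by
      rw [unitInterference, ← ENNReal.tsum_mul_left, expNeg_tsum, ← infProd_mul]
      · congr 1; ext m
        by_cases hmn : m = n
        · simp [hmn, expNeg_zero]
        by_cases hc : f ∈ E.cache i m w ∧ ‖E.loc i m w‖ < ‖E.loc i n w‖
        · have hc' : (mark E f (i, m) w).1 ∧ ‖E.loc i m w‖ < ‖E.loc i n w‖ := hc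
          simp only [Params.ownFactor, if_neg hmn, if_pos hc, if_pos hc', zero_mul]
        · have hc' : ¬((mark E f (i, m) w).1 ∧ ‖E.loc i m w‖ < ‖E.loc i n w‖) := hc
          simp only [Params.ownFactor, if_neg hmn, if_neg hc, if_neg hc', one_mul]
          rfl
      · intro m; split_ifs <;> simp
      · exact fun m => expNeg_le_one _
    simp_rw [Tier.prod_eq i]
    rw [infProd_mul (fun m => hφ1 _ _ _ _) (fun m => hφ1 _ _ _ _)]
    simp only [φ, if_true, if_neg hio]
    have hif : (if (mark E f (i, n) w).1 then (1 : ℝ≥0∞) else 0) ≤ 1 := by split_ifs <;> simp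
    have h2 : infProd (fun m => if m = n then (if (mark E f (i, m) w).1 then (1 : ℝ≥0∞) else 0) else
          par.ownFactor i κ ‖E.loc i n w‖ ‖E.loc i m w‖ (mark E f (i, m) w)) =
        (if (mark E f (i, n) w).1 then (1 : ℝ≥0∞) else 0) *
        infProd (fun m => if m = n then 1 else
          par.ownFactor i κ ‖E.loc i n w‖ ‖E.loc i m w‖ (mark E f (i, m) w)) := by
      rw [← infProd_ite hif (fun m => par.ownFactor_le_one _ _ _ _ _)]
      congr 1; ext m
      by_cases hmn : m = n
      · simp [hmn]
      · simp [hmn]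
    simp only [locs]
    rw [h2, h1, nearest]
    by_cases hc : f ∈ E.cache i n w
    · have hc' : (mark E f (i, n) w).1 := hc
      rw [if_pos hc, if_pos hc', one_mul, one_mul, mul_right_comm]
      rfl
    · have hc' : ¬(mark E f (i, n) w).1 := hc
      simp only [if_neg hc, if_neg hc', zero_mul]
  -- Averaging the marks gives the caching probability for `n`, the mean factor for its tier, and a
  -- thinning factor for the other tier.
  have step2 : ∀ n w, infProd (fun m => ∏ t, ∫⁻ y, φ n (t, m) (locs E w) y ∂(markLaw par f t)) =
      ENNReal.ofReal (par.p i f) * infProd (fun m => if m = n then 1 else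
        par.meanOwnFactor f i κ ‖E.loc i n w‖ ‖E.loc i m w‖) *
      infProd (fun m => if ‖E.loc i.other m w‖ ≤ ρ ‖E.loc i n w‖
        then 1 - ENNReal.ofReal (par.p i.other f) else 1) := by
    intro n w
    have h1 : ∀ m, ∫⁻ y, φ n (i, m) (locs E w) y ∂(markLaw par f i) =
        if m = n then ENNReal.ofReal (par.p i f) else
          par.meanOwnFactor f i κ ‖E.loc i n w‖ ‖E.loc i m w‖ := fun m => by
      simp only [φ, if_true]
      split_ifs with hmn
      · rw [lintegral_markLaw_of_fst i fun c => if c then 1 else 0]; simp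
      · rfl
    have h2 : ∀ m, ∫⁻ y, φ n (i.other, m) (locs E w) y ∂(markLaw par f i.other) =
        if ‖E.loc i.other m w‖ ≤ ρ ‖E.loc i n w‖
          then 1 - ENNReal.ofReal (par.p i.other f) else 1 := fun m => by
      have h3 : ∀ y, φ n (i.other, m) (locs E w) y = (fun c : Prop =>
          if c ∧ ‖E.loc i.other m w‖ ≤ ρ ‖E.loc i n w‖ then (0 : ℝ≥0∞) else 1) y.1 := fun y => by
        simp only [φ, if_neg hio]
        rfl
      rw [lintegral_congr h3, lintegral_markLaw_of_fst i.other fun c =>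
        if c ∧ ‖E.loc i.other m w‖ ≤ ρ ‖E.loc i n w‖ then 0 else 1]
      by_cases hb : ‖E.loc i.other m w‖ ≤ ρ ‖E.loc i n w‖
      · simp [hb, ENNReal.ofReal_sub _ (hE.p_nonneg i.other f)]
      · simp only [hb, and_false, if_false, mul_one]
        rw [← ENNReal.ofReal_add (hE.p_nonneg _ _) (sub_nonneg.2 (hE.p_le_one _ _))]
        simp
    simp_rw [Tier.prod_eq i, h1, h2]
    rw [infProd_mul, infProd_ite (hp1 i) fun m => hE.meanOwnFactor_le_one _ _ _ _ _]
    · intro m; split_ifs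
      exacts [hp1 i, hE.meanOwnFactor_le_one _ _ _ _ _]
    · intro m; split_ifs
      exacts [tsub_le_self, le_rfl]
  have hGm : Measurable fun r => expNeg (ENNReal.ofReal (par.p i.other f) *
      intensity (par.lam i.other) (Metric.closedBall 0 (ρ r))) := by
    have : Monotone fun r => intensity (par.lam i.other) (Metric.closedBall (0 : Plane) r) :=
      fun r r' h => measure_mono (Metric.closedBall_subset_closedBall h)
    exact measurable_expNeg.comp ((this.measurable.comp hρ).const_mul _)
  have hXi : Measurable fun w n => E.loc i n w := measurable_pi_lambda _ hHi.measurable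
  have hXj : Measurable fun w n => E.loc i.other n w := measurable_pi_lambda _ hHj.measurable
  have hij : IndepFun (fun w n => E.loc i n w) (fun w n => E.loc i.other n w) P := by
    rw [IndepFun_iff_Indep]
    exact hE.indep.indep (i := .loc i) (j := .loc i.other) (by simpa using hio.symm)
  have hn : ∀ m, Measurable fun q : (ℕ → Plane) × (ℕ → Plane) => ‖q.1 m‖ := fun m =>
    ((measurable_pi_apply m).comp measurable_fst).norm
  have hn' : ∀ m, Measurable fun q : (ℕ → Plane) × (ℕ → Plane) => ‖q.2 m‖ := fun m =>
    ((measurable_pi_apply m).comp measurable_snd).norm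
  -- The locations of the two tiers are independent, so the other tier is averaged with the distance
  -- of station `n` frozen.
  have step3 : ∀ n, ∫⁻ w, g ‖E.loc i n w‖ * (ENNReal.ofReal (par.p i f) *
        infProd (fun m => if m = n then 1 else
          par.meanOwnFactor f i κ ‖E.loc i n w‖ ‖E.loc i m w‖) *
        infProd (fun m => if ‖E.loc i.other m w‖ ≤ ρ ‖E.loc i n w‖
          then 1 - ENNReal.ofReal (par.p i.other f) else 1)) ∂P =
      ∫⁻ w, ENNReal.ofReal (par.p i f) * g ‖E.loc i n w‖ *
          expNeg (ENNReal.ofReal (par.p i.other f) *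
            intensity (par.lam i.other) (Metric.closedBall 0 (ρ ‖E.loc i n w‖))) *
        infProd (fun m => if m = n then 1 else
          par.meanOwnFactor f i κ ‖E.loc i n w‖ ‖E.loc i m w‖) ∂P := by
    intro n
    have hM : Measurable fun q : (ℕ → Plane) × (ℕ → Plane) => infProd (fun m =>
        if ‖q.2 m‖ ≤ ρ ‖q.1 n‖ then 1 - ENNReal.ofReal (par.p i.other f) else 1) :=
      measurable_infProd fun m => Measurable.ite (measurableSet_le (hn' m) (hρ.comp (hn n)))
        measurable_const measurable_const
    rw [lintegral_indepFun hij hXi hXj (F := fun z z' => g ‖z n‖ * (ENNReal.ofReal (par.p i f) *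
        infProd (fun m => if m = n then 1 else par.meanOwnFactor f i κ ‖z n‖ ‖z m‖) *
        infProd (fun m => if ‖z' m‖ ≤ ρ ‖z n‖
          then 1 - ENNReal.ofReal (par.p i.other f) else 1)))]
    · refine lintegral_congr fun w => ?_
      have hM' : Measurable fun z' : ℕ → Plane => infProd (fun m =>
          if ‖z' m‖ ≤ ρ ‖E.loc i n w‖ then 1 - ENNReal.ofReal (par.p i.other f) else 1) :=
        measurable_infProd fun m => Measurable.ite (measurableSet_le
          (measurable_pi_apply m).norm measurable_const) measurable_const measurable_const
      rw [lintegral_const_mul _ (hM'.const_mul _), lintegral_const_mul _ hM',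
        lintegral_map hM' hXj, hE.lintegral_infProd_other f i.other]
      ring
    · refine (hg.comp (hn n)).mul ((Measurable.const_mul (measurable_infProd fun m => ?_) _).mul hM)
      by_cases hmn : m = n
      · simp [hmn]
      · simp only [if_neg hmn]
        exact (hE.measurable_meanOwnFactor_prod f i κ).comp ((hn n).prodMk (hn m))
  -- Only the locations of the serving tier remain; the mean factor inherits monotonicity and left
  -- continuity in `r`.
  have step4 := hHi.mecke (par.lam_pos i).le (g := fun x => ENNReal.ofReal (par.p i f) * g ‖x‖ *
          expNeg (ENNReal.ofReal (par.p i.other f) *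
            intensity (par.lam i.other) (Metric.closedBall 0 (ρ ‖x‖))))
    (ψ := fun r y => par.meanOwnFactor f i κ r ‖y‖)
    (((hg.comp measurable_norm).const_mul _).mul (hGm.comp measurable_norm))
    (fun r => (hE.measurable_meanOwnFactor f i κ r).comp measurable_norm)
    (fun r x => hE.meanOwnFactor_le_one _ _ _ _ _)
    (fun x => antitoneOn_meanOwnFactor par f i hκ _)
    (fun x r _ => hE.continuousWithinAt_meanOwnFactor f i κ _ r)
  rw [← step4]
  refine tsum_congr fun n => ?_
  rw [← step3 n, lintegral_congr (step1 n), hE.lintegral_infProd_marks f (hB n) (fun z => hg1 _)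
    (hφ n) (hφ1 n), lintegral_congr fun w => by rw [step2 n w]]
  rfl

end

/-! ### Polar coordinates and the Gamma distribution. -/

section

/-- Polar coordinates for radial functions. -/
lemma lintegral_fun_norm_plane {F : ℝ → ℝ≥0∞} (hF : Measurable F) :
    ∫⁻ x : Plane, F ‖x‖ = ∫⁻ r in Set.Ioi 0, ENNReal.ofReal (2 * Real.pi * r) * F r := by
  have hmp := (volume : Measure Plane).measurePreserving_homeomorphUnitSphereProd
  have h0 : ∫⁻ x : Plane, F ‖x‖ = ∫⁻ x in ({0}ᶜ : Set Plane), F ‖x‖ := by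
    rw [restrict_compl_singleton]
  rw [h0, ← lintegral_subtype_comap (measurableSet_singleton (0 : Plane)).compl fun x => F ‖x‖]
  have h1 := hmp.lintegral_comp_emb (Homeomorph.measurableEmbedding _)
    (fun q : Metric.sphere (0 : Plane) 1 × Set.Ioi (0 : ℝ) => F q.2)
  simp only [homeomorphUnitSphereProd_apply_snd_coe] at h1
  rw [h1, lintegral_prod (fun q : Metric.sphere (0 : Plane) 1 × Set.Ioi (0 : ℝ) => F q.2)
    (hF.comp (measurable_subtype_coe.comp measurable_snd)).aemeasurable]
  have hdim : Module.finrank ℝ Plane = 2 := by simp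
  have hconst : (volume : Measure Plane).toSphere Set.univ = ENNReal.ofReal (2 * Real.pi) := by
    rw [Measure.toSphere_apply_univ, hdim, EuclideanSpace.volume_ball_fin_two,
      ENNReal.ofReal_mul (by norm_num)]
    simp
  have hF' : Measurable fun r : Set.Ioi (0 : ℝ) => F r := hF.comp measurable_subtype_coe
  simp only [lintegral_const]
  rw [hconst, Measure.volumeIoiPow, lintegral_withDensity_eq_lintegral_mul _
    (by fun_prop) hF', hdim, mul_comm]
  simp only [Pi.mul_apply]
  rw [lintegral_subtype_comap measurableSet_Ioi (fun r : ℝ => ENNReal.ofReal (r ^ (2 - 1)) * F r),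
    ← lintegral_const_mul _ (by fun_prop)]
  refine setLIntegral_congr_fun measurableSet_Ioi fun r hr => ?_
  have hr : 0 < r := hr
  change ENNReal.ofReal (2 * Real.pi) * (ENNReal.ofReal (r ^ (2 - 1)) * F r) = _
  rw [← mul_assoc, ← ENNReal.ofReal_mul (by positivity), show 2 - 1 = 1 from rfl, pow_one]

lemma lintegral_fun_norm_intensity {lam : ℝ} (hl : 0 ≤ lam) {F : ℝ → ℝ≥0∞} (hF : Measurable F) :
    ∫⁻ x, F ‖x‖ ∂intensity lam =
      ∫⁻ r in Set.Ioi 0, ENNReal.ofReal (2 * Real.pi * lam * r) * F r := by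
  rw [intensity, lintegral_smul_measure, lintegral_fun_norm_plane hF, smul_eq_mul,
    ← lintegral_const_mul _ (by fun_prop)]
  refine lintegral_congr fun r => ?_
  rw [← mul_assoc, ← ENNReal.ofReal_mul hl]
  congr 2; ring

lemma intensity_closedBall {lam r : ℝ} (hl : 0 ≤ lam) (hr : 0 ≤ r) :
    intensity lam (Metric.closedBall 0 r) = ENNReal.ofReal (Real.pi * lam * r ^ 2) := by
  rw [intensity, Measure.smul_apply, EuclideanSpace.volume_closedBall_fin_two, smul_eq_mul,
    ← ENNReal.ofReal_pow hr, ← ENNReal.ofReal_mul (by positivity), ← ENNReal.ofReal_mul hl]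
  congr 1; ring

lemma intensity_ball {lam r : ℝ} (hl : 0 ≤ lam) (hr : 0 ≤ r) :
    intensity lam (Metric.ball 0 r) = ENNReal.ofReal (Real.pi * lam * r ^ 2) := by
  rw [intensity, Measure.smul_apply, EuclideanSpace.volume_ball_fin_two, smul_eq_mul,
    ← ENNReal.ofReal_pow hr, ← ENNReal.ofReal_mul (by positivity), ← ENNReal.ofReal_mul hl]
  congr 1; ring

section Gamma

lemma measurable_gammaPDF (a r : ℝ) : Measurable (gammaPDF a r) :=
  (measurable_gammaPDFReal a r).ennreal_ofReal

lemma lintegral_gammaMeasure (a r : ℝ) {F : ℝ → ℝ≥0∞} (hF : Measurable F) :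
    ∫⁻ x, F x ∂gammaMeasure a r = ∫⁻ x, gammaPDF a r x * F x := by
  rw [gammaMeasure, lintegral_withDensity_eq_lintegral_mul _ (measurable_gammaPDF a r) hF]
  rfl

/-- Laplace transform of the Gamma distribution. -/
lemma lintegral_expNeg_gamma {a r t : ℝ} (ha : 0 < a) (hr : 0 < r) (ht : 0 ≤ t) :
    ∫⁻ x, expNeg (ENNReal.ofReal t * ENNReal.ofReal x) ∂gammaMeasure a r =
      ENNReal.ofReal ((1 + t / r) ^ (-a)) := by
  have hrt : 0 < r + t := by linarith
  rw [lintegral_gammaMeasure a r (F := fun x => expNeg (ENNReal.ofReal t * ENNReal.ofReal x))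
    (measurable_expNeg.comp (by fun_prop))]
  -- Exponential tilting of a Gamma density is a multiple of the Gamma density with rate `r + t`,
  -- whose total mass is `1`.
  have : ∀ x, gammaPDF a r x * expNeg (ENNReal.ofReal t * ENNReal.ofReal x) =
      ENNReal.ofReal ((1 + t / r) ^ (-a)) * gammaPDF a (r + t) x := by
    intro x
    rcases lt_or_ge x 0 with hx | hx
    · rw [gammaPDF_of_neg hx, gammaPDF_of_neg hx]; simp
    · rw [gammaPDF_of_nonneg hx, gammaPDF_of_nonneg hx, ← ENNReal.ofReal_mul ht,
        expNeg_ofReal (by positivity), ← ENNReal.ofReal_mul (by positivity),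
        ← ENNReal.ofReal_mul (by positivity)]
      congr 1
      have h1 : 1 + t / r = (r + t) / r := by field_simp
      rw [h1, Real.rpow_neg (by positivity), Real.div_rpow hrt.le hr.le,
        show -((r + t) * x) = -(r * x) + -(t * x) by ring, Real.exp_add]
      have := (Real.rpow_pos_of_pos hrt a).ne'
      have := (Real.rpow_pos_of_pos hr a).ne'
      field_simp
  rw [lintegral_congr this, lintegral_const_mul _ (measurable_gammaPDF _ _),
    lintegral_gammaPDF_eq_one ha hrt, mul_one]

/-- Size-biasing the exponential density produces the Gamma density of shape `2`, of mass `1`. -/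
lemma lintegral_ofReal_gamma_one_ne_top :
    ∫⁻ x, ENNReal.ofReal x ∂gammaMeasure 1 1 ≠ ⊤ := by
  rw [lintegral_gammaMeasure 1 1 (by fun_prop)]
  have : ∀ x, gammaPDF 1 1 x * ENNReal.ofReal x = gammaPDF 2 1 x := by
    intro x
    rcases lt_or_ge x 0 with hx | hx
    · rw [gammaPDF_of_neg hx, gammaPDF_of_neg hx]; simp
    · rw [gammaPDF_of_nonneg hx, gammaPDF_of_nonneg hx, ← ENNReal.ofReal_mul (by positivity)]
      congr 1
      norm_num [Real.Gamma_two]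
      ring
  rw [lintegral_congr this, lintegral_gammaPDF_eq_one (by norm_num) (by norm_num)]
  simp

/-- Tail of the Gamma distribution. -/
def gammaTail (a r : ℝ) (x : ℝ≥0∞) : ℝ≥0∞ := gammaMeasure a r {h | x < ENNReal.ofReal h}

lemma gammaTail_top (a r : ℝ) : gammaTail a r ⊤ = 0 := by simp [gammaTail]

lemma gammaTail_of_ne_top {a r : ℝ} (ha : 0 < a) (hr : 0 < r) {x : ℝ≥0∞} (hx : x ≠ ⊤) :
    gammaTail a r x = ENNReal.ofReal (1 - cdf (gammaMeasure a r) x.toReal) := by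
  have := isProbabilityMeasure_gammaMeasure ha hr
  have h1 : {h : ℝ | x < ENNReal.ofReal h} = (Set.Iic x.toReal)ᶜ := by
    ext h
    simp only [Set.mem_ofPred_eq, Set.mem_compl_iff, Set.mem_Iic, not_le]
    exact ENNReal.lt_ofReal_iff_toReal_lt hx
  rw [gammaTail, h1, prob_compl_eq_one_sub measurableSet_Iic, cdf_eq_real, measureReal_def,
    ENNReal.ofReal_sub _ ENNReal.toReal_nonneg, ENNReal.ofReal_one,
    ENNReal.ofReal_toReal (measure_ne_top _ _)]

/-- Rayleigh fading has an exponential tail. This makes macro coverage a Laplace transform of the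
interference with no approximation. -/
lemma gammaTail_one_one (x : ℝ≥0∞) : gammaTail 1 1 x = expNeg x := by
  rcases eq_or_ne x ⊤ with rfl | hx
  · rw [gammaTail_top, expNeg_top]
  · have := cdf_expMeasure_eq one_pos x.toReal
    rw [expMeasure] at this
    rw [gammaTail_of_ne_top one_pos one_pos hx, this, if_pos ENNReal.toReal_nonneg, expNeg_eq hx]
    simp

lemma measurable_gammaTail (a r : ℝ) : Measurable (gammaTail a r) := by
  have : Antitone (gammaTail a r) := fun x y h => measure_mono fun z hz => h.trans_lt hz
  exact this.measurable

end Gamma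

end

/-! ### The nearest caching station. -/

section

lemma infProd_ite_zero (p : ℕ → Prop) [DecidablePred p] [Decidable (∃ m, p m)] :
    infProd (fun m => if p m then 0 else 1) = if ∃ m, p m then 0 else 1 := by
  by_cases h : ∃ m, p m
  · rw [if_pos h]
    obtain ⟨m, hm⟩ := h
    refine le_antisymm ((iInf_le _ (m + 1)).trans (le_of_eq ?_)) zero_le
    exact Finset.prod_eq_zero (Finset.self_mem_range_succ m) (if_pos hm)
  · rw [if_neg h]
    push Not at h
    simp [h, infProd_one]

variable {Ω : Type*} [MeasurableSpace Ω] {P : Measure Ω} [IsProbabilityMeasure P] {par : Params}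
  {E : Elements Ω} {f : ℕ}

/-- Base station `n` of tier `i` caches the file, no base station of its tier that caches it is
closer, and no base station of the other tier that caches it is within the distance
prescribed by `ρ`. -/
def IsNearest (E : Elements Ω) (f : ℕ) (i : Tier) (ρ : ℝ → ℝ) (n : ℕ) (w : Ω) : Prop :=
  f ∈ E.cache i n w ∧ (∀ m, f ∈ E.cache i m w → ‖E.loc i n w‖ ≤ ‖E.loc i m w‖) ∧
    ∀ m, f ∈ E.cache i.other m w → ρ ‖E.loc i n w‖ < ‖E.loc i.other m w‖

open Classical in
-- No station is strictly nearer than itself, so exempting the index `n` in the first product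
-- changes nothing.
lemma nearest_eq (E : Elements Ω) (f : ℕ) (i : Tier) (ρ : ℝ → ℝ) (n : ℕ) (w : Ω) :
    nearest E f i ρ n w = if IsNearest E f i ρ n w then 1 else 0 := by
  have h1 : infProd (fun m => if m = n then 1 else
      if f ∈ E.cache i m w ∧ ‖E.loc i m w‖ < ‖E.loc i n w‖ then 0 else 1) =
      infProd (fun m => if f ∈ E.cache i m w ∧ ‖E.loc i m w‖ < ‖E.loc i n w‖ then 0 else 1) := by
    congr 1; ext m
    by_cases hm : m = n
    · simp [hm]
    · rw [if_neg hm]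
  rw [nearest, h1, infProd_ite_zero, infProd_ite_zero]
  by_cases ha : f ∈ E.cache i n w
  · by_cases hb : ∃ m, f ∈ E.cache i m w ∧ ‖E.loc i m w‖ < ‖E.loc i n w‖
    · have hno : ¬IsNearest E f i ρ n w := by
        rintro ⟨-, h, -⟩
        obtain ⟨m, hm, hlt⟩ := hb
        exact (h m hm).not_gt hlt
      rw [if_pos hb, if_neg hno]
      simp
    · by_cases hc : ∃ m, f ∈ E.cache i.other m w ∧ ‖E.loc i.other m w‖ ≤ ρ ‖E.loc i n w‖
      · have hno : ¬IsNearest E f i ρ n w := by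
          rintro ⟨-, -, h⟩
          obtain ⟨m, hm, hlt⟩ := hc
          exact (h m hm).not_ge hlt
        rw [if_pos hc, if_neg hno]
        simp
      · push Not at hb hc
        rw [if_pos ha, if_neg (by push Not; exact hb), if_neg (by push Not; exact hc), if_pos ⟨ha, hb, hc⟩]
        simp
  · have hno : ¬IsNearest E f i ρ n w := fun h => ha h.1
    rw [if_neg ha, if_neg hno, zero_mul]

lemma IsNearest.mono {i : Tier} {ρ ρ' : ℝ → ℝ} {n : ℕ} {w : Ω} (h : IsNearest E f i ρ n w)
    (hρ : ∀ r s, ρ r < s → 0 ≤ s → ρ' r < s) : IsNearest E f i ρ' n w :=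
  ⟨h.1, h.2.1, fun m hm => hρ _ _ (h.2.2 m hm) (norm_nonneg _)⟩

lemma IsNetwork.measurable_nearest (hE : IsNetwork par P E) (f : ℕ) (i : Tier) {ρ : ℝ → ℝ}
    (hρ : Measurable ρ) (n : ℕ) : Measurable (nearest E f i ρ n) := by
  have hc : ∀ i m, MeasurableSet {w | f ∈ E.cache i m w} := fun i m =>
    measurableSet_setOfPred.2 (hE.measurable_mem_cache i m f)
  have hn : ∀ i m, Measurable fun w => ‖E.loc i m w‖ := fun i m => ((hE.hppp i).measurable m).norm
  refine Measurable.mul (Measurable.ite (hc i n) measurable_const measurable_const)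
    (Measurable.mul (measurable_infProd fun m => ?_) (measurable_infProd fun m => ?_))
  · by_cases hm : m = n
    · simp [hm]
    · simp only [if_neg hm]
      exact Measurable.ite ((hc i m).inter (measurableSet_lt (hn i m) (hn i n))) measurable_const
        measurable_const
  · exact Measurable.ite ((hc _ m).inter (measurableSet_le (hn _ m) (hρ.comp (hn i n))))
      measurable_const measurable_const

/-- Campbell's formula for the indicator of the origin: the mean number of stations there is the
intensity of a single point, which is zero. -/
lemma IsNetwork.ae_norm_pos (hE : IsNetwork par P E) : ∀ᵐ w ∂P, ∀ i m, 0 < ‖E.loc i m w‖ := by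
  have h : ∀ i m, ∀ᵐ w ∂P, 0 < ‖E.loc i m w‖ := by
    intro i
    have hg : Measurable (Set.indicator {(0 : Plane)} fun _ => (1 : ℝ≥0∞)) :=
      measurable_const.indicator (measurableSet_singleton 0)
    have := (hE.hppp i).campbell (par.lam_pos i).le hg
    rw [lintegral_indicator_const (measurableSet_singleton 0)] at this
    have h0 : intensity (par.lam i) {0} = 0 := by
      rw [intensity, Measure.smul_apply, measure_singleton, smul_zero]
    rw [h0, mul_zero, ENNReal.tsum_eq_zero] at this
    intro m
    have h2 := (lintegral_eq_zero_iff (hg.comp ((hE.hppp i).measurable m))).1 (this m)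
    filter_upwards [h2] with w hw
    rw [norm_pos_iff]
    intro h
    simp [h] at hw
  filter_upwards [ae_all_iff.2 (h .macroBS), ae_all_iff.2 (h .picoBS)] with w h1 h2 i m
  cases i
  · exact h1 m
  · exact h2 m

lemma IsNetwork.ae_finite (hE : IsNetwork par P E) :
    ∀ᵐ w ∂P, ∀ i (k : ℕ), {m | ‖E.loc i m w‖ ≤ k}.Finite := by
  have h : ∀ i (k : ℕ), ∀ᵐ w ∂P, {m | ‖E.loc i m w‖ ≤ k}.Finite := by
    intro i k
    filter_upwards [(hE.hppp i).count_lt_top (par.lam_pos i).le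
      (measurableSet_closedBall (x := (0 : Plane)) (ε := k)) measure_closedBall_lt_top.ne] with w hw
    have := Set.encard_ne_top_iff.1 hw
    simpa using this
  filter_upwards [ae_all_iff.2 (h .macroBS), ae_all_iff.2 (h .picoBS)] with w h1 h2 i m
  cases i
  · exact h1 m
  · exact h2 m

/-! ### Almost sure uniqueness of the nearest caching station. -/

section Unique

lemma IsNetwork.meanOwnFactor_zero (hE : IsNetwork par P E) (f : ℕ) (i : Tier) (r s : ℝ) :
    1 - par.meanOwnFactor f i 0 r s = if s < r then ENNReal.ofReal (par.p i f) else 0 := by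
  classical
  have := hE.isProbabilityMeasure_markLaw f i
  have hp := hE.p_nonneg i f
  have hp1 := hE.p_le_one i f
  have h1 : ∀ y : Mark, par.ownFactor i 0 r s y =
      (fun c : Prop => if c ∧ s < r then (0 : ℝ≥0∞) else 1) y.1 := fun y => by
    by_cases h : y.1 ∧ s < r
    · rw [Params.ownFactor, if_pos h]; simp only [if_pos h]
    · rw [Params.ownFactor, if_neg h]; simp [h, expNeg_zero]
  rw [Params.meanOwnFactor, lintegral_congr h1,
    lintegral_markLaw_of_fst i fun c : Prop => if c ∧ s < r then (0 : ℝ≥0∞) else 1]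
  by_cases h : s < r
  · simp only [h, and_true, if_true, mul_zero, if_false, mul_one, zero_add]
    rw [← ENNReal.ofReal_one, ← ENNReal.ofReal_sub _ (by linarith)]
    congr 1; ring
  · simp only [h, and_false, if_false, mul_one]
    rw [← ENNReal.ofReal_add hp (by linarith)]
    simp

lemma lintegral_poisson_distance {c M : ℝ} (hc : 0 ≤ c) (hM : 0 ≤ M) :
    ∫⁻ r in Set.Ioc 0 M, ENNReal.ofReal (2 * c * r * Real.exp (-(c * r ^ 2))) =
      ENNReal.ofReal (1 - Real.exp (-(c * M ^ 2))) := by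
  have hcont : Continuous fun r : ℝ => 2 * c * r * Real.exp (-(c * r ^ 2)) := by fun_prop
  rw [← ofReal_integral_eq_lintegral_ofReal
    (hcont.integrableOn_Icc.mono_set Set.Ioc_subset_Icc_self), ← intervalIntegral.integral_of_le hM]
  · congr 1
    have hd : ∀ r ∈ Set.uIcc 0 M, HasDerivAt (fun r : ℝ => -Real.exp (-(c * r ^ 2)))
        (2 * c * r * Real.exp (-(c * r ^ 2))) r := fun r _ => by
      have := (((hasDerivAt_pow 2 r).const_mul c).neg.exp).neg
      refine HasDerivAt.congr_deriv (f := fun r : ℝ => -Real.exp (-(c * r ^ 2))) this ?_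
      simp; ring
    rw [intervalIntegral.integral_eq_sub_of_hasDerivAt hd (hcont.intervalIntegrable _ _)]
    simp [sub_eq_neg_add, add_comm]
  · refine (ae_restrict_iff' measurableSet_Ioc).2 (.of_forall fun r hr => ?_)
    have : 0 < r := hr.1
    positivity

open Classical in
-- The network Mecke formula without interference (`κ = 0`) and with radius `-1`, an empty exclusion
-- ball that removes the other tier. What is left is the distance law for the nearest point of a
-- thinned Poisson process.
lemma IsNetwork.tsum_nearest_le (hE : IsNetwork par P E) (f : ℕ) (i : Tier) {M : ℝ} (hM : 0 ≤ M) :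
    ∑' n, ∫⁻ w, (if ‖E.loc i n w‖ ≤ M then 1 else 0) * nearest E f i (fun _ => -1) n w ∂P =
      ENNReal.ofReal (1 - Real.exp (-(Real.pi * par.lam i * par.p i f * M ^ 2))) := by
  have hl := (par.lam_pos i).le
  have hp := hE.p_nonneg i f
  have key := hE.mecke f i (g := fun r => if r ≤ M then 1 else 0) (ρ := fun _ => -1)
    (Measurable.ite measurableSet_Iic measurable_const measurable_const)
    (fun r => by split_ifs <;> simp) measurable_const (κ := 0) le_rfl
  simp only [zero_mul, ENNReal.ofReal_zero, expNeg_zero, mul_one] at key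
  rw [key]
  have hball : Metric.closedBall (0 : Plane) (-1) = ∅ := Metric.closedBall_eq_empty.2 (by norm_num)
  have hE1 : ∀ x : Plane, ∫⁻ y : Plane, 1 - par.meanOwnFactor f i 0 ‖x‖ ‖y‖ ∂intensity (par.lam i) =
      ENNReal.ofReal (Real.pi * par.lam i * par.p i f * ‖x‖ ^ 2) := fun x => by
    simp_rw [hE.meanOwnFactor_zero f i]
    have : ∀ y : Plane, (if ‖y‖ < ‖x‖ then ENNReal.ofReal (par.p i f) else 0) =
        (Metric.ball (0 : Plane) ‖x‖).indicator (fun _ => ENNReal.ofReal (par.p i f)) y := fun y => by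
      simp [Set.indicator]
    rw [lintegral_congr this, lintegral_indicator_const measurableSet_ball,
      intensity_ball hl (norm_nonneg x), ← ENNReal.ofReal_mul hp]
    congr 1; ring
  simp_rw [hE1, hball, measure_empty, mul_zero, expNeg_zero, mul_one]
  have hmeas : Measurable fun r : ℝ => ENNReal.ofReal (par.p i f) * (if r ≤ M then 1 else 0) *
      expNeg (ENNReal.ofReal (Real.pi * par.lam i * par.p i f * r ^ 2)) :=
    ((Measurable.ite measurableSet_Iic measurable_const measurable_const).const_mul _).mul
      (measurable_expNeg.comp (by fun_prop))
  rw [lintegral_fun_norm_intensity hl hmeas,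
    ← lintegral_poisson_distance (c := Real.pi * par.lam i * par.p i f) (by positivity) hM,
    ← lintegral_indicator measurableSet_Ioi, ← lintegral_indicator measurableSet_Ioc]
  refine lintegral_congr fun r => ?_
  by_cases hr : 0 < r
  · rw [Set.indicator_of_mem (Set.mem_Ioi.2 hr), expNeg_ofReal (by positivity)]
    by_cases hrM : r ≤ M
    · rw [Set.indicator_of_mem (Set.mem_Ioc.2 ⟨hr, hrM⟩), if_pos hrM, mul_one,
        ← ENNReal.ofReal_mul hp, ← ENNReal.ofReal_mul (by positivity)]
      congr 1; ring
    · rw [Set.indicator_of_notMem (show r ∉ Set.Ioc 0 M from fun h => hrM h.2), if_neg hrM]; simp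
  · rw [Set.indicator_of_notMem (show r ∉ Set.Ioi 0 from hr),
      Set.indicator_of_notMem (show r ∉ Set.Ioc 0 M from fun h => hr h.1)]

open Classical in
-- Averaging the caching marks reduces this to the void probability of the thinned process. It is
-- exactly complementary to the mean number of nearest caching stations within `M`.
lemma IsNetwork.lintegral_no_hit (hE : IsNetwork par P E) (f : ℕ) (i : Tier) {M : ℝ} (hM : 0 ≤ M) :
    ∫⁻ w, infProd (fun m => if f ∈ E.cache i m w ∧ ‖E.loc i m w‖ ≤ M then 0 else 1) ∂P =
      ENNReal.ofReal (Real.exp (-(Real.pi * par.lam i * par.p i f * M ^ 2))) := by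
  have hpr := hE.isProbabilityMeasure_markLaw f
  have hl := (par.lam_pos i).le
  have hp := hE.p_nonneg i f
  let φ : Tier × ℕ → (Tier → ℕ → Plane) → Mark → ℝ≥0∞ := fun k z y =>
    if k.1 = i then (if y.1 ∧ ‖z i k.2‖ ≤ M then 0 else 1) else 1
  have hφ : ∀ k, Measurable (Function.uncurry (φ k)) := fun k => by
    simp only [φ, Function.uncurry_def]
    split_ifs
    · exact Measurable.ite ((measurableSet_setOfPred.2 (measurable_fst.comp measurable_snd)).inter
        (measurableSet_le ((measurable_pi_apply k.2).comp ((measurable_pi_apply i).comp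
          measurable_fst)).norm measurable_const)) measurable_const measurable_const
    · exact measurable_const
  have key := hE.lintegral_infProd_marks f (B := fun _ => 1) measurable_const (fun _ => le_rfl) hφ
    (fun k z y => by simp only [φ]; split_ifs <;> simp)
  simp only [one_mul, Tier.prod_eq i] at key
  have h1 : ∀ w m, φ (i, m) (locs E w) (mark E f (i, m) w) * φ (i.other, m) (locs E w)
      (mark E f (i.other, m) w) =
      if f ∈ E.cache i m w ∧ ‖E.loc i m w‖ ≤ M then 0 else 1 := fun w m => by
    simp only [φ, if_true, if_neg i.other_ne, mul_one]
    rfl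
  have h2 : ∀ w m, (∫⁻ y, φ (i, m) (locs E w) y ∂markLaw par f i) *
      ∫⁻ y, φ (i.other, m) (locs E w) y ∂markLaw par f i.other =
      if ‖E.loc i m w‖ ≤ M then 1 - ENNReal.ofReal (par.p i f) else 1 := fun w m => by
    simp only [φ, if_true, if_neg i.other_ne]
    have h3 : ∀ y : Mark, (if y.1 ∧ ‖locs E w i m‖ ≤ M then (0 : ℝ≥0∞) else 1) =
        (fun c : Prop => if c ∧ ‖E.loc i m w‖ ≤ M then (0 : ℝ≥0∞) else 1) y.1 := fun y => rfl
    rw [lintegral_congr h3, lintegral_markLaw_of_fst i fun c : Prop =>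
      if c ∧ ‖E.loc i m w‖ ≤ M then (0 : ℝ≥0∞) else 1]
    by_cases hb : ‖E.loc i m w‖ ≤ M
    · simp [hb, ENNReal.ofReal_sub _ hp]
    · simp only [hb, and_false, if_false, mul_one]
      rw [← ENNReal.ofReal_add hp (sub_nonneg.2 (hE.p_le_one _ _))]
      simp
  simp only [h1, h2] at key
  rw [key, hE.lintegral_infProd_other f i, intensity_closedBall hl hM, ← ENNReal.ofReal_mul hp,
    expNeg_ofReal (by positivity)]
  congr 3; ring

open Classical in
/-- Almost surely, the nearest base station of a tier that caches the file is unique. -/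
lemma IsNetwork.ae_unique (hE : IsNetwork par P E) (f : ℕ) (i : Tier) :
    ∀ᵐ w ∂P, ∀ n n', IsNearest E f i (fun _ => -1) n w → IsNearest E f i (fun _ => -1) n' w →
      n = n' := by
  have hn : ∀ m, Measurable fun w => ‖E.loc i m w‖ := fun m => ((hE.hppp i).measurable m).norm
  -- The number of nearest caching stations within `M`, plus the indicator that no caching station
  -- lies within `M`, is at least `1`, since a nonempty finite set of distances has a minimum. Its
  -- mean is exactly `1`, so it equals `1` almost surely, and the number is at most `1`.
  have step : ∀ M : ℕ, ∀ᵐ w ∂P, ∑' n, (if ‖E.loc i n w‖ ≤ M then 1 else 0) *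
      nearest E f i (fun _ => -1) n w ≤ 1 := by
    intro M
    have hM : (0 : ℝ) ≤ M := Nat.cast_nonneg M
    set c := Real.exp (-(Real.pi * par.lam i * par.p i f * (M : ℝ) ^ 2)) with hc
    have hc1 : c ≤ 1 := Real.exp_le_one_iff.2 (by
      have := par.lam_pos i
      have := hE.p_nonneg i f
      have : 0 ≤ Real.pi * par.lam i * par.p i f * (M : ℝ) ^ 2 := by positivity
      linarith)
    have hNm : ∀ n, Measurable fun w => (if ‖E.loc i n w‖ ≤ M then 1 else 0) *
        nearest E f i (fun _ => -1) n w := fun n =>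
      (Measurable.ite (measurableSet_le (hn n) measurable_const) measurable_const
        measurable_const).mul (hE.measurable_nearest f i measurable_const n)
    have hHm : Measurable fun w => infProd (fun m =>
        if f ∈ E.cache i m w ∧ ‖E.loc i m w‖ ≤ M then 0 else 1) :=
      measurable_infProd fun m => Measurable.ite ((measurableSet_setOfPred.2
        (hE.measurable_mem_cache i m f)).inter (measurableSet_le (hn m) measurable_const))
        measurable_const measurable_const
    have hle : ∀ᵐ w ∂P, 1 ≤ (∑' n, (if ‖E.loc i n w‖ ≤ M then 1 else 0) *
        nearest E f i (fun _ => -1) n w) + infProd (fun m =>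
        if f ∈ E.cache i m w ∧ ‖E.loc i m w‖ ≤ M then 0 else 1) := by
      filter_upwards [hE.ae_finite] with w hw
      rw [infProd_ite_zero]
      split_ifs with h
      · have hfin : {m | f ∈ E.cache i m w ∧ ‖E.loc i m w‖ ≤ M}.Finite :=
          (hw i M).subset fun m hm => hm.2
        obtain ⟨n, hn1, hn2⟩ := Set.exists_min_image _ (fun m => ‖E.loc i m w‖) hfin h
        rw [add_zero]
        refine le_trans (le_of_eq ?_) (ENNReal.le_tsum n)
        rw [if_pos hn1.2, nearest_eq, if_pos, one_mul]
        refine ⟨hn1.1, fun m hm => ?_, fun m _ => by linarith [norm_nonneg (E.loc i.other m w)]⟩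
        rcases le_or_gt ‖E.loc i m w‖ M with h' | h'
        · exact hn2 m ⟨hm, h'⟩
        · exact hn1.2.trans h'.le
      · simp
    have hint : ∫⁻ w, (∑' n, (if ‖E.loc i n w‖ ≤ M then 1 else 0) *
        nearest E f i (fun _ => -1) n w) + infProd (fun m =>
        if f ∈ E.cache i m w ∧ ‖E.loc i m w‖ ≤ M then 0 else 1) ∂P = 1 := by
      rw [lintegral_add_right _ hHm, lintegral_tsum fun n => (hNm n).aemeasurable,
        hE.tsum_nearest_le f i hM, hE.lintegral_no_hit f i hM, ← ENNReal.ofReal_add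
        (sub_nonneg.2 hc1) (Real.exp_nonneg _), ← hc, sub_add_cancel, ENNReal.ofReal_one]
    have hae := ae_eq_of_ae_le_of_lintegral_le hle (by simp)
      ((Measurable.tsum hNm).add hHm).aemeasurable (by rw [hint]; simp)
    filter_upwards [hae] with w hw
    exact le_self_add.trans hw.symm.le
  filter_upwards [ae_all_iff.2 step] with w hw n n' h h'
  by_contra hne
  obtain ⟨M, hM⟩ := exists_nat_ge (max ‖E.loc i n w‖ ‖E.loc i n' w‖)
  have h2 := (ENNReal.sum_le_tsum {n, n'}).trans (hw M)
  rw [Finset.sum_pair hne, nearest_eq, nearest_eq, if_pos ((le_max_left _ _).trans hM),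
    if_pos ((le_max_right _ _).trans hM), if_pos h, if_pos h'] at h2
  norm_num at h2

end Unique

end

/-! ### Geometry of the association rule and of the SINR condition. -/

section

namespace Params

variable (par : Params)

/-- Biased received power per unit of path loss. -/
def coeff (i : Tier) : ℝ := par.bias i * par.power i * par.C i * par.N i

lemma coeff_pos (i : Tier) : 0 < par.coeff i := by
  have := par.bias_pos i
  have := par.power_pos i
  have := par.C_pos i
  have : (0 : ℝ) < par.N i := Nat.cast_pos.2 (par.N_pos i)
  unfold coeff
  positivity

/-- Distances at which a base station of tier `i` can serve the user. -/
def InRange : Tier → ℝ → Prop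
  | .macroBS, _ => True
  | .picoBS, r => r ≤ par.RL

/-- Radius of the ball around the user in which there is no base station of the other tier that
caches the file, when the serving base station belongs to tier `i` and is at distance `r`. -/
def exclRadius : Tier → ℝ → ℝ
  | .macroBS, r => min ((par.powerRatio .picoBS .macroBS * r ^ par.alpha .macroBS) ^
      (1 / par.alpha .picoBS)) par.RL
  | .picoBS, r => (par.powerRatio .macroBS .picoBS * r ^ par.alpha .picoBS) ^
      (1 / par.alpha .macroBS)

lemma measurableSet_inRange (i : Tier) : MeasurableSet {r | par.InRange i r} := by
  cases i
  · exact MeasurableSet.univ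
  · exact measurableSet_Iic

lemma measurable_exclRadius (i : Tier) : Measurable (par.exclRadius i) := by
  cases i
  · exact (((measurable_id.pow_const _).const_mul _).pow_const _).min measurable_const
  · exact ((measurable_id.pow_const _).const_mul _).pow_const _

lemma powerRatio_eq (j i : Tier) : par.powerRatio j i = par.coeff j / par.coeff i := rfl

lemma powerRatio_pos (j i : Tier) : 0 < par.powerRatio j i :=
  div_pos (par.coeff_pos j) (par.coeff_pos i)

lemma loss_of_inRange {i : Tier} {r : ℝ} (h : par.InRange i r) :
    par.loss i r = r ^ (-par.alpha i) := by
  cases i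
  · rfl
  · have : (0 : ℝ) ≤ par.RL - r := sub_nonneg.2 h
    simp [loss, unitStep, this]

lemma inRange_of_loss_pos {i : Tier} {r : ℝ} (h : 0 < par.loss i r) : par.InRange i r := by
  cases i
  · trivial
  · by_contra hr
    have : ¬(0 : ℝ) ≤ par.RL - r := fun h => hr (sub_nonneg.1 h)
    simp [loss, unitStep, this] at h

lemma loss_le (i : Tier) {r : ℝ} (hr : 0 ≤ r) : par.loss i r ≤ r ^ (-par.alpha i) := by
  cases i
  · exact le_rfl
  · simp only [loss, unitStep]
    split_ifs
    · rw [one_mul]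
    · rw [zero_mul]; positivity

/-- Within the range the path loss is strictly decreasing, and beyond the LOS radius it drops to
zero. The reference distance must be in range, since two stations out of range tie at zero. -/
lemma loss_le_loss_iff {i : Tier} {r s : ℝ} (hr : 0 < r) (hs : 0 < s) (h : par.InRange i r) :
    par.loss i s ≤ par.loss i r ↔ r ≤ s := by
  have ha := par.alpha_pos i
  rw [par.loss_of_inRange h]
  constructor
  · intro hle
    by_contra! hlt
    have hs' : par.InRange i s := by
      cases i
      · trivial
      · exact hlt.le.trans h
    rw [par.loss_of_inRange hs'] at hle
    exact (Real.rpow_lt_rpow_of_neg hs hlt (neg_lt_zero.2 ha)).not_ge hle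
  · exact fun hrs => (par.loss_le i hs.le).trans
      (Real.rpow_le_rpow_of_nonpos hr hrs (neg_nonpos.2 ha.le))

lemma mul_rpow_neg_lt_iff {a b K K' r s : ℝ} (hb : 0 < b) (hK : 0 < K) (hK' : 0 < K')
    (hr : 0 < r) (hs : 0 < s) :
    K' * s ^ (-b) < K * r ^ (-a) ↔ (K' / K * r ^ a) ^ (1 / b) < s := by
  have h1 := Real.rpow_pos_of_pos hs b
  have h2 := Real.rpow_pos_of_pos hr a
  rw [one_div, Real.rpow_inv_lt_iff_of_pos (by positivity) hs.le hb, Real.rpow_neg hs.le,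
    Real.rpow_neg hr.le, ← div_eq_mul_inv, ← div_eq_mul_inv, div_lt_div_iff₀ h1 h2,
    div_mul_eq_mul_div, div_lt_iff₀ hK, mul_comm K]

/-- Solving the comparison of two power laws for `s` gives the radius. The minimum with `R_L` in the
macro case appears because a pico station outside the LOS ball delivers no power and never competes.
-/
lemma coeff_mul_loss_lt_iff {i : Tier} {r s : ℝ} (hr : 0 < r) (hs : 0 < s) (h : par.InRange i r) :
    par.coeff i.other * par.loss i.other s < par.coeff i * par.loss i r ↔
      par.exclRadius i r < s := by
  rw [par.loss_of_inRange h]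
  cases i
  · simp only [Tier.other, exclRadius, min_lt_iff]
    by_cases hsR : par.InRange .picoBS s
    · rw [par.loss_of_inRange hsR, mul_rpow_neg_lt_iff (par.alpha_pos _) (par.coeff_pos _)
        (par.coeff_pos _) hr hs, or_iff_left (not_lt.2 hsR), powerRatio_eq]
    · have h0 : par.loss .picoBS s = 0 := (par.loss_nonneg _ hs.le).antisymm'
        (not_lt.1 fun h => hsR (par.inRange_of_loss_pos h))
      rw [h0, mul_zero]
      have := Real.rpow_pos_of_pos hr (-par.alpha .macroBS)
      exact iff_of_true (mul_pos (par.coeff_pos _) this) (Or.inr (not_le.1 hsR))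
  · simp only [Tier.other, exclRadius]
    exact mul_rpow_neg_lt_iff (par.alpha_pos _) (par.coeff_pos _) (par.coeff_pos _) hr hs

lemma tendsto_loss (i : Tier) : Tendsto (par.loss i) atTop (𝓝 0) :=
  squeeze_zero' ((eventually_ge_atTop 0).mono fun _ h => par.loss_nonneg i h)
    ((eventually_ge_atTop 0).mono fun _ h => par.loss_le i h)
    (tendsto_rpow_neg_atTop (par.alpha_pos i))

end Params

/-- Terms all below `b` may have supremum `b`. This is excluded when only finitely many of them
reach `b / 2`. -/
lemma iSup_lt_of_finite {ι : Type*} {x : ι → ℝ≥0∞} {b : ℝ≥0∞} (hb : 0 < b) (hb' : b ≠ ⊤)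
    (hfin : {m | b / 2 ≤ x m}.Finite) (h : ∀ m, x m < b) : ⨆ m, x m < b := by
  have h2 : b / 2 < b := ENNReal.half_lt_self hb.ne' hb'
  have : ⨆ m, x m ≤ (hfin.toFinset.sup x) ⊔ (b / 2) := iSup_le fun m => by
    by_cases hm : b / 2 ≤ x m
    · exact le_sup_of_le_left (Finset.le_sup (f := x) (by simpa using hm))
    · exact le_sup_of_le_right (not_le.1 hm).le
  refine this.trans_lt (sup_lt_iff.2 ⟨(Finset.sup_lt_iff ?_).2 fun m _ => h m, h2⟩)
  exact hb

variable {Ω : Type*} [MeasurableSpace Ω] {P : Measure Ω} [IsProbabilityMeasure P] {par : Params}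
  {E : Elements Ω} {f : ℕ}

lemma biasedPower_eq (i : Tier) (n : ℕ) (w : Ω) :
    biasedPower par E i n w = ENNReal.ofReal (par.coeff i * par.loss i ‖E.loc i n w‖) := by
  rw [biasedPower, par.pathLoss_eq, Params.coeff, G0]
  congr 1; ring

/-- Almost surely, the serving base station is characterized by the absence of base stations that
cache the file in two balls. -/
lemma isServing_iff {w : Ω} (hpos : ∀ i m, 0 < ‖E.loc i m w‖)
    (hfin : ∀ i (k : ℕ), {m | ‖E.loc i m w‖ ≤ k}.Finite) (i : Tier) (n : ℕ) :
    IsServing par E f i n w ↔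
      par.InRange i ‖E.loc i n w‖ ∧ IsNearest E f i (par.exclRadius i) n w := by
  have hK := par.coeff_pos
  have own : f ∈ E.cache i n w → par.InRange i ‖E.loc i n w‖ →
      (biasedPower par E i n w = bestPower par E f i w ↔
        ∀ m, f ∈ E.cache i m w → ‖E.loc i n w‖ ≤ ‖E.loc i m w‖) := by
    intro hn hr
    have h1 : bestPower par E f i w ≤ biasedPower par E i n w ↔
        ∀ m, f ∈ E.cache i m w → ‖E.loc i n w‖ ≤ ‖E.loc i m w‖ := by
      rw [bestPower, iSup₂_le_iff]
      refine forall₂_congr fun m _ => ?_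
      rw [biasedPower_eq, biasedPower_eq, ENNReal.ofReal_le_ofReal_iff
        (mul_nonneg (hK i).le (par.loss_nonneg i (norm_nonneg _))),
        mul_le_mul_iff_right₀ (hK i), par.loss_le_loss_iff (hpos i n) (hpos i m) hr]
    rw [← h1]
    exact ⟨fun h => h.ge, fun h => le_antisymm (le_iSup₂_of_le n hn le_rfl) h⟩
  have cross : par.InRange i ‖E.loc i n w‖ →
      (bestPower par E f i.other w < biasedPower par E i n w ↔
        ∀ m, f ∈ E.cache i.other m w → par.exclRadius i ‖E.loc i n w‖ < ‖E.loc i.other m w‖) := by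
    intro hr
    have hB : 0 < par.coeff i * par.loss i ‖E.loc i n w‖ := by
      rw [par.loss_of_inRange hr]
      exact mul_pos (hK i) (Real.rpow_pos_of_pos (hpos i n) _)
    have h1 : ∀ m, biasedPower par E i.other m w < biasedPower par E i n w ↔
        par.exclRadius i ‖E.loc i n w‖ < ‖E.loc i.other m w‖ := fun m => by
      rw [biasedPower_eq, biasedPower_eq, ENNReal.ofReal_lt_ofReal_iff hB,
        par.coeff_mul_loss_lt_iff (hpos i n) (hpos _ m) hr]
    constructor
    · exact fun h m hm => (h1 m).1 ((le_iSup₂_of_le m hm le_rfl).trans_lt h)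
    · intro h
      have hb : 0 < biasedPower par E i n w := by
        rw [biasedPower_eq]; exact ENNReal.ofReal_pos.2 hB
      have hb' : biasedPower par E i n w ≠ ⊤ := by rw [biasedPower_eq]; exact ENNReal.ofReal_ne_top
      refine iSup_lt_of_finite hb hb' ?_ fun m => ?_
      -- Biased powers tend to zero with distance and each disc contains finitely many stations, so
      -- only finitely many powers reach half of the serving one.
      · have ht : Tendsto (fun s => par.coeff i.other * par.loss i.other s) atTop (𝓝 0) := by
          simpa using (par.tendsto_loss i.other).const_mul (par.coeff i.other)
        obtain ⟨k, hk⟩ := eventually_atTop.1 (ht.eventually (gt_mem_nhds (half_pos hB)))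
        obtain ⟨k', hk'⟩ := exists_nat_ge k
        refine (hfin i.other k').subset fun m hm => ?_
        by_contra! hgt
        simp only [Set.mem_ofPred_eq, not_le] at hgt
        have h2 := hk _ (hk'.trans hgt.le)
        have h3 : biasedPower par E i.other m w < biasedPower par E i n w / 2 := by
          have h4 : ∀ x : ℝ, ENNReal.ofReal x / 2 = ENNReal.ofReal (x / 2) := fun x => by
            rw [ENNReal.ofReal_div_of_pos two_pos, ENNReal.ofReal_ofNat]
          rw [biasedPower_eq, biasedPower_eq, h4]
          exact (ENNReal.ofReal_lt_ofReal_iff (half_pos hB)).2 h2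
        exact (iSup_le fun _ => le_rfl : (⨆ _ : f ∈ E.cache i.other m w,
          biasedPower par E i.other m w) ≤ _).trans_lt h3 |>.not_ge hm
      · by_cases hm : f ∈ E.cache i.other m w
        · simpa only [hm, iSup_pos] using (h1 m).2 (h m hm)
        · simp only [hm, iSup_false]; exact hb
  constructor
  · rintro ⟨hn, h2, h3⟩
    have hr : par.InRange i ‖E.loc i n w‖ := by
      refine par.inRange_of_loss_pos ?_
      -- Strictly beating the other tier forces positive power, hence a distance in range.
      have h4 := bot_le.trans_lt h3
      rw [biasedPower_eq] at h4
      exact pos_of_mul_pos_right (ENNReal.ofReal_pos.1 h4) (hK i).le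
    exact ⟨hr, hn, (own hn hr).1 h2, (cross hr).1 h3⟩
  · rintro ⟨hr, hn, h2, h3⟩
    exact ⟨hn, (own hn hr).2 h2, (cross hr).2 h3⟩

/-- The common factor `P C N r ^ (-α)` cancels; bias plays no role. Finite interference matters at
`τ = 0`, where `0 * ⊤ = 0` would make the right side true for positive fading although the SINR is
`0`. -/
lemma lt_sinr_iff {w : Ω} {i : Tier} {n : ℕ} {τ : ℝ} (hτ : 0 ≤ τ) (hpos : 0 < ‖E.loc i n w‖)
    (hr : par.InRange i ‖E.loc i n w‖) (hI : unitInterference par E i n w ≠ ⊤) :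
    ENNReal.ofReal τ < sinr par E 0 i n w ↔
      ENNReal.ofReal (τ * ‖E.loc i n w‖ ^ par.alpha i) * unitInterference par E i n w <
        ENNReal.ofReal (E.fading i n w) := by
  set c : ℝ := par.power i * par.C i * par.N i with hcdef
  have hc : 0 < c := by
    have := par.power_pos i
    have := par.C_pos i
    have : (0 : ℝ) < par.N i := Nat.cast_pos.2 (par.N_pos i)
    positivity
  have hint : interference par E i n w = ENNReal.ofReal c * unitInterference par E i n w := by
    classical
    rw [interference, unitInterference, ← ENNReal.tsum_mul_left]
    have : (fun m => ENNReal.ofReal c * if m = n then 0 else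
        ENNReal.ofReal (par.loss i ‖E.loc i m w‖ * (E.fading i m w * par.gain i (E.angle i m w)))) =
        Set.indicator {m | m ≠ n} fun m => ENNReal.ofReal (par.power i *
          par.pathLoss i ‖E.loc i m w‖ * (par.N i * E.fading i m w *
            par.gain i (E.angle i m w))) := by
      ext m
      by_cases hm : m = n
      · simp [hm]
      · rw [if_neg hm, Set.indicator_of_mem (by exact hm), ← ENNReal.ofReal_mul hc.le,
          par.pathLoss_eq]
        congr 1; rw [hcdef]; ring
    rw [this, ← tsum_subtype]
    rfl
  have hsig : signal par E i n w =
      ENNReal.ofReal (c * ‖E.loc i n w‖ ^ (-par.alpha i)) * ENNReal.ofReal (E.fading i n w) := by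
    rw [signal, par.pathLoss_eq, par.loss_of_inRange hr, G0, ← ENNReal.ofReal_mul (by positivity)]
    congr 1; rw [hcdef]; ring
  have hR := Real.rpow_pos_of_pos hpos (par.alpha i)
  rw [sinr, ENNReal.ofReal_zero, zero_add, ENNReal.lt_div_iff_mul_lt
    (Or.inr ENNReal.ofReal_ne_top) (Or.inl (by
      rw [hint]; exact ENNReal.mul_ne_top ENNReal.ofReal_ne_top hI)), hint, hsig]
  have h0 : ENNReal.ofReal (c * ‖E.loc i n w‖ ^ (-par.alpha i)) ≠ 0 := by
    have := Real.rpow_pos_of_pos hpos (-par.alpha i)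
    exact (ENNReal.ofReal_pos.2 (by positivity)).ne'
  refine Iff.trans ?_ (ENNReal.mul_lt_mul_iff_right h0 ENNReal.ofReal_ne_top)
  congr! 1
  rw [← mul_assoc, ← mul_assoc, ← ENNReal.ofReal_mul hτ,
    ← ENNReal.ofReal_mul (by positivity)]
  congr 2
  rw [Real.rpow_neg hpos.le]
  field_simp

end

/-! ### Finiteness of the interference, and integrating out the serving fading gain. -/

section

variable {Ω : Type*} [MeasurableSpace Ω] {P : Measure Ω} [IsProbabilityMeasure P] {par : Params}
  {E : Elements Ω} {f : ℕ}

lemma tsum_ne_top_of_finite_support {x : ℕ → ℝ≥0∞} (hx : ∀ m, x m ≠ ⊤)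
    (hfin : {m | x m ≠ 0}.Finite) : ∑' m, x m ≠ ⊤ := by
  rw [tsum_eq_sum (s := hfin.toFinset) fun m hm => by simpa using hm]
  exact ENNReal.sum_ne_top.2 fun m _ => hx m

instance (par : Params) : IsProbabilityMeasure
    (cond volume (Set.Icc (-(par.d / par.wavelength)) (par.d / par.wavelength))) := by
  refine cond_isProbabilityMeasure_of_finite ?_ ?_
  · have := par.d_pos
    have := par.wavelength_pos
    rw [Real.volume_Icc, ENNReal.ofReal_ne_zero_iff]
    have : 0 < par.d / par.wavelength := by positivity
    linarith
  · simp

lemma lintegral_markLaw_mul (i : Tier) {φ : Prop → ℝ≥0∞} {ψ : ℝ → ℝ≥0∞} (hψ : Measurable ψ) :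
    ∫⁻ y : Mark, φ y.1 * ψ y.2.1 ∂markLaw par f i =
      (ENNReal.ofReal (par.p i f) * φ True + ENNReal.ofReal (1 - par.p i f) * φ False) *
        ∫⁻ h, ψ h ∂gammaMeasure (par.fadingParam i) (par.fadingParam i) := by
  have h1 : Measurable φ := measurable_of_countable _
  have h2 : ∫⁻ z : ℝ × ℝ, ψ z.1 ∂((gammaMeasure (par.fadingParam i) (par.fadingParam i)).prod
      (cond volume (Set.Icc (-(par.d / par.wavelength)) (par.d / par.wavelength)))) =
      ∫⁻ h, ψ h ∂gammaMeasure (par.fadingParam i) (par.fadingParam i) := by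
    rw [lintegral_prod (fun z : ℝ × ℝ => ψ z.1) (hψ.comp measurable_fst).aemeasurable]
    simp
  rw [markLaw, lintegral_prod_mul (f := φ) (g := fun z : ℝ × ℝ => ψ z.1) h1.aemeasurable
      (hψ.comp measurable_fst).aemeasurable, h2,
    lintegral_bern _ _ _ φ rfl]

lemma lintegral_markLaw_fading (hE : IsNetwork par P E) (i : Tier) {ψ : ℝ → ℝ≥0∞}
    (hψ : Measurable ψ) :
    ∫⁻ y : Mark, ψ y.2.1 ∂markLaw par f i =
      ∫⁻ h, ψ h ∂gammaMeasure (par.fadingParam i) (par.fadingParam i) := by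
  have := lintegral_markLaw_mul (par := par) (f := f) i (φ := fun _ => 1) hψ
  simp only [one_mul, mul_one] at this
  rw [this, ← ENNReal.ofReal_add (hE.p_nonneg i f) (sub_nonneg.2 (hE.p_le_one i f))]
  simp

/-- The far field of the interference of the macro tier is integrable. -/
lemma IsNetwork.lintegral_farField (hE : IsNetwork par P E) :
    ∫⁻ w, ∑' m, Set.indicator (Set.Ioi (1 : ℝ))
      (fun r => ENNReal.ofReal (r ^ (-par.alpha .macroBS))) ‖E.loc .macroBS m w‖ *
        ENNReal.ofReal (E.fading .macroBS m w) ∂P ≠ ⊤ := by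
  set g : ℝ → ℝ≥0∞ := Set.indicator (Set.Ioi (1 : ℝ))
    (fun r => ENNReal.ofReal (r ^ (-par.alpha .macroBS))) with hg
  have hgm : Measurable g :=
    (measurable_id.pow_const _).ennreal_ofReal.indicator measurableSet_Ioi
  have hX := (hE.hppp .macroBS).measurable
  set c := ∫⁻ h, ENNReal.ofReal h ∂gammaMeasure 1 1 with hc
  have h1 : ∀ m, ∫⁻ w, g ‖E.loc .macroBS m w‖ * ENNReal.ofReal (E.fading .macroBS m w) ∂P =
      (∫⁻ w, g ‖E.loc .macroBS m w‖ ∂P) * c := fun m => by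
    have key := hE.lintegral_prod_marks 0 {(.macroBS, m)}
      (B := fun z => g ‖z .macroBS m‖)
      (hgm.comp ((measurable_pi_apply m).comp (measurable_pi_apply _)).norm)
      (φ := fun _ _ y => ENNReal.ofReal y.2.1) (fun k => by fun_prop)
    simp only [Finset.prod_singleton] at key
    have h2 := lintegral_markLaw_fading (f := 0) hE .macroBS (ψ := ENNReal.ofReal) (by fun_prop)
    rw [h2] at key
    simp only [Params.fadingParam, Nat.cast_one] at key
    rw [lintegral_mul_const _ ?_] at key
    · exact key
    · exact (hgm.comp ((measurable_pi_apply m).comp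
        (measurable_pi_apply _)).norm).comp hE.measurable_locs
  have hm : ∀ m, Measurable fun w => g ‖E.loc .macroBS m w‖ *
      ENNReal.ofReal (E.fading .macroBS m w) := fun m =>
    (hgm.comp (hX m).norm).mul (hE.fading_measurable _ m).ennreal_ofReal
  rw [lintegral_tsum fun m => (hm m).aemeasurable]
  simp_rw [h1]
  rw [ENNReal.tsum_mul_right, (hE.hppp .macroBS).campbell (par.lam_pos _).le
    (g := fun x => g ‖x‖) (hgm.comp measurable_norm),
    lintegral_fun_norm_intensity (par.lam_pos _).le hgm]
  refine ENNReal.mul_ne_top ?_ lintegral_ofReal_gamma_one_ne_top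
  -- The mean far field is governed by `r ^ (1 - α₁)` on `(1, ∞)`, integrable because `α₁ > 2`.
  have hint : IntegrableOn (fun r : ℝ => 2 * Real.pi * par.lam .macroBS *
      r ^ (1 - par.alpha .macroBS)) (Set.Ioi 1) :=
    (integrableOn_Ioi_rpow_of_lt (by linarith [par.two_lt_alpha_macro]) one_pos).const_mul _
  refine ne_top_of_le_ne_top hint.lintegral_lt_top.ne ?_
  rw [← lintegral_indicator measurableSet_Ioi, ← lintegral_indicator measurableSet_Ioi]
  refine lintegral_mono fun r => ?_
  by_cases hr : 1 < r
  · have h0 : 0 < r := by linarith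
    rw [Set.indicator_of_mem (Set.mem_Ioi.2 h0), Set.indicator_of_mem (Set.mem_Ioi.2 hr), hg,
      Set.indicator_of_mem (Set.mem_Ioi.2 hr), ← ENNReal.ofReal_mul (by
        have := par.lam_pos .macroBS; positivity)]
    refine le_of_eq ?_
    congr 1
    rw [sub_eq_add_neg, Real.rpow_add h0, Real.rpow_one]
    ring
  · have : g r = 0 := Set.indicator_of_notMem (by simpa using hr) _
    by_cases h0 : 0 < r
    · rw [Set.indicator_of_mem (Set.mem_Ioi.2 h0), this, mul_zero]; exact zero_le
    · rw [Set.indicator_of_notMem (by simpa using h0)]; exact zero_le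

/-- In the macro tier the unit disc holds finitely many stations and the far field has finite mean.
In the pico tier only the finitely many stations of the LOS ball interfere, so the exponent `α₂ = 2`
is harmless. -/
lemma IsNetwork.ae_unitInterference_ne_top (hE : IsNetwork par P E) (i : Tier) :
    ∀ᵐ w ∂P, ∀ n, unitInterference par E i n w ≠ ⊤ := by
  classical
  suffices h : ∀ᵐ w ∂P, ∑' m, ENNReal.ofReal (par.loss i ‖E.loc i m w‖ *
      (E.fading i m w * par.gain i (E.angle i m w))) ≠ ⊤ by
    filter_upwards [h] with w hw n
    refine ne_top_of_le_ne_top hw (ENNReal.tsum_le_tsum fun m => ?_)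
    split_ifs
    exacts [zero_le, le_rfl]
  cases i
  · have hX := (hE.hppp .macroBS).measurable
    filter_upwards [hE.ae_finite, ae_lt_top' (Measurable.aemeasurable <| Measurable.tsum fun m =>
      (((measurable_id.pow_const _).ennreal_ofReal.indicator measurableSet_Ioi).comp
        (hX m).norm).mul (hE.fading_measurable _ m).ennreal_ofReal) hE.lintegral_farField]
      with w hfin hfar
    have h1 : ∑' m, (if ‖E.loc .macroBS m w‖ ≤ (1 : ℕ) then ENNReal.ofReal
        (par.loss .macroBS ‖E.loc .macroBS m w‖ * (E.fading .macroBS m w *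
          par.gain .macroBS (E.angle .macroBS m w))) else 0) ≠ ⊤ := by
      refine tsum_ne_top_of_finite_support (fun m => ?_) ((hfin .macroBS 1).subset fun m hm => ?_)
      · split_ifs <;> simp
      · by_contra hgt
        exact hm (if_neg hgt)
    refine ne_top_of_le_ne_top (ENNReal.add_ne_top.2 ⟨h1, hfar.ne⟩) ?_
    rw [← ENNReal.tsum_add]
    refine ENNReal.tsum_le_tsum fun m => ?_
    by_cases hm : ‖E.loc .macroBS m w‖ ≤ (1 : ℕ)
    · rw [if_pos hm]; exact le_self_add
    · rw [if_neg hm, zero_add]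
      have : ‖E.loc .macroBS m w‖ ∈ Set.Ioi (1 : ℝ) := by simpa using hm
      change _ ≤ Set.indicator (Set.Ioi (1 : ℝ))
        (fun r => ENNReal.ofReal (r ^ (-par.alpha .macroBS))) ‖E.loc .macroBS m w‖ *
          ENNReal.ofReal (E.fading .macroBS m w)
      rw [Set.indicator_of_mem this]
      simp only [Params.loss, Params.gain, mul_one]
      rw [ENNReal.ofReal_mul (by positivity)]
  · filter_upwards [hE.ae_finite] with w hfin
    obtain ⟨k, hk⟩ := exists_nat_ge par.RL
    refine tsum_ne_top_of_finite_support (fun m => ENNReal.ofReal_ne_top)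
      ((hfin .picoBS k).subset fun m hm => ?_)
    by_contra hgt
    simp only [Set.mem_ofPred_eq, not_le] at hgt
    have h0 : ¬(0 : ℝ) ≤ par.RL - ‖E.loc .picoBS m w‖ := by linarith
    exact hm (by simp [Params.loss, unitStep, h0])

/-- Configurations of locations and marks. -/
abbrev Config := (Tier → ℕ → Plane) × (Tier × ℕ → Mark)

open Classical in
/-- `nearest` as a function of the configuration, without the condition on the cache of the base
station itself. -/
def Config.nearest (i : Tier) (ρ : ℝ → ℝ) (n : ℕ) (c : Config) : ℝ≥0∞ :=
  infProd (fun m => if m = n then 1 else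
    if (c.2 (i, m)).1 ∧ ‖c.1 i m‖ < ‖c.1 i n‖ then 0 else 1) *
  infProd (fun m => if (c.2 (i.other, m)).1 ∧ ‖c.1 i.other m‖ ≤ ρ ‖c.1 i n‖ then 0 else 1)

/-- `unitInterference` as a function of the configuration. -/
def Config.interference (par : Params) (i : Tier) (n : ℕ) (c : Config) : ℝ≥0∞ :=
  ∑' m, if m = n then 0 else
    ENNReal.ofReal (par.loss i ‖c.1 i m‖ * ((c.2 (i, m)).2.1 * par.gain i (c.2 (i, m)).2.2))

lemma Config.measurable_norm (t : Tier) (m : ℕ) : Measurable fun c : Config => ‖c.1 t m‖ :=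
  ((measurable_pi_apply m).comp ((measurable_pi_apply t).comp measurable_fst)).norm

lemma Config.measurable_mark (k : Tier × ℕ) : Measurable fun c : Config => c.2 k :=
  (measurable_pi_apply k).comp measurable_snd

lemma Config.measurableSet_mark (k : Tier × ℕ) : MeasurableSet {c : Config | (c.2 k).1} :=
  measurableSet_setOfPred.2 (measurable_fst.comp (Config.measurable_mark k))

lemma Config.measurable_nearest (i : Tier) {ρ : ℝ → ℝ} (hρ : Measurable ρ) (n : ℕ) :
    Measurable (Config.nearest i ρ n) := by
  refine (measurable_infProd fun m => ?_).mul (measurable_infProd fun m => ?_)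
  · by_cases hm : m = n
    · simp [hm]
    · simp only [if_neg hm]
      exact Measurable.ite ((measurableSet_mark _).inter
        (measurableSet_lt (Config.measurable_norm i m) (Config.measurable_norm i n)))
        measurable_const measurable_const
  · exact Measurable.ite ((measurableSet_mark _).inter (measurableSet_le
      (Config.measurable_norm _ m) (hρ.comp (Config.measurable_norm i n))))
      measurable_const measurable_const

lemma Config.measurable_interference (par : Params) (i : Tier) (n : ℕ) :
    Measurable (Config.interference par i n) := by
  refine Measurable.tsum fun m => ?_
  by_cases hm : m = n
  · simp [hm]
  · simp only [if_neg hm]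
    exact (((par.measurable_loss i).comp (Config.measurable_norm i m)).mul
      ((measurable_fst.comp (measurable_snd.comp (measurable_mark (i, m)))).mul
      ((par.measurable_gain i).comp (measurable_snd.comp (measurable_snd.comp
        (measurable_mark (i, m))))))).ennreal_ofReal

/-- The configuration with a fixed mark for one base station. -/
def maskedConfig (E : Elements Ω) (f : ℕ) (k : Tier × ℕ) (w : Ω) : Config :=
  (locs E w, Function.update (fun j => mark E f j w) k (True, 0, 0))

lemma maskedConfig_mark (E : Elements Ω) (f : ℕ) {j k : Tier × ℕ} (h : j ≠ k) (w : Ω) :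
    (maskedConfig E f k w).2 j = mark E f j w := by
  simp [maskedConfig, Function.update_of_ne h]

/-- The interference omits station `n`, so overwriting its mark has no effect. -/
lemma interference_maskedConfig (E : Elements Ω) (f : ℕ) (i : Tier) (n : ℕ) (w : Ω) :
    Config.interference par i n (maskedConfig E f (i, n) w) = unitInterference par E i n w := by
  refine tsum_congr fun m => ?_
  by_cases hm : m = n
  · simp [hm]
  · rw [if_neg hm, if_neg hm, maskedConfig_mark E f (by simpa using hm)]; rfl

open Classical in
lemma nearest_maskedConfig (E : Elements Ω) (f : ℕ) (i : Tier) (ρ : ℝ → ℝ) (n : ℕ) (w : Ω) :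
    nearest E f i ρ n w = (if (mark E f (i, n) w).1 then 1 else 0) *
      Config.nearest i ρ n (maskedConfig E f (i, n) w) := by
  have e1 : (fun m => if m = n then (1 : ℝ≥0∞) else
      if ((maskedConfig E f (i, n) w).2 (i, m)).1 ∧
        ‖locs E w i m‖ < ‖locs E w i n‖ then 0 else 1) = fun m => if m = n then (1 : ℝ≥0∞) else
      if (mark E f (i, m) w).1 ∧ ‖locs E w i m‖ < ‖locs E w i n‖ then 0 else 1 := by
    ext m
    by_cases hm : m = n
    · simp [hm]
    · rw [if_neg hm, if_neg hm, maskedConfig_mark E f (by simpa using hm)]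
  have e2 : (fun m =>
      if ((maskedConfig E f (i, n) w).2 (i.other, m)).1 ∧
        ‖locs E w i.other m‖ ≤ ρ ‖locs E w i n‖ then (0 : ℝ≥0∞) else 1) = fun m =>
      if (mark E f (i.other, m) w).1 ∧ ‖locs E w i.other m‖ ≤ ρ ‖locs E w i n‖
        then 0 else 1 := by
    ext m
    rw [maskedConfig_mark E f (by simp [i.other_ne])]
  have e3 : Config.nearest i ρ n (maskedConfig E f (i, n) w) = _ * _ :=
    congrArg₂ (fun a b => infProd a * infProd b) e1 e2
  rw [e3]
  rfl

open Classical in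
-- The masked configuration is independent of the mark of `k`; caching averages to the caching
-- probability and, independently, fading to its Gamma law.
lemma IsNetwork.lintegral_masked (hE : IsNetwork par P E) (f : ℕ) (k : Tier × ℕ)
    {B x : Config → ℝ≥0∞} (hB : Measurable B) (hx : Measurable x) {Θ : ℝ≥0∞ × ℝ → ℝ≥0∞}
    (hΘ : Measurable Θ) :
    ∫⁻ w, (if (mark E f k w).1 then 1 else 0) * (B (maskedConfig E f k w) *
        Θ (x (maskedConfig E f k w), (mark E f k w).2.1)) ∂P =
      ∫⁻ w, ENNReal.ofReal (par.p k.1 f) * (B (maskedConfig E f k w) *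
        ∫⁻ h, Θ (x (maskedConfig E f k w), h)
          ∂gammaMeasure (par.fadingParam k.1) (par.fadingParam k.1)) ∂P := by
  have hF : Measurable (Function.uncurry fun (c : Config) (y : Mark) =>
      (if y.1 then (1 : ℝ≥0∞) else 0) * (B c * Θ (x c, y.2.1))) :=
    (Measurable.ite (measurableSet_setOfPred.2 (measurable_fst.comp measurable_snd))
      measurable_const measurable_const).mul ((hB.comp measurable_fst).mul
        (hΘ.comp ((hx.comp measurable_fst).prodMk
          (measurable_fst.comp (measurable_snd.comp measurable_snd)))))
  refine (hE.lintegral_mark f k (True, 0, 0) hF).trans (lintegral_congr fun w => ?_)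
  have h3 : Measurable fun h => Θ (x (maskedConfig E f k w), h) :=
    hΘ.comp (measurable_const.prodMk measurable_id)
  have h2 := lintegral_markLaw_mul (par := par) (f := f) k.1
    (φ := fun c : Prop => if c then (1 : ℝ≥0∞) else 0)
    (ψ := fun h => B (maskedConfig E f k w) * Θ (x (maskedConfig E f k w), h)) (h3.const_mul _)
  rw [lintegral_const_mul _ h3] at h2
  simp only [if_true, if_false, mul_one, mul_zero, add_zero] at h2
  exact h2

open Classical in
/-- The fading gain of the serving base station is independent of everything else. -/
lemma IsNetwork.lintegral_fading (hE : IsNetwork par P E) (f : ℕ) (i : Tier) (n : ℕ) {g : ℝ → ℝ≥0∞}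
    {ρ : ℝ → ℝ} (hg : Measurable g) (hρ : Measurable ρ) (τ : ℝ) {Θ : ℝ≥0∞ × ℝ → ℝ≥0∞}
    (hΘ : Measurable Θ) :
    ∫⁻ w, g ‖E.loc i n w‖ * (nearest E f i ρ n w * Θ
        (ENNReal.ofReal (τ * ‖E.loc i n w‖ ^ par.alpha i) * unitInterference par E i n w,
          E.fading i n w)) ∂P =
      ∫⁻ w, g ‖E.loc i n w‖ * (nearest E f i ρ n w * ∫⁻ h, Θ
        (ENNReal.ofReal (τ * ‖E.loc i n w‖ ^ par.alpha i) * unitInterference par E i n w, h)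
          ∂gammaMeasure (par.fadingParam i) (par.fadingParam i)) ∂P := by
  have hz := Config.measurable_norm i n
  have hx : Measurable fun c : Config =>
      ENNReal.ofReal (τ * ‖c.1 i n‖ ^ par.alpha i) * Config.interference par i n c :=
    ((hz.pow_const _).const_mul τ).ennreal_ofReal.mul (Config.measurable_interference par i n)
  have hB : Measurable fun c : Config => g ‖c.1 i n‖ * Config.nearest i ρ n c :=
    (hg.comp hz).mul (Config.measurable_nearest i hρ n)
  have key : ∀ Θ : ℝ≥0∞ × ℝ → ℝ≥0∞, ∀ w, g ‖E.loc i n w‖ * (nearest E f i ρ n w * Θ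
        (ENNReal.ofReal (τ * ‖E.loc i n w‖ ^ par.alpha i) * unitInterference par E i n w,
          E.fading i n w)) =
      (if (mark E f (i, n) w).1 then 1 else 0) *
        ((fun c : Config => g ‖c.1 i n‖ * Config.nearest i ρ n c) (maskedConfig E f (i, n) w) *
        Θ ((fun c : Config => ENNReal.ofReal (τ * ‖c.1 i n‖ ^ par.alpha i) *
          Config.interference par i n c) (maskedConfig E f (i, n) w), (mark E f (i, n) w).2.1)) := by
    intro Θ w
    have assoc : ∀ a b c d : ℝ≥0∞, a * (b * c * d) = b * (a * c * d) := fun a b c d => by ring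
    beta_reduce
    rw [interference_maskedConfig, nearest_maskedConfig]
    exact assoc _ _ _ _
  have hΘ' : Measurable fun q : ℝ≥0∞ × ℝ => ∫⁻ h, Θ (q.1, h)
      ∂gammaMeasure (par.fadingParam i) (par.fadingParam i) := by
    have : Measurable fun a : ℝ≥0∞ => ∫⁻ h, Θ (a, h)
      ∂gammaMeasure (par.fadingParam i) (par.fadingParam i) := hΘ.lintegral_prod_right'
    exact this.comp measurable_fst
  -- The same reduction is applied to `Θ` and to its average over the fading, which is constant in
  -- its second argument; the results coincide.
  rw [lintegral_congr (key Θ), hE.lintegral_masked f (i, n) hB hx hΘ,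
    lintegral_congr (key fun q => ∫⁻ h, Θ (q.1, h)
      ∂gammaMeasure (par.fadingParam i) (par.fadingParam i)),
    hE.lintegral_masked f (i, n) hB hx hΘ']
  simp

lemma IsNetwork.measurable_unitInterference (hE : IsNetwork par P E) (i : Tier) (n : ℕ) :
    Measurable (unitInterference par E i n) := by
  refine Measurable.tsum fun m => ?_
  by_cases hm : m = n
  · simp [hm]
  · simp only [if_neg hm]
    exact (((par.measurable_loss i).comp ((hE.hppp i).measurable m).norm).mul
      ((hE.fading_measurable i m).mul ((par.measurable_gain i).comp
        (hE.angle_measurable i m)))).ennreal_ofReal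

end

/-! ### The coverage probability as a series over base stations. -/

section

variable {Ω : Type*} [MeasurableSpace Ω] {P : Measure Ω} [IsProbabilityMeasure P] {par : Params}
  {E : Elements Ω} {f : ℕ}

open Classical in
/-- Indicator of the distances at which a base station of tier `i` can serve the user. -/
def Params.rangeInd (par : Params) (i : Tier) (r : ℝ) : ℝ≥0∞ := if par.InRange i r then 1 else 0

lemma Params.measurable_rangeInd (par : Params) (i : Tier) : Measurable (par.rangeInd i) :=
  Measurable.ite (par.measurableSet_inRange i) measurable_const measurable_const

lemma Params.rangeInd_le_one (par : Params) (i : Tier) (r : ℝ) : par.rangeInd i r ≤ 1 := by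
  unfold Params.rangeInd
  split_ifs <;> simp

open Classical in
-- By almost sure uniqueness the events for different `n` are disjoint up to null sets, so the
-- probability of the union is the sum.
lemma IsNetwork.measure_iUnion_serving (hE : IsNetwork par P E) (f : ℕ) (i : Tier)
    {D : ℕ → Set Ω} (hD : ∀ n, MeasurableSet (D n)) :
    P (⋃ n, {w | (par.InRange i ‖E.loc i n w‖ ∧ IsNearest E f i (par.exclRadius i) n w) ∧ w ∈ D n}) =
      ∑' n, ∫⁻ w, par.rangeInd i ‖E.loc i n w‖ * (nearest E f i (par.exclRadius i) n w *
        if w ∈ D n then 1 else 0) ∂P := by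
  have hn : ∀ m, Measurable fun w => ‖E.loc i m w‖ := fun m => ((hE.hppp i).measurable m).norm
  have hN : ∀ n, MeasurableSet {w | IsNearest E f i (par.exclRadius i) n w} := fun n => by
    have h := hE.measurable_nearest f i (par.measurable_exclRadius i) n (measurableSet_singleton 1)
    convert h using 1
    ext w
    by_cases hw : IsNearest E f i (par.exclRadius i) n w <;> simp [nearest_eq, hw]
  have hS : ∀ n, MeasurableSet {w | (par.InRange i ‖E.loc i n w‖ ∧
      IsNearest E f i (par.exclRadius i) n w) ∧ w ∈ D n} := fun n =>
    ((hn n (par.measurableSet_inRange i)).inter (hN n)).inter (hD n)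
  rw [measure_iUnion₀ ?_ fun n => (hS n).nullMeasurableSet]
  · refine tsum_congr fun n => ?_
    rw [← lintegral_indicator_one (hS n)]
    refine lintegral_congr fun w => ?_
    rw [Set.indicator_apply, nearest_eq, Params.rangeInd]
    simp only [Set.mem_ofPred_eq]
    by_cases h1 : par.InRange i ‖E.loc i n w‖ <;>
      by_cases h2 : IsNearest E f i (par.exclRadius i) n w <;>
      by_cases h3 : w ∈ D n <;> simp [h1, h2, h3]
  · intro n m hnm
    refine measure_mono_null (fun w hw => ?_) (hE.ae_unique f i)
    intro hu
    -- Any exclusion radius may be weakened to `-1`, a condition that norms always satisfy, which is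
    -- the form of the uniqueness result.
    have hρ : ∀ r s, par.exclRadius i r < s → 0 ≤ s → (-1 : ℝ) < s := fun _ _ _ h => by linarith
    exact hnm (hu n m (hw.1.1.2.mono hρ) (hw.2.1.2.mono hρ))

/-- The coverage probability, with the fading gain of the serving base station integrated out. -/
lemma IsNetwork.coverageProb_eq (hE : IsNetwork par P E) (f : ℕ) (i : Tier) {τ : ℝ} (hτ : 0 ≤ τ) :
    ENNReal.ofReal (coverageProb par E P f i τ) =
      ∑' n, ∫⁻ w, par.rangeInd i ‖E.loc i n w‖ * (nearest E f i (par.exclRadius i) n w *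
        gammaTail (par.fadingParam i) (par.fadingParam i)
          (ENNReal.ofReal (τ * ‖E.loc i n w‖ ^ par.alpha i) * unitInterference par E i n w)) ∂P := by
  classical
  have hn : ∀ m, Measurable fun w => ‖E.loc i m w‖ := fun m => ((hE.hppp i).measurable m).norm
  let D : ℕ → Set Ω := fun n => {w | ENNReal.ofReal (τ * ‖E.loc i n w‖ ^ par.alpha i) *
    unitInterference par E i n w < ENNReal.ofReal (E.fading i n w)}
  have hD : ∀ n, MeasurableSet (D n) := fun n => measurableSet_lt
    ((((hn n).pow_const _).const_mul τ).ennreal_ofReal.mul (hE.measurable_unitInterference i n))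
    (hE.fading_measurable i n).ennreal_ofReal
  have h1 : P {w | ∃ n, IsServing par E f i n w ∧ ENNReal.ofReal τ < sinr par E 0 i n w} =
      P (⋃ n, {w | (par.InRange i ‖E.loc i n w‖ ∧ IsNearest E f i (par.exclRadius i) n w) ∧
        w ∈ D n}) := by
    refine measure_congr ?_
    filter_upwards [hE.ae_norm_pos, hE.ae_finite, hE.ae_unitInterference_ne_top i] with w h1 h2 h3
    refine propext ?_
    change (∃ n, _) ↔ w ∈ ⋃ n, _
    rw [Set.mem_iUnion]
    refine exists_congr fun n => ?_
    rw [isServing_iff h1 h2]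
    exact and_congr_right fun h => lt_sinr_iff hτ (h1 i n) h.1 (h3 n)
  rw [coverageProb, ofReal_measureReal, h1, hE.measure_iUnion_serving f i hD]
  refine tsum_congr fun n => ?_
  have hΘ : Measurable fun q : ℝ≥0∞ × ℝ => if q.1 < ENNReal.ofReal q.2 then (1 : ℝ≥0∞) else 0 :=
    Measurable.ite (measurableSet_lt measurable_fst measurable_snd.ennreal_ofReal)
      measurable_const measurable_const
  have h2 := hE.lintegral_fading f i n (par.measurable_rangeInd i) (par.measurable_exclRadius i) τ hΘ
  refine (Eq.trans (lintegral_congr fun w => ?_) h2).trans (lintegral_congr fun w => ?_)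
  · congr!
  · congr 2
    rw [gammaTail, ← lintegral_indicator_one (measurableSet_lt measurable_const
      ENNReal.measurable_ofReal)]
    refine lintegral_congr fun h => ?_
    rw [Set.indicator_apply]
    rfl

/-- The total weight of the serving base stations is at most the association probability. -/
lemma IsNetwork.tsum_weight_le (hE : IsNetwork par P E) (f : ℕ) (i : Tier) :
    ∑' n, ∫⁻ w, par.rangeInd i ‖E.loc i n w‖ * nearest E f i (par.exclRadius i) n w ∂P ≤
      ENNReal.ofReal (assocProb par E P f i) := by
  classical
  have h := hE.measure_iUnion_serving f i (D := fun _ => Set.univ) fun _ => MeasurableSet.univ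
  simp only [Set.mem_univ, and_true, if_true, mul_one] at h
  rw [← h, assocProb, ofReal_measureReal]
  refine measure_mono_ae ?_
  filter_upwards [hE.ae_norm_pos, hE.ae_finite] with w h1 h2 hw
  obtain ⟨n, hn⟩ := Set.mem_iUnion.1 hw
  have hs := (isServing_iff h1 h2 i n).2 hn
  exact hs.2.2.trans_eq hs.2.1

end

/-! ### Power series and the differential equations of the hypergeometric functions. -/

section

section PowerSeries

/-- The sum of a real power series. -/
def psum (c : ℕ → ℝ) (y : ℝ) : ℝ := ∑' n, c n * y ^ n

/-- The power series with coefficients `c` converges absolutely in the open unit disc. -/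
def ConvergesOnDisc (c : ℕ → ℝ) : Prop := ∀ r : ℝ, 0 ≤ r → r < 1 → Summable fun n => |c n| * r ^ n

variable {c : ℕ → ℝ}

lemma ConvergesOnDisc.summable (hc : ConvergesOnDisc c) {y : ℝ} (hy : |y| < 1) :
    Summable fun n => c n * y ^ n := by
  refine .of_norm ?_
  simpa [abs_mul, abs_pow] using hc |y| (abs_nonneg y) hy

/-- For `r < s < 1` the factor `n (r / s) ^ n` is bounded, so convergence at `s` absorbs the extra
`n`. -/
lemma ConvergesOnDisc.nat_mul (hc : ConvergesOnDisc c) : ConvergesOnDisc fun n => n * c n := by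
  intro r hr hr1
  obtain ⟨s, hs, hs1⟩ := exists_between hr1
  have hs0 : 0 < s := hr.trans_lt hs
  refine summable_of_isBigO_nat (hc s hs0.le hs1) ?_
  have h1 : Tendsto (fun n : ℕ => (n : ℝ) * (r / s) ^ n) atTop (𝓝 0) :=
    tendsto_self_mul_const_pow_of_lt_one (by positivity) ((div_lt_one hs0).2 hs)
  have h2 : (fun n : ℕ => |(n : ℝ) * c n| * r ^ n) =
      fun n : ℕ => ((n : ℝ) * (r / s) ^ n) * (|c n| * s ^ n) := by
    ext n
    have : s ^ n ≠ 0 := by positivity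
    rw [abs_mul, Nat.abs_cast, div_pow]
    field_simp
  rw [h2]
  simpa using (h1.isBigO_one ℝ).mul (Asymptotics.isBigO_refl (fun n => |c n| * s ^ n) atTop)

lemma ConvergesOnDisc.succ (hc : ConvergesOnDisc c) : ConvergesOnDisc fun n => c (n + 1) := by
  intro r hr hr1
  rcases hr.eq_or_lt with rfl | hr0
  · exact summable_of_hasFiniteSupport ((Set.finite_singleton 0).subset fun n hn => by
      by_contra h
      exact hn (by simp [zero_pow h]))
  · have h := ((summable_nat_add_iff 1).2 (hc r hr hr1)).mul_right r⁻¹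
    refine h.congr fun n => ?_
    rw [pow_succ]
    field_simp

lemma ConvergesOnDisc.add {c' : ℕ → ℝ} (hc : ConvergesOnDisc c) (hc' : ConvergesOnDisc c') :
    ConvergesOnDisc fun n => c n + c' n := by
  intro r hr hr1
  refine Summable.of_nonneg_of_le (fun n => by positivity) (fun n => ?_)
    ((hc r hr hr1).add (hc' r hr hr1))
  rw [← add_mul]
  exact mul_le_mul_of_nonneg_right (abs_add_le _ _) (by positivity)

lemma ConvergesOnDisc.const_mul (hc : ConvergesOnDisc c) (k : ℝ) :
    ConvergesOnDisc fun n => k * c n := by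
  intro r hr hr1
  refine ((hc r hr hr1).mul_left |k|).congr fun n => ?_
  rw [abs_mul, mul_assoc]

lemma psum_zero (c : ℕ → ℝ) : psum c 0 = c 0 := by
  rw [psum, tsum_eq_single 0 fun n hn => by simp [zero_pow hn]]
  simp

lemma psum_add {c' : ℕ → ℝ} (hc : ConvergesOnDisc c) (hc' : ConvergesOnDisc c') {y : ℝ}
    (hy : |y| < 1) : psum (fun n => c n + c' n) y = psum c y + psum c' y := by
  rw [psum, psum, psum, ← (hc.summable hy).tsum_add (hc'.summable hy)]
  exact tsum_congr fun n => by ring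

lemma psum_const_mul (c : ℕ → ℝ) (k y : ℝ) : psum (fun n => k * c n) y = k * psum c y := by
  rw [psum, psum, ← tsum_mul_left]
  exact tsum_congr fun n => by ring

lemma psum_eq_add (hc : ConvergesOnDisc c) {y : ℝ} (hy : |y| < 1) :
    psum c y = c 0 + y * psum (fun n => c (n + 1)) y := by
  rw [psum, (hc.summable hy).tsum_eq_zero_add, psum, ← tsum_mul_left]
  simp only [pow_zero, mul_one]
  congr 1
  exact tsum_congr fun n => by ring

lemma hasDerivAt_psum (hc : ConvergesOnDisc c) {y : ℝ} (hy : |y| < 1) :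
    HasDerivAt (psum c) (psum (fun n => (n + 1 : ℕ) * c (n + 1)) y) y := by
  obtain ⟨r, hr, hr1⟩ := exists_between hy
  have hr0 : 0 ≤ r := (abs_nonneg y).trans hr.le
  have hu : Summable fun n : ℕ => |n * c n| * r ^ (n - 1) := by
    rw [← summable_nat_add_iff 1]
    exact hc.nat_mul.succ r hr0 hr1
  have hball : ∀ {z : ℝ}, z ∈ Metric.ball (0 : ℝ) r → |z| < r := fun h => by simpa using h
  have key := hasDerivAt_tsum_of_isPreconnected (g := fun n z => c n * z ^ n)
    (g' := fun n z => c n * (n * z ^ (n - 1))) (y₀ := 0) (y := y) (t := Metric.ball 0 r)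
    hu Metric.isOpen_ball (convex_ball (0 : ℝ) r).isPreconnected
    (fun n z _ => (hasDerivAt_pow n z).const_mul (c n)) (fun n z hz => ?_)
    (by simpa using (abs_nonneg y).trans_lt hr) (hc.summable (by simp)) (by simpa using hr)
  · refine key.congr_deriv ?_
    rw [psum]
    have hs : Summable fun n : ℕ => c n * (n * y ^ (n - 1)) := by
      rw [← summable_nat_add_iff 1]
      refine (hc.nat_mul.succ.summable hy).congr fun n => ?_
      simp only [Nat.add_sub_cancel]; ring
    rw [hs.tsum_eq_zero_add]
    simp only [Nat.cast_zero, zero_mul, mul_zero, zero_add, Nat.add_sub_cancel]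
    exact tsum_congr fun n => by ring
  · rw [Real.norm_eq_abs, show c n * (n * z ^ (n - 1)) = n * c n * z ^ (n - 1) by ring, abs_mul,
      abs_pow]
    exact mul_le_mul_of_nonneg_left (pow_le_pow_left₀ (abs_nonneg z) (hball hz).le _)
      (abs_nonneg _)

/-- The Euler operator on a power series. -/
lemma mul_deriv_psum (hc : ConvergesOnDisc c) {y : ℝ} (hy : |y| < 1) :
    y * psum (fun n => (n + 1 : ℕ) * c (n + 1)) y = psum (fun n => n * c n) y := by
  rw [psum_eq_add hc.nat_mul hy]
  simp

end PowerSeries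

section Hypergeometric

/-- The hypotheses exclude nonpositive integer parameters, for which the coefficients terminate or
degenerate; otherwise the radius of convergence is `1`. -/
lemma convergesOnDisc_hypergeometric {a b c : ℝ} (h : ∀ k : ℕ, (k : ℝ) ≠ -a ∧ (k : ℝ) ≠ -b ∧
    (k : ℝ) ≠ -c) : ConvergesOnDisc (ordinaryHypergeometricCoefficient a b c) := by
  intro r hr hr1
  lift r to NNReal using hr
  have h1 := (ordinaryHypergeometricSeries ℝ a b c).summable_norm_mul_pow (r := r) (by
    rw [ordinaryHypergeometricSeries_radius_eq_one ℝ a b c h]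
    exact_mod_cast hr1)
  refine h1.congr fun n => ?_
  rw [ordinaryHypergeometricSeries, FormalMultilinearSeries.ofScalars_norm, Real.norm_eq_abs]

lemma ordinaryHypergeometric_eq_psum (a b c y : ℝ) :
    ordinaryHypergeometric a b c y = psum (ordinaryHypergeometricCoefficient a b c) y := by
  rw [ordinaryHypergeometric_eq_tsum]
  rfl

lemma hypergeometricCoefficient_zero (a b c : ℝ) :
    ordinaryHypergeometricCoefficient a b c 0 = 1 := by
  simp [ordinaryHypergeometricCoefficient]

/-- The recursion of the hypergeometric coefficients. -/
lemma hypergeometricCoefficient_succ (a b : ℝ) {c : ℝ} (hc : ∀ k : ℕ, (k : ℝ) ≠ -c) (n : ℕ) :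
    (n + 1) * (c + n) * ordinaryHypergeometricCoefficient a b c (n + 1) =
      (a + n) * (b + n) * ordinaryHypergeometricCoefficient a b c n := by
  simp only [ordinaryHypergeometricCoefficient, ascPochhammer_succ_eval, Nat.factorial_succ]
  have h1 : c + n ≠ 0 := fun h => hc n (by linarith)
  have h2 : (n.factorial : ℝ) ≠ 0 := by positivity
  have h3 : (n : ℝ) + 1 ≠ 0 := by positivity
  push_cast
  rw [mul_inv, mul_inv]
  field_simp

/-- The binomial series. -/
lemma psum_binomial {b : ℝ} (hb : 0 < b) {y : ℝ} (hy : |y| < 1) :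
    psum (ordinaryHypergeometricCoefficient 1 b 1) y = (1 - y) ^ (-b) := by
  have hk : ∀ k : ℕ, (k : ℝ) ≠ -1 ∧ (k : ℝ) ≠ -b ∧ (k : ℝ) ≠ -1 := fun k => by
    have : (0 : ℝ) ≤ k := k.cast_nonneg
    exact ⟨by linarith, by linarith, by linarith⟩
  set c := ordinaryHypergeometricCoefficient (1 : ℝ) b 1 with hcdef
  have hc : ConvergesOnDisc c := convergesOnDisc_hypergeometric hk
  have hrec : ∀ n : ℕ, ((n + 1 : ℕ) : ℝ) * c (n + 1) = n * c n + b * c n := fun n => by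
    have := hypergeometricCoefficient_succ 1 b (fun k => (hk k).2.2) n
    have h3 : (n : ℝ) + 1 ≠ 0 := by positivity
    have h4 : (1 + (n : ℝ)) * (((n : ℝ) + 1) * c (n + 1) - (n * c n + b * c n)) = 0 := by
      linear_combination this
    rcases mul_eq_zero.1 h4 with h | h
    · exact absurd h (by rwa [add_comm])
    · push_cast; linarith
  -- The recursion says `(1 - y) F' = b F`, so `(1 - y) ^ b F` is constant on the disc.
  have hode : ∀ y : ℝ, |y| < 1 →
      (1 - y) * psum (fun n => (n + 1 : ℕ) * c (n + 1)) y = b * psum c y := fun y hy => by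
    rw [sub_mul, one_mul, mul_deriv_psum hc hy]
    simp_rw [hrec]
    rw [psum_add hc.nat_mul (hc.const_mul b) hy, psum_const_mul]
    ring
  have hder : ∀ y ∈ Metric.ball (0 : ℝ) 1,
      HasDerivAt (fun y => (1 - y) ^ b * psum c y) 0 y := fun y hy => by
    have hy' : |y| < 1 := by simpa using hy
    have hpos : 0 < 1 - y := by linarith [(abs_lt.1 hy').2]
    have h1 : HasDerivAt (fun y : ℝ => (1 - y) ^ b) (-1 * b * (1 - y) ^ (b - 1)) y :=
      ((hasDerivAt_id y).const_sub 1).rpow_const (Or.inl hpos.ne')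
    refine (h1.mul (hasDerivAt_psum hc hy')).congr_deriv ?_
    have h2 : (1 - y) ^ b = (1 - y) ^ (b - 1) * (1 - y) := by
      rw [← Real.rpow_add_one hpos.ne', sub_add_cancel]
    rw [h2, mul_assoc ((1 - y) ^ (b - 1)), hode y hy']
    ring
  have hconst := Metric.isOpen_ball.is_const_of_deriv_eq_zero
    (convex_ball (0 : ℝ) 1).isPreconnected
    (fun y hy => (hder y hy).differentiableAt.differentiableWithinAt)
    (fun y hy => (hder y hy).deriv) (x := y) (y := 0) (by simpa using hy) (by simp)
  have h0 : c 0 = 1 := hypergeometricCoefficient_zero _ _ _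
  simp only [sub_zero, Real.one_rpow, psum_zero, h0, mul_one] at hconst
  have hpos : 0 < 1 - y := by linarith [(abs_lt.1 hy).2]
  rw [Real.rpow_neg hpos.le]
  exact eq_inv_of_mul_eq_one_right hconst

variable {a b : ℝ}

lemma convergesOnDisc_direct (ha : 0 < a) (ha1 : a < 1) (hb : 0 < b) :
    ConvergesOnDisc (ordinaryHypergeometricCoefficient (-a) b (1 - a)) := by
  refine convergesOnDisc_hypergeometric fun k => ⟨?_, ?_, ?_⟩
  · rw [neg_neg]
    rcases k.eq_zero_or_pos with rfl | hk
    · simpa using ha.ne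
    · have : (1 : ℝ) ≤ k := by exact_mod_cast hk
      linarith
  · have : (0 : ℝ) ≤ k := k.cast_nonneg
    linarith
  · have : (0 : ℝ) ≤ k := k.cast_nonneg
    linarith

lemma convergesOnDisc_pfaff (ha1 : a < 1) (hb : 0 < b) :
    ConvergesOnDisc (ordinaryHypergeometricCoefficient 1 b (1 - a)) := by
  refine convergesOnDisc_hypergeometric fun k => ?_
  have : (0 : ℝ) ≤ k := k.cast_nonneg
  exact ⟨by linarith, by linarith, by linarith⟩

/-- The differential equation of `₂F₁ (-a, b; 1 - a; -z)`. -/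
lemma hasDerivAt_direct (ha : 0 < a) (ha1 : a < 1) (hb : 0 < b) {z : ℝ} (hz : |z| < 1) :
    ∃ d, HasDerivAt (fun z => ordinaryHypergeometric (-a) b (1 - a) (-z)) d z ∧
      z * d = a * ordinaryHypergeometric (-a) b (1 - a) (-z) - a * (1 + z) ^ (-b) := by
  set c := ordinaryHypergeometricCoefficient (-a) b (1 - a) with hcdef
  have hc : ConvergesOnDisc c := convergesOnDisc_direct ha ha1 hb
  have hz' : |-z| < 1 := by rwa [abs_neg]
  have h1 : (fun z => ordinaryHypergeometric (-a) b (1 - a) (-z)) = fun z => psum c (-z) := by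
    ext z; exact ordinaryHypergeometric_eq_psum _ _ _ _
  refine ⟨-psum (fun n => (n + 1 : ℕ) * c (n + 1)) (-z), ?_, ?_⟩
  · rw [h1]
    have := (hasDerivAt_psum hc hz').comp z (hasDerivAt_neg z)
    simpa [Function.comp_def] using this
  · rw [ordinaryHypergeometric_eq_psum, show 1 + z = 1 - -z by ring, ← psum_binomial hb hz',
      ← psum_const_mul, ← psum_const_mul _ a, ← hcdef, mul_neg, ← neg_mul, mul_deriv_psum hc hz']
    -- The quotient of rising factorials `(-a)ₙ / (1 - a)ₙ` is `-a / (n - a)`, hence `(n - a) cₙ` is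
    -- `-a` times the binomial coefficient `(b)ₙ / n!`. Induction avoids the division.
    have hcoef : ∀ n : ℕ, (n : ℝ) * c n =
        a * c n + -a * ordinaryHypergeometricCoefficient 1 b 1 n := by
      intro n
      induction n with
      | zero => simp [hcdef, hypergeometricCoefficient_zero]
      | succ n ih =>
        have r1 := hypergeometricCoefficient_succ (-a) b (c := 1 - a)
          (fun k => by have : (0 : ℝ) ≤ k := k.cast_nonneg; linarith) n
        have r2 := hypergeometricCoefficient_succ 1 b (c := 1)
          (fun k => by have : (0 : ℝ) ≤ k := k.cast_nonneg; linarith) n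
        rw [← hcdef] at r1
        have h3 : (n : ℝ) + 1 ≠ 0 := by positivity
        have h4 : (n + 1 : ℝ) * (((n : ℝ) + 1 - a) * c (n + 1) +
            a * ordinaryHypergeometricCoefficient 1 b 1 (n + 1)) = 0 := by
          have r3 : (n + 1 : ℝ) * ordinaryHypergeometricCoefficient 1 b 1 (n + 1) =
              (b + n) * ordinaryHypergeometricCoefficient 1 b 1 n := by
            have : (n + 1 : ℝ) * ((n + 1 : ℝ) * ordinaryHypergeometricCoefficient 1 b 1 (n + 1) -
              (b + n) * ordinaryHypergeometricCoefficient 1 b 1 n) = 0 := by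
              linear_combination r2
            rcases mul_eq_zero.1 this with h | h
            · exact absurd h h3
            · linarith
          linear_combination r1 + a * r3 + (b + n) * ih
        rcases mul_eq_zero.1 h4 with h | h
        · exact absurd h h3
        · push_cast; linarith
    have hc1 : ConvergesOnDisc (ordinaryHypergeometricCoefficient 1 b 1) :=
      convergesOnDisc_hypergeometric fun k => by
        have : (0 : ℝ) ≤ k := k.cast_nonneg
        exact ⟨by linarith, by linarith, by linarith⟩
    simp_rw [hcoef]
    rw [psum_add (hc.const_mul a) (hc1.const_mul (-a)) hz', psum_const_mul _ (-a),
      psum_const_mul _ a, psum_const_mul _ a]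
    ring

/-- Pfaff's form of `₂F₁ (-a, b; 1 - a; -z)`. -/
def pfaff (a b z : ℝ) : ℝ :=
  (1 + z) ^ (-b) * ordinaryHypergeometric 1 b (1 - a) (z / (1 + z))

/-- The differential equation of Pfaff's form. -/
lemma hasDerivAt_pfaff (ha1 : a < 1) (hb : 0 < b) {z : ℝ} (hz : 0 ≤ z) :
    ∃ d, HasDerivAt (pfaff a b) d z ∧ z * d = a * pfaff a b z - a * (1 + z) ^ (-b) := by
  set c := ordinaryHypergeometricCoefficient 1 b (1 - a) with hcdef
  have hc : ConvergesOnDisc c := convergesOnDisc_pfaff ha1 hb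
  have hp : 0 < 1 + z := by linarith
  set y := z / (1 + z) with hy
  have hy1 : |y| < 1 := by
    rw [abs_of_nonneg (by positivity), hy, div_lt_one hp]; linarith
  have h1 : pfaff a b = fun z => (1 + z) ^ (-b) * psum c (z / (1 + z)) := by
    ext z; rw [pfaff, ordinaryHypergeometric_eq_psum]
  have hd1 : HasDerivAt (fun z : ℝ => (1 + z) ^ (-b)) (1 * -b * (1 + z) ^ (-b - 1)) z :=
    ((hasDerivAt_id z).const_add 1).rpow_const (Or.inl hp.ne')
  have hd2 : HasDerivAt (fun z : ℝ => z / (1 + z)) ((1 * (1 + z) - z * 1) / (1 + z) ^ 2) z :=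
    (hasDerivAt_id z).div ((hasDerivAt_id z).const_add 1) hp.ne'
  have hd3 : HasDerivAt (fun z : ℝ => psum c (z / (1 + z)))
      (psum (fun n => (n + 1 : ℕ) * c (n + 1)) y * ((1 * (1 + z) - z * 1) / (1 + z) ^ 2)) z :=
    HasDerivAt.comp (h₂ := psum c) z (hasDerivAt_psum hc hy1) hd2
  refine ⟨_, by rw [h1]; exact hd1.mul hd3, ?_⟩
  set D := psum (fun n => (n + 1 : ℕ) * c (n + 1)) y with hD
  have hE : y * D = psum (fun n : ℕ => (n : ℝ) * c n) y := mul_deriv_psum hc hy1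
  -- With upper parameter `1` the factor `n + 1` cancels from the recursion, and the hypergeometric
  -- equation drops to the first-order equation `y (1 - y) F' = a F - a + b y F`.
  have hode : y * D - y * (y * D) = a * psum c y - a + b * y * psum c y := by
    have e1 := psum_eq_add (hc.nat_mul.add (hc.const_mul (-a))) hy1
    have e2 : (fun n : ℕ => ((n + 1 : ℕ) : ℝ) * c (n + 1) + -a * c (n + 1)) =
        fun n : ℕ => (n : ℝ) * c n + b * c n := by
      ext n
      have r1 := hypergeometricCoefficient_succ 1 b (c := 1 - a)
        (fun k => by have : (0 : ℝ) ≤ k := k.cast_nonneg; linarith) n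
      rw [← hcdef] at r1
      have h3 : (n : ℝ) + 1 ≠ 0 := by positivity
      have h4 : (n + 1 : ℝ) * ((n + 1) * c (n + 1) + -a * c (n + 1) - (n * c n + b * c n)) = 0 := by
        linear_combination r1
      rcases mul_eq_zero.1 h4 with h | h
      · exact absurd h h3
      · push_cast; linarith
    rw [e2, psum_add hc.nat_mul (hc.const_mul (-a)) hy1, psum_const_mul,
      psum_add hc.nat_mul (hc.const_mul b) hy1, psum_const_mul, ← hE] at e1
    simp only [hcdef, hypergeometricCoefficient_zero] at e1 ⊢
    push_cast at e1
    linear_combination e1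
  have hpf : pfaff a b z = (1 + z) ^ (-b) * psum c y := by rw [h1]
  rw [hpf]
  have h5 : (1 + z) ^ (-b - 1) = (1 + z) ^ (-b) / (1 + z) := Real.rpow_sub_one hp.ne' _
  have h6 : z = y * (1 + z) := by rw [hy]; field_simp
  have h7 : y * (1 - y) = z / (1 + z) ^ 2 := by rw [hy]; field_simp; ring
  have h8 : y * D - y * (y * D) = z / (1 + z) ^ 2 * D := by rw [← h7]; ring
  rw [h8] at hode
  rw [h5]
  have h9 : z * (1 * -b * ((1 + z) ^ (-b) / (1 + z)) * psum c y + (1 + z) ^ (-b) *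
      (D * ((1 * (1 + z) - z * 1) / (1 + z) ^ 2))) =
      (1 + z) ^ (-b) * (-b * y * psum c y + z / (1 + z) ^ 2 * D) := by
    rw [hy]; field_simp; ring
  rw [h9, hode]
  ring

end Hypergeometric

end

/-! ### The continued hypergeometric function, its asymptotics, and the radial antiderivative. -/

section

section HypS

/-- `₂F₁ (-a, b; 1 - a; -z)`. -/
def hypS (a b z : ℝ) : ℝ := gaussHyp (-a) b (1 - a) (-z)

variable {a b : ℝ}

/-- Write the product as `z ^ (1 - a)` times `g z / z`; the second factor tends to the derivative at
`0`, the first to `0` since `a < 1`. -/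
lemma tendsto_rpow_neg_mul_zero (ha1 : a < 1) {g : ℝ → ℝ} {d : ℝ} (hg : HasDerivAt g d 0)
    (h0 : g 0 = 0) : Tendsto (fun z => z ^ (-a) * g z) (𝓝[>] 0) (𝓝 0) := by
  have h1 : Tendsto (fun z => z⁻¹ * g z) (𝓝[>] 0) (𝓝 d) := by
    have := hg.tendsto_slope_zero_right
    simpa [h0] using this
  have h2 : Tendsto (fun z : ℝ => z ^ (1 - a)) (𝓝[>] 0) (𝓝 0) := by
    have := (Real.continuousAt_rpow_const 0 (1 - a) (Or.inr (by linarith))).tendsto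
    rw [Real.zero_rpow (by linarith)] at this
    exact this.mono_left nhdsWithin_le_nhds
  have h3 := h2.mul h1
  rw [zero_mul] at h3
  refine h3.congr' ?_
  filter_upwards [self_mem_nhdsWithin] with z hz
  have hz : 0 < z := hz
  rw [sub_eq_add_neg, Real.rpow_add hz, Real.rpow_one]
  field_simp

/-- Both sides solve the same linear first-order equation, so their difference `D` satisfies `z D' =
a D` and `z ^ (-a) D` is constant on `(0, 1)`. As `D 0 = 0` and `a < 1`, this constant is the limit
`0` at the origin. -/
lemma direct_eq_pfaff (ha : 0 < a) (ha1 : a < 1) (hb : 0 < b) {z : ℝ} (hz : 0 ≤ z) (hz1 : z < 1) :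
    ordinaryHypergeometric (-a) b (1 - a) (-z) = pfaff a b z := by
  rcases hz.eq_or_lt with rfl | hz0
  · simp [pfaff]
  set D : ℝ → ℝ := fun z => ordinaryHypergeometric (-a) b (1 - a) (-z) - pfaff a b z with hD
  have hder : ∀ z, 0 ≤ z → z < 1 → ∃ d, HasDerivAt D d z ∧ z * d = a * D z := fun z h0 h1 => by
    obtain ⟨d, hd, hd'⟩ := hasDerivAt_direct ha ha1 hb (z := z) (by rw [abs_of_nonneg h0]; exact h1)
    obtain ⟨e, he, he'⟩ := hasDerivAt_pfaff ha1 hb h0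
    refine ⟨d - e, hd.sub he, ?_⟩
    rw [mul_sub, hd', he', hD]
    ring
  have hder2 : ∀ z ∈ Set.Ioo (0 : ℝ) 1, HasDerivAt (fun z => z ^ (-a) * D z) 0 z := fun z hz => by
    obtain ⟨d, hd, hd'⟩ := hder z hz.1.le hz.2
    have h1 : HasDerivAt (fun z : ℝ => z ^ (-a)) (-a * z ^ (-a - 1)) z :=
      Real.hasDerivAt_rpow_const (Or.inl hz.1.ne')
    refine (h1.mul hd).congr_deriv ?_
    have h2 : z ^ (-a) = z ^ (-a - 1) * z := by
      rw [← Real.rpow_add_one hz.1.ne', sub_add_cancel]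
    rw [h2, mul_assoc (z ^ (-a - 1)), hd']
    ring
  obtain ⟨e, he⟩ := isOpen_Ioo.exists_is_const_of_deriv_eq_zero isPreconnected_Ioo
    (fun z hz => (hder2 z hz).differentiableAt.differentiableWithinAt)
    (fun z hz => (hder2 z hz).deriv)
  obtain ⟨d, hd, -⟩ := hder 0 le_rfl one_pos
  have hlim := tendsto_rpow_neg_mul_zero ha1 hd (by simp [hD, pfaff])
  have he0 : e = 0 := by
    refine tendsto_nhds_unique (tendsto_const_nhds.congr' ?_) hlim
    filter_upwards [Ioo_mem_nhdsGT one_pos] with x hx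
    exact (he x hx).symm
  have h := he z ⟨hz0, hz1⟩
  rw [he0] at h
  rcases mul_eq_zero.1 h with h | h
  · exact absurd h (Real.rpow_pos_of_pos hz0 _).ne'
  · exact sub_eq_zero.1 h

/-- `gaussHyp` switches from the series to Pfaff's form at `z = 1`. One formula valid for all `z ≥
0` makes the function differentiable across the switch. -/
lemma hypS_eq_pfaff (ha : 0 < a) (ha1 : a < 1) (hb : 0 < b) {z : ℝ} (hz : 0 ≤ z) :
    hypS a b z = pfaff a b z := by
  rw [hypS, gaussHyp]
  by_cases h : z < 1
  · rw [if_pos (by linarith), direct_eq_pfaff ha ha1 hb hz h]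
  · rw [if_neg (by linarith), pfaff, sub_neg_eq_add, show 1 - a - -a = (1 : ℝ) by ring]
    congr 2
    rw [← neg_add', neg_div_neg_eq, add_comm]

lemma hypS_zero : hypS a b 0 = 1 := by simp [hypS, gaussHyp]

/-- The differential equation of the hypergeometric function. -/
lemma hasDerivAt_hypS (ha : 0 < a) (ha1 : a < 1) (hb : 0 < b) {z : ℝ} (hz : 0 < z) :
    HasDerivAt (hypS a b) ((a * hypS a b z - a * (1 + z) ^ (-b)) / z) z := by
  obtain ⟨d, hd, hd'⟩ := hasDerivAt_pfaff (a := a) ha1 hb hz.le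
  rw [hypS_eq_pfaff ha ha1 hb hz.le, ← hd', mul_div_cancel_left₀ _ hz.ne']
  refine hd.congr_of_eventuallyEq ?_
  filter_upwards [lt_mem_nhds hz] with x hx
  exact hypS_eq_pfaff ha ha1 hb hx.le

lemma exists_hasDerivAt_hypS_zero (ha : 0 < a) (ha1 : a < 1) (hb : 0 < b) :
    ∃ d, HasDerivAt (hypS a b) d 0 := by
  obtain ⟨d, hd, -⟩ := hasDerivAt_direct ha ha1 hb (z := 0) (by simp)
  refine ⟨d, hd.congr_of_eventuallyEq ?_⟩
  filter_upwards [gt_mem_nhds one_pos] with x hx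
  rw [hypS, gaussHyp, if_pos (by linarith)]

lemma tendsto_hypS_sub_one (ha : 0 < a) (ha1 : a < 1) (hb : 0 < b) :
    Tendsto (fun z => z ^ (-a) * (hypS a b z - 1)) (𝓝[>] 0) (𝓝 0) := by
  obtain ⟨d, hd⟩ := exists_hasDerivAt_hypS_zero ha ha1 hb
  exact tendsto_rpow_neg_mul_zero ha1 (hd.sub_const 1) (by simp [hypS_zero])

/-- `Γ (1 - a) Γ (b + a) / Γ (b)`. -/
def hypK (a b : ℝ) : ℝ := Real.Gamma (1 - a) * Real.Gamma (b + a) * (Real.Gamma b)⁻¹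

/-- The factor `(1 + z) ^ (-b - 1)` is the Laplace transform of a Gamma law of shape `b + 1`. After
swapping the integrals, the inner integrand is a multiple of the Gamma density of shape `1 - a` and
rate `t`, and the outer one a multiple of that of shape `b + a`. -/
lemma lintegral_beta_prime (ha : 0 < a) (ha1 : a < 1) (hb : 0 < b) :
    ∫⁻ z in Set.Ioi 0, ENNReal.ofReal (b * z ^ (-a) * (1 + z) ^ (-b - 1)) =
      ENNReal.ofReal (hypK a b) := by
  have hb1 : 0 < b + 1 := by linarith
  have := isProbabilityMeasure_gammaMeasure hb1 one_pos
  have h1 : ∀ z ∈ Set.Ioi (0 : ℝ), ENNReal.ofReal (b * z ^ (-a) * (1 + z) ^ (-b - 1)) =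
      ∫⁻ t, ENNReal.ofReal (b * z ^ (-a)) * expNeg (ENNReal.ofReal z * ENNReal.ofReal t)
        ∂gammaMeasure (b + 1) 1 := fun z hz => by
    have hz : 0 < z := hz
    have hm : Measurable fun t => expNeg (ENNReal.ofReal z * ENNReal.ofReal t) :=
      measurable_expNeg.comp (by fun_prop)
    rw [lintegral_const_mul _ hm, lintegral_expNeg_gamma hb1 one_pos hz.le, ← ENNReal.ofReal_mul (by positivity), div_one,
      neg_add']
  rw [setLIntegral_congr_fun measurableSet_Ioi h1, lintegral_lintegral_swap]
  · have hm : Measurable fun t : ℝ => ∫⁻ z in Set.Ioi (0 : ℝ), ENNReal.ofReal (b * z ^ (-a)) *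
        expNeg (ENNReal.ofReal z * ENNReal.ofReal t) := by
      refine Measurable.lintegral_prod_right' (f := fun q : ℝ × ℝ => ENNReal.ofReal
        (b * q.2 ^ (-a)) * expNeg (ENNReal.ofReal q.2 * ENNReal.ofReal q.1)) ?_
      exact (by fun_prop : Measurable fun q : ℝ × ℝ => ENNReal.ofReal (b * q.2 ^ (-a))).mul
        (measurable_expNeg.comp (by fun_prop))
    rw [lintegral_gammaMeasure _ _ hm]
    have h2 : ∀ t : ℝ, t ≠ 0 → gammaPDF (b + 1) 1 t * ∫⁻ z in Set.Ioi (0 : ℝ),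
        ENNReal.ofReal (b * z ^ (-a)) * expNeg (ENNReal.ofReal z * ENNReal.ofReal t) =
        ENNReal.ofReal (hypK a b) * gammaPDF (b + a) 1 t := fun t ht0 => by
      rcases lt_or_ge t 0 with ht | ht
      · rw [gammaPDF_of_neg ht, gammaPDF_of_neg ht]; simp
      have ht : 0 < t := lt_of_le_of_ne ht (Ne.symm ht0)
      have hG := Real.Gamma_pos_of_pos (by linarith : 0 < 1 - a)
      have hGb := Real.Gamma_pos_of_pos hb
      have hGba := Real.Gamma_pos_of_pos (by linarith : 0 < b + a)
      have h3 : ∀ z : ℝ, z ≠ 0 → Set.indicator (Set.Ioi (0 : ℝ)) (fun z => ENNReal.ofReal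
          (b * z ^ (-a)) * expNeg (ENNReal.ofReal z * ENNReal.ofReal t)) z =
          ENNReal.ofReal (b * Real.Gamma (1 - a) * t ^ (a - 1)) * gammaPDF (1 - a) t z :=
        fun z hz0 => by
          rcases lt_or_ge z 0 with hz | hz
          · rw [gammaPDF_of_neg hz, Set.indicator_of_notMem (by simpa using hz.le), mul_zero]
          have hz : 0 < z := lt_of_le_of_ne hz (Ne.symm hz0)
          rw [Set.indicator_of_mem (Set.mem_Ioi.2 hz), gammaPDF_of_nonneg hz.le,
            ← ENNReal.ofReal_mul hz.le, expNeg_ofReal (by positivity),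
            ← ENNReal.ofReal_mul (by positivity), ← ENNReal.ofReal_mul (by positivity)]
          congr 1
          have h4 : t ^ (a - 1) * t ^ (1 - a) = 1 := by
            rw [← Real.rpow_add ht]; simp
          rw [show 1 - a - 1 = -a by ring, mul_comm z t]
          field_simp
          linear_combination -h4
      rw [← lintegral_indicator measurableSet_Ioi, lintegral_congr_ae (g := fun z =>
        ENNReal.ofReal (b * Real.Gamma (1 - a) * t ^ (a - 1)) * gammaPDF (1 - a) t z),
        lintegral_const_mul _ (measurable_gammaPDF _ _),
        lintegral_gammaPDF_eq_one (by linarith) ht, mul_one, gammaPDF_of_nonneg ht.le,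
        gammaPDF_of_nonneg ht.le, ← ENNReal.ofReal_mul (by positivity), hypK,
        ← ENNReal.ofReal_mul (by positivity)]
      · congr 1
        rw [Real.Gamma_add_one hb.ne', show b + a - 1 = b + (a - 1) by ring, Real.rpow_add ht,
          show b + 1 - 1 = b by ring]
        simp only [Real.one_rpow]
        field_simp
      · filter_upwards [compl_mem_ae_iff.2 (measure_singleton (0 : ℝ))] with z hz
        exact h3 z (by simpa using hz)
    rw [lintegral_congr_ae (g := fun t => ENNReal.ofReal (hypK a b) * gammaPDF (b + a) 1 t),
      lintegral_const_mul _ (measurable_gammaPDF _ _),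
      lintegral_gammaPDF_eq_one (by linarith) one_pos, mul_one]
    filter_upwards [compl_mem_ae_iff.2 (measure_singleton (0 : ℝ))] with t ht
    exact h2 t (by simpa using ht)
  · exact ((by fun_prop : Measurable fun q : ℝ × ℝ => ENNReal.ofReal (b * q.1 ^ (-a))).mul
      (measurable_expNeg.comp (by fun_prop))).aemeasurable

/-- The behaviour of the hypergeometric function at infinity. -/
lemma tendsto_hypS_atTop (ha : 0 < a) (ha1 : a < 1) (hb : 0 < b) :
    Tendsto (fun z => z ^ (-a) * hypS a b z) atTop (𝓝 (hypK a b)) := by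
  -- By the differential equation, `Q` has the beta-type integrand `q` as its derivative.
  -- Subtracting `(1 + z) ^ (-b)` makes `Q` vanish at `0`, and the subtracted term is negligible at
  -- infinity, so the limit is the full integral of `q`.
  set Q : ℝ → ℝ := fun z => z ^ (-a) * (hypS a b z - (1 + z) ^ (-b)) with hQ
  set q : ℝ → ℝ := fun z => b * z ^ (-a) * (1 + z) ^ (-b - 1) with hq
  have hpow : ∀ z : ℝ, 0 ≤ z → HasDerivAt (fun z : ℝ => (1 + z) ^ (-b))
      (1 * -b * (1 + z) ^ (-b - 1)) z := fun z hz =>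
    ((hasDerivAt_id z).const_add 1).rpow_const (Or.inl (by simp only [id]; linarith))
  have hder : ∀ z, 0 < z → HasDerivAt Q (q z) z := fun z hz => by
    have h1 : HasDerivAt (fun z : ℝ => z ^ (-a)) (-a * z ^ (-a - 1)) z :=
      Real.hasDerivAt_rpow_const (Or.inl hz.ne')
    refine (h1.mul ((hasDerivAt_hypS ha ha1 hb hz).sub (hpow z hz.le))).congr_deriv ?_
    rw [Real.rpow_sub_one hz.ne', hq]
    simp only [Pi.sub_apply]
    field_simp
    ring
  have hQ0 : Q 0 = 0 := by simp [hQ, hypS_zero]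
  have hcont0 : ContinuousWithinAt Q (Set.Ici 0) 0 := by
    rw [← continuousWithinAt_Ioi_iff_Ici, ContinuousWithinAt, hQ0]
    obtain ⟨d, hd⟩ := exists_hasDerivAt_hypS_zero ha ha1 hb
    exact tendsto_rpow_neg_mul_zero ha1 (hd.sub (hpow 0 le_rfl)) (by simp [hypS_zero])
  have hqnn : ∀ z ∈ Set.Ioi (0 : ℝ), 0 ≤ q z := fun z hz => by
    have hz : 0 < z := hz
    rw [hq]; positivity
  have hqm : Measurable q := by rw [hq]; fun_prop
  have hqae : 0 ≤ᵐ[volume.restrict (Set.Ioi 0)] q :=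
    (ae_restrict_iff' measurableSet_Ioi).2 (.of_forall hqnn)
  have hlint := lintegral_beta_prime ha ha1 hb
  have hint : IntegrableOn q (Set.Ioi 0) := by
    refine ⟨hqm.aestronglyMeasurable, ?_⟩
    rw [hasFiniteIntegral_iff_ofReal hqae, hlint]
    exact ENNReal.ofReal_lt_top
  have hK : 0 ≤ hypK a b := by
    have := Real.Gamma_pos_of_pos (by linarith : 0 < 1 - a)
    have := Real.Gamma_pos_of_pos hb
    have := Real.Gamma_pos_of_pos (by linarith : 0 < b + a)
    rw [hypK]; positivity
  have hval : ∫ z in Set.Ioi 0, q z = hypK a b := by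
    rw [integral_eq_lintegral_of_nonneg_ae hqae hqm.aestronglyMeasurable, hlint,
      ENNReal.toReal_ofReal hK]
  have h1 := intervalIntegral_tendsto_integral_Ioi 0 hint tendsto_id
  rw [hval] at h1
  have h2 : Tendsto Q atTop (𝓝 (hypK a b)) := by
    refine h1.congr' ?_
    filter_upwards [eventually_gt_atTop 0] with z hz
    rw [id, intervalIntegral.integral_eq_sub_of_hasDerivAt_of_le (f := Q) hz.le, hQ0, sub_zero]
    · intro x hx
      rcases hx.1.eq_or_lt with rfl | h
      · exact hcont0.mono Set.Icc_subset_Ici_self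
      · exact (hder x h).continuousAt.continuousWithinAt
    · exact fun x hx => hder x hx.1
    · exact (intervalIntegrable_iff_integrableOn_Ioc_of_le hz.le).2
        (hint.mono_set Set.Ioc_subset_Ioi_self)
  have h3 : Tendsto (fun z : ℝ => z ^ (-a) * (1 + z) ^ (-b)) atTop (𝓝 0) := by
    have e1 := tendsto_rpow_neg_atTop ha
    have e2 := (tendsto_rpow_neg_atTop hb).comp (tendsto_atTop_add_const_left atTop (1 : ℝ) tendsto_id)
    simpa using e1.mul e2
  refine ((h2.add h3).congr fun z => ?_).trans (by rw [add_zero])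
  rw [hQ]; ring

end HypS

section Radial

variable {α b X : ℝ}

/-- Antiderivative of `s ↦ 2 s (1 + X s ^ (-α)) ^ (-b)`. -/
def radial (α b X s : ℝ) : ℝ :=
  if s = 0 then hypK (2 / α) b * X ^ (2 / α) else s ^ 2 * hypS (2 / α) b (X * s ^ (-α))

lemma radial_of_pos {s : ℝ} (hs : 0 < s) :
    radial α b X s = s ^ 2 * hypS (2 / α) b (X * s ^ (-α)) := if_neg hs.ne'

/-- With `z = X s ^ (-α)` one has `dz/ds = -α z / s`, and the exponent `a = 2 / α` is chosen so that
the terms containing the hypergeometric function cancel, leaving `α a s (1 + z) ^ (-b)`. -/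
lemma hasDerivAt_radial (hα : 2 < α) (hb : 0 < b) (hX : 0 ≤ X) {s : ℝ} (hs : 0 < s) :
    HasDerivAt (radial α b X) (2 * s * (1 + X * s ^ (-α)) ^ (-b)) s := by
  have ha : 0 < 2 / α := by positivity
  have ha1 : 2 / α < 1 := (div_lt_one (by linarith)).2 hα
  have hev : radial α b X =ᶠ[𝓝 s] fun s => s ^ 2 * hypS (2 / α) b (X * s ^ (-α)) := by
    filter_upwards [lt_mem_nhds hs] with x hx using radial_of_pos hx
  refine HasDerivAt.congr_of_eventuallyEq ?_ hev
  rcases hX.eq_or_lt with rfl | hX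
  · simp only [zero_mul, hypS_zero, mul_one, add_zero, Real.one_rpow]
    simpa using hasDerivAt_pow 2 s
  set z := X * s ^ (-α) with hz
  have hz0 : 0 < z := mul_pos hX (Real.rpow_pos_of_pos hs _)
  have h1 : HasDerivAt (fun s : ℝ => X * s ^ (-α)) (X * (-α * s ^ (-α - 1))) s :=
    (Real.hasDerivAt_rpow_const (Or.inl hs.ne')).const_mul X
  have h2 := HasDerivAt.comp (h₂ := hypS (2 / α) b) s (hasDerivAt_hypS ha ha1 hb hz0) h1
  refine ((hasDerivAt_pow 2 s).mul h2).congr_deriv ?_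
  have h3 : X * (-α * s ^ (-α - 1)) = -α * z / s := by
    rw [Real.rpow_sub_one hs.ne', hz]; ring
  simp only [Function.comp_apply, ← hz]
  rw [h3]
  have : α ≠ 0 := by linarith
  field_simp
  ring

/-- As `s → 0` the argument tends to infinity and `s ^ 2` equals `X ^ (2/α)` times its power `-2/α`,
so the asymptotics at infinity apply. This limit is the source of the `Δ` terms. -/
lemma continuousWithinAt_radial_zero (hα : 2 < α) (hb : 0 < b) (hX : 0 ≤ X) :
    ContinuousWithinAt (radial α b X) (Set.Ici 0) 0 := by
  have hα0 : 0 < α := by linarith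
  have ha : 0 < 2 / α := by positivity
  have ha1 : 2 / α < 1 := (div_lt_one hα0).2 hα
  rw [← continuousWithinAt_Ioi_iff_Ici, ContinuousWithinAt]
  have h0 : radial α b X 0 = hypK (2 / α) b * X ^ (2 / α) := if_pos rfl
  rw [h0]
  rcases hX.eq_or_lt with rfl | hX
  · rw [Real.zero_rpow ha.ne', mul_zero]
    have : Tendsto (fun s : ℝ => s ^ 2) (𝓝[>] 0) (𝓝 0) := by
      have := (continuous_pow 2 : Continuous fun s : ℝ => s ^ 2).tendsto 0
      simp only [ne_eq, OfNat.ofNat_ne_zero, not_false_eq_true, zero_pow] at this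
      exact this.mono_left nhdsWithin_le_nhds
    refine this.congr' ?_
    filter_upwards [self_mem_nhdsWithin] with s hs
    rw [radial_of_pos hs, zero_mul, hypS_zero, mul_one]
  · have h1 : Tendsto (fun s : ℝ => X * s ^ (-α)) (𝓝[>] 0) atTop :=
      (tendsto_rpow_neg_nhdsGT_zero (by linarith)).const_mul_atTop hX
    refine (((tendsto_hypS_atTop ha ha1 hb).comp h1).mul_const (X ^ (2 / α))).congr' ?_
    filter_upwards [self_mem_nhdsWithin] with s hs
    have hs : 0 < s := hs
    rw [radial_of_pos hs, Function.comp_apply, Real.mul_rpow hX.le (by positivity),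
      ← Real.rpow_mul hs.le, Real.rpow_neg hX.le,
      show -α * -(2 / α) = (2 : ℕ) by push_cast; field_simp, Real.rpow_natCast]
    field_simp

lemma continuousOn_radial (hα : 2 < α) (hb : 0 < b) (hX : 0 ≤ X) :
    ContinuousOn (radial α b X) (Set.Ici 0) := by
  intro s hs
  rcases (Set.mem_Ici.1 hs).eq_or_lt with rfl | h
  · exact continuousWithinAt_radial_zero hα hb hX
  · exact (hasDerivAt_radial hα hb hX h).continuousAt.continuousWithinAt

/-- As `s → ∞` the argument tends to `0`, and the deviation of the hypergeometric function from `1`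
is of smaller order than the power `2 / α < 1` carried by `s ^ 2`. -/
lemma tendsto_sub_radial_atTop (hα : 2 < α) (hb : 0 < b) (hX : 0 ≤ X) :
    Tendsto (fun s => s ^ 2 - radial α b X s) atTop (𝓝 0) := by
  have hα0 : 0 < α := by linarith
  have ha : 0 < 2 / α := by positivity
  have ha1 : 2 / α < 1 := (div_lt_one hα0).2 hα
  rcases hX.eq_or_lt with rfl | hX
  · refine tendsto_const_nhds.congr' ?_
    filter_upwards [eventually_gt_atTop 0] with s hs
    rw [radial_of_pos hs, zero_mul, hypS_zero]; ring
  · have h1 : Tendsto (fun s : ℝ => X * s ^ (-α)) atTop (𝓝[>] 0) := by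
      refine tendsto_nhdsWithin_iff.2 ⟨by simpa using (tendsto_rpow_neg_atTop hα0).const_mul X, ?_⟩
      filter_upwards [eventually_gt_atTop 0] with s hs
      exact mul_pos hX (Real.rpow_pos_of_pos hs _)
    have h2 := ((tendsto_hypS_sub_one ha ha1 hb).comp h1).mul_const (-X ^ (2 / α))
    rw [zero_mul] at h2
    refine h2.congr' ?_
    filter_upwards [eventually_gt_atTop 0] with s hs
    rw [radial_of_pos hs, Function.comp_apply, Real.mul_rpow hX.le (by positivity),
      ← Real.rpow_mul hs.le, Real.rpow_neg hX.le,
      show -α * -(2 / α) = (2 : ℕ) by push_cast; field_simp, Real.rpow_natCast]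
    field_simp
    ring

/-- The integral over the complement of a disc that appears in the exponent of the Laplace
transform of the interference. -/
lemma lintegral_Ioi_radial (hα : 2 < α) (hb : 0 < b) (hX : 0 ≤ X) {r : ℝ} (hr : 0 ≤ r) :
    ∫⁻ s in Set.Ioi r, ENNReal.ofReal (2 * s * (1 - (1 + X * s ^ (-α)) ^ (-b))) =
      ENNReal.ofReal (radial α b X r - r ^ 2) := by
  have hnn : ∀ s ∈ Set.Ioi r, 0 ≤ 2 * s * (1 - (1 + X * s ^ (-α)) ^ (-b)) := fun s hs => by
    have hs0 : 0 < s := hr.trans_lt hs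
    have := Real.rpow_nonneg hs0.le (-α)
    have h1 : (1 + X * s ^ (-α)) ^ (-b) ≤ 1 :=
      Real.rpow_le_one_of_one_le_of_nonpos (by nlinarith) (by linarith)
    exact mul_nonneg (by linarith) (by linarith)
  have hcont : ContinuousWithinAt (fun s => s ^ 2 - radial α b X s) (Set.Ici r) r :=
    ((continuous_pow 2).continuousWithinAt).sub
      (((continuousOn_radial hα hb hX) r hr).mono (Set.Ici_subset_Ici.2 hr))
  have hder : ∀ s ∈ Set.Ioi r, HasDerivAt (fun s => s ^ 2 - radial α b X s)
      (2 * s * (1 - (1 + X * s ^ (-α)) ^ (-b))) s := fun s hs => by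
    refine ((hasDerivAt_pow 2 s).sub (hasDerivAt_radial hα hb hX (hr.trans_lt hs))).congr_deriv ?_
    push_cast; ring
  have hlim := tendsto_sub_radial_atTop hα hb hX
  rw [← ofReal_integral_eq_lintegral_ofReal
    (integrableOn_Ioi_deriv_of_nonneg hcont hder hnn hlim)
    ((ae_restrict_iff' measurableSet_Ioi).2 (.of_forall hnn)),
    integral_Ioi_of_hasDerivAt_of_nonneg hcont hder hnn hlim]
  congr 1; ring

end Radial

end

/-! ### The Laplace exponent of the macro tier. -/

section

namespace Params

variable (par : Params)

/-- The uniform distribution of the angles. -/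
def angleLaw : Measure ℝ :=
  cond volume (Set.Icc (-(par.d / par.wavelength)) (par.d / par.wavelength))

instance : IsProbabilityMeasure par.angleLaw :=
  inferInstanceAs (IsProbabilityMeasure
    (cond volume (Set.Icc (-(par.d / par.wavelength)) (par.d / par.wavelength))))

lemma fadingParam_pos (i : Tier) : 0 < par.fadingParam i := by
  cases i
  · exact one_pos
  · exact par.Nak_pos

end Params

variable {Ω : Type*} [MeasurableSpace Ω] {P : Measure Ω} [IsProbabilityMeasure P] {par : Params}
  {E : Elements Ω} {f : ℕ}

lemma lintegral_markLaw_prod (i : Tier) (φ : Prop → ℝ≥0∞) {ψ : ℝ × ℝ → ℝ≥0∞}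
    (hψ : Measurable ψ) :
    ∫⁻ y : Mark, φ y.1 * ψ y.2 ∂markLaw par f i =
      (ENNReal.ofReal (par.p i f) * φ True + ENNReal.ofReal (1 - par.p i f) * φ False) *
        ∫⁻ ω, ∫⁻ h, ψ (h, ω) ∂gammaMeasure (par.fadingParam i) (par.fadingParam i)
          ∂par.angleLaw := by
  have hφ : Measurable φ := measurable_of_countable _
  rw [markLaw, lintegral_prod_mul (f := φ) (g := ψ) hφ.aemeasurable hψ.aemeasurable,
    lintegral_bern _ _ _ φ rfl, lintegral_prod_symm _ hψ.aemeasurable]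
  rfl

open Classical in
/-- The mean contribution of a base station to the Laplace transform of the interference. -/
lemma IsNetwork.meanOwnFactor_eq (hE : IsNetwork par P E) (f : ℕ) (i : Tier) {κ r s : ℝ}
    (hκ : 0 ≤ κ) (hr : 0 ≤ r) (hs : 0 ≤ s) :
    par.meanOwnFactor f i κ r s = (if s < r then ENNReal.ofReal (1 - par.p i f) else 1) *
      ∫⁻ ω, ENNReal.ofReal ((1 + κ * r ^ par.alpha i * (par.loss i s * par.gain i ω) /
        par.fadingParam i) ^ (-(par.fadingParam i : ℝ))) ∂par.angleLaw := by
  have hN : (0 : ℝ) < par.fadingParam i := Nat.cast_pos.2 (par.fadingParam_pos i)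
  have hκr : 0 ≤ κ * r ^ par.alpha i := by positivity
  have hl := par.loss_nonneg i hs
  let φ : Prop → ℝ≥0∞ := fun c => if c ∧ s < r then 0 else 1
  let ψ : ℝ × ℝ → ℝ≥0∞ := fun z => expNeg
    (ENNReal.ofReal (κ * r ^ par.alpha i * (par.loss i s * par.gain i z.2)) * ENNReal.ofReal z.1)
  have hG : Measurable fun z : ℝ × ℝ => par.gain i z.2 := (par.measurable_gain i).comp measurable_snd
  have hψ : Measurable ψ := measurable_expNeg.comp
    (((hG.const_mul _).const_mul _).ennreal_ofReal.mul measurable_fst.ennreal_ofReal)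
  have h1 : ∀ y : Mark, par.ownFactor i κ r s y = φ y.1 * ψ y.2 := fun y => by
    by_cases h : y.1 ∧ s < r
    · simp only [φ, Params.ownFactor, if_pos h, zero_mul]
    · simp only [φ, ψ, Params.ownFactor, if_neg h, one_mul]
      rw [ENNReal.ofReal_mul hκr, mul_assoc, ← ENNReal.ofReal_mul
        (mul_nonneg hl (par.gain_nonneg i _))]
      congr 3; ring
  have h2 : ENNReal.ofReal (par.p i f) * φ True + ENNReal.ofReal (1 - par.p i f) * φ False =
      if s < r then ENNReal.ofReal (1 - par.p i f) else 1 := by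
    by_cases h : s < r
    · simp [φ, h]
    · simp only [φ, h, and_false, if_false, mul_one]
      rw [← ENNReal.ofReal_add (hE.p_nonneg i f) (sub_nonneg.2 (hE.p_le_one i f))]
      simp
  have h3 : ∀ ω, ∫⁻ h, ψ (h, ω) ∂gammaMeasure (par.fadingParam i) (par.fadingParam i) =
      ENNReal.ofReal ((1 + κ * r ^ par.alpha i * (par.loss i s * par.gain i ω) /
        par.fadingParam i) ^ (-(par.fadingParam i : ℝ))) := fun ω => by
    have ht : 0 ≤ κ * r ^ par.alpha i * (par.loss i s * par.gain i ω) :=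
      mul_nonneg hκr (mul_nonneg hl (par.gain_nonneg i ω))
    simp only [ψ]
    generalize (par.fadingParam i : ℝ) = N at hN ⊢
    generalize κ * r ^ par.alpha i * (par.loss i s * par.gain i ω) = t at ht ⊢
    exact lintegral_expNeg_gamma hN hN ht
  rw [Params.meanOwnFactor, lintegral_congr h1, lintegral_markLaw_prod i φ hψ, h2,
    lintegral_congr h3]

section Macro

lemma hypK_pos {a b : ℝ} (ha : 0 < a) (ha1 : a < 1) (hb : 0 < b) : 0 < hypK a b := by
  have := Real.Gamma_pos_of_pos (by linarith : 0 < 1 - a)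
  have := Real.Gamma_pos_of_pos hb
  have := Real.Gamma_pos_of_pos (by linarith : 0 < b + a)
  rw [hypK]; positivity

/-- The difference `s ^ 2 - radial` has nonnegative derivative and tends to `0` at infinity, so it
is nonpositive. -/
lemma sq_le_radial {α b X r : ℝ} (hα : 2 < α) (hb : 0 < b) (hX : 0 ≤ X) (hr : 0 < r) :
    r ^ 2 ≤ radial α b X r := by
  have h2 : Tendsto (fun s => s ^ 2 - radial α b X s) atTop (𝓝 0) :=
    tendsto_sub_radial_atTop hα hb hX
  have hd : ∀ s, 0 < s → HasDerivAt (fun s => s ^ 2 - radial α b X s)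
      ((2 : ℕ) * s ^ (2 - 1) - 2 * s * (1 + X * s ^ (-α)) ^ (-b)) s := fun s hs =>
    (hasDerivAt_pow 2 s).sub (hasDerivAt_radial hα hb hX hs)
  have h3 : MonotoneOn (fun s => s ^ 2 - radial α b X s) (Set.Ici r) := by
    refine monotoneOn_of_deriv_nonneg (convex_Ici r) ?_ ?_ ?_
    · exact fun s hs => (hd s (hr.trans_le hs)).continuousAt.continuousWithinAt
    · intro s hs
      rw [interior_Ici] at hs
      exact (hd s (hr.trans hs)).differentiableAt.differentiableWithinAt
    · intro s hs
      rw [interior_Ici] at hs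
      have hs0 : 0 < s := hr.trans hs
      have := Real.rpow_nonneg hs0.le (-α)
      have h1 : (1 + X * s ^ (-α)) ^ (-b) ≤ 1 :=
        Real.rpow_le_one_of_one_le_of_nonpos (by nlinarith) (by linarith)
      rw [(hd s hs0).deriv]
      push_cast
      nlinarith
  have h4 : r ^ 2 - radial α b X r ≤ 0 := ge_of_tendsto h2 (by
    filter_upwards [eventually_ge_atTop r] with s hs
    exact h3 Set.self_mem_Ici hs hs)
  linarith

lemma one_le_hypS {α b z : ℝ} (hα : 2 < α) (hb : 0 < b) (hz : 0 ≤ z) : 1 ≤ hypS (2 / α) b z := by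
  simpa [radial_of_pos] using sq_le_radial hα hb hz one_pos

lemma Params.S_macro_eq (par : Params) (z : ℝ) :
    par.S .macroBS z = hypS (2 / par.alpha .macroBS) 1 z := by
  simp only [Params.S, Params.fadingParam, Nat.cast_one]; rfl

lemma Params.Delta_macro_eq (par : Params) (z : ℝ) : par.Delta .macroBS z =
    hypK (2 / par.alpha .macroBS) 1 * z ^ (2 / par.alpha .macroBS) := by
  simp only [Params.Delta, Params.fadingParam, Nat.cast_one]; rfl

lemma setLIntegral_Ioi_indicator {r : ℝ} (hr : 0 ≤ r) (g : ℝ → ℝ≥0∞) :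
    ∫⁻ s in Set.Ioi 0, (Set.Ioi r).indicator g s = ∫⁻ s in Set.Ioi r, g s := by
  rw [setLIntegral_indicator measurableSet_Ioi]
  congr 2
  ext s
  simp only [Set.mem_inter_iff, Set.mem_Ioi, and_iff_left_iff_imp]
  exact fun h => hr.trans_lt h

lemma lintegral_two_mul {r : ℝ} (hr : 0 ≤ r) :
    ∫⁻ s in Set.Ioi 0, (Set.Iic r).indicator (fun s => ENNReal.ofReal (2 * s)) s =
      ENNReal.ofReal (r ^ 2) := by
  rw [setLIntegral_indicator measurableSet_Iic, Set.inter_comm, Set.Ioi_inter_Iic,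
    ← ofReal_integral_eq_lintegral_ofReal, ← intervalIntegral.integral_of_le hr]
  · congr 1
    rw [intervalIntegral.integral_const_mul, integral_id]
    ring
  · exact (continuous_const.mul continuous_id).integrableOn_Icc.mono_set Set.Ioc_subset_Icc_self
  · refine (ae_restrict_iff' measurableSet_Ioc).2 (.of_forall fun s hs => ?_)
    exact mul_nonneg zero_le_two hs.1.le

lemma IsNetwork.meanOwnFactor_macro (hE : IsNetwork par P E) (f : ℕ) {κ r s : ℝ}
    (hκ : 0 ≤ κ) (hr : 0 ≤ r) (hs : 0 ≤ s) :
    par.meanOwnFactor f .macroBS κ r s = ENNReal.ofReal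
      ((if s < r then 1 - par.p .macroBS f else 1) *
        (1 + κ * r ^ par.alpha .macroBS * s ^ (-par.alpha .macroBS)) ^ (-1 : ℝ)) := by
  rw [hE.meanOwnFactor_eq f .macroBS hκ hr hs]
  simp only [Params.gain, Params.loss, Params.fadingParam, Nat.cast_one, mul_one, div_one,
    lintegral_const, measure_univ]
  have hp := hE.p_le_one .macroBS f
  by_cases h : s < r
  · rw [if_pos h, if_pos h, ENNReal.ofReal_mul (by linarith)]
  · rw [if_neg h, if_neg h, one_mul, one_mul]

/-- The exponent of the Laplace transform of the interference in the macro tier. -/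
lemma IsNetwork.lintegral_meanOwnFactor_macro (hE : IsNetwork par P E) (f : ℕ) {τ r : ℝ}
    (hτ : 0 ≤ τ) (hr : 0 < r) :
    ∫⁻ y : Plane, 1 - par.meanOwnFactor f .macroBS τ r ‖y‖ ∂intensity (par.lam .macroBS) =
      ENNReal.ofReal (Real.pi * par.lam .macroBS * r ^ 2 *
        (par.p .macroBS f * par.S .macroBS τ + (1 - par.p .macroBS f) * par.Delta .macroBS τ)) := by
  set α := par.alpha .macroBS with hα
  set p := par.p .macroBS f with hpdef
  set l := par.lam .macroBS with hl
  have hα2 : 2 < α := par.two_lt_alpha_macro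
  have hp := hE.p_nonneg .macroBS f
  have hp1 := hE.p_le_one .macroBS f
  rw [← hpdef] at hp hp1
  have hl0 : 0 < l := par.lam_pos _
  set X := τ * r ^ α with hX
  have hX0 : 0 ≤ X := by positivity
  set u : ℝ → ℝ := fun s => 2 * s * (1 - (1 + X * s ^ (-α)) ^ (-1 : ℝ)) with hu
  have hum : Measurable fun s => ENNReal.ofReal (u s) := by rw [hu]; fun_prop
  have hm : Measurable fun s => 1 - par.meanOwnFactor f .macroBS τ r s :=
    measurable_const.sub (hE.measurable_meanOwnFactor f .macroBS τ r)
  rw [lintegral_fun_norm_intensity hl0.le hm]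
  have hq : ∀ s : ℝ, 0 < s → 0 ≤ (1 + X * s ^ (-α)) ^ (-1 : ℝ) ∧
      (1 + X * s ^ (-α)) ^ (-1 : ℝ) ≤ 1 := fun s hs => by
    have := Real.rpow_nonneg hs.le (-α)
    have h1 : 1 ≤ 1 + X * s ^ (-α) := by nlinarith
    exact ⟨by positivity, Real.rpow_le_one_of_one_le_of_nonpos h1 (by linarith)⟩
  -- Split by caching status: caching stations are forbidden inside the disc, giving the full area
  -- with weight `p`; they interfere outside it with weight `p`; non-caching stations interfere
  -- everywhere with weight `1 - p`. The circle `s = r`, where the indicators differ from the strict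
  -- inequality, is a null set.
  have hpt : ∀ s ∈ Set.Ioi (0 : ℝ), s ≠ r → ENNReal.ofReal (2 * Real.pi * l * s) *
      (1 - par.meanOwnFactor f .macroBS τ r s) =
      ENNReal.ofReal (Real.pi * l * p) * (Set.Iic r).indicator (fun s => ENNReal.ofReal (2 * s)) s +
      (ENNReal.ofReal (Real.pi * l * (1 - p)) * ENNReal.ofReal (u s) +
      ENNReal.ofReal (Real.pi * l * p) * (Set.Ioi r).indicator (fun s => ENNReal.ofReal (u s)) s) := by
    intro s hs hsr
    have hs0 : 0 < s := hs
    obtain ⟨q0, q1⟩ := hq s hs0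
    have hu0 : 0 ≤ u s := mul_nonneg (by linarith) (by linarith)
    rw [hE.meanOwnFactor_macro f hτ hr.le hs0.le, ← hα, ← hpdef, ← hX]
    rcases lt_or_gt_of_ne hsr with h | h
    · rw [if_pos h, Set.indicator_of_mem (Set.mem_Iic.2 h.le),
        Set.indicator_of_notMem (by simpa using h.le), mul_zero, add_zero, ← ENNReal.ofReal_one,
        ← ENNReal.ofReal_sub _ (mul_nonneg (by linarith) q0), ← ENNReal.ofReal_mul (by positivity),
        ← ENNReal.ofReal_mul (by positivity), ← ENNReal.ofReal_mul (by
          have : 0 ≤ 1 - p := by linarith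
          positivity), ← ENNReal.ofReal_add (by positivity) (by
          have : 0 ≤ 1 - p := by linarith
          positivity)]
      congr 1
      rw [hu]; ring
    · rw [if_neg h.not_gt, Set.indicator_of_notMem (by simpa using h),
        Set.indicator_of_mem (Set.mem_Ioi.2 h), mul_zero, zero_add, one_mul, ← ENNReal.ofReal_one,
        ← ENNReal.ofReal_sub _ q0, ← ENNReal.ofReal_mul (by positivity),
        ← ENNReal.ofReal_mul (by
          have : 0 ≤ 1 - p := by linarith
          positivity), ← ENNReal.ofReal_mul (by positivity), ← ENNReal.ofReal_add (by
          have : 0 ≤ 1 - p := by linarith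
          positivity) (by positivity)]
      congr 1
      rw [hu]; ring
  rw [lintegral_congr_ae (g := fun s =>
      ENNReal.ofReal (Real.pi * l * p) * (Set.Iic r).indicator (fun s => ENNReal.ofReal (2 * s)) s +
      (ENNReal.ofReal (Real.pi * l * (1 - p)) * ENNReal.ofReal (u s) +
      ENNReal.ofReal (Real.pi * l * p) * (Set.Ioi r).indicator (fun s => ENNReal.ofReal (u s)) s))]
  · have hi1 : Measurable ((Set.Iic r).indicator fun s : ℝ => ENNReal.ofReal (2 * s)) :=
      Measurable.indicator (by fun_prop) measurableSet_Iic
    have hi2 : Measurable ((Set.Ioi r).indicator fun s : ℝ => ENNReal.ofReal (u s)) :=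
      hum.indicator measurableSet_Ioi
    have e1 := lintegral_Ioi_radial hα2 one_pos hX0 le_rfl
    have e2 := lintegral_Ioi_radial hα2 one_pos hX0 hr.le
    rw [lintegral_add_left (hi1.const_mul _), lintegral_add_left (hum.const_mul _),
      lintegral_const_mul _ hi1, lintegral_const_mul _ hum, lintegral_const_mul _ hi2,
      lintegral_two_mul hr.le, setLIntegral_Ioi_indicator hr.le, hu, e1, e2]
    -- The Laplace argument scales with `r ^ α`, so at the serving distance the hypergeometric
    -- argument is `τ` whatever `r` is.
    have hS : X * r ^ (-α) = τ := by
      rw [hX, mul_assoc, ← Real.rpow_add hr]; simp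
    have hr0 : radial α 1 X 0 = hypK (2 / α) 1 * τ ^ (2 / α) * r ^ 2 := by
      rw [radial, if_pos rfl, hX, Real.mul_rpow hτ (by positivity), ← Real.rpow_mul hr.le,
        mul_div_cancel₀ _ (by linarith), Real.rpow_two, mul_assoc]
    have hSd : par.S .macroBS τ = hypS (2 / α) 1 τ := par.S_macro_eq τ
    have hDd : par.Delta .macroBS τ = hypK (2 / α) 1 * τ ^ (2 / α) := par.Delta_macro_eq τ
    have hn1 : 0 ≤ radial α 1 X r - r ^ 2 := sub_nonneg.2 (sq_le_radial hα2 one_pos hX0 hr)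
    have hK := (hypK_pos (a := 2 / α) (b := 1) (by positivity)
      ((div_lt_one (by linarith)).2 hα2) one_pos).le
    have h1p : 0 ≤ 1 - p := by linarith
    rw [radial_of_pos hr, hS] at hn1 ⊢
    rw [hr0, hSd, hDd, ← ENNReal.ofReal_mul (by positivity), ← ENNReal.ofReal_mul (by positivity),
      ← ENNReal.ofReal_mul (by positivity), ← ENNReal.ofReal_add _ (by positivity),
      ← ENNReal.ofReal_add (by positivity)]
    · congr 1; ring
    · refine add_nonneg (mul_nonneg (by positivity) ?_) (by positivity)
      have : 0 ≤ hypK (2 / α) 1 * τ ^ (2 / α) * r ^ 2 := by positivity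
      simpa using this
    · refine mul_nonneg (by positivity) ?_
      have : 0 ≤ hypK (2 / α) 1 * τ ^ (2 / α) * r ^ 2 := by positivity
      simpa using this
  · filter_upwards [ae_restrict_mem measurableSet_Ioi, ae_restrict_of_ae
      (compl_mem_ae_iff.2 (measure_singleton r))] with s hs hs'
    exact hpt s hs (by simpa using hs')

end Macro

end

/-! ### Distance density and coverage of the macro tier. -/

section

variable {Ω : Type*} [MeasurableSpace Ω] {P : Measure Ω} [IsProbabilityMeasure P] {par : Params}
  {E : Elements Ω} {f : ℕ}

lemma unitStep_of_nonneg {x : ℝ} (hx : 0 ≤ x) : unitStep x = 1 := if_pos hx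

lemma unitStep_of_neg {x : ℝ} (hx : x < 0) : unitStep x = 0 := if_neg hx.not_ge

lemma unitStep_nonneg (x : ℝ) : 0 ≤ unitStep x := by
  unfold unitStep
  split_ifs <;> simp

lemma Params.measurable_servingDensity (par : Params) (f : ℕ) (i : Tier) :
    Measurable (par.servingDensity f i) := by
  have h1 : ∀ c : ℝ, Measurable fun r : ℝ => unitStep (c - r) := fun c =>
    Params.measurable_unitStep.comp (measurable_const.sub measurable_id)
  have h2 : ∀ c : ℝ, Measurable fun r : ℝ => unitStep (r - c) := fun c =>
    Params.measurable_unitStep.comp (measurable_id.sub measurable_const)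
  cases i
  · exact (Measurable.mul (by fun_prop) (h1 _)).add (Measurable.mul (by fun_prop) (h2 _))
  · exact Measurable.mul (by fun_prop) (h1 _)

lemma IsNetwork.servingDensity_nonneg (hE : IsNetwork par P E) (f : ℕ) (i : Tier) {r : ℝ}
    (hr : 0 ≤ r) : 0 ≤ par.servingDensity f i r := by
  have := hE.p_nonneg .macroBS f
  have := hE.p_nonneg .picoBS f
  have := par.lam_pos .macroBS
  have := par.lam_pos .picoBS
  have h1 := unitStep_nonneg (par.Rr - r)
  have h2 := unitStep_nonneg (r - par.Rr)
  have h3 := unitStep_nonneg (par.RL - r)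
  cases i <;> simp only [Params.servingDensity] <;> positivity

lemma Params.powerRatio_self (par : Params) (i : Tier) : par.powerRatio i i = 1 :=
  div_self (par.coeff_pos i).ne'

lemma Params.powerRatio_swap (par : Params) (i j : Tier) :
    par.powerRatio i j * par.powerRatio j i = 1 := by
  have h1 := (par.coeff_pos i).ne'
  have h2 := (par.coeff_pos j).ne'
  rw [powerRatio_eq, powerRatio_eq]
  field_simp

lemma Params.exclRadius_nonneg (par : Params) (i : Tier) {r : ℝ} (hr : 0 ≤ r) :
    0 ≤ par.exclRadius i r := by
  have := par.RL_pos
  have := par.powerRatio_pos .picoBS .macroBS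
  have := par.powerRatio_pos .macroBS .picoBS
  cases i <;> simp only [Params.exclRadius]
  · exact le_min (by positivity) (by positivity)
  · positivity

/-- `R_r` is the macro distance at which the equal-power radius of the pico tier reaches `R_L`;
below it the minimum is the power law, above it the constant. -/
lemma Params.exclRadius_macro_of_le (par : Params) {r : ℝ} (hr : 0 ≤ r) (h : r ≤ par.Rr) :
    par.exclRadius .macroBS r =
      (par.powerRatio .picoBS .macroBS * r ^ par.alpha .macroBS) ^ (1 / par.alpha .picoBS) := by
  have h1 := par.alpha_pos .macroBS
  have h2 := par.alpha_pos .picoBS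
  have h3 := par.powerRatio_pos .picoBS .macroBS
  have h4 := par.powerRatio_pos .macroBS .picoBS
  have hR := par.RL_pos
  rw [Params.exclRadius, min_eq_left]
  rw [one_div, Real.rpow_inv_le_iff_of_pos (by positivity) hR.le h2]
  rw [Params.Rr, one_div, Real.le_rpow_inv_iff_of_pos hr (by positivity) h1] at h
  have := mul_le_mul_of_nonneg_left h h3.le
  rwa [← mul_assoc, par.powerRatio_swap, one_mul] at this

lemma Params.exclRadius_macro_of_ge (par : Params) {r : ℝ} (hr : 0 ≤ r) (h : par.Rr ≤ r) :
    par.exclRadius .macroBS r = par.RL := by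
  have h1 := par.alpha_pos .macroBS
  have h2 := par.alpha_pos .picoBS
  have h3 := par.powerRatio_pos .picoBS .macroBS
  have h4 := par.powerRatio_pos .macroBS .picoBS
  have hR := par.RL_pos
  rw [Params.exclRadius, min_eq_right]
  rw [one_div, Real.le_rpow_inv_iff_of_pos hR.le (by positivity) h2]
  rw [Params.Rr, one_div, Real.rpow_inv_le_iff_of_pos (by positivity) hr h1] at h
  have := mul_le_mul_of_nonneg_left h h3.le
  rwa [← mul_assoc, par.powerRatio_swap, one_mul] at this

lemma sq_rpow_mul_rpow {c r a b : ℝ} (hc : 0 ≤ c) (hr : 0 ≤ r) (ha : a ≠ 0) :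
    ((c * r ^ a) ^ (1 / b)) ^ 2 = c ^ (2 / b) * r ^ (2 / (b / a)) := by
  have h : ∀ x : ℝ, 0 ≤ x → (x ^ (1 / b)) ^ 2 = x ^ (2 / b) := fun x hx => by
    rw [← Real.rpow_natCast, ← Real.rpow_mul hx]; congr 1; push_cast; ring
  rw [h _ (by positivity), Real.mul_rpow hc (by positivity), ← Real.rpow_mul hr]
  congr 2
  rcases eq_or_ne b 0 with rfl | hb
  · simp
  · field_simp

/-- The density of the distance to the serving base station of the macro tier. -/
lemma Params.servingDensity_macro (par : Params) (f : ℕ) {r : ℝ} (hr : 0 < r) (hne : r ≠ par.Rr) :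
    par.servingDensity f .macroBS r = 2 * Real.pi * par.p .macroBS f * par.lam .macroBS * r *
      Real.exp (-(Real.pi * par.p .macroBS f * par.lam .macroBS * r ^ 2 +
        Real.pi * par.p .picoBS f * par.lam .picoBS * par.exclRadius .macroBS r ^ 2)) := by
  -- The ratios of a tier with itself are `1`, so the exponent of the other tier attached to the
  -- own-tier power ratio in the density has no effect.
  have hself : par.alphaRatio .macroBS .macroBS = 1 := div_self (par.alpha_pos _).ne'
  simp only [Params.servingDensity, par.powerRatio_self, Real.one_rpow, mul_one, hself, div_one,
    Real.rpow_two]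
  -- At `r = R_r` both unit steps equal `1` and the two branches would be added; this point is
  -- therefore excluded.
  rcases lt_or_gt_of_ne hne with h | h
  · rw [unitStep_of_nonneg (sub_nonneg.2 h.le), unitStep_of_neg (sub_neg.2 h),
      par.exclRadius_macro_of_le hr.le h.le, sq_rpow_mul_rpow (par.powerRatio_pos _ _).le hr.le
        (par.alpha_pos _).ne', mul_zero, add_zero, mul_one, Params.alphaRatio]
    congr 2
    ring
  · rw [unitStep_of_neg (sub_neg.2 h), unitStep_of_nonneg (sub_nonneg.2 h.le),
      par.exclRadius_macro_of_ge hr.le h.le, mul_zero, zero_add, mul_one]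
    congr 2
    ring

/-- The SINR coverage probability of the macro tier. -/
theorem IsNetwork.coverageProb_macro (hE : IsNetwork par P E) (f : ℕ) {τ : ℝ} (hτ : 0 ≤ τ) :
    IntegrableOn (par.macroIntegrand f τ) (Set.Ioi 0) ∧
      coverageProb par E P f .macroBS τ = ∫ r in Set.Ioi 0, par.macroIntegrand f τ r := by
  have hp := hE.p_nonneg .macroBS f
  have hp' := hE.p_nonneg .picoBS f
  have hl := par.lam_pos .macroBS
  have hl' := par.lam_pos .picoBS
  have hmeas : Measurable (par.macroIntegrand f τ) := by
    unfold Params.macroIntegrand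
    exact Measurable.mul (by fun_prop) (par.measurable_servingDensity f _)
  have hnn : ∀ r ∈ Set.Ioi (0 : ℝ), 0 ≤ par.macroIntegrand f τ r := fun r hr =>
    mul_nonneg (Real.exp_nonneg _) (hE.servingDensity_nonneg f _ (le_of_lt hr))
  have hae : 0 ≤ᵐ[volume.restrict (Set.Ioi 0)] par.macroIntegrand f τ :=
    (ae_restrict_iff' measurableSet_Ioi).2 (.of_forall hnn)
  have key : ENNReal.ofReal (coverageProb par E P f .macroBS τ) =
      ∫⁻ r in Set.Ioi 0, ENNReal.ofReal (par.macroIntegrand f τ r) := by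
    have h0 := hE.coverageProb_eq f .macroBS hτ
    simp only [Params.fadingParam, Nat.cast_one, gammaTail_one_one] at h0
    rw [h0, hE.mecke f .macroBS (par.measurable_rangeInd _) (par.rangeInd_le_one _)
      (par.measurable_exclRadius _) hτ]
    have hball : Measurable fun r => intensity (par.lam .picoBS)
        (Metric.closedBall (0 : Plane) (par.exclRadius .macroBS r)) := by
      have : Monotone fun r => intensity (par.lam .picoBS) (Metric.closedBall (0 : Plane) r) :=
        fun r r' h => measure_mono (Metric.closedBall_subset_closedBall h)
      exact this.measurable.comp (par.measurable_exclRadius _)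
    let F : ℝ → ℝ≥0∞ := fun r => ENNReal.ofReal (par.p .macroBS f) *
      expNeg (ENNReal.ofReal (par.p .picoBS f) * intensity (par.lam .picoBS)
        (Metric.closedBall (0 : Plane) (par.exclRadius .macroBS r))) *
      expNeg (ENNReal.ofReal (Real.pi * par.lam .macroBS * r ^ 2 *
        (par.p .macroBS f * par.S .macroBS τ + (1 - par.p .macroBS f) * par.Delta .macroBS τ)))
    have hF : Measurable F := ((measurable_expNeg.comp (hball.const_mul _)).const_mul _).mul
      (measurable_expNeg.comp (by fun_prop))
    have hF' : ∀ᵐ x : Plane ∂intensity (par.lam .macroBS),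
        ENNReal.ofReal (par.p .macroBS f) * par.rangeInd .macroBS ‖x‖ *
          expNeg (ENNReal.ofReal (par.p Tier.macroBS.other f) *
            intensity (par.lam Tier.macroBS.other)
              (Metric.closedBall 0 (par.exclRadius .macroBS ‖x‖))) *
          expNeg (∫⁻ y : Plane, 1 - par.meanOwnFactor f .macroBS τ ‖x‖ ‖y‖
            ∂intensity (par.lam .macroBS)) = F ‖x‖ := by
      have h0 : intensity (par.lam .macroBS) {0} = 0 := by
        rw [intensity, Measure.smul_apply, measure_singleton, smul_zero]
      filter_upwards [compl_mem_ae_iff.2 h0] with x hx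
      have hx : 0 < ‖x‖ := norm_pos_iff.2 (by simpa using hx)
      have h1 : par.rangeInd .macroBS ‖x‖ = 1 := if_pos trivial
      rw [hE.lintegral_meanOwnFactor_macro f hτ hx, h1, mul_one]
      rfl
    rw [lintegral_congr_ae hF', lintegral_fun_norm_intensity hl.le hF]
    refine lintegral_congr_ae ?_
    filter_upwards [ae_restrict_mem measurableSet_Ioi, ae_restrict_of_ae
      (compl_mem_ae_iff.2 (measure_singleton par.Rr))] with r hr hr'
    have hr : 0 < r := hr
    have hne : r ≠ par.Rr := by simpa using hr'
    have hS : 0 ≤ par.S .macroBS τ := by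
      rw [par.S_macro_eq]
      exact zero_le_one.trans (one_le_hypS par.two_lt_alpha_macro one_pos hτ)
    have hD : 0 ≤ par.Delta .macroBS τ := by
      have h2 := par.two_lt_alpha_macro
      rw [par.Delta_macro_eq]
      exact mul_nonneg (hypK_pos (by positivity) ((div_lt_one (by linarith)).2 h2) one_pos).le
        (by positivity)
    have hp1 : 0 ≤ 1 - par.p .macroBS f := sub_nonneg.2 (hE.p_le_one _ _)
    have hρ := par.exclRadius_nonneg .macroBS hr.le
    simp only [F]
    rw [intensity_closedBall hl'.le hρ, ← ENNReal.ofReal_mul hp', expNeg_ofReal (by positivity),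
      expNeg_ofReal (by positivity), ← ENNReal.ofReal_mul hp, ← ENNReal.ofReal_mul (by positivity),
      ← ENNReal.ofReal_mul (by positivity), Params.macroIntegrand,
      par.servingDensity_macro f hr hne]
    congr 1
    rw [mul_assoc (par.p .macroBS f), ← Real.exp_add, mul_left_comm (Real.exp _), ← Real.exp_add,
      ← mul_assoc]
    congr 1
    · ring
    · congr 1; ring
  -- Integrability needs no estimate: the lower integral of the nonnegative integrand equals a
  -- probability.
  refine ⟨⟨hmeas.aestronglyMeasurable, ?_⟩, ?_⟩
  · rw [hasFiniteIntegral_iff_ofReal hae, ← key]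
    exact ENNReal.ofReal_lt_top
  · rw [integral_eq_lintegral_of_nonneg_ae hae hmeas.aestronglyMeasurable, ← key,
      ENNReal.toReal_ofReal (by exact measureReal_nonneg)]

end

/-! ### Alzer's inequality for the Gamma distribution. -/

section

section Alzer

/-- `log (u / (1 - exp (-u)))`, continuously extended to `0`. -/
def logRatio (u : ℝ) : ℝ := -Real.log (dslope (fun x => 1 - Real.exp (-x)) 0 u)

lemma hasDerivAt_one_sub_exp_neg (u : ℝ) :
    HasDerivAt (fun x => 1 - Real.exp (-x)) (Real.exp (-u)) u := by
  refine ((hasDerivAt_neg u).exp.const_sub 1).congr_deriv ?_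
  ring

lemma dslope_one_sub_exp_neg_zero : dslope (fun x => 1 - Real.exp (-x)) 0 0 = 1 := by
  rw [dslope_same, (hasDerivAt_one_sub_exp_neg 0).deriv]; simp

lemma dslope_one_sub_exp_neg {u : ℝ} (hu : u ≠ 0) :
    dslope (fun x => 1 - Real.exp (-x)) 0 u = (1 - Real.exp (-u)) / u := by
  rw [dslope_of_ne _ hu, slope_def_field]; simp

lemma one_sub_exp_neg_pos {u : ℝ} (hu : 0 < u) : 0 < 1 - Real.exp (-u) :=
  by
  have := Real.exp_lt_exp.2 (neg_lt_zero.2 hu)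
  rw [Real.exp_zero] at this
  linarith

lemma logRatio_zero : logRatio 0 = 0 := by
  rw [logRatio, dslope_one_sub_exp_neg_zero]; simp

lemma logRatio_of_pos {u : ℝ} (hu : 0 < u) :
    logRatio u = Real.log u - Real.log (1 - Real.exp (-u)) := by
  rw [logRatio, dslope_one_sub_exp_neg hu.ne',
    Real.log_div (one_sub_exp_neg_pos hu).ne' hu.ne']
  ring

lemma continuousOn_logRatio : ContinuousOn logRatio (Set.Ici 0) := by
  refine (ContinuousOn.log (fun u _ => ?_) fun u hu => ?_).neg
  · rcases eq_or_ne u 0 with rfl | h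
    · exact (continuousAt_dslope_same.2
        (hasDerivAt_one_sub_exp_neg 0).differentiableAt).continuousWithinAt
    · exact ((continuousAt_dslope_of_ne h).2
        (hasDerivAt_one_sub_exp_neg u).continuousAt).continuousWithinAt
  · rcases (Set.mem_Ici.1 hu).eq_or_lt with rfl | h
    · rw [dslope_one_sub_exp_neg_zero]; exact one_ne_zero
    · rw [dslope_one_sub_exp_neg h.ne']
      exact (div_pos (one_sub_exp_neg_pos h) h).ne'

lemma hasDerivAt_logRatio {u : ℝ} (hu : 0 < u) :
    HasDerivAt logRatio (u⁻¹ - Real.exp (-u) / (1 - Real.exp (-u))) u := by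
  refine ((Real.hasDerivAt_log hu.ne').sub
    ((hasDerivAt_one_sub_exp_neg u).log (one_sub_exp_neg_pos hu).ne')).congr_of_eventuallyEq ?_
  filter_upwards [lt_mem_nhds hu] with x hx
  exact logRatio_of_pos hx

/-- The derivative decreases because `u ^ 2 exp (-u) ≤ (1 - exp (-u)) ^ 2`, which after division by
`exp (-u / 2)` and taking roots is `u / 2 ≤ sinh (u / 2)`. -/
lemma concaveOn_logRatio : ConcaveOn ℝ (Set.Ici 0) logRatio := by
  refine AntitoneOn.concaveOn_of_deriv (convex_Ici 0) continuousOn_logRatio ?_ ?_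
  · rw [interior_Ici]
    exact fun u hu => (hasDerivAt_logRatio hu).differentiableAt.differentiableWithinAt
  · rw [interior_Ici]
    have hd : ∀ u : ℝ, 0 < u → HasDerivAt (fun u => u⁻¹ - Real.exp (-u) / (1 - Real.exp (-u)))
        (-(u ^ 2)⁻¹ - (-Real.exp (-u) * (1 - Real.exp (-u)) - Real.exp (-u) * Real.exp (-u)) /
          (1 - Real.exp (-u)) ^ 2) u := fun u hu => by
      refine (hasDerivAt_inv hu.ne').sub
        (HasDerivAt.div ?_ (hasDerivAt_one_sub_exp_neg u) (one_sub_exp_neg_pos hu).ne')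
      refine (hasDerivAt_neg u).exp.congr_deriv ?_
      ring
    have h1 : AntitoneOn (fun u => u⁻¹ - Real.exp (-u) / (1 - Real.exp (-u))) (Set.Ioi 0) := by
      refine antitoneOn_of_deriv_nonpos (convex_Ioi 0)
        (fun u hu => (hd u hu).continuousAt.continuousWithinAt) ?_ ?_
      · rw [interior_Ioi]
        exact fun u hu => (hd u hu).differentiableAt.differentiableWithinAt
      · rw [interior_Ioi]
        intro u hu
        have hu : 0 < u := hu
        rw [(hd u hu).deriv]
        have hs : u / 2 ≤ Real.sinh (u / 2) := Real.self_le_sinh_iff.2 (by linarith)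
        rw [Real.sinh_eq] at hs
        have e1 : Real.exp (-u) = Real.exp (-(u / 2)) ^ 2 := by
          rw [← Real.exp_nat_mul]; congr 1; push_cast; ring
        have e2 : Real.exp (u / 2) * Real.exp (-(u / 2)) = 1 := by
          rw [← Real.exp_add]; simp
        have h0 := one_sub_exp_neg_pos hu
        have he := Real.exp_pos (-(u / 2))
        have h2 : u * Real.exp (-(u / 2)) ≤ 1 - Real.exp (-u) := by
          rw [e1]; nlinarith
        have h3 : u ^ 2 * Real.exp (-u) ≤ (1 - Real.exp (-u)) ^ 2 := by
          rw [e1, ← mul_pow, ← e1]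
          exact pow_le_pow_left₀ (by positivity) h2 2
        have h4 : -(u ^ 2)⁻¹ - (-Real.exp (-u) * (1 - Real.exp (-u)) -
            Real.exp (-u) * Real.exp (-u)) / (1 - Real.exp (-u)) ^ 2 =
            (u ^ 2 * Real.exp (-u) - (1 - Real.exp (-u)) ^ 2) /
              (u ^ 2 * (1 - Real.exp (-u)) ^ 2) := by
          field_simp; ring
        rw [h4]
        exact div_nonpos_of_nonpos_of_nonneg (by linarith) (by positivity)
    exact h1.congr fun u hu => (hasDerivAt_logRatio hu).deriv.symm

/-- A concave function vanishing at `0` has decreasing slope `logRatio u / u` from the origin. -/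
lemma mul_logRatio_le {u v : ℝ} (hu : 0 < u) (huv : u ≤ v) :
    u * logRatio v ≤ v * logRatio u := by
  have hv := hu.trans_le huv
  have h := concaveOn_logRatio.2 (Set.mem_Ici.2 hv.le) (Set.mem_Ici.2 le_rfl)
    (by positivity : 0 ≤ u / v) (sub_nonneg.2 ((div_le_one hv).2 huv)) (by ring)
  simp only [smul_eq_mul, logRatio_zero, mul_zero, add_zero, div_mul_cancel₀ u hv.ne'] at h
  rw [div_mul_eq_mul_div, div_le_iff₀ hv] at h
  linarith

lemma etaL_pos {N : ℕ} (hN : 0 < N) : 0 < etaL N := by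
  have : (0 : ℝ) < N := Nat.cast_pos.2 hN
  have : (0 : ℝ) < N.factorial := Nat.cast_pos.2 N.factorial_pos
  rw [etaL]; positivity

lemma etaL_one : etaL 1 = 1 := by simp [etaL]

/-- This normalization makes `(1 - exp (-η x)) ^ N` and the Gamma distribution function agree to
leading order `x ^ N` at the origin. -/
lemma etaL_pow {N : ℕ} (hN : 0 < N) : etaL N ^ N = (N : ℝ) ^ N / N.factorial := by
  have h0 : (N : ℝ) ≠ 0 := (Nat.cast_pos.2 hN).ne'
  rw [etaL, mul_pow, ← Real.rpow_natCast ((N.factorial : ℝ) ^ _), ← Real.rpow_mul (by positivity),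
    div_mul_cancel₀ _ h0, Real.rpow_neg_one]
  rfl

lemma cdf_gammaMeasure_succ (n : ℕ) {x : ℝ} (hx : 0 ≤ x) :
    cdf (gammaMeasure (n + 1 : ℕ) (n + 1 : ℕ)) x =
      ∫ t in (0 : ℝ)..x, (n + 1 : ℝ) ^ (n + 1) / n.factorial * t ^ n *
        Real.exp (-((n + 1) * t)) := by
  have hN : (0 : ℝ) < (n + 1 : ℕ) := by positivity
  rw [cdf_gammaMeasure_eq_integral hN hN, intervalIntegral.integral_of_le hx,
    ← integral_Icc_eq_integral_Ioc, ← integral_indicator measurableSet_Iic,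
    ← integral_indicator measurableSet_Icc]
  congr 1
  ext t
  simp only [Set.indicator_apply, Set.mem_Iic, Set.mem_Icc, gammaPDFReal]
  by_cases h0 : 0 ≤ t <;> by_cases h1 : t ≤ x <;>
    simp only [h0, h1, if_true, if_false, and_true, and_false]
  rw [Real.rpow_natCast]
  push_cast
  rw [Real.Gamma_nat_eq_factorial, add_sub_cancel_right, Real.rpow_natCast]

lemma hasDerivAt_cdf_gammaMeasure_succ (n : ℕ) {x : ℝ} (hx : 0 < x) :
    HasDerivAt (fun x => cdf (gammaMeasure (n + 1 : ℕ) (n + 1 : ℕ)) x)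
      ((n + 1 : ℝ) ^ (n + 1) / n.factorial * x ^ n * Real.exp (-((n + 1) * x))) x := by
  have hc : Continuous fun t : ℝ => (n + 1 : ℝ) ^ (n + 1) / n.factorial * t ^ n *
      Real.exp (-((n + 1) * t)) := by fun_prop
  refine (hc.integral_hasStrictDerivAt 0 x).hasDerivAt.congr_of_eventuallyEq ?_
  filter_upwards [lt_mem_nhds hx] with y hy
  exact cdf_gammaMeasure_succ n hy.le

lemma hasDerivAt_one_sub_exp_pow (n : ℕ) (η x : ℝ) :
    HasDerivAt (fun x => (1 - Real.exp (-(η * x))) ^ (n + 1))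
      ((n + 1) * η * Real.exp (-(η * x)) * (1 - Real.exp (-(η * x))) ^ n) x := by
  have h1 : HasDerivAt (fun x : ℝ => η * x) η x := by
    simpa using (hasDerivAt_id x).const_mul η
  refine (((h1.neg.exp).const_sub 1).pow (n + 1)).congr_deriv ?_
  simp only [Pi.neg_apply, Nat.add_sub_cancel]
  push_cast
  ring

/-- The ratio of the Gamma density to the density of the approximation is the exponential of a
multiple of `logRatio` minus a linear function, so the sign of this exponent decides which density
is larger. -/
lemma deriv_cdf_gamma_eq (n : ℕ) {x : ℝ} (hx : 0 < x) :
    (n + 1 : ℝ) ^ (n + 1) / n.factorial * x ^ n * Real.exp (-((n + 1) * x)) =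
      ((n + 1) * etaL (n + 1) * Real.exp (-(etaL (n + 1) * x)) *
        (1 - Real.exp (-(etaL (n + 1) * x))) ^ n) *
      Real.exp (n * logRatio (etaL (n + 1) * x) - (n + 1 - etaL (n + 1)) * x) := by
  have hη := etaL_pos n.succ_pos
  have hpow := etaL_pow n.succ_pos
  simp only [Nat.succ_eq_add_one] at hη hpow
  generalize etaL (n + 1) = η at hη hpow
  have hu : 0 < η * x := mul_pos hη hx
  have hg := one_sub_exp_neg_pos hu
  have e1 : Real.exp (n * logRatio (η * x)) = (η * x / (1 - Real.exp (-(η * x)))) ^ n := by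
    rw [logRatio_of_pos hu, ← Real.log_div hu.ne' hg.ne', Real.exp_nat_mul,
      Real.exp_log (div_pos hu hg)]
  have e2 : Real.exp (-((n + 1) * x)) = Real.exp (-(η * x)) * Real.exp (-((n + 1 - η) * x)) := by
    rw [← Real.exp_add]; congr 1; ring
  have e3 : (n + 1 : ℝ) ^ (n + 1) / n.factorial = (n + 1) * η ^ (n + 1) := by
    rw [hpow, Nat.factorial_succ]
    have : (n.factorial : ℝ) ≠ 0 := by positivity
    push_cast
    field_simp
  rw [sub_eq_add_neg (_ * _) (_ * x), Real.exp_add, e1, e2, e3, div_pow, mul_pow, pow_succ]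
  field_simp

/-- **Alzer's inequality** for the distribution function of the normalized Gamma distribution. -/
lemma one_sub_exp_pow_le_cdf {N : ℕ} (hN : 0 < N) {x : ℝ} (hx : 0 ≤ x) :
    (1 - Real.exp (-(etaL N * x))) ^ N ≤ cdf (gammaMeasure N N) x := by
  obtain ⟨n, rfl⟩ := Nat.exists_eq_succ_of_ne_zero hN.ne'
  have hη := etaL_pos n.succ_pos
  simp only [Nat.succ_eq_add_one] at hη ⊢
  set F : ℝ → ℝ := fun x => cdf (gammaMeasure (n + 1 : ℕ) (n + 1 : ℕ)) x with hF
  set η := etaL (n + 1) with hηd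
  set H : ℝ → ℝ := fun x => F x - (1 - Real.exp (-(η * x))) ^ (n + 1) with hH
  set g : ℝ → ℝ := fun x => (n + 1) * η * Real.exp (-(η * x)) * (1 - Real.exp (-(η * x))) ^ n with hg
  -- Logarithm of the ratio of densities. Since `φ x / x` decreases, once negative it stays
  -- negative: the difference `H` can only increase first and then decrease, and it vanishes both at
  -- `0` and at infinity.
  set φ : ℝ → ℝ := fun x => n * logRatio (η * x) - (n + 1 - η) * x with hφ
  have hd : ∀ x, 0 < x → HasDerivAt H (g x * (Real.exp (φ x) - 1)) x := fun x hx => by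
    refine ((hasDerivAt_cdf_gammaMeasure_succ n hx).sub
      (hasDerivAt_one_sub_exp_pow n η x)).congr_deriv ?_
    rw [deriv_cdf_gamma_eq n hx, mul_sub, mul_one]
  have hg0 : ∀ x, 0 < x → 0 ≤ g x := fun x hx => by
    have := one_sub_exp_neg_pos (mul_pos hη hx)
    rw [hg]; positivity
  have hH0 : H 0 = 0 := by
    have : F 0 = 0 := by
      rw [hF]
      simp only
      rw [cdf_gammaMeasure_succ n le_rfl, intervalIntegral.integral_same]
    rw [hH]
    simp [this]
  suffices h : 0 ≤ H x from sub_nonneg.1 h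
  -- If `H x < 0`, the mean value theorem yields `c < x` with `φ c < 0`. Then `H` decreases beyond
  -- `x` and cannot return to its limit `0`.
  by_contra! hneg
  have hx0 : 0 < x := lt_of_le_of_ne hx (by rintro rfl; linarith)
  have hcont : ContinuousOn H (Set.Icc 0 x) := by
    have hc : Continuous fun t : ℝ => (n + 1 : ℝ) ^ (n + 1) / n.factorial * t ^ n *
        Real.exp (-((n + 1) * t)) := by fun_prop
    have h1 : ContinuousOn F (Set.Icc 0 x) := by
      refine ContinuousOn.congr (f := fun y => ∫ t in (0 : ℝ)..y, (n + 1 : ℝ) ^ (n + 1) /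
        n.factorial * t ^ n * Real.exp (-((n + 1) * t)))
        (fun y _ => (hc.integral_hasStrictDerivAt 0 y).hasDerivAt.continuousAt.continuousWithinAt)
        fun y hy => cdf_gammaMeasure_succ n hy.1
    exact h1.sub (by fun_prop)
  obtain ⟨c, hc, hc'⟩ := exists_hasDerivAt_eq_slope H (fun x => g x * (Real.exp (φ x) - 1)) hx0
    hcont fun y hy => hd y hy.1
  have hφc : φ c < 0 := by
    by_contra! h
    have h1 : 0 ≤ g c * (Real.exp (φ c) - 1) :=
      mul_nonneg (hg0 c hc.1) (sub_nonneg.2 (Real.one_le_exp h))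
    rw [hc', hH0, sub_zero, sub_zero] at h1
    exact absurd h1 (not_le.2 (div_neg_of_neg_of_pos hneg hx0))
  have hφ' : ∀ y, c ≤ y → φ y < 0 := fun y hy => by
    have hy0 := hc.1.trans_le hy
    have h1 := mul_logRatio_le (mul_pos hη hc.1) (mul_le_mul_of_nonneg_left hy hη.le)
    have h2 : c * logRatio (η * y) ≤ y * logRatio (η * c) := by
      rw [mul_assoc, mul_assoc] at h1
      exact le_of_mul_le_mul_left h1 hη
    have h3 : c * φ y ≤ y * φ c := by
      have := mul_le_mul_of_nonneg_left h2 (Nat.cast_nonneg (α := ℝ) n)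
      rw [hφ]
      simp only
      nlinarith
    have h4 : y * φ c < 0 := mul_neg_of_pos_of_neg hy0 hφc
    by_contra! h
    have := mul_nonneg hc.1.le h
    linarith
  have hanti : AntitoneOn H (Set.Ici x) := by
    refine antitoneOn_of_deriv_nonpos (convex_Ici x)
      (fun y hy => (hd y (hx0.trans_le hy)).continuousAt.continuousWithinAt) ?_ ?_
    · rw [interior_Ici]
      exact fun y hy => (hd y (hx0.trans hy)).differentiableAt.differentiableWithinAt
    · rw [interior_Ici]
      intro y hy
      have hy : x < y := hy
      rw [(hd y (hx0.trans hy)).deriv]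
      have := hφ' y (hc.2.le.trans hy.le)
      exact mul_nonpos_of_nonneg_of_nonpos (hg0 y (hx0.trans hy))
        (sub_nonpos.2 (Real.exp_le_one_iff.2 this.le))
  have hlim : Tendsto H atTop (𝓝 0) := by
    have h1 : Tendsto F atTop (𝓝 1) := tendsto_cdf_atTop _
    have h2 : Tendsto (fun x : ℝ => Real.exp (-(η * x))) atTop (𝓝 0) :=
      Real.tendsto_exp_neg_atTop_nhds_zero.comp (tendsto_id.const_mul_atTop hη)
    have h3 := h1.sub ((h2.const_sub 1).pow (n + 1))
    simpa using h3
  have : 0 ≤ H x := le_of_tendsto hlim (by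
    filter_upwards [eventually_ge_atTop x] with y hy
    exact hanti Set.self_mem_Ici hy hy)
  linarith

lemma one_sub_exp_pow_mem_Icc (N : ℕ) {η x : ℝ} (hη : 0 ≤ η) (hx : 0 ≤ x) :
    (1 - Real.exp (-(η * x))) ^ N ∈ Set.Icc (0 : ℝ) 1 := by
  have h1 : Real.exp (-(η * x)) ≤ 1 := Real.exp_le_one_iff.2 (by nlinarith)
  have h2 := Real.exp_pos (-(η * x))
  exact ⟨pow_nonneg (by linarith) _, pow_le_one₀ (by linarith) (by linarith)⟩

/-- For an unbounded family the real supremum would be the default value `0` and would bound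
nothing. -/
lemma bddAbove_gammaGap {N : ℕ} (hN : 0 < N) :
    BddAbove (Set.range fun γ : Set.Ioi (0 : ℝ) =>
      |cdf (gammaMeasure N N) (γ : ℝ) - (1 - Real.exp (-(etaL N * (γ : ℝ)))) ^ N|) := by
  refine ⟨1, ?_⟩
  rintro _ ⟨γ, rfl⟩
  have h1 := one_sub_exp_pow_mem_Icc N (etaL_pos hN).le (le_of_lt γ.2)
  have h2 := cdf_nonneg (gammaMeasure N N) (γ : ℝ)
  have h3 := cdf_le_one (gammaMeasure N N) (γ : ℝ)
  exact abs_le.2 ⟨by linarith [h1.2], by linarith [h1.1]⟩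

lemma gammaGap_nonneg (N : ℕ) : 0 ≤ gammaGap N := Real.iSup_nonneg fun _ => abs_nonneg _

lemma cdf_sub_le_gammaGap {N : ℕ} (hN : 0 < N) {x : ℝ} (hx : 0 ≤ x) :
    cdf (gammaMeasure N N) x - (1 - Real.exp (-(etaL N * x))) ^ N ≤ gammaGap N := by
  rcases hx.eq_or_lt with rfl | hx
  · obtain ⟨n, rfl⟩ := Nat.exists_eq_succ_of_ne_zero hN.ne'
    rw [Nat.succ_eq_add_one, cdf_gammaMeasure_succ n le_rfl, intervalIntegral.integral_same]
    simpa using gammaGap_nonneg (n + 1)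
  · exact (le_abs_self _).trans (le_ciSup (bddAbove_gammaGap hN) (⟨x, hx⟩ : Set.Ioi (0 : ℝ)))

lemma gammaGap_one : gammaGap 1 = 0 := by
  have h : ∀ γ : Set.Ioi (0 : ℝ), |cdf (gammaMeasure (1 : ℕ) (1 : ℕ)) (γ : ℝ) -
      (1 - Real.exp (-(etaL 1 * (γ : ℝ)))) ^ 1| = 0 := fun γ => by
    have h1 := cdf_expMeasure_eq one_pos (γ : ℝ)
    rw [expMeasure, if_pos (le_of_lt γ.2)] at h1
    rw [Nat.cast_one, h1, etaL_one]
    simp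
  rw [gammaGap]
  simp_rw [h]
  simp

end Alzer

end

/-! ### The function `F_y` and the radial integrals of the pico tier. -/

section

section Fy

/-- Reversing the index gives a finite geometric sum with ratio `(1 + y)⁻¹`, starting at the second
power. -/
lemma sum_inv_pow (N : ℕ) {y : ℝ} (hy : 0 < y) :
    ∑ m ∈ Finset.Icc 1 N, ((1 + y) ^ (N + 1 - m + 1))⁻¹ =
      ((1 + y)⁻¹ - ((1 + y) ^ (N + 1))⁻¹) / y := by
  have h1 : ∑ m ∈ Finset.Icc 1 N, ((1 + y) ^ (N + 1 - m + 1))⁻¹ =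
      ∑ j ∈ Finset.range N, ((1 + y) ^ (j + 2))⁻¹ := by
    rw [← Finset.sum_range_reflect, Finset.range_eq_Ico, Finset.sum_Ico_eq_sum_range]
    rw [← Finset.Ico_succ_right_eq_Icc, Finset.sum_Ico_eq_sum_range]
    simp only [Nat.succ_eq_succ, Nat.succ_eq_add_one, Nat.add_sub_cancel, Nat.sub_zero]
    refine Finset.sum_congr rfl fun j hj => ?_
    have := Finset.mem_range.1 hj
    congr 2
    omega
  rw [h1]
  clear h1
  induction N with
  | zero => simp
  | succ k ih =>
    rw [Finset.sum_range_succ, ih]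
    field_simp
    ring

/-- Differentiating the sum term by term gives the geometric sum above, which cancels all but `y ^
(-2) (1 + y) ^ (-N)`. Together with its zero limit at infinity this identifies `F_y` as the
antiderivative needed for `α₂ = 2`. -/
lemma hasDerivAt_Fy {N : ℕ} (hN : 0 < N) {y : ℝ} (hy : 0 < y) :
    HasDerivAt (Fy N) ((y ^ 2 * (1 + y) ^ N)⁻¹) y := by
  obtain ⟨n, rfl⟩ := Nat.exists_eq_succ_of_ne_zero hN.ne'
  simp only [Nat.succ_eq_add_one]
  have h1y : (1 + y) ≠ 0 := by positivity
  have hadd : HasDerivAt (fun y : ℝ => 1 + y) 1 y := (hasDerivAt_id y).const_add 1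
  have h1 : HasDerivAt (fun y : ℝ => ((n + 1 : ℕ) : ℝ) * Real.log (1 + 1 / y))
      (-((n + 1) / (y * (1 + y)))) y := by
    have h := (((hasDerivAt_inv hy.ne').const_add 1).log (by positivity)).const_mul
      ((n + 1 : ℕ) : ℝ)
    simp only [one_div]
    refine h.congr_deriv ?_
    push_cast
    field_simp
    ring
  have h2 : HasDerivAt (fun y : ℝ => 1 / (y * (1 + y) ^ n))
      (-((1 + y) ^ n + y * (n * (1 + y) ^ (n - 1))) / (y * (1 + y) ^ n) ^ 2) y := by
    simp only [one_div]
    refine (((hasDerivAt_id y).mul (hadd.pow n)).inv (by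
      simp only [id, Pi.mul_apply, Pi.pow_apply]; positivity)).congr_deriv ?_
    simp
  have h3 : HasDerivAt (fun y : ℝ => ∑ m ∈ Finset.Icc 1 n, ((n + 1 : ℕ) : ℝ) /
      ((1 + y) ^ (n + 1 - m) * (((n + 1 : ℕ) : ℝ) - m)))
      (∑ m ∈ Finset.Icc 1 n, -(n + 1 : ℝ) * ((1 + y) ^ (n + 1 - m + 1))⁻¹) y := by
    refine HasDerivAt.fun_sum fun m hm => ?_
    obtain ⟨hm1, hm2⟩ := Finset.mem_Icc.1 hm
    obtain ⟨j, hj⟩ : ∃ j, n + 1 - m = j + 1 := ⟨n - m, by omega⟩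
    have hc : ((n + 1 : ℕ) : ℝ) - m = j + 1 := by
      rw [← Nat.cast_sub (by omega), hj]; push_cast; rfl
    rw [hc, hj]
    have hj0 : (j + 1 : ℝ) ≠ 0 := by positivity
    have h := (((hadd.pow (j + 1)).inv (by
      simp only [Pi.pow_apply]; positivity)).const_mul (((n + 1 : ℕ) : ℝ) / (j + 1)))
    refine (h.congr_deriv ?_).congr_of_eventuallyEq (.of_forall fun z => ?_)
    · simp only [Pi.pow_apply]
      push_cast
      field_simp
      ring
    · simp only [Pi.pow_apply, Pi.inv_apply]
      rw [div_mul_eq_div_div_swap, div_eq_mul_inv _ ((1 + z) ^ (j + 1))]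
  refine ((h1.sub h2).sub h3).congr_deriv ?_
  rw [← Finset.mul_sum, sum_inv_pow n hy]
  rcases n with _ | k
  · simp
    field_simp
    ring
  · rw [Nat.add_sub_cancel]
    push_cast
    field_simp
    ring

lemma tendsto_Fy_atTop {N : ℕ} : Tendsto (Fy N) atTop (𝓝 0) := by
  have hinv : Tendsto (fun y : ℝ => y⁻¹) atTop (𝓝 0) := tendsto_inv_atTop_zero
  have hadd : Tendsto (fun y : ℝ => (1 + y)⁻¹) atTop (𝓝 0) :=
    tendsto_inv_atTop_zero.comp (tendsto_atTop_add_const_left _ 1 tendsto_id)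
  have h1 : Tendsto (fun y : ℝ => (N : ℝ) * Real.log (1 + 1 / y)) atTop (𝓝 0) := by
    have h := ((hinv.const_add 1).log (by norm_num)).const_mul (N : ℝ)
    simpa [one_div] using h
  have h2 : Tendsto (fun y : ℝ => 1 / (y * (1 + y) ^ (N - 1))) atTop (𝓝 0) := by
    have h : Tendsto (fun y : ℝ => y⁻¹ * (1 + y)⁻¹ ^ (N - 1)) atTop (𝓝 (0 * 0 ^ (N - 1))) :=
      hinv.mul (hadd.pow _)
    rw [zero_mul] at h
    refine h.congr fun y => ?_
    rw [inv_pow, ← mul_inv, one_div]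
  have h3 : Tendsto (fun y : ℝ => ∑ m ∈ Finset.Icc 1 (N - 1), (N : ℝ) /
      ((1 + y) ^ (N - m) * ((N : ℝ) - m))) atTop (𝓝 0) := by
    rw [← Finset.sum_const_zero (s := Finset.Icc 1 (N - 1))]
    refine tendsto_finsetSum _ fun m hm => ?_
    obtain ⟨hm1, hm2⟩ := Finset.mem_Icc.1 hm
    have h := ((hadd.pow (N - m)).const_mul ((N : ℝ) / ((N : ℝ) - m)))
    rw [zero_pow (by omega), mul_zero] at h
    refine h.congr fun y => ?_
    rw [div_mul_eq_div_div_swap, div_eq_mul_inv _ ((1 + y) ^ (N - m)), inv_pow]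
  have h := (h1.sub h2).sub h3
  simp only [sub_zero] at h
  exact h

end Fy

section RadialInt

/-- The integral of `2 t (1 + X t ^ (-α)) ^ (-b)` over `[0, r]`. -/
def radialInt (α b X r : ℝ) : ℝ :=
  ∫ t in (0 : ℝ)..r, 2 * |t| * (1 + |X| * |t| ^ (-α)) ^ (-b)

variable {α b : ℝ}

lemma radialKernel_mem_Icc (hb : 0 ≤ b) (X t : ℝ) :
    (1 + |X| * |t| ^ (-α)) ^ (-b) ∈ Set.Icc (0 : ℝ) 1 := by
  have h1 : 0 ≤ |X| * |t| ^ (-α) := by positivity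
  exact ⟨by positivity, Real.rpow_le_one_of_one_le_of_nonpos (by linarith) (by linarith)⟩

/-- The absolute values extend the kernel to the whole plane. At `t = 0`, where the power is a
default value, the bound `2 |t|` forces continuity. -/
lemma continuous_radialKernel (hb : 0 ≤ b) :
    Continuous fun q : ℝ × ℝ => 2 * |q.2| * (1 + |q.1| * |q.2| ^ (-α)) ^ (-b) := by
  rw [continuous_iff_continuousAt]
  rintro ⟨X, t⟩
  rcases eq_or_ne t 0 with rfl | ht
  · rw [ContinuousAt]
    simp only [abs_zero, mul_zero, zero_mul]
    refine squeeze_zero (g := fun q : ℝ × ℝ => 2 * |q.2|) (fun q => ?_) (fun q => ?_) ?_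
    · exact mul_nonneg (by positivity) (radialKernel_mem_Icc hb _ _).1
    · exact mul_le_of_le_one_right (by positivity) (radialKernel_mem_Icc hb _ _).2
    · have h : Continuous fun q : ℝ × ℝ => 2 * |q.2| := by fun_prop
      have := h.tendsto (X, 0)
      simpa using this
  · have h1 : 0 < |t| := abs_pos.2 ht
    have h2 : 0 ≤ |X| * |t| ^ (-α) := by positivity
    have h3 : ContinuousAt (fun q : ℝ × ℝ => |q.2| ^ (-α)) (X, t) :=
      ContinuousAt.rpow_const (by fun_prop) (Or.inl h1.ne')
    have h4 : ContinuousAt (fun q : ℝ × ℝ => 1 + |q.1| * |q.2| ^ (-α)) (X, t) :=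
      continuousAt_const.add (ContinuousAt.mul (by fun_prop) h3)
    exact ContinuousAt.mul (by fun_prop) (h4.rpow_const (Or.inl (by
      simp only; linarith)))

/-- The integral form is jointly continuous at `X = 0` and for every exponent, in particular `α =
2`. The closed forms do not show this, and the quadrature limits with moving parameters rely on it.
-/
lemma continuous_radialInt (hb : 0 ≤ b) :
    Continuous fun q : ℝ × ℝ => radialInt α b q.1 q.2 := by
  have h := intervalIntegral.continuous_parametric_intervalIntegral_of_continuous (μ := volume)
    (f := fun (q : ℝ × ℝ) t => 2 * |t| * (1 + |q.1| * |t| ^ (-α)) ^ (-b)) (a₀ := 0)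
    (s := fun q => q.2)
    ((continuous_radialKernel hb).comp (continuous_fst.fst.prodMk continuous_snd)) continuous_snd
  exact h

lemma continuous_radialKernel_right (hb : 0 ≤ b) (X : ℝ) :
    Continuous fun t : ℝ => 2 * |t| * (1 + |X| * |t| ^ (-α)) ^ (-b) :=
  (continuous_radialKernel hb).comp (continuous_const.prodMk continuous_id)

lemma radialInt_nonneg (X : ℝ) {r : ℝ} (hb : 0 ≤ b) (hr : 0 ≤ r) : 0 ≤ radialInt α b X r :=
  intervalIntegral.integral_nonneg hr fun _ _ =>
    mul_nonneg (by positivity) (radialKernel_mem_Icc hb _ _).1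

lemma radialInt_le (X : ℝ) {r : ℝ} (hb : 0 ≤ b) (hr : 0 ≤ r) : radialInt α b X r ≤ r ^ 2 := by
  have h1 : ∫ t in (0 : ℝ)..r, 2 * t = r ^ 2 := by
    rw [intervalIntegral.integral_const_mul, integral_id]; ring
  rw [← h1]
  refine intervalIntegral.integral_mono_on hr
    ((continuous_radialKernel_right hb X).intervalIntegrable _ _)
    (Continuous.intervalIntegrable (by fun_prop) _ _) fun t ht => ?_
  have h := (radialKernel_mem_Icc (α := α) hb X t).2
  rw [abs_of_nonneg ht.1] at h ⊢
  exact mul_le_of_le_one_right (by linarith [ht.1]) h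

lemma radialInt_eq_sub {V : ℝ → ℝ} {X r : ℝ} (hb : 0 ≤ b) (hX : 0 ≤ X) (hr : 0 ≤ r)
    (hV : ContinuousOn V (Set.Ici 0))
    (hd : ∀ s, 0 < s → HasDerivAt V (2 * s * (1 + X * s ^ (-α)) ^ (-b)) s) :
    radialInt α b X r = V r - V 0 := by
  refine intervalIntegral.integral_eq_sub_of_hasDerivAt_of_le hr
    (hV.mono Set.Icc_subset_Ici_self) (fun s hs => ?_)
    ((continuous_radialKernel_right hb X).intervalIntegrable _ _)
  rw [abs_of_pos hs.1, abs_of_nonneg hX]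
  exact hd s hs.1

lemma radialInt_eq_radial (hα : 2 < α) (hb : 0 < b) {X r : ℝ} (hX : 0 ≤ X) (hr : 0 ≤ r) :
    radialInt α b X r = radial α b X r - radial α b X 0 :=
  radialInt_eq_sub hb.le hX hr (continuousOn_radial hα hb hX)
    fun _ hs => hasDerivAt_radial hα hb hX hs

lemma radialInt_zero (hb : 0 ≤ b) {r : ℝ} (hr : 0 ≤ r) : radialInt α b 0 r = r ^ 2 := by
  rw [radialInt_eq_sub (V := fun s => s ^ 2) hb le_rfl hr (by fun_prop) fun s hs => ?_]
  · simp
  · simpa using hasDerivAt_pow 2 s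

/-- For `α = 2` the hypergeometric parameter `1 - 2/α` vanishes, so `-X F_y (X / s ^ 2)` replaces
the antiderivative. As `s → 0` its argument tends to infinity and `F_y` to `0`, so there is no
boundary term. -/
lemma radialInt_two {N : ℕ} (hN : 0 < N) {X r : ℝ} (hX : 0 < X) (hr : 0 < r) :
    radialInt 2 N X r = -(X * Fy N (X / r ^ 2)) := by
  set V : ℝ → ℝ := fun s => if s = 0 then 0 else -(X * Fy N (X / s ^ 2)) with hV
  have hd : ∀ s, 0 < s → HasDerivAt V (2 * s * (1 + X * s ^ (-2 : ℝ)) ^ (-(N : ℝ))) s :=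
    fun s hs => by
      have h1 : HasDerivAt (fun s : ℝ => X / s ^ 2) (-(2 * X / s ^ 3)) s := by
        refine (((hasDerivAt_pow 2 s).inv (by positivity)).const_mul X).congr_deriv ?_
        simp
        field_simp
      have h2 : HasDerivAt (fun s : ℝ => -(X * Fy N (X / s ^ 2)))
          (-(X * ((((X / s ^ 2) ^ 2 * (1 + X / s ^ 2) ^ N)⁻¹) * (-(2 * X / s ^ 3))))) s :=
        ((HasDerivAt.comp s (h₂ := Fy N) (hasDerivAt_Fy hN (by positivity)) h1).const_mul X).neg
      refine (h2.congr_deriv ?_).congr_of_eventuallyEq ?_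
      · rw [Real.rpow_neg (by positivity : 0 ≤ 1 + X * s ^ (-2 : ℝ)), Real.rpow_natCast,
          Real.rpow_neg hs.le, Real.rpow_two]
        have h3 : 1 + X / s ^ 2 = 1 + X * (s ^ 2)⁻¹ := by rw [div_eq_mul_inv]
        rw [h3]
        field_simp
      · filter_upwards [lt_mem_nhds hs] with t ht
        exact if_neg ht.ne'
  have hc : ContinuousOn V (Set.Ici 0) := by
    intro s hs
    rcases (Set.mem_Ici.1 hs).eq_or_lt with rfl | hs
    · have h1 : Tendsto (fun s : ℝ => X / s ^ 2) (𝓝[>] 0) atTop := by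
        have h : Tendsto (fun s : ℝ => s ^ 2) (𝓝[>] 0) (𝓝[>] 0) := by
          refine tendsto_nhdsWithin_iff.2 ⟨?_, ?_⟩
          · have := (continuous_pow 2).tendsto (0 : ℝ)
            simp only [ne_eq, OfNat.ofNat_ne_zero, not_false_eq_true, zero_pow] at this
            exact this.mono_left nhdsWithin_le_nhds
          · filter_upwards [self_mem_nhdsWithin] with s hs
            exact pow_pos (Set.mem_Ioi.1 hs) 2
        exact (tendsto_inv_nhdsGT_zero.comp h).const_mul_atTop hX
      have h2 := ((tendsto_Fy_atTop (N := N)).comp h1).const_mul X |>.neg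
      simp only [mul_zero, neg_zero] at h2
      rw [← continuousWithinAt_Ioi_iff_Ici]
      have h0 : V 0 = 0 := if_pos rfl
      rw [ContinuousWithinAt, h0]
      refine h2.congr' ?_
      filter_upwards [self_mem_nhdsWithin] with s hs
      exact (if_neg (ne_of_gt hs)).symm
    · exact (hd s hs).continuousAt.continuousWithinAt
  rw [radialInt_eq_sub (Nat.cast_nonneg N) hX.le hr.le hc hd, hV]
  simp [hr.ne']

end RadialInt

/-- `W_f` as a difference of integrals. -/
lemma Params.W_eq (par : Params) (f : ℕ) {r ω s τ : ℝ} (hr : 0 < r) (hs : 0 ≤ s) (hτ : 0 ≤ τ) :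
    par.W f r ω s τ =
      par.p .picoBS f * radialInt (par.alpha .picoBS) par.Nak
        (s * par.gain .picoBS ω * τ / par.Nak) r -
      radialInt (par.alpha .picoBS) par.Nak (s * par.gain .picoBS ω * τ / par.Nak) par.RL := by
  have hN : (0 : ℝ) < par.Nak := Nat.cast_pos.2 par.Nak_pos
  have hR := par.RL_pos
  have hS : ∀ z, par.S .picoBS z = hypS (2 / par.alpha .picoBS) par.Nak z := fun z => rfl
  have hD : ∀ z, par.Delta .picoBS z =
      hypK (2 / par.alpha .picoBS) par.Nak * z ^ (2 / par.alpha .picoBS) := fun z => rfl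
  have hg := par.gain_nonneg .picoBS ω
  have hY : 0 ≤ s * par.gain .picoBS ω * τ := by positivity
  rw [Params.W]
  generalize s * par.gain .picoBS ω * τ = Y at hY
  rcases par.two_le_alpha_pico.lt_or_eq with hα | hα
  · have hX : 0 ≤ Y / par.Nak := by positivity
    have harg : ∀ t : ℝ, 0 < t → Y / (par.Nak * t ^ par.alpha .picoBS) =
        Y / par.Nak * t ^ (-par.alpha .picoBS) := fun t ht => by
      rw [Real.rpow_neg ht.le, div_mul_eq_div_div, div_eq_mul_inv]
    -- The value of the antiderivative at `0` enters with weight `-p` from the first integral and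
    -- `+1` from the second; together they are the `(1 - p) Δ` term.
    rw [if_pos hα, radialInt_eq_radial hα hN hX hr.le, radialInt_eq_radial hα hN hX hR.le,
      radial_of_pos hr, radial_of_pos hR, hS, hS, hD, harg r hr, harg _ hR, radial, if_pos rfl]
    ring
  · rw [if_neg hα.not_lt, ← hα]
    rcases hY.eq_or_lt with rfl | hY
    · rw [if_pos rfl, zero_div, radialInt_zero hN.le hr.le, radialInt_zero hN.le hR.le]
    · have hX : 0 < Y / par.Nak := by positivity
      rw [if_neg hY.ne', radialInt_two par.Nak_pos hX hr, radialInt_two par.Nak_pos hX hR,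
        div_div, div_div]
      ring

end

/-! ### The Laplace exponent of the pico tier. -/

section

variable {Ω : Type*} [MeasurableSpace Ω] {P : Measure Ω} [IsProbabilityMeasure P] {par : Params}
  {E : Elements Ω} {f : ℕ}

namespace Params

variable (par : Params) (f : ℕ)

/-- The argument of `W_f` normalized by the fading parameter. -/
def picoScale (κ r ω : ℝ) : ℝ := κ * r ^ par.alpha .picoBS * par.gain .picoBS ω / par.Nak

/-- `W_f` as a difference of integrals. -/
def picoW (κ r ω : ℝ) : ℝ :=
  par.p .picoBS f * radialInt (par.alpha .picoBS) par.Nak (par.picoScale κ r ω) r -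
    radialInt (par.alpha .picoBS) par.Nak (par.picoScale κ r ω) par.RL

lemma Nak_cast_pos : (0 : ℝ) < par.Nak := Nat.cast_pos.2 par.Nak_pos

lemma picoScale_nonneg {κ r : ℝ} (hκ : 0 ≤ κ) (hr : 0 ≤ r) (ω : ℝ) : 0 ≤ par.picoScale κ r ω := by
  have := par.gain_nonneg .picoBS ω
  rw [picoScale]; positivity

lemma measurable_picoScale (κ r : ℝ) : Measurable (par.picoScale κ r) :=
  ((par.measurable_gain .picoBS).const_mul _).div_const _

lemma measurable_picoW (κ r : ℝ) : Measurable (par.picoW f κ r) := by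
  have h : ∀ t, Measurable fun ω =>
      radialInt (par.alpha .picoBS) par.Nak (par.picoScale κ r ω) t := fun t =>
    (continuous_radialInt par.Nak_cast_pos.le).measurable.comp
      ((par.measurable_picoScale κ r).prodMk measurable_const)
  exact ((h r).const_mul _).sub (h _)

end Params

/-- Each radial integral lies between `0` and the square of its endpoint. These bounds supply the
domination for the quadrature and the nonnegativity of the exponent. -/
lemma IsNetwork.picoW_mem_Icc (hE : IsNetwork par P E) (f : ℕ) {r : ℝ} (κ : ℝ) (hr : 0 ≤ r)
    (ω : ℝ) : par.picoW f κ r ω ∈ Set.Icc (-par.RL ^ 2) (r ^ 2) := by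
  have hp := hE.p_nonneg .picoBS f
  have hp1 := hE.p_le_one .picoBS f
  have h1 := radialInt_nonneg (α := par.alpha .picoBS) (par.picoScale κ r ω) par.Nak_cast_pos.le hr
  have h2 := radialInt_le (α := par.alpha .picoBS) (par.picoScale κ r ω) par.Nak_cast_pos.le hr
  have h3 := radialInt_nonneg (α := par.alpha .picoBS) (par.picoScale κ r ω) par.Nak_cast_pos.le
    par.RL_pos.le
  have h4 := radialInt_le (α := par.alpha .picoBS) (par.picoScale κ r ω) par.Nak_cast_pos.le
    par.RL_pos.le
  rw [Params.picoW]
  constructor <;> nlinarith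

lemma IsNetwork.integrable_picoW (hE : IsNetwork par P E) (f : ℕ) {r : ℝ} (κ : ℝ) (hr : 0 ≤ r) :
    Integrable (par.picoW f κ r) par.angleLaw := by
  refine Integrable.of_bound (par.measurable_picoW f κ r).aestronglyMeasurable
    (max (par.RL ^ 2) (r ^ 2)) (.of_forall fun ω => ?_)
  obtain ⟨h1, h2⟩ := hE.picoW_mem_Icc f κ hr ω
  rw [Real.norm_eq_abs, abs_le]
  exact ⟨by linarith [le_max_left (par.RL ^ 2) (r ^ 2)], h2.trans (le_max_right _ _)⟩

/-- The density of the mean number of base stations affecting the interference. -/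
def Params.thinning (par : Params) (f : ℕ) (κ r ω s : ℝ) : ℝ :=
  (if s < r then 1 - par.p .picoBS f else 1) *
    (1 + |par.picoScale κ r ω| * |s| ^ (-par.alpha .picoBS)) ^ (-(par.Nak : ℝ))

lemma IsNetwork.thinning_mem_Icc (hE : IsNetwork par P E) (f : ℕ) (κ r ω s : ℝ) :
    par.thinning f κ r ω s ∈ Set.Icc (0 : ℝ) 1 := by
  have hp := hE.p_nonneg .picoBS f
  have hp1 := hE.p_le_one .picoBS f
  obtain ⟨h1, h2⟩ := radialKernel_mem_Icc (α := par.alpha .picoBS) par.Nak_cast_pos.le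
    (par.picoScale κ r ω) s
  rw [Params.thinning]
  split_ifs
  · exact ⟨mul_nonneg (by linarith) h1, mul_le_one₀ (by linarith) h1 h2⟩
  · rw [one_mul]; exact ⟨h1, h2⟩

lemma Params.measurable_thinning (par : Params) (f : ℕ) (κ r : ℝ) :
    Measurable fun q : ℝ × ℝ => par.thinning f κ r q.1 q.2 := by
  have h1 : Measurable fun q : ℝ × ℝ => if q.2 < r then 1 - par.p .picoBS f else 1 :=
    Measurable.ite (measurableSet_lt measurable_snd measurable_const) measurable_const
      measurable_const
  have h2 : Measurable fun q : ℝ × ℝ => par.picoScale κ r q.1 :=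
    (par.measurable_picoScale κ r).comp measurable_fst
  have h3 : Measurable fun q : ℝ × ℝ => |par.picoScale κ r q.1| := h2.abs
  refine h1.mul ?_
  exact ((h3.mul (by fun_prop)).const_add 1).pow_const _

/-- The angle law is a probability measure and the factor is at most `1`, so the subtraction passes
inside the average. In this form the angular and radial integrations can be exchanged. -/
lemma IsNetwork.one_sub_meanOwnFactor_pico (hE : IsNetwork par P E) (f : ℕ) {κ r s : ℝ}
    (hκ : 0 ≤ κ) (hr : 0 ≤ r) (hs : 0 ≤ s) (hsR : s ≤ par.RL) :
    1 - par.meanOwnFactor f .picoBS κ r s =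
      ∫⁻ ω, ENNReal.ofReal (1 - par.thinning f κ r ω s) ∂par.angleLaw := by
  have hm : Measurable fun ω => ENNReal.ofReal (par.thinning f κ r ω s) :=
    ((par.measurable_thinning f κ r).comp (measurable_id.prodMk measurable_const)).ennreal_ofReal
  have hp1 := hE.p_le_one .picoBS f
  have h1 : par.meanOwnFactor f .picoBS κ r s =
      ∫⁻ ω, ENNReal.ofReal (par.thinning f κ r ω s) ∂par.angleLaw := by
    have hc : (if s < r then ENNReal.ofReal (1 - par.p .picoBS f) else 1) =
        ENNReal.ofReal (if s < r then 1 - par.p .picoBS f else 1) := by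
      split_ifs <;> simp
    have hc0 : 0 ≤ (if s < r then 1 - par.p .picoBS f else 1) := by
      split_ifs
      · linarith
      · exact zero_le_one
    have hq : ∀ ω, ENNReal.ofReal ((1 + κ * r ^ par.alpha .picoBS *
        (par.loss .picoBS s * par.gain .picoBS ω) / par.fadingParam .picoBS) ^
          (-(par.fadingParam .picoBS : ℝ))) =
        ENNReal.ofReal ((1 + |par.picoScale κ r ω| * |s| ^ (-par.alpha .picoBS)) ^
          (-(par.Nak : ℝ))) := fun ω => by
      rw [abs_of_nonneg (par.picoScale_nonneg hκ hr ω), abs_of_nonneg hs, Params.loss,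
        unitStep_of_nonneg (sub_nonneg.2 hsR), one_mul, Params.picoScale]
      simp only [Params.fadingParam]
      congr 3
      ring
    have hm' : Measurable fun ω => ENNReal.ofReal ((1 + |par.picoScale κ r ω| *
        |s| ^ (-par.alpha .picoBS)) ^ (-(par.Nak : ℝ))) :=
      ((((par.measurable_picoScale κ r).abs.mul_const _).const_add 1).pow_const _).ennreal_ofReal
    rw [hE.meanOwnFactor_eq f .picoBS hκ hr hs, lintegral_congr hq, hc, ← lintegral_const_mul _ hm']
    refine lintegral_congr fun ω => ?_
    rw [← ENNReal.ofReal_mul hc0, Params.thinning]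
  have hle : ∀ ω, ENNReal.ofReal (par.thinning f κ r ω s) ≤ 1 := fun ω =>
    ENNReal.ofReal_le_one.2 (hE.thinning_mem_Icc f κ r ω s).2
  have h2 : ∫⁻ ω, ENNReal.ofReal (par.thinning f κ r ω s) ∂par.angleLaw ≠ ⊤ := by
    refine ne_top_of_le_ne_top ENNReal.one_ne_top ((lintegral_mono hle).trans ?_)
    simp
  rw [h1]
  have h3 := lintegral_sub (μ := par.angleLaw) (f := fun _ => 1) hm h2 (.of_forall hle)
  rw [lintegral_one, measure_univ] at h3
  rw [← h3]
  refine lintegral_congr fun ω => ?_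
  rw [ENNReal.ofReal_sub _ (hE.thinning_mem_Icc f κ r ω s).1, ENNReal.ofReal_one]

lemma IsNetwork.meanOwnFactor_pico_of_gt (hE : IsNetwork par P E) (f : ℕ) {κ r s : ℝ}
    (hκ : 0 ≤ κ) (hr : 0 ≤ r) (hrR : r ≤ par.RL) (hsR : par.RL < s) :
    par.meanOwnFactor f .picoBS κ r s = 1 := by
  rw [hE.meanOwnFactor_eq f .picoBS hκ hr (hr.trans (hrR.trans hsR.le)),
    if_neg (hrR.trans hsR.le).not_gt, one_mul, Params.loss, unitStep_of_neg (sub_neg.2 hsR)]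
  simp

/-- With `q` the radial kernel, the integrand is `2 s - q` on the LOS interval plus `p q` below `r`;
the three pieces integrate to `R_L ^ 2` and the two terms of `picoW`. -/
lemma IsNetwork.lintegral_thinning (hE : IsNetwork par P E) (f : ℕ) {κ r : ℝ}
    (hr : 0 ≤ r) (hrR : r ≤ par.RL) (ω : ℝ) :
    ∫⁻ s in Set.Ioc 0 par.RL, ENNReal.ofReal (2 * Real.pi * par.lam .picoBS * s *
      (1 - par.thinning f κ r ω s)) =
      ENNReal.ofReal (Real.pi * par.lam .picoBS * (par.RL ^ 2 + par.picoW f κ r ω)) := by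
  have hl := par.lam_pos .picoBS
  have hR := par.RL_pos
  set X := par.picoScale κ r ω with hX
  set q : ℝ → ℝ := fun t => 2 * |t| * (1 + |X| * |t| ^ (-par.alpha .picoBS)) ^ (-(par.Nak : ℝ))
    with hq
  have hqc : Continuous q := continuous_radialKernel_right par.Nak_cast_pos.le X
  have hind : Measurable ((Set.Iio r).indicator q) := hqc.measurable.indicator measurableSet_Iio
  have e1 : ∀ s ∈ Set.Ioc 0 par.RL, 2 * Real.pi * par.lam .picoBS * s *
      (1 - par.thinning f κ r ω s) = Real.pi * par.lam .picoBS *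
        (2 * s - q s + par.p .picoBS f * (Set.Iio r).indicator q s) := fun s hs => by
    rw [Params.thinning, ← hX]
    by_cases h : s < r
    · rw [if_pos h, Set.indicator_of_mem (Set.mem_Iio.2 h), hq]
      simp only [abs_of_pos hs.1]
      ring
    · rw [if_neg h, Set.indicator_of_notMem (by simpa using h), hq]
      simp only [abs_of_pos hs.1]
      ring
  have hi1 : IntegrableOn (fun s : ℝ => 2 * s) (Set.Ioc 0 par.RL) :=
    (by fun_prop : Continuous fun s : ℝ => 2 * s).integrableOn_Ioc
  have hi2 : IntegrableOn q (Set.Ioc 0 par.RL) := hqc.integrableOn_Ioc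
  have hi3 : IntegrableOn ((Set.Iio r).indicator q) (Set.Ioc 0 par.RL) :=
    hi2.indicator measurableSet_Iio
  have hi4 : IntegrableOn (fun s => 2 * s - q s) (Set.Ioc 0 par.RL) := hi1.sub hi2
  have hint : IntegrableOn (fun s => Real.pi * par.lam .picoBS *
      (2 * s - q s + par.p .picoBS f * (Set.Iio r).indicator q s)) (Set.Ioc 0 par.RL) :=
    (hi4.add (hi3.const_mul _)).const_mul _
  have hnn : ∀ s ∈ Set.Ioc 0 par.RL, 0 ≤ Real.pi * par.lam .picoBS *
      (2 * s - q s + par.p .picoBS f * (Set.Iio r).indicator q s) := fun s hs => by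
    rw [← e1 s hs]
    have h1 := (hE.thinning_mem_Icc f κ r ω s).2
    have h2 := hs.1
    exact mul_nonneg (by positivity) (by linarith)
  have h3 : ∫ s in Set.Ioc 0 par.RL, (Set.Iio r).indicator q s =
      radialInt (par.alpha .picoBS) par.Nak X r := by
    rw [setIntegral_indicator measurableSet_Iio, radialInt, intervalIntegral.integral_of_le hr,
      integral_Ioc_eq_integral_Ioo]
    congr 2
    ext s
    simp only [Set.mem_inter_iff, Set.mem_Ioc, Set.mem_Iio, Set.mem_Ioo]
    exact ⟨fun h => ⟨h.1.1, h.2⟩, fun h => ⟨⟨h.1, h.2.le.trans hrR⟩, h.2⟩⟩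
  have h2 : ∫ s in Set.Ioc 0 par.RL, q s = radialInt (par.alpha .picoBS) par.Nak X par.RL := by
    rw [radialInt, intervalIntegral.integral_of_le hR.le]
  have h1 : ∫ s in Set.Ioc 0 par.RL, 2 * s = par.RL ^ 2 := by
    rw [← intervalIntegral.integral_of_le hR.le, intervalIntegral.integral_const_mul, integral_id]
    ring
  rw [setLIntegral_congr_fun measurableSet_Ioc fun s hs => congrArg ENNReal.ofReal (e1 s hs),
    ← ofReal_integral_eq_lintegral_ofReal hint
      ((ae_restrict_iff' measurableSet_Ioc).2 (.of_forall hnn)), integral_const_mul,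
    integral_add hi4 (hi3.const_mul _), integral_sub hi1 hi2, h1, h2,
    integral_const_mul, h3, Params.picoW, ← hX]
  congr 1
  ring

/-- The exponent of the Laplace transform of the interference in the pico tier. -/
lemma IsNetwork.lintegral_meanOwnFactor_pico (hE : IsNetwork par P E) (f : ℕ) {κ r : ℝ}
    (hκ : 0 ≤ κ) (hr : 0 ≤ r) (hrR : r ≤ par.RL) :
    ∫⁻ y : Plane, 1 - par.meanOwnFactor f .picoBS κ r ‖y‖ ∂intensity (par.lam .picoBS) =
      ENNReal.ofReal (Real.pi * par.lam .picoBS *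
        (par.RL ^ 2 + ∫ ω, par.picoW f κ r ω ∂par.angleLaw)) := by
  have hl := par.lam_pos .picoBS
  have hm : Measurable fun s => 1 - par.meanOwnFactor f .picoBS κ r s :=
    measurable_const.sub (hE.measurable_meanOwnFactor f .picoBS κ r)
  have hm2 : Measurable fun q : ℝ × ℝ => ENNReal.ofReal (2 * Real.pi * par.lam .picoBS * q.1 *
      (1 - par.thinning f κ r q.2 q.1)) := by
    have h1 : Measurable fun q : ℝ × ℝ => par.thinning f κ r q.2 q.1 :=
      (par.measurable_thinning f κ r).comp measurable_swap
    exact ((by fun_prop : Measurable fun q : ℝ × ℝ => 2 * Real.pi * par.lam .picoBS * q.1).mul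
      (measurable_const.sub h1)).ennreal_ofReal
  have h1 : ∀ s ∈ Set.Ioi (0 : ℝ), ENNReal.ofReal (2 * Real.pi * par.lam .picoBS * s) *
      (1 - par.meanOwnFactor f .picoBS κ r s) = (Set.Iic par.RL).indicator (fun s =>
        ∫⁻ ω, ENNReal.ofReal (2 * Real.pi * par.lam .picoBS * s *
          (1 - par.thinning f κ r ω s)) ∂par.angleLaw) s := fun s hs => by
    have hs : 0 < s := hs
    rcases le_or_gt s par.RL with h | h
    · have hm3 : Measurable fun ω => ENNReal.ofReal (1 - par.thinning f κ r ω s) :=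
        (measurable_const.sub ((par.measurable_thinning f κ r).comp
          (measurable_id.prodMk measurable_const))).ennreal_ofReal
      rw [Set.indicator_of_mem (Set.mem_Iic.2 h), hE.one_sub_meanOwnFactor_pico f hκ hr hs.le h,
        ← lintegral_const_mul _ hm3]
      refine lintegral_congr fun ω => ?_
      rw [← ENNReal.ofReal_mul (by positivity)]
    · rw [Set.indicator_of_notMem (by simpa using h),
        hE.meanOwnFactor_pico_of_gt f hκ hr hrR h, tsub_self, mul_zero]
  -- Only the LOS ball contributes. Tonelli moves the angular average outside, and the radial
  -- integral is then explicit for each angle.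
  rw [lintegral_fun_norm_intensity hl.le hm, setLIntegral_congr_fun measurableSet_Ioi h1,
    setLIntegral_indicator measurableSet_Iic, Set.inter_comm, Set.Ioi_inter_Iic,
    lintegral_lintegral_swap hm2.aemeasurable,
    lintegral_congr fun ω => hE.lintegral_thinning f hr hrR ω]
  have hi := hE.integrable_picoW f κ hr
  have hi' : Integrable (fun ω => Real.pi * par.lam .picoBS * (par.RL ^ 2 + par.picoW f κ r ω))
      par.angleLaw := ((integrable_const _).add hi).const_mul _
  rw [← ofReal_integral_eq_lintegral_ofReal hi'
    (.of_forall fun ω => ?_), integral_const_mul, integral_add (integrable_const _) hi,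
    integral_const, probReal_univ, one_smul]
  have := (hE.picoW_mem_Icc f κ hr ω).1
  exact mul_nonneg (by positivity) (by linarith)

end

/-! ### Gauss-Chebyshev quadrature and the array gain. -/

section

section Quadrature

/-- The midpoint of the interval of the subdivision of `[0, π]` into `u` parts that contains `θ`. -/
def midpointOf (u : ℕ) (θ : ℝ) : ℝ := (2 * (⌈u * θ / Real.pi⌉ : ℝ) - 1) / (2 * u) * Real.pi

lemma abs_midpointOf_sub_le {u : ℕ} (hu : 0 < u) (θ : ℝ) :
    |midpointOf u θ - θ| ≤ Real.pi / (2 * u) := by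
  have hu' : (0 : ℝ) < u := Nat.cast_pos.2 hu
  have hπ := Real.pi_pos
  have h1 := Int.le_ceil (u * θ / Real.pi)
  have h2 := Int.ceil_lt_add_one (u * θ / Real.pi)
  have h3 : midpointOf u θ - θ =
      (2 * ((⌈u * θ / Real.pi⌉ : ℝ) - u * θ / Real.pi) - 1) * (Real.pi / (2 * u)) := by
    rw [midpointOf]; field_simp; ring
  rw [h3, abs_mul, abs_of_pos (by positivity : 0 < Real.pi / (2 * u))]
  refine mul_le_of_le_one_left (by positivity) (abs_le.2 ⟨by linarith, by linarith⟩)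

lemma tendsto_midpointOf {ι : Type*} {l : Filter ι} {u : ι → ℕ} (hu : Tendsto u l atTop) (θ : ℝ) :
    Tendsto (fun i => midpointOf (u i) θ) l (𝓝 θ) := by
  rw [tendsto_iff_dist_tendsto_zero]
  have h1 : Tendsto (fun i => Real.pi / 2 * ((u i : ℝ))⁻¹) l (𝓝 0) := by
    have := ((tendsto_inv_atTop_zero (𝕜 := ℝ)).comp
      (tendsto_natCast_atTop_atTop.comp hu)).const_mul (Real.pi / 2)
    simpa using this
  refine squeeze_zero' (.of_forall fun _ => dist_nonneg) ?_ h1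
  filter_upwards [hu.eventually_gt_atTop 0] with i hi
  rw [Real.dist_eq]
  refine (abs_midpointOf_sub_le hi θ).trans (le_of_eq ?_)
  rw [div_mul_eq_div_div, div_eq_mul_inv _ (u i : ℝ)]

/-- The Gauss-Chebyshev nodes are the cosines of the midpoints, so the quadrature sum becomes the
exact integral of a step function, to which dominated convergence applies. -/
lemma integral_comp_midpointOf {u : ℕ} (hu : 0 < u) (h : ℝ → ℝ) :
    ∫ θ in (0 : ℝ)..Real.pi, h (midpointOf u θ) =
      Real.pi / u * ∑ k ∈ Finset.Icc 1 u, h ((2 * (k : ℝ) - 1) / (2 * u) * Real.pi) := by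
  have hu' : (0 : ℝ) < u := Nat.cast_pos.2 hu
  have hπ := Real.pi_pos
  let a : ℕ → ℝ := fun k => k * (Real.pi / u)
  have hpt : ∀ k : ℕ, ∀ θ ∈ Set.uIoc (a k) (a (k + 1)),
      h (midpointOf u θ) = h ((2 * ((k + 1 : ℕ) : ℝ) - 1) / (2 * u) * Real.pi) := fun k θ hθ => by
    rw [Set.uIoc_of_le (by simp only [a]; gcongr; simp)] at hθ
    have h1 : (⌈u * θ / Real.pi⌉ : ℤ) = ((k + 1 : ℕ) : ℤ) := by
      rw [Int.ceil_eq_iff]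
      have e : θ = u * θ / Real.pi * (Real.pi / u) := by field_simp
      have hp : 0 < Real.pi / u := by positivity
      constructor
      · have := hθ.1
        simp only [a] at this
        rw [e] at this
        have := lt_of_mul_lt_mul_right this hp.le
        push_cast; linarith
      · have := hθ.2
        simp only [a] at this
        rw [e] at this
        have := le_of_mul_le_mul_right this hp
        exact_mod_cast this
    rw [midpointOf, h1]
    norm_cast
  have hint : ∀ k < u, IntervalIntegrable (fun θ => h (midpointOf u θ)) volume (a k) (a (k + 1)) :=
    fun k _ => (intervalIntegrable_const
      (c := h ((2 * ((k + 1 : ℕ) : ℝ) - 1) / (2 * u) * Real.pi))).congr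
        fun θ hθ => (hpt k θ hθ).symm
  have h0 : a 0 = 0 := by simp [a]
  have hu1 : a u = Real.pi := by simp only [a]; field_simp
  rw [← h0, ← hu1, ← intervalIntegral.sum_integral_adjacent_intervals hint, hu1,
    ← Finset.Ico_succ_right_eq_Icc, Finset.sum_Ico_eq_sum_range, Finset.mul_sum]
  refine Finset.sum_congr rfl fun k _ => ?_
  rw [intervalIntegral.integral_congr_ae (.of_forall fun θ hθ => hpt k θ hθ),
    intervalIntegral.integral_const, smul_eq_mul, add_comm 1 k]
  simp only [a]
  push_cast
  ring

lemma measurable_comp_midpointOf (u : ℕ) (h : ℝ → ℝ) : Measurable fun θ => h (midpointOf u θ) := by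
  have h1 : Measurable fun z : ℤ => h ((2 * (z : ℝ) - 1) / (2 * u) * Real.pi) :=
    measurable_of_countable _
  exact h1.comp (Int.measurable_ceil.comp (by fun_prop))

lemma midpointOf_mem {u : ℕ} (hu : 0 < u) {θ : ℝ} (hθ : θ ∈ Set.Ioc 0 Real.pi) :
    midpointOf u θ ∈ Set.Ioo 0 Real.pi := by
  have hu' : (0 : ℝ) < u := Nat.cast_pos.2 hu
  have hπ := Real.pi_pos
  have h1 : 1 ≤ ⌈u * θ / Real.pi⌉ := by
    have : 0 < ⌈u * θ / Real.pi⌉ := Int.ceil_pos.2 (by have := hθ.1; positivity)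
    omega
  have h2 : ⌈u * θ / Real.pi⌉ ≤ u := by
    rw [Int.ceil_le]
    rw [div_le_iff₀ hπ]
    exact_mod_cast mul_le_mul_of_nonneg_left hθ.2 hu'.le
  have h1' : (1 : ℝ) ≤ ⌈u * θ / Real.pi⌉ := by exact_mod_cast h1
  have h2' : (⌈u * θ / Real.pi⌉ : ℝ) ≤ u := by exact_mod_cast h2
  rw [midpointOf]
  refine ⟨mul_pos (div_pos (by linarith) (by positivity)) hπ, ?_⟩
  refine mul_lt_of_lt_one_left hπ ?_
  rw [div_lt_one (by positivity)]
  linarith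

lemma cos_mem_Ioo {θ : ℝ} (hθ : θ ∈ Set.Ioo 0 Real.pi) : Real.cos θ ∈ Set.Ioo (-1 : ℝ) 1 := by
  have h0 : θ ∈ Set.Icc 0 Real.pi := Set.Ioo_subset_Icc_self hθ
  constructor
  · rw [← Real.cos_pi]
    exact Real.strictAntiOn_cos h0 ⟨Real.pi_pos.le, le_rfl⟩ hθ.2
  · rw [← Real.cos_zero]
    exact Real.strictAntiOn_cos ⟨le_rfl, Real.pi_pos.le⟩ h0 hθ.1

/-- Convergence of the Gauss-Chebyshev rule, the integrand being allowed to vary. -/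
lemma tendsto_gaussChebyshev {ι : Type*} {l : Filter ι} [l.IsCountablyGenerated] {u : ι → ℕ}
    (hu : Tendsto u l atTop) {g : ι → ℝ → ℝ} {g' : ℝ → ℝ} (hg' : Continuous g') {M : ℝ}
    (hM : ∀ᶠ i in l, ∀ x ∈ Set.Ioo (-1 : ℝ) 1, |g i x| ≤ M)
    (hg : ∀ x ∈ Set.Ioo (-1 : ℝ) 1,
      Tendsto (fun q : ι × ℝ => g q.1 q.2) (l ×ˢ 𝓝 x) (𝓝 (g' x))) :
    Tendsto (fun i => Real.pi / u i *
      ∑ k ∈ Finset.Icc 1 (u i), g i (node (u i) k) * Real.sqrt (1 - node (u i) k ^ 2)) l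
      (𝓝 (∫ x in (-1 : ℝ)..1, g' x)) := by
  have hπ := Real.pi_pos
  -- Under `x = cos θ` the weight `√(1 - x ^ 2)` is the Jacobian `sin θ`, so the rule is the
  -- midpoint rule in `θ`.
  have hsub : ∫ x in (-1 : ℝ)..1, g' x =
      ∫ θ in (0 : ℝ)..Real.pi, g' (Real.cos θ) * Real.sqrt (1 - Real.cos θ ^ 2) := by
    have h := intervalIntegral.integral_comp_mul_deriv (a := 0) (b := Real.pi)
      (f := Real.cos) (f' := fun θ => -Real.sin θ) (g := g')
      (fun θ _ => Real.hasDerivAt_cos θ) (by fun_prop) hg'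
    rw [Real.cos_zero, Real.cos_pi] at h
    rw [intervalIntegral.integral_symm, ← h, ← intervalIntegral.integral_neg]
    refine intervalIntegral.integral_congr fun θ hθ => ?_
    rw [Set.uIcc_of_le hπ.le] at hθ
    simp only [Function.comp_apply]
    rw [← Real.sin_sq, Real.sqrt_sq (Real.sin_nonneg_of_mem_Icc hθ)]
    ring
  have h1 : Tendsto (fun i => ∫ θ in (0 : ℝ)..Real.pi, g i (Real.cos (midpointOf (u i) θ)) *
      Real.sqrt (1 - Real.cos (midpointOf (u i) θ) ^ 2)) l
      (𝓝 (∫ θ in (0 : ℝ)..Real.pi, g' (Real.cos θ) * Real.sqrt (1 - Real.cos θ ^ 2))) := by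
    refine intervalIntegral.tendsto_integral_filter_of_dominated_convergence (fun _ => M)
      (.of_forall fun i => ?_) ?_ intervalIntegrable_const ?_
    · exact (measurable_comp_midpointOf (u i) fun θ => g i (Real.cos θ) *
        Real.sqrt (1 - Real.cos θ ^ 2)).aestronglyMeasurable
    · filter_upwards [hM, hu.eventually_gt_atTop 0] with i hi hi0
      refine .of_forall fun θ hθ => ?_
      rw [Set.uIoc_of_le hπ.le] at hθ
      have h2 := hi _ (cos_mem_Ioo (midpointOf_mem hi0 hθ))
      have h3 : Real.sqrt (1 - Real.cos (midpointOf (u i) θ) ^ 2) ≤ 1 :=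
        Real.sqrt_le_one.2 (by nlinarith [sq_nonneg (Real.cos (midpointOf (u i) θ))])
      rw [Real.norm_eq_abs, abs_mul, abs_of_nonneg (Real.sqrt_nonneg _)]
      exact (mul_le_of_le_one_right (abs_nonneg _) h3).trans h2
    · filter_upwards [compl_mem_ae_iff.2 (measure_singleton Real.pi)] with θ hθπ hθ
      rw [Set.uIoc_of_le hπ.le] at hθ
      have hθ' : θ ∈ Set.Ioo 0 Real.pi := ⟨hθ.1, lt_of_le_of_ne hθ.2 (by simpa using hθπ)⟩
      have h2 : Tendsto (fun i => Real.cos (midpointOf (u i) θ)) l (𝓝 (Real.cos θ)) :=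
        (Real.continuous_cos.tendsto θ).comp (tendsto_midpointOf hu θ)
      have h3 := (hg _ (cos_mem_Ioo hθ')).comp (tendsto_id.prodMk h2)
      have h4 : Continuous fun x : ℝ => Real.sqrt (1 - x ^ 2) := by fun_prop
      exact h3.mul ((h4.tendsto _).comp h2)
  rw [hsub]
  refine h1.congr' ?_
  filter_upwards [hu.eventually_gt_atTop 0] with i hi
  exact integral_comp_midpointOf hi fun θ => g i (Real.cos θ) * Real.sqrt (1 - Real.cos θ ^ 2)

/-- The parameter of the inner rule moves while the number of nodes grows; the outer rule needs this
joint limit. The function summed has to coincide with its continuous version only near `r`. -/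
lemma tendsto_gaussChebyshev_param {w W : ℝ → ℝ → ℝ} {c : ℝ → ℝ} {r M : ℝ} (hc : Continuous c)
    (hw : Continuous fun q : ℝ × ℝ => w q.1 q.2) (hM : ∀ᶠ s in 𝓝 r, ∀ ω, |w s ω| ≤ M)
    (hW : ∀ᶠ s in 𝓝 r, ∀ ω, W s ω = w s ω) :
    Tendsto (fun q : ℕ × ℝ => Real.pi / q.1 * ∑ k ∈ Finset.Icc 1 q.1,
        W q.2 (c (node q.1 k)) * Real.sqrt (1 - node q.1 k ^ 2)) (atTop ×ˢ 𝓝 r)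
      (𝓝 (∫ x in (-1 : ℝ)..1, w r (c x))) := by
  have h1 : Continuous fun x => (r, c x) := by fun_prop
  have h2 : Continuous fun q : ℝ × ℝ => (q.1, c q.2) := by fun_prop
  refine tendsto_gaussChebyshev (M := M) (u := fun q : ℕ × ℝ => q.1)
    (g := fun q x => W q.2 (c x)) tendsto_fst (hw.comp h1) ?_ fun x _ => ?_
  · filter_upwards [tendsto_snd.eventually hM, tendsto_snd.eventually hW] with q h3 h4 x _
    rw [h4]
    exact h3 _
  · have h5 : Tendsto (fun q : (ℕ × ℝ) × ℝ => (q.1.2, q.2)) ((atTop ×ˢ 𝓝 r) ×ˢ 𝓝 x)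
        (𝓝 (r, x)) := (tendsto_snd.comp tendsto_fst).prodMk_nhds tendsto_snd
    refine (((hw.comp h2).tendsto (r, x)).comp h5).congr' ?_
    filter_upwards [tendsto_fst.eventually (tendsto_snd.eventually hW)] with q hq
    exact (hq _).symm

/-- The function evaluated by the outer rule changes with the number of inner nodes. Convergence
along moving points and a uniform bound suffice for the limit in both numbers jointly, with no
relation between them. -/
lemma tendsto_gaussChebyshev_joint {F : ℕ → ℝ → ℝ} {D c : ℝ → ℝ} {s : Set ℝ} {M : ℝ}
    (hc : Continuous c) (hs : ∀ x ∈ Set.Ioo (-1 : ℝ) 1, c x ∈ s) (hD : Continuous D)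
    (hM : ∀ u, ∀ r ∈ s, |F u r| ≤ M)
    (hF : ∀ r ∈ s, Tendsto (fun q : ℕ × ℝ => F q.1 q.2) (atTop ×ˢ 𝓝 r) (𝓝 (D r))) :
    Tendsto (fun u : ℕ × ℕ => Real.pi / u.2 * ∑ k ∈ Finset.Icc 1 u.2,
        F u.1 (c (node u.2 k)) * Real.sqrt (1 - node u.2 k ^ 2)) atTop
      (𝓝 (∫ x in (-1 : ℝ)..1, D (c x))) := by
  refine tendsto_gaussChebyshev (M := M) (u := fun u : ℕ × ℕ => u.2) (g := fun u x => F u.1 (c x))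
    (tendsto_snd.mono_left prod_atTop_atTop_eq.ge) (hD.comp hc)
    (.of_forall fun u x hx => hM _ _ (hs x hx)) fun x hx => ?_
  have h1 : Tendsto (fun q : (ℕ × ℕ) × ℝ => (q.1.1, c q.2)) (atTop ×ˢ 𝓝 x)
      (atTop ×ˢ 𝓝 (c x)) :=
    ((tendsto_fst.mono_left prod_atTop_atTop_eq.ge).comp tendsto_fst).prodMk
      ((hc.tendsto x).comp tendsto_snd)
  exact (hF _ (hs x hx)).comp h1

end Quadrature

section Gain

/-- `sin (N θ) / sin θ` is the Chebyshev polynomial of the second kind of degree `N - 1` in `cos θ`.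
The gain is thus a polynomial in a cosine, hence continuous through its removable singularities. -/
lemma arrayGain_eq {N : ℕ} (hN : 0 < N) (ω : ℝ) :
    arrayGain N ω = ((Polynomial.Chebyshev.U ℝ ((N : ℤ) - 1)).eval (Real.cos (Real.pi * ω)) / N) ^ 2 := by
  have hN' : (N : ℝ) ≠ 0 := (Nat.cast_pos.2 hN).ne'
  rw [arrayGain]
  split_ifs with h
  · have h1 : Real.cos (Real.pi * ω) ^ 2 = 1 := by
      have := Real.sin_sq_add_cos_sq (Real.pi * ω)
      rw [h] at this
      linarith
    rcases sq_eq_one_iff.1 h1 with h1 | h1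
    · rw [h1, Polynomial.Chebyshev.U_eval_one]
      push_cast
      rw [sub_add_cancel, div_self hN', one_pow]
    · rw [h1, Polynomial.Chebyshev.U_eval_neg_one]
      push_cast
      rw [sub_add_cancel, mul_div_assoc, div_self hN', mul_one]
      rcases Int.units_eq_one_or (Int.negOnePow ((N : ℤ) - 1)) with h2 | h2 <;> rw [h2] <;> simp
  · have h1 := Polynomial.Chebyshev.U_real_cos (Real.pi * ω) ((N : ℤ) - 1)
    push_cast at h1
    rw [sub_add_cancel] at h1
    rw [show Real.pi * N * ω = N * (Real.pi * ω) by ring, ← h1]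
    field_simp

lemma Params.continuous_gain_pico (par : Params) : Continuous (par.gain .picoBS) := by
  have h : par.gain .picoBS = fun ω => arrayGain (par.N .picoBS) ω := rfl
  rw [h]
  simp_rw [arrayGain_eq (par.N_pos .picoBS)]
  have h1 := (Polynomial.Chebyshev.U ℝ ((par.N .picoBS : ℤ) - 1)).continuous
  exact ((h1.comp (by fun_prop : Continuous fun ω => Real.cos (Real.pi * ω))).div_const _).pow 2

/-- The factor `1 / 2` is the uniform density on `[-1, 1]`; with the weight `π / u₁` of the rule it
accounts for `π ^ 2 λ₂ / (2 u₁)`. -/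
lemma Params.integral_angleLaw (par : Params) (h : ℝ → ℝ) :
    ∫ ω, h ω ∂par.angleLaw = (1 / 2) * ∫ x in (-1 : ℝ)..1, h (x * par.d / par.wavelength) := by
  have ha : 0 < par.d / par.wavelength := div_pos par.d_pos par.wavelength_pos
  simp_rw [mul_div_assoc]
  generalize hb : par.d / par.wavelength = a at ha
  have hv : volume (Set.Icc (-a) a) = ENNReal.ofReal (2 * a) := by
    rw [Real.volume_Icc]; congr 1; ring
  rw [Params.angleLaw, hb, ProbabilityTheory.cond, integral_smul_measure, integral_Icc_eq_integral_Ioc,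
    ← intervalIntegral.integral_of_le (by linarith), intervalIntegral.integral_comp_mul_right _ ha.ne',
    hv, ENNReal.toReal_inv, ENNReal.toReal_ofReal (by linarith)]
  simp only [smul_eq_mul, neg_one_mul, one_mul]
  rw [mul_inv]
  ring

end Gain

end

/-! ### The limit of the approximate pico expression. -/

section

variable {Ω : Type*} [MeasurableSpace Ω] {P : Measure Ω} [IsProbabilityMeasure P] {par : Params}
  {E : Elements Ω} {f : ℕ}

namespace Params

variable (par : Params) (f : ℕ)

/-- The limit of `F_R` as the number of Gauss-Chebyshev nodes tends to infinity. -/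
def picoDensity (κ r : ℝ) : ℝ :=
  Real.exp (-(Real.pi * par.lam .picoBS * (par.RL ^ 2 + ∫ ω, par.picoW f κ r ω ∂par.angleLaw))) *
    (2 * Real.pi * par.p .picoBS f * par.lam .picoBS * r *
      Real.exp (-(Real.pi * par.p .macroBS f * par.lam .macroBS * par.exclRadius .picoBS r ^ 2)))

lemma continuous_picoW (κ : ℝ) : Continuous fun q : ℝ × ℝ => par.picoW f κ q.1 q.2 := by
  have hα := par.alpha_pos .picoBS
  have h1 : Continuous fun q : ℝ × ℝ => par.picoScale κ q.1 q.2 := by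
    have h2 : Continuous fun q : ℝ × ℝ => q.1 ^ par.alpha .picoBS :=
      continuous_fst.rpow_const fun _ => Or.inr hα.le
    have h3 : Continuous fun q : ℝ × ℝ => par.gain .picoBS q.2 :=
      par.continuous_gain_pico.comp continuous_snd
    exact ((h2.const_mul κ).mul h3).div_const _
  have h4 := continuous_radialInt (α := par.alpha .picoBS) par.Nak_cast_pos.le
  exact ((h4.comp (h1.prodMk continuous_fst)).const_mul _).sub
    (h4.comp (h1.prodMk continuous_const))

lemma continuous_integral_picoW (κ : ℝ) :
    Continuous fun r => ∫ ω, par.picoW f κ r ω ∂par.angleLaw := by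
  simp_rw [par.integral_angleLaw]
  refine Continuous.const_mul ?_ _
  have h2 := par.continuous_picoW f κ
  generalize par.picoW f κ = w at h2
  have h1 : Continuous fun q : ℝ × ℝ => (q.1, q.2 * par.d / par.wavelength) := by fun_prop
  have h3 : Continuous (Function.uncurry fun r x => w r (x * par.d / par.wavelength)) :=
    h2.comp h1
  exact intervalIntegral.continuous_parametric_intervalIntegral_of_continuous' h3 _ _

lemma continuous_picoDensity (κ : ℝ) : Continuous (par.picoDensity f κ) := by
  have h1 := par.continuous_integral_picoW f κ
  have h2 : Continuous fun r => par.exclRadius .picoBS r := by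
    have hα := par.alpha_pos .picoBS
    have hα' := par.alpha_pos .macroBS
    simp only [exclRadius]
    exact (continuous_const.mul (continuous_id.rpow_const fun _ => Or.inr hα.le)).rpow_const
      fun _ => Or.inr (by positivity)
  unfold picoDensity
  fun_prop

lemma servingDensity_pico {r : ℝ} (hr : 0 ≤ r) (hrR : r ≤ par.RL) :
    par.servingDensity f .picoBS r = 2 * Real.pi * par.p .picoBS f * par.lam .picoBS * r *
      Real.exp (-(Real.pi * par.p .macroBS f * par.lam .macroBS * par.exclRadius .picoBS r ^ 2 +
        Real.pi * par.p .picoBS f * par.lam .picoBS * r ^ 2)) := by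
  have hself : par.alphaRatio .picoBS .picoBS = 1 := div_self (par.alpha_pos _).ne'
  simp only [Params.servingDensity, par.powerRatio_self, Real.one_rpow, mul_one, hself, div_one,
    Real.rpow_two, exclRadius]
  rw [unitStep_of_nonneg (sub_nonneg.2 hrR), sq_rpow_mul_rpow (par.powerRatio_pos _ _).le hr
    (par.alpha_pos _).ne', mul_one, Params.alphaRatio]
  congr 2
  ring

/-- The threshold `τ` and the Laplace argument occur only through their product, so they combine
into `κ = n η τ`. -/
lemma W_eq_picoW (n : ℕ) {r ω τ : ℝ} (hr : 0 < r) (hτ : 0 ≤ τ) :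
    par.W f r ω (n * etaL par.Nak * r ^ par.alpha .picoBS / G0) τ =
      par.picoW f (n * etaL par.Nak * τ) r ω := by
  have := etaL_pos par.Nak_pos
  rw [par.W_eq f hr (by rw [G0]; positivity) hτ, picoW]
  have h : n * etaL par.Nak * r ^ par.alpha .picoBS / G0 * par.gain .picoBS ω * τ / par.Nak =
      par.picoScale (n * etaL par.Nak * τ) r ω := by
    rw [picoScale, G0, div_one]; ring
  rw [h]

end Params

lemma IsNetwork.tendsto_sum_W (hE : IsNetwork par P E) (f n : ℕ) {τ r : ℝ} (hτ : 0 ≤ τ)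
    (hr : 0 < r) :
    Tendsto (fun q : ℕ × ℝ => Real.pi / q.1 * ∑ k ∈ Finset.Icc 1 q.1,
        par.W f q.2 (node q.1 k * par.d / par.wavelength)
          (n * etaL par.Nak * q.2 ^ par.alpha .picoBS / G0) τ * Real.sqrt (1 - node q.1 k ^ 2))
      (atTop ×ˢ 𝓝 r)
      (𝓝 (∫ x in (-1 : ℝ)..1,
        par.picoW f (n * etaL par.Nak * τ) r (x * par.d / par.wavelength))) := by
  have hc := par.continuous_picoW f (n * etaL par.Nak * τ)
  have hbd : ∀ᶠ s in 𝓝 r, ∀ ω, |par.picoW f (n * etaL par.Nak * τ) s ω| ≤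
      max (par.RL ^ 2) ((r + 1) ^ 2) := by
    filter_upwards [Ioo_mem_nhds hr (lt_add_one r)] with s hs ω
    obtain ⟨h1, h2⟩ := hE.picoW_mem_Icc f (n * etaL par.Nak * τ) (le_of_lt hs.1) ω
    have h3 : s ^ 2 ≤ (r + 1) ^ 2 := pow_le_pow_left₀ (le_of_lt hs.1) (le_of_lt hs.2) 2
    exact abs_le.2 ⟨by linarith [le_max_left (par.RL ^ 2) ((r + 1) ^ 2)],
      h2.trans (h3.trans (le_max_right _ _))⟩
  have hW : ∀ᶠ s in 𝓝 r, ∀ ω,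
      par.W f s ω (n * etaL par.Nak * s ^ par.alpha .picoBS / G0) τ =
      par.picoW f (n * etaL par.Nak * τ) s ω := by
    filter_upwards [lt_mem_nhds hr] with s hs ω
    exact par.W_eq_picoW f n hs hτ
  exact tendsto_gaussChebyshev_param
    (W := fun s ω => par.W f s ω (n * etaL par.Nak * s ^ par.alpha .picoBS / G0) τ)
    (c := fun x => x * par.d / par.wavelength) (by fun_prop) hc hbd hW

lemma IsNetwork.tendsto_L2 (hE : IsNetwork par P E) (f n : ℕ) {τ r : ℝ} (hτ : 0 ≤ τ) (hr : 0 < r) :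
    Tendsto (fun q : ℕ × ℝ =>
        par.L2 f q.1 q.2 (n * etaL par.Nak * q.2 ^ par.alpha .picoBS / G0) τ) (atTop ×ˢ 𝓝 r)
      (𝓝 (Real.exp (-Real.pi * par.lam .picoBS * (par.RL ^ 2 - par.p .picoBS f * r ^ 2) -
        Real.pi * par.lam .picoBS *
          ∫ ω, par.picoW f (n * etaL par.Nak * τ) r ω ∂par.angleLaw))) := by
  have hquad := hE.tendsto_sum_W f n hτ hr
  have h1 : Tendsto (fun q : ℕ × ℝ => q.2) (atTop ×ˢ 𝓝 r) (𝓝 r) := tendsto_snd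
  have h2 := (Real.continuous_exp.tendsto _).comp
    ((((h1.pow 2).const_mul (par.p .picoBS f)).const_sub (par.RL ^ 2)).const_mul
      (-Real.pi * par.lam .picoBS) |>.sub (hquad.const_mul (Real.pi * par.lam .picoBS / 2)))
  rw [par.integral_angleLaw, ← mul_assoc (Real.pi * _), mul_one_div]
  refine h2.congr fun q => ?_
  rw [Params.L2, Function.comp_apply]
  congr 2
  rw [← mul_assoc]
  congr 1
  rcases Nat.eq_zero_or_pos q.1 with h0 | h0
  · simp [h0]
  · have : (0 : ℝ) < q.1 := Nat.cast_pos.2 h0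
    field_simp

/-- Each term of the rule is at least `-R_L ^ 2`, a bound independent of the number of nodes; it
provides the domination for the outer rule. -/
lemma IsNetwork.L2_le (hE : IsNetwork par P E) (f n u : ℕ) {τ r : ℝ} (hτ : 0 ≤ τ) (hr : 0 < r)
    (hrR : r ≤ par.RL) :
    par.L2 f u r (n * etaL par.Nak * r ^ par.alpha .picoBS / G0) τ ≤
      Real.exp (Real.pi ^ 2 * par.lam .picoBS / 2 * par.RL ^ 2) := by
  have hl := par.lam_pos .picoBS
  have hp1 := hE.p_le_one .picoBS f
  have hπ := Real.pi_pos
  rw [Params.L2]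
  refine Real.exp_le_exp.2 ?_
  have h1 : 0 ≤ Real.pi * par.lam .picoBS * (par.RL ^ 2 - par.p .picoBS f * r ^ 2) := by
    have : r ^ 2 ≤ par.RL ^ 2 := pow_le_pow_left₀ hr.le hrR 2
    exact mul_nonneg (by positivity) (by nlinarith [sq_nonneg r])
  have h2 : -(u * par.RL ^ 2) ≤ ∑ k ∈ Finset.Icc 1 u,
      par.W f r (node u k * par.d / par.wavelength)
        (n * etaL par.Nak * r ^ par.alpha .picoBS / G0) τ * Real.sqrt (1 - node u k ^ 2) := by
    have h3 : ∑ _k ∈ Finset.Icc 1 u, -par.RL ^ 2 = -(u * par.RL ^ 2) := by simp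
    rw [← h3]
    refine Finset.sum_le_sum fun k _ => ?_
    rw [par.W_eq_picoW f n hr hτ]
    have h4 := (hE.picoW_mem_Icc f (n * etaL par.Nak * τ) hr.le
      (node u k * par.d / par.wavelength)).1
    have h5 : Real.sqrt (1 - node u k ^ 2) ≤ 1 :=
      Real.sqrt_le_one.2 (by nlinarith [sq_nonneg (node u k)])
    have h6 := Real.sqrt_nonneg (1 - node u k ^ 2)
    nlinarith [sq_nonneg par.RL]
  have h3 := mul_le_mul_of_nonneg_left h2
    (by positivity : 0 ≤ Real.pi ^ 2 * par.lam .picoBS / (2 * u))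
  have h4 : -(Real.pi ^ 2 * par.lam .picoBS / 2 * par.RL ^ 2) ≤
      Real.pi ^ 2 * par.lam .picoBS / (2 * u) * -(u * par.RL ^ 2) := by
    -- With no nodes the quotient is `0` by the convention for division by zero, and the bound still
    -- holds.
    rcases Nat.eq_zero_or_pos u with h0 | h0
    · simp only [h0, Nat.cast_zero, mul_zero, div_zero, zero_mul]
      have : 0 ≤ Real.pi ^ 2 * par.lam .picoBS / 2 * par.RL ^ 2 := by positivity
      linarith
    · have : (0 : ℝ) < u := Nat.cast_pos.2 h0
      refine le_of_eq ?_
      field_simp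
  linarith

/-- The unit step at `R_L` restricts the continuity in `r` to the open interval, which contains all
outer nodes. -/
lemma IsNetwork.tendsto_FR (hE : IsNetwork par P E) (f n : ℕ) {τ r : ℝ} (hτ : 0 ≤ τ) (hr : 0 < r)
    (hrR : r < par.RL) :
    Tendsto (fun q : ℕ × ℝ => par.FR f q.1 n q.2 τ) (atTop ×ˢ 𝓝 r)
      (𝓝 (par.picoDensity f (n * etaL par.Nak * τ) r)) := by
  have h1 := hE.tendsto_L2 f n hτ hr
  set D : ℝ → ℝ := fun r => 2 * Real.pi * par.p .picoBS f * par.lam .picoBS * r *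
    Real.exp (-(Real.pi * par.p .macroBS f * par.lam .macroBS * par.exclRadius .picoBS r ^ 2 +
      Real.pi * par.p .picoBS f * par.lam .picoBS * r ^ 2)) with hD
  have h2 : Continuous D := by
    have hα := par.alpha_pos .picoBS
    have hα' := par.alpha_pos .macroBS
    have h3 : Continuous fun r => par.exclRadius .picoBS r := by
      simp only [Params.exclRadius]
      exact (continuous_const.mul (continuous_id.rpow_const fun _ => Or.inr hα.le)).rpow_const
        fun _ => Or.inr (by positivity)
    rw [hD]
    fun_prop
  have h3 : Tendsto (fun q : ℕ × ℝ => D q.2) (atTop ×ˢ 𝓝 r) (𝓝 (D r)) :=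
    (h2.tendsto r).comp tendsto_snd
  have h4 := h1.mul h3
  have h5 : par.picoDensity f (n * etaL par.Nak * τ) r =
      Real.exp (-Real.pi * par.lam .picoBS * (par.RL ^ 2 - par.p .picoBS f * r ^ 2) -
        Real.pi * par.lam .picoBS *
          ∫ ω, par.picoW f (n * etaL par.Nak * τ) r ω ∂par.angleLaw) * D r := by
    -- The factor `exp (π λ₂ p r ^ 2)` in the Laplace transform cancels the own-tier void
    -- probability in the serving density.
    rw [Params.picoDensity, hD]
    simp only
    rw [mul_left_comm, ← Real.exp_add, mul_left_comm (Real.exp _), ← Real.exp_add]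
    congr 2
    ring
  rw [h5]
  refine h4.congr' ?_
  filter_upwards [tendsto_snd.eventually (Ioo_mem_nhds hr hrR)] with q hq
  rw [Params.FR, par.servingDensity_pico f (le_of_lt hq.1) (le_of_lt hq.2)]

lemma IsNetwork.abs_FR_le (hE : IsNetwork par P E) (f n u : ℕ) {τ r : ℝ} (hτ : 0 ≤ τ) (hr : 0 < r)
    (hrR : r ≤ par.RL) :
    |par.FR f u n r τ| ≤ Real.exp (Real.pi ^ 2 * par.lam .picoBS / 2 * par.RL ^ 2) *
      (2 * Real.pi * par.p .picoBS f * par.lam .picoBS * par.RL) := by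
  have hl := par.lam_pos .picoBS
  have hl' := par.lam_pos .macroBS
  have hp := hE.p_nonneg .picoBS f
  have hp' := hE.p_nonneg .macroBS f
  have h1 := hE.L2_le f n u hτ hr hrR
  have h2 := hE.servingDensity_nonneg f .picoBS hr.le
  have h0 : 0 ≤ par.L2 f u r (n * etaL par.Nak * r ^ par.alpha .picoBS / G0) τ :=
    Real.exp_nonneg _
  rw [Params.FR, abs_of_nonneg (mul_nonneg h0 h2)]
  refine mul_le_mul h1 ?_ h2 (Real.exp_nonneg _)
  rw [par.servingDensity_pico f hr.le hrR]
  refine (mul_le_of_le_one_right (by positivity) (Real.exp_le_one_iff.2 ?_)).trans ?_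
  · have h3 : 0 ≤ Real.pi * par.p .macroBS f * par.lam .macroBS * par.exclRadius .picoBS r ^ 2 +
        Real.pi * par.p .picoBS f * par.lam .picoBS * r ^ 2 := by positivity
    linarith
  · gcongr

lemma IsNetwork.tendsto_sum_FR (hE : IsNetwork par P E) (f n : ℕ) {τ : ℝ} (hτ : 0 ≤ τ) :
    Tendsto (fun u : ℕ × ℕ => Real.pi / u.2 * ∑ k ∈ Finset.Icc 1 u.2,
      par.FR f u.1 n ((node u.2 k + 1) * par.RL / 2) τ * Real.sqrt (1 - node u.2 k ^ 2)) atTop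
      (𝓝 (∫ x in (-1 : ℝ)..1, par.picoDensity f (n * etaL par.Nak * τ)
        ((x + 1) * par.RL / 2))) := by
  have hR := par.RL_pos
  have hmem : ∀ x ∈ Set.Ioo (-1 : ℝ) 1, (x + 1) * par.RL / 2 ∈ Set.Ioo 0 par.RL := fun x hx => by
    have h1 : 0 < x + 1 := by linarith [hx.1]
    exact ⟨by positivity, by nlinarith [hx.2]⟩
  exact tendsto_gaussChebyshev_joint (F := fun u r => par.FR f u n r τ)
    (c := fun x => (x + 1) * par.RL / 2) (by fun_prop) hmem
    (par.continuous_picoDensity f (n * etaL par.Nak * τ))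
    (fun u r hr => hE.abs_FR_le f n u hτ hr.1 hr.2.le) fun r hr => hE.tendsto_FR f n hτ hr.1 hr.2

lemma Params.integral_picoDensity (par : Params) (f : ℕ) (κ : ℝ) :
    par.RL / 2 * ∫ x in (-1 : ℝ)..1, par.picoDensity f κ ((x + 1) * par.RL / 2) =
      ∫ r in (0 : ℝ)..par.RL, par.picoDensity f κ r := by
  have h3 := intervalIntegral.mul_integral_comp_mul_add (a := -1) (b := 1)
    (f := par.picoDensity f κ) (par.RL / 2) (par.RL / 2)
  have e1 : par.RL / 2 * -1 + par.RL / 2 = 0 := by ring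
  have e2 : par.RL / 2 * 1 + par.RL / 2 = par.RL := by ring
  rw [e1, e2] at h3
  rw [← h3]
  congr 1
  refine intervalIntegral.integral_congr fun x _ => ?_
  congr 1
  ring

/-- The limit of the approximate expression as the numbers of nodes tend to infinity. -/
theorem IsNetwork.tendsto_coverageApprox (hE : IsNetwork par P E) (f : ℕ) {τ : ℝ} (hτ : 0 ≤ τ) :
    Tendsto (fun u : ℕ × ℕ => par.coverageApprox f u.1 u.2 τ) atTop
      (𝓝 (∑ n ∈ Finset.Icc 1 par.Nak, (-1 : ℝ) ^ (n + 1) * (par.Nak.choose n : ℝ) *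
        ∫ r in (0 : ℝ)..par.RL, par.picoDensity f (n * etaL par.Nak * τ) r)) := by
  have h3 := tendsto_finsetSum (Finset.Icc 1 par.Nak) fun n _ =>
    ((hE.tendsto_sum_FR f n hτ).const_mul (par.RL / 2)).const_mul
      ((-1 : ℝ) ^ (n + 1) * (par.Nak.choose n : ℝ))
  simp only [par.integral_picoDensity f] at h3
  refine h3.congr fun u => ?_
  rw [Params.coverageApprox, Finset.mul_sum]
  refine Finset.sum_congr rfl fun n _ => ?_
  have e : Real.pi * par.RL / (2 * (u.2 : ℝ)) = par.RL / 2 * (Real.pi / u.2) := by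
    rw [mul_comm Real.pi, mul_div_mul_comm]
  rw [e]
  ring

end

/-! ### Comparison of the pico coverage with the limit. -/

section

section Comparison

lemma sum_choose_mul_pow (N : ℕ) (e : ℝ) :
    ∑ n ∈ Finset.Icc 1 N, (-1 : ℝ) ^ (n + 1) * (N.choose n : ℝ) * e ^ n = 1 - (1 - e) ^ N := by
  have h1 : (1 - e) ^ N = ∑ n ∈ Finset.range (N + 1), (-1 : ℝ) ^ n * (N.choose n : ℝ) * e ^ n := by
    rw [sub_eq_neg_add, add_pow]
    refine Finset.sum_congr rfl fun n _ => ?_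
    rw [neg_pow]; ring
  rw [h1, Finset.sum_range_succ', ← Finset.Ico_succ_right_eq_Icc, Finset.sum_Ico_eq_sum_range]
  simp only [pow_zero, Nat.choose_zero_right, Nat.cast_one, mul_one, sub_add_cancel_right]
  rw [← Finset.sum_neg_distrib]
  refine Finset.sum_congr (by simp) fun n _ => ?_
  rw [add_comm 1 n]
  ring

lemma integrable_of_mem_Icc {X : Type*} [MeasurableSpace X] {ν : Measure X} [IsFiniteMeasure ν]
    {h : X → ℝ} (hm : Measurable h) (h01 : ∀ x, h x ∈ Set.Icc (0 : ℝ) 1) : Integrable h ν :=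
  Integrable.of_bound hm.aestronglyMeasurable 1 (.of_forall fun x => by
    rw [Real.norm_eq_abs, abs_of_nonneg (h01 x).1]; exact (h01 x).2)

/-- Comparison of the tail of the Gamma distribution and the alternating sum of exponentials. -/
lemma gammaTail_comparison {X : Type*} [MeasurableSpace X] (ν : Measure X) [IsFiniteMeasure ν]
    {γ : X → ℝ} (hγ : Measurable γ) (h0 : ∀ x, 0 ≤ γ x) {N : ℕ} (hN : 0 < N) :
    ∫ x, (1 - cdf (gammaMeasure N N) (γ x)) ∂ν ≤
        ∑ n ∈ Finset.Icc 1 N, (-1 : ℝ) ^ (n + 1) * (N.choose n : ℝ) *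
          ∫ x, Real.exp (-(n * etaL N * γ x)) ∂ν ∧
      (∑ n ∈ Finset.Icc 1 N, (-1 : ℝ) ^ (n + 1) * (N.choose n : ℝ) *
          ∫ x, Real.exp (-(n * etaL N * γ x)) ∂ν) - ∫ x, (1 - cdf (gammaMeasure N N) (γ x)) ∂ν ≤
        gammaGap N * ν.real Set.univ := by
  have hη := etaL_pos hN
  have hcdf : Measurable fun x => cdf (gammaMeasure N N) (γ x) :=
    (monotone_cdf (gammaMeasure N N)).measurable.comp hγ
  have hi1 : Integrable (fun x => cdf (gammaMeasure N N) (γ x)) ν :=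
    integrable_of_mem_Icc hcdf fun x => ⟨cdf_nonneg _ _, cdf_le_one _ _⟩
  have hi2 : Integrable (fun x => (1 - Real.exp (-(etaL N * γ x))) ^ N) ν :=
    integrable_of_mem_Icc (by fun_prop) fun x => one_sub_exp_pow_mem_Icc N hη.le (h0 x)
  have hi3 : ∀ n : ℕ, Integrable (fun x => Real.exp (-(n * etaL N * γ x))) ν := fun n =>
    integrable_of_mem_Icc (by fun_prop) fun x => ⟨(Real.exp_pos _).le, Real.exp_le_one_iff.2 (by
      have := h0 x
      have : 0 ≤ n * etaL N * γ x := by positivity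
      linarith)⟩
  have hsum : ∑ n ∈ Finset.Icc 1 N, (-1 : ℝ) ^ (n + 1) * (N.choose n : ℝ) *
      ∫ x, Real.exp (-(n * etaL N * γ x)) ∂ν =
      ∫ x, (1 - (1 - Real.exp (-(etaL N * γ x))) ^ N) ∂ν := by
    simp_rw [← integral_const_mul]
    rw [← integral_finsetSum _ fun n _ => (hi3 n).const_mul _]
    refine integral_congr_ae (.of_forall fun x => ?_)
    simp only
    rw [← sum_choose_mul_pow]
    refine Finset.sum_congr rfl fun n _ => ?_
    rw [← Real.exp_nat_mul]
    congr 2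
    ring
  have hc : Integrable (fun _ : X => (1 : ℝ)) ν := integrable_const _
  rw [hsum]
  constructor
  · refine integral_mono (hc.sub hi1) (hc.sub hi2) fun x => ?_
    simp only
    linarith [one_sub_exp_pow_le_cdf hN (h0 x)]
  · have hi4 : Integrable (fun x => 1 - (1 - Real.exp (-(etaL N * γ x))) ^ N) ν := hc.sub hi2
    have hi5 : Integrable (fun x => 1 - cdf (gammaMeasure N N) (γ x)) ν := hc.sub hi1
    rw [← integral_sub hi4 hi5]
    have h1 : ∫ _x : X, gammaGap N ∂ν = gammaGap N * ν.real Set.univ := by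
      rw [integral_const, smul_eq_mul, mul_comm]
    rw [← h1]
    refine integral_mono (hi4.sub hi5) (integrable_const _) fun x => ?_
    simp only
    linarith [cdf_sub_le_gammaGap hN (h0 x)]

end Comparison

variable {Ω : Type*} [MeasurableSpace Ω] {P : Measure Ω} [IsProbabilityMeasure P] {par : Params}
  {E : Elements Ω} {f : ℕ}

lemma IsNetwork.picoDensity_nonneg (hE : IsNetwork par P E) (f : ℕ) (κ : ℝ) {r : ℝ} (hr : 0 ≤ r) :
    0 ≤ par.picoDensity f κ r := by
  have hl := par.lam_pos .picoBS
  have hp := hE.p_nonneg .picoBS f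
  rw [Params.picoDensity]
  positivity

/-- The Laplace transform of the interference at the serving base station of the pico tier. -/
lemma IsNetwork.tsum_laplace_pico (hE : IsNetwork par P E) (f : ℕ) {κ : ℝ} (hκ : 0 ≤ κ) :
    ∑' n, ∫⁻ w, par.rangeInd .picoBS ‖E.loc .picoBS n w‖ *
        (nearest E f .picoBS (par.exclRadius .picoBS) n w *
          expNeg (ENNReal.ofReal (κ * ‖E.loc .picoBS n w‖ ^ par.alpha .picoBS) *
            unitInterference par E .picoBS n w)) ∂P =
      ENNReal.ofReal (∫ r in (0 : ℝ)..par.RL, par.picoDensity f κ r) := by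
  have hl := par.lam_pos .picoBS
  have hl' := par.lam_pos .macroBS
  have hp := hE.p_nonneg .picoBS f
  have hp' := hE.p_nonneg .macroBS f
  have hR := par.RL_pos
  have hc := par.continuous_picoDensity f κ
  let D : ℝ → ℝ := fun r => Real.exp (-(Real.pi * par.lam .picoBS *
      (par.RL ^ 2 + ∫ ω, par.picoW f κ r ω ∂par.angleLaw))) *
    (par.p .picoBS f *
      Real.exp (-(Real.pi * par.p .macroBS f * par.lam .macroBS * par.exclRadius .picoBS r ^ 2)))
  have hDm : Measurable D := by
    have h1 := (par.continuous_integral_picoW f κ).measurable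
    have h2 := par.measurable_exclRadius .picoBS
    simp only [D]
    fun_prop
  have hF : Measurable fun r => (Set.Iic par.RL).indicator (fun r => ENNReal.ofReal (D r)) r :=
    hDm.ennreal_ofReal.indicator measurableSet_Iic
  rw [hE.mecke f .picoBS (par.measurable_rangeInd _) (par.rangeInd_le_one _)
    (par.measurable_exclRadius _) hκ, lintegral_congr (g := fun x : Plane =>
      (Set.Iic par.RL).indicator (fun r => ENNReal.ofReal (D r)) ‖x‖),
    lintegral_fun_norm_intensity hl.le hF]
  · have h1 : ∀ r ∈ Set.Ioi (0 : ℝ), ENNReal.ofReal (2 * Real.pi * par.lam .picoBS * r) *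
        (Set.Iic par.RL).indicator (fun r => ENNReal.ofReal (D r)) r =
        (Set.Iic par.RL).indicator (fun r => ENNReal.ofReal (par.picoDensity f κ r)) r :=
      fun r hr => by
        have hr : 0 < r := hr
        by_cases h : r ≤ par.RL
        · rw [Set.indicator_of_mem (Set.mem_Iic.2 h), Set.indicator_of_mem (Set.mem_Iic.2 h),
            ← ENNReal.ofReal_mul (by positivity), Params.picoDensity]
          congr 1
          simp only [D]
          ring
        · rw [Set.indicator_of_notMem (by simpa using h), Set.indicator_of_notMem (by simpa using h),
            mul_zero]
    rw [setLIntegral_congr_fun measurableSet_Ioi h1, setLIntegral_indicator measurableSet_Iic,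
      Set.inter_comm, Set.Ioi_inter_Iic, intervalIntegral.integral_of_le hR.le,
      ofReal_integral_eq_lintegral_ofReal hc.integrableOn_Ioc
        ((ae_restrict_iff' measurableSet_Ioc).2 (.of_forall fun r hr =>
          hE.picoDensity_nonneg f κ hr.1.le))]
  · intro x
    by_cases h : ‖x‖ ≤ par.RL
    · have h1 : par.rangeInd .picoBS ‖x‖ = 1 := if_pos h
      have hρ := par.exclRadius_nonneg .picoBS (norm_nonneg x)
      have h2 : 0 ≤ Real.pi * par.lam .picoBS *
          (par.RL ^ 2 + ∫ ω, par.picoW f κ ‖x‖ ω ∂par.angleLaw) := by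
        have h3 : ∫ _ω, -par.RL ^ 2 ∂par.angleLaw ≤ ∫ ω, par.picoW f κ ‖x‖ ω ∂par.angleLaw :=
          integral_mono (integrable_const _) (hE.integrable_picoW f κ (norm_nonneg x))
            fun ω => (hE.picoW_mem_Icc f κ (norm_nonneg x) ω).1
        rw [integral_const, probReal_univ, one_smul] at h3
        exact mul_nonneg (by positivity) (by linarith)
      have h4 : 0 ≤ par.p Tier.picoBS.other f * (Real.pi * par.lam Tier.picoBS.other *
          par.exclRadius .picoBS ‖x‖ ^ 2) := by
        simp only [Tier.other]; positivity
      rw [Set.indicator_of_mem (Set.mem_Iic.2 h), hE.lintegral_meanOwnFactor_pico f hκ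
        (norm_nonneg x) h, h1, mul_one, intensity_closedBall (par.lam_pos _).le hρ,
        ← ENNReal.ofReal_mul (hE.p_nonneg _ f), expNeg_ofReal h4, expNeg_ofReal h2,
        ← ENNReal.ofReal_mul hp, ← ENNReal.ofReal_mul (by positivity)]
      congr 1
      simp only [D, Tier.other]
      rw [mul_comm]
      congr 4
      ring
    · have h1 : par.rangeInd .picoBS ‖x‖ = 0 := if_neg h
      rw [Set.indicator_of_notMem (by simpa using h), h1, mul_zero, zero_mul, zero_mul]

/-- Comparison of the SINR coverage probability of the pico tier with the limit of its approximate
expression. -/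
theorem IsNetwork.coverageProb_pico (hE : IsNetwork par P E) (f : ℕ) {τ : ℝ} (hτ : 0 ≤ τ) :
    coverageProb par E P f .picoBS τ ≤
        ∑ n ∈ Finset.Icc 1 par.Nak, (-1 : ℝ) ^ (n + 1) * (par.Nak.choose n : ℝ) *
          ∫ r in (0 : ℝ)..par.RL, par.picoDensity f (n * etaL par.Nak * τ) r ∧
      (∑ n ∈ Finset.Icc 1 par.Nak, (-1 : ℝ) ^ (n + 1) * (par.Nak.choose n : ℝ) *
          ∫ r in (0 : ℝ)..par.RL, par.picoDensity f (n * etaL par.Nak * τ) r) -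
          coverageProb par E P f .picoBS τ ≤
        gammaGap par.Nak * assocProb par E P f .picoBS := by
  have hη := etaL_pos par.Nak_pos
  have hn : ∀ m, Measurable fun w => ‖E.loc .picoBS m w‖ :=
    fun m => ((hE.hppp .picoBS).measurable m).norm
  let wt : ℕ → Ω → ℝ≥0∞ := fun n w => par.rangeInd .picoBS ‖E.loc .picoBS n w‖ *
    nearest E f .picoBS (par.exclRadius .picoBS) n w
  let Y : ℕ → Ω → ℝ≥0∞ := fun n w => ENNReal.ofReal (τ * ‖E.loc .picoBS n w‖ ^ par.alpha .picoBS) *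
    unitInterference par E .picoBS n w
  have hwt : ∀ n, Measurable (wt n) := fun n => ((par.measurable_rangeInd _).comp (hn n)).mul
    (hE.measurable_nearest f .picoBS (par.measurable_exclRadius _) n)
  have hY : ∀ n, Measurable (Y n) := fun n => (((hn n).pow_const _).const_mul τ).ennreal_ofReal.mul
    (hE.measurable_unitInterference .picoBS n)
  have hwt2 : Measurable fun q : ℕ × Ω => wt q.1 q.2 := measurable_from_prod_countable_right hwt
  have hY2 : Measurable fun q : ℕ × Ω => Y q.1 q.2 := measurable_from_prod_countable_right hY
  have hYfin : ∀ᵐ w ∂P, ∀ n, Y n w ≠ ⊤ := by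
    filter_upwards [hE.ae_unitInterference_ne_top .picoBS] with w hw n
    exact ENNReal.mul_ne_top ENNReal.ofReal_ne_top (hw n)
  -- The weights of the serving events form a finite measure on indices and outcomes, of mass at
  -- most the association probability. Coverage and all Laplace transforms are integrals of
  -- functions of the single variable `γ` against it.
  let ν : Measure (ℕ × Ω) := (Measure.count.prod P).withDensity fun q => wt q.1 q.2
  -- The interference is almost surely finite, so a function on `[0, ∞]` may be exchanged for a real
  -- function agreeing with it off `⊤`.
  have hν : ∀ {H : ℝ≥0∞ → ℝ≥0∞}, Measurable H → ∀ {h : ℝ → ℝ},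
      (∀ y, y ≠ ⊤ → H y = ENNReal.ofReal (h y.toReal)) →
      ∑' n, ∫⁻ w, wt n w * H (Y n w) ∂P = ∫⁻ q, ENNReal.ofReal (h (Y q.1 q.2).toReal) ∂ν :=
    fun {H} hH {h} hHh => by
      have h1 : ∀ᵐ q ∂ν, Y q.1 q.2 ≠ ⊤ := by
        refine (withDensity_absolutelyContinuous _ _).ae_le ?_
        exact (Measure.ae_prod_iff_ae_ae (p := fun q : ℕ × Ω => Y q.1 q.2 ≠ ⊤)
          (hY2 (measurableSet_singleton ⊤).compl)).2
          (.of_forall fun n => hYfin.mono fun w hw => hw n)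
      have h2 : ∫⁻ q, ENNReal.ofReal (h (Y q.1 q.2).toReal) ∂ν = ∫⁻ q, H (Y q.1 q.2) ∂ν :=
        lintegral_congr_ae (h1.mono fun q hq => (hHh _ hq).symm)
      have h3 := lintegral_withDensity_eq_lintegral_mul (Measure.count.prod P) hwt2 (hH.comp hY2)
      rw [h2]
      refine Eq.trans ?_ h3.symm
      exact tsum_lintegral_eq_lintegral_prod P fun n => (hwt n).mul (hH.comp (hY n))
  have hνuniv : ν Set.univ ≤ ENNReal.ofReal (assocProb par E P f .picoBS) := by
    rw [withDensity_apply _ MeasurableSet.univ, Measure.restrict_univ,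
      ← tsum_lintegral_eq_lintegral_prod P hwt]
    exact hE.tsum_weight_le f .picoBS
  have : IsFiniteMeasure ν := ⟨hνuniv.trans_lt ENNReal.ofReal_lt_top⟩
  have hνreal : ν.real Set.univ ≤ assocProb par E P f .picoBS :=
    ENNReal.toReal_le_of_le_ofReal measureReal_nonneg hνuniv
  let γ : ℕ × Ω → ℝ := fun q => (Y q.1 q.2).toReal
  have hγ : Measurable γ := hY2.ennreal_toReal
  have hγ0 : ∀ q, 0 ≤ γ q := fun q => ENNReal.toReal_nonneg
  have hreal : ∀ {h : ℝ → ℝ}, (∀ x, 0 ≤ x → 0 ≤ h x) → Measurable h → ∀ {c : ℝ}, 0 ≤ c →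
      ENNReal.ofReal c = ∫⁻ q, ENNReal.ofReal (h (γ q)) ∂ν → ∫ q, h (γ q) ∂ν = c :=
    fun {h} h0 hm {c} hc he => by
      rw [integral_eq_lintegral_of_nonneg_ae (.of_forall fun q => h0 _ (hγ0 q))
        (hm.comp hγ).aestronglyMeasurable, ← he, ENNReal.toReal_ofReal hc]
  have hcov : ∫ q, (1 - cdf (gammaMeasure par.Nak par.Nak) (γ q)) ∂ν =
      coverageProb par E P f .picoBS τ := by
    refine hreal (h := fun x => 1 - cdf (gammaMeasure par.Nak par.Nak) x)
      (fun x _ => sub_nonneg.2 (cdf_le_one _ _))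
      (measurable_const.sub (monotone_cdf _).measurable) measureReal_nonneg ?_
    refine (hE.coverageProb_eq f .picoBS hτ).trans (Eq.trans ?_
      (hν (measurable_gammaTail par.Nak par.Nak)
        (h := fun x => 1 - cdf (gammaMeasure par.Nak par.Nak) x)
        fun y hy => gammaTail_of_ne_top par.Nak_cast_pos par.Nak_cast_pos hy))
    refine tsum_congr fun n => lintegral_congr fun w => ?_
    exact (mul_assoc _ _ _).symm
  -- Scaling the argument by `n η` turns the threshold `τ` into `κ = n η τ` in the Laplace
  -- transform.
  have hlap : ∀ n : ℕ, ∫ q, Real.exp (-(n * etaL par.Nak * γ q)) ∂ν =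
      ∫ r in (0 : ℝ)..par.RL, par.picoDensity f (n * etaL par.Nak * τ) r := fun n => by
    have hc0 : 0 ≤ n * etaL par.Nak := by positivity
    refine hreal (h := fun x => Real.exp (-(n * etaL par.Nak * x)))
      (fun x _ => (Real.exp_pos _).le) (by fun_prop)
      (intervalIntegral.integral_nonneg par.RL_pos.le fun r hr =>
        hE.picoDensity_nonneg f _ hr.1) ?_
    refine (hE.tsum_laplace_pico f (mul_nonneg hc0 hτ)).symm.trans (Eq.trans ?_
      (hν (H := fun y => expNeg (ENNReal.ofReal (n * etaL par.Nak) * y))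
        (measurable_expNeg.comp (by fun_prop))
        (h := fun x => Real.exp (-(n * etaL par.Nak * x))) fun y hy => by
          rw [expNeg_eq (ENNReal.mul_ne_top ENNReal.ofReal_ne_top hy), ENNReal.toReal_mul,
            ENNReal.toReal_ofReal hc0]))
    refine tsum_congr fun m => lintegral_congr fun w => ?_
    simp only [wt, Y]
    rw [mul_assoc, ← mul_assoc (ENNReal.ofReal _) (ENNReal.ofReal _), ← ENNReal.ofReal_mul hc0,
      ← mul_assoc (_ * _) τ, mul_assoc (par.rangeInd _ _)]
  obtain ⟨h1, h2⟩ := gammaTail_comparison ν hγ hγ0 par.Nak_pos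
  simp only [hcov, hlap] at h1 h2
  exact ⟨h1, h2.trans (mul_le_mul_of_nonneg_left hνreal (gammaGap_nonneg _))⟩

end

end

end HetNet

theorem lemma5 {Ω : Type*} [MeasurableSpace Ω] (P : Measure Ω) [IsProbabilityMeasure P]
    (par : HetNet.Params) (E : HetNet.Elements Ω) (hE : HetNet.IsNetwork par P E)
    (f : ℕ) (τ : ℝ) (hτ : 0 ≤ τ) :
    (IntegrableOn (par.macroIntegrand f τ) (Set.Ioi 0) ∧
      HetNet.coverageProb par E P f .macroBS τ = ∫ r in Set.Ioi 0, par.macroIntegrand f τ r) ∧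
    ∃ L : ℝ,
      Tendsto (fun u : ℕ × ℕ => par.coverageApprox f u.1 u.2 τ) atTop (𝓝 L) ∧
      HetNet.coverageProb par E P f .picoBS τ ≤ L ∧
      L - HetNet.coverageProb par E P f .picoBS τ ≤
        HetNet.gammaGap par.Nak * HetNet.assocProb par E P f .picoBS ∧
      (par.Nak = 1 → L = HetNet.coverageProb par E P f .picoBS τ) := by
  obtain ⟨h1, h2⟩ := hE.coverageProb_pico f hτ
  refine ⟨hE.coverageProb_macro f hτ, _, hE.tendsto_coverageApprox f hτ, h1, h2, fun hN => ?_⟩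
  -- For parameter `1` the Gamma law is exponential and `η = 1`, so the approximation is exact and
  -- the two inequalities force equality.
  have hgap : HetNet.gammaGap par.Nak = 0 := by rw [hN, HetNet.gammaGap_one]
  rw [hgap, zero_mul] at h2
  exact le_antisymm (sub_nonpos.1 h2) h1
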